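/- Let $n\ge 2$, $0<\lambda_0\le 1$ and $\Lambda_0>0$. Consider real $n\times n$ matrix functions $A=(a_{ij}(x))$ on $\mathbb R^n$ whose symmetric part $A^s=\frac12(A+A^{\top})$ is bounded and elliptic, $\lambda_0|\xi|^2\le \sum_{i,j}a^s_{ij}(x)\xi_i\xi_j$ for all $\xi\in\mathbb R^n$ and $|a^s_{ij}(x)|\le\lambda_0^{-1}$ for a.e. $x$, and whose antisymmetric part $A^a=\frac12(A-A^{\top})$ is in $BMO(\mathbb R^n)$ with $\sup_Q\frac1{|Q|}\int_Q|a^a_{ij}-(a^a_{ij})_Q|\,dx\le\Lambda_0$ for all $i,j$ (supremum over axis-parallel cubes $Q$). For $u,v\in W^{1,2}(\mathbb R^n;\mathbb C)$ let $$t[u,v]=\int_{\mathbb R^n}A^s\nabla u\cdot\nabla\bar v+\int_{\mathbb R^n}A^a\nabla u\cdot\nabla\bar v ,$$ where the second integral is understood through the $BMO$–$\mathcal H^1$ duality, i.e. as $\lim_{k\to\infty}\int T_k(A^a)\nabla u\cdot\nabla\bar v$ with $T_k$ the entrywise truncation at height $k$. Let $L=-\operatorname{div}(A\nabla)$ be the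 operator on $L^2(\mathbb R^n;\mathbb C)$ associated with $t$: $u\in D(L)$ and $Lu=w$ if and only if $u\in W^{1,2}$, $w\in L^2$ and $t[u,v]=(w,v)_{L^2}$ for all $v\in W^{1,2}$. For $\theta>0$ put $\Sigma_\theta=\{z\in\mathbb C\setminus\{0\}:|\arg z|<\theta\}$. There exists $\omega_0=\omega_0(n,\lambda_0,\Lambda_0)\in(0,\frac\pi2)$ such that for every such $A$ the operator $-L$ generates an analytic semigroup $(e^{-zL})_{z\in\Sigma_{\pi/2-\omega_0}}$ on $L^2$, and such that for every $\mu\in(0,\frac\pi2-\omega_0)$ there are constants $C\ge0$ and $\alpha>0$, depending only on $n,\lambda_0,\Lambda_0,\mu$, with the following property. For every such $A$, all $z\in\Sigma_\mu$ and all $h\in L^2$ one has $e^{-zL}h\in D(L)\subset W^{1,2}$, and for all closed sets $E,F\subset\mathbb R^n$, all $h\in L^2$ supported in $E$ and all $z\in\Sigma_\mu$, $$\|e^{-zL}h\|_{L^2(F)},\quad \|zLe^{-zL}h\|_{L^2(F)},\quad \|\sqrt z\,\nabla e^{-zL}h\|_{L^2(F)}\quad\text{are all}\ \le\ C\,e^{-\alpha\,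 d(E,F)^2/|z|}\,\|h\|_{L^2},$$ where $d(E,F)=\inf\{|x-y|:x\in E,\ y\in F\}$ (the value of $d$ is irrelevant if $E$ or $F$ is empty). -/

import Mathlib

open MeasureTheory Filter Topology
open scoped ContDiff ENNReal

noncomputable section

namespace GaffneyBMO

/-- Euclidean space `ℝⁿ`. -/
abbrev Rn (n : ℕ) : Type := EuclideanSpace ℝ (Fin n)

/-- The complex Hilbert space `L²(ℝⁿ; ℂ)`. -/
abbrev L2 (n : ℕ) : Type := Lp ℂ 2 (volume : Measure (Rn n))

/-- The `i`-th partial derivative of a (smooth) real function on `ℝⁿ`. -/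
def partialDeriv {n : ℕ} (i : Fin n) (φ : Rn n → ℝ) (x : Rn n) : ℝ :=
  fderiv ℝ φ x (EuclideanSpace.single i 1)

/-! ### The Sobolev space `W^{1,2}` and the weak gradient -/

/-- `G = (G₁, …, Gₙ)` with `Gᵢ ∈ L²` is the weak gradient of `u ∈ L²`. -/
def HasWeakGrad {n : ℕ} (u : L2 n) (G : Fin n → L2 n) : Prop :=
  ∀ φ : Rn n → ℝ, ContDiff ℝ ∞ φ → HasCompactSupport φ →
    ∀ i, ∫ x, partialDeriv i φ x • u x = - ∫ x, φ x • G i x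

lemma integrable_test_smul {n : ℕ} {φ : Rn n → ℝ} (hφ : Continuous φ) (hc : HasCompactSupport φ)
    (u : L2 n) : Integrable (fun x => φ x • u x) :=
  memLp_one_iff_integrable.1
    (MemLp.smul (p := 2) (q := 2) (r := 1) (Lp.memLp u) (hφ.memLp_of_hasCompactSupport hc))

lemma continuous_partialDeriv {n : ℕ} {φ : Rn n → ℝ} (hφ : ContDiff ℝ ∞ φ) (i : Fin n) :
    Continuous (partialDeriv i φ) :=
  (hφ.continuous_fderiv (by simp)).clm_apply continuous_const

lemma hasCompactSupport_partialDeriv {n : ℕ} {φ : Rn n → ℝ} (hc : HasCompactSupport φ)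
    (i : Fin n) : HasCompactSupport (partialDeriv i φ) :=
  hc.fderiv_apply (𝕜 := ℝ) (EuclideanSpace.single i 1)

lemma HasWeakGrad.add {n : ℕ} {u v : L2 n} {G H : Fin n → L2 n} (hu : HasWeakGrad u G)
    (hv : HasWeakGrad v H) : HasWeakGrad (u + v) (G + H) := by
  intro φ hφ hc i
  have h1 : ∫ x, partialDeriv i φ x • (u + v : L2 n) x
      = ∫ x, (partialDeriv i φ x • u x + partialDeriv i φ x • v x) := by
    refine integral_congr_ae ?_
    filter_upwards [Lp.coeFn_add u v] with x hx
    rw [hx, Pi.add_apply, smul_add]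
  have h2 : ∫ x, φ x • ((G + H) i : L2 n) x = ∫ x, (φ x • G i x + φ x • H i x) := by
    refine integral_congr_ae ?_
    filter_upwards [Lp.coeFn_add (G i) (H i)] with x hx
    rw [Pi.add_apply, hx, Pi.add_apply, smul_add]
  have hd := continuous_partialDeriv hφ i
  have hdc := hasCompactSupport_partialDeriv hc i
  rw [h1, h2, integral_add (integrable_test_smul hd hdc u) (integrable_test_smul hd hdc v),
    integral_add (integrable_test_smul hφ.continuous hc _)
      (integrable_test_smul hφ.continuous hc _), hu φ hφ hc i, hv φ hφ hc i, neg_add]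

lemma HasWeakGrad.smul {n : ℕ} {u : L2 n} {G : Fin n → L2 n} (c : ℂ) (hu : HasWeakGrad u G) :
    HasWeakGrad (c • u) (c • G) := by
  intro φ hφ hc i
  have h1 : ∫ x, partialDeriv i φ x • (c • u : L2 n) x = ∫ x, c • (partialDeriv i φ x • u x) := by
    refine integral_congr_ae ?_
    filter_upwards [Lp.coeFn_smul c u] with x hx
    rw [hx, Pi.smul_apply, smul_comm]
  have h2 : ∫ x, φ x • ((c • G) i : L2 n) x = ∫ x, c • (φ x • G i x) := by
    refine integral_congr_ae ?_
    filter_upwards [Lp.coeFn_smul c (G i)] with x hx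
    rw [Pi.smul_apply, hx, Pi.smul_apply, smul_comm]
  rw [h1, h2, integral_smul, integral_smul, hu φ hφ hc i, smul_neg]

lemma HasWeakGrad.unique {n : ℕ} {u : L2 n} {G H : Fin n → L2 n} (hG : HasWeakGrad u G)
    (hH : HasWeakGrad u H) : G = H := by
  funext i
  refine Lp.ext (ae_eq_of_integral_contDiff_smul_eq
    ((Lp.memLp (G i)).locallyIntegrable (by norm_num))
    ((Lp.memLp (H i)).locallyIntegrable (by norm_num)) ?_)
  intro φ hφ hc
  have := (hG φ hφ hc i).symm.trans (hH φ hφ hc i)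
  exact neg_injective this

lemma HasWeakGrad.zero {n : ℕ} : HasWeakGrad (0 : L2 n) 0 := by
  intro φ hφ hc i
  have h1 : ∫ x, partialDeriv i φ x • (0 : L2 n) x = ∫ _ : Rn n, (0 : ℂ) := by
    refine integral_congr_ae ?_
    filter_upwards [Lp.coeFn_zero ℂ 2 (volume : Measure (Rn n))] with x hx
    rw [hx, Pi.zero_apply, smul_zero]
  have h2 : ∫ x, φ x • ((0 : Fin n → L2 n) i) x = ∫ _ : Rn n, (0 : ℂ) := by
    refine integral_congr_ae ?_
    filter_upwards [Lp.coeFn_zero ℂ 2 (volume : Measure (Rn n))] with x hx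
    rw [Pi.zero_apply, hx, Pi.zero_apply, smul_zero]
  rw [h1, h2]
  simp

/-- The Sobolev space `W^{1,2}(ℝⁿ; ℂ)`, as a subspace of `L²`. -/
def W12 (n : ℕ) : Submodule ℂ (L2 n) where
  carrier := {u | ∃ G, HasWeakGrad u G}
  add_mem' := by
    rintro u v ⟨G, hG⟩ ⟨H, hH⟩
    exact ⟨G + H, hG.add hH⟩
  zero_mem' := ⟨0, HasWeakGrad.zero⟩
  smul_mem' := by
    rintro c u ⟨G, hG⟩
    exact ⟨c • G, hG.smul c⟩

open scoped Classical in
/-- The weak gradient `(∂₁u, …, ∂ₙu)` of `u ∈ W^{1,2}` (and `0` for `u ∉ W^{1,2}`). -/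
def weakGrad {n : ℕ} (u : L2 n) : Fin n → L2 n :=
  if h : ∃ G, HasWeakGrad u G then h.choose else 0

lemma hasWeakGrad_weakGrad {n : ℕ} {u : L2 n} (hu : u ∈ W12 n) : HasWeakGrad u (weakGrad u) := by
  have h : ∃ G, HasWeakGrad u G := hu
  rw [weakGrad, dif_pos h]
  exact h.choose_spec

lemma HasWeakGrad.weakGrad_eq {n : ℕ} {u : L2 n} {G : Fin n → L2 n} (h : HasWeakGrad u G) :
    weakGrad u = G :=
  (hasWeakGrad_weakGrad (u := u) ⟨G, h⟩).unique h

/-- The weak gradient as a vector field `x ↦ ∇u(x) ∈ ℂⁿ`, with the Euclidean norm on `ℂⁿ`. -/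
def gradField {n : ℕ} (u : L2 n) (x : Rn n) : EuclideanSpace ℂ (Fin n) :=
  WithLp.toLp 2 (fun i => weakGrad u i x)

/-! ### The coefficients -/

/-- The closed cube with centre `c`, side length `2r` and sides parallel to the axes. -/
def cube {n : ℕ} (c : Rn n) (r : ℝ) : Set (Rn n) := {x | ∀ i, |x i - c i| ≤ r}

/-- `b ∈ BMO(ℝⁿ)` with `‖b‖_BMO = sup_Q ⨍_Q |b - b_Q| ≤ Λ`. -/
def IsBMOWith {n : ℕ} (b : Rn n → ℝ) (Λ : ℝ) : Prop :=
  LocallyIntegrable b volume ∧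
    ∀ (c : Rn n) (r : ℝ), 0 < r →
      ⨍ x in cube c r, |b x - ⨍ y in cube c r, b y| ≤ Λ

/-- Real `n × n` coefficient matrices `A(x)`, `x ∈ ℝⁿ`, whose symmetric part is bounded by `λ₀⁻¹`
and elliptic with constant `λ₀`, and whose antisymmetric part is in BMO with seminorm `≤ Λ₀`. -/
structure CoeffMatrix (n : ℕ) (lam0 Lam0 : ℝ) where
  /-- the matrix field `x ↦ A(x)` -/
  a : Rn n → Matrix (Fin n) (Fin n) ℝ
  aestronglyMeasurable : ∀ i j, AEStronglyMeasurable (fun x => a x i j) volume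
  elliptic : ∀ᵐ x, ∀ ξ : Rn n,
    lam0 * ‖ξ‖ ^ 2 ≤ ∑ i, ∑ j, (a x i j + a x j i) / 2 * ξ i * ξ j
  bounded : ∀ᵐ x, ∀ i j, |(a x i j + a x j i) / 2| ≤ lam0⁻¹
  bmo : ∀ i j, IsBMOWith (fun x => (a x i j - a x j i) / 2) Lam0

namespace CoeffMatrix

variable {n : ℕ} {lam0 Lam0 : ℝ} (A : CoeffMatrix n lam0 Lam0)

/-- The symmetric part `Aˢ`. -/
def sym (x : Rn n) (i j : Fin n) : ℝ := (A.a x i j + A.a x j i) / 2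

/-- The antisymmetric part `Aᵃ`. -/
def anti (x : Rn n) (i j : Fin n) : ℝ := (A.a x i j - A.a x j i) / 2

/-- The entries of `Aˢ + T_k(Aᵃ)`, where `T_k(s) = max(-k, min(k, s))` is truncation at height `k`. -/
def trunc (k : ℕ) (x : Rn n) (i j : Fin n) : ℝ :=
  A.sym x i j + max (-(k : ℝ)) (min (k : ℝ) (A.anti x i j))

/-- `∫ (Aˢ + T_k(Aᵃ)) ∇u · ∇v̄`, an absolutely convergent integral for `u, v ∈ W^{1,2}`. -/
def truncForm (k : ℕ) (u v : L2 n) : ℂ :=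
  ∫ x, ∑ i, ∑ j, (A.trunc k x i j : ℂ) * weakGrad u j x * starRingEnd ℂ (weakGrad v i x)

/-- `t[u, v] = c`, where `t[u, v] = ∫ Aˢ ∇u · ∇v̄ + ∫ Aᵃ ∇u · ∇v̄` for `u, v ∈ W^{1,2}`.
The second integral need not converge absolutely; it is the duality pairing of the `BMO` functions
`aᵃᵢⱼ` with the functions `½ (∂ⱼu ∂ᵢv̄ - ∂ᵢu ∂ⱼv̄)` of the real Hardy space `H¹`. The pairing of
`b ∈ BMO` with `f ∈ H¹` is `lim_k ∫ T_k(b) f`; as `T_k` is odd, summing over `i, j` gives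
`lim_k ∫ T_k(Aᵃ) ∇u · ∇v̄`. -/
def HasForm (u v : L2 n) (c : ℂ) : Prop :=
  Tendsto (fun k : ℕ => A.truncForm k u v) atTop (𝓝 c)

lemma integrable_entry (k : ℕ) (i j : Fin n) (f g : L2 n) :
    Integrable (fun x => (A.trunc k x i j : ℂ) * f x * starRingEnd ℂ (g x)) := by
  have hfg : Integrable (fun x => f x * starRingEnd ℂ (g x)) :=
    MemLp.integrable_mul (p := 2) (q := 2) (Lp.memLp f) (Lp.memLp g).star
  have hmeas : AEStronglyMeasurable (fun x => (A.trunc k x i j : ℂ)) volume := by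
    have h1 := (A.aestronglyMeasurable i j).aemeasurable
    have h2 := (A.aestronglyMeasurable j i).aemeasurable
    have h3 : AEMeasurable (fun x => A.trunc k x i j) volume := by
      unfold trunc sym anti
      exact ((h1.add h2).div_const 2).add
        (aemeasurable_const.max (aemeasurable_const.min ((h1.sub h2).div_const 2)))
    exact (Complex.measurable_ofReal.comp_aemeasurable h3).aestronglyMeasurable
  have := hfg.bdd_mul (c := lam0⁻¹ + k) hmeas (by
    filter_upwards [A.bounded] with x hx
    rw [Complex.norm_real, Real.norm_eq_abs]
    refine (abs_add_le _ _).trans (add_le_add (hx i j) ?_)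
    rw [abs_le]
    exact ⟨le_max_left _ _, max_le (by linarith [(Nat.cast_nonneg k : (0 : ℝ) ≤ k)])
      (min_le_left _ _)⟩)
  simpa only [mul_assoc] using this

lemma truncForm_add (k : ℕ) {u u' : L2 n} (v : L2 n) (hu : u ∈ W12 n) (hu' : u' ∈ W12 n) :
    A.truncForm k (u + u') v = A.truncForm k u v + A.truncForm k u' v := by
  have hG : weakGrad (u + u') = weakGrad u + weakGrad u' :=
    ((hasWeakGrad_weakGrad hu).add (hasWeakGrad_weakGrad hu')).weakGrad_eq
  unfold truncForm
  rw [← integral_add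
    (integrable_finsetSum _ fun i _ => integrable_finsetSum _ fun j _ => A.integrable_entry k i j _ _)
    (integrable_finsetSum _ fun i _ => integrable_finsetSum _ fun j _ => A.integrable_entry k i j _ _)]
  refine integral_congr_ae ?_
  have h : ∀ᵐ x, ∀ j, (weakGrad (u + u') j) x = weakGrad u j x + weakGrad u' j x := by
    rw [ae_all_iff]
    intro j
    rw [hG]
    exact Lp.coeFn_add _ _
  filter_upwards [h] with x hx
  simp only [hx, mul_add, add_mul, Finset.sum_add_distrib]

lemma truncForm_smul (k : ℕ) (c : ℂ) {u : L2 n} (v : L2 n) (hu : u ∈ W12 n) :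
    A.truncForm k (c • u) v = c * A.truncForm k u v := by
  have hG : weakGrad (c • u) = c • weakGrad u :=
    ((hasWeakGrad_weakGrad hu).smul c).weakGrad_eq
  unfold truncForm
  rw [← integral_const_mul]
  refine integral_congr_ae ?_
  have h : ∀ᵐ x, ∀ j, (weakGrad (c • u) j) x = c * weakGrad u j x := by
    rw [ae_all_iff]
    intro j
    rw [hG]
    exact Lp.coeFn_smul _ _
  filter_upwards [h] with x hx
  simp only [hx, Finset.mul_sum]
  refine Finset.sum_congr rfl fun i _ => Finset.sum_congr rfl fun j _ => by ring

/-- The graph of the operator associated with the form `t`: all pairs `(u, w)` with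
`u ∈ W^{1,2}`, `w ∈ L²` and `t[u, v] = (w, v)` for every `v ∈ W^{1,2}`. -/
def opGraph : Submodule ℂ (L2 n × L2 n) where
  carrier := {p | p.1 ∈ W12 n ∧ ∀ v ∈ W12 n, A.HasForm p.1 v (inner ℂ v p.2)}
  add_mem' := by
    rintro ⟨u, w⟩ ⟨u', w'⟩ ⟨hu, h⟩ ⟨hu', h'⟩
    refine ⟨add_mem hu hu', fun v hv => ?_⟩
    simp only [HasForm, Prod.mk_add_mk, inner_add_right, A.truncForm_add _ v hu hu']
    exact (h v hv).add (h' v hv)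
  zero_mem' := by
    refine ⟨zero_mem _, fun v _ => ?_⟩
    have h0 : ∀ k, A.truncForm k 0 v = 0 := fun k => by
      have := A.truncForm_smul k 0 v (zero_mem (W12 n))
      simpa using this
    simp only [HasForm, Prod.fst_zero, Prod.snd_zero, inner_zero_right, h0]
    exact tendsto_const_nhds
  smul_mem' := by
    rintro c ⟨u, w⟩ ⟨hu, h⟩
    refine ⟨(W12 n).smul_mem c hu, fun v hv => ?_⟩
    simp only [HasForm, Prod.smul_mk, inner_smul_right, A.truncForm_smul _ c v hu]
    exact (h v hv).const_mul c

/-- The operator `L = -div(A∇)` on `L²`: the operator associated with the form `t`. -/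
def op : L2 n →ₗ.[ℂ] L2 n := A.opGraph.toLinearPMap

lemma dense_W12 : Dense (W12 n : Set (L2 n)) := by
  refine (Lp.dense_hasCompactSupport_contDiff (E := Rn n) (F := ℂ) (p := 2) (μ := volume)
    (by norm_num)).mono ?_
  rintro u ⟨g, hug, hgc, hg⟩
  have hd : ∀ i : Fin n, Continuous fun x => fderiv ℝ g x (EuclideanSpace.single i 1) := fun i =>
    (hg.continuous_fderiv (by simp)).clm_apply continuous_const
  have hdc : ∀ i : Fin n, HasCompactSupport fun x => fderiv ℝ g x (EuclideanSpace.single i 1) :=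
    fun i => hgc.fderiv_apply (𝕜 := ℝ) (EuclideanSpace.single i 1)
  have hL : ∀ i : Fin n, MemLp (fun x => fderiv ℝ g x (EuclideanSpace.single i 1)) 2 volume :=
    fun i => (hd i).memLp_of_hasCompactSupport (hdc i)
  refine ⟨fun i => (hL i).toLp, fun φ hφ hc i => ?_⟩
  have h1 : ∫ x, partialDeriv i φ x • u x = ∫ x, partialDeriv i φ x • g x := by
    refine integral_congr_ae ?_
    filter_upwards [hug] with x hx
    rw [hx]
  have h2 : ∫ x, φ x • ((hL i).toLp : L2 n) x
      = ∫ x, φ x • fderiv ℝ g x (EuclideanSpace.single i 1) := by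
    refine integral_congr_ae ?_
    filter_upwards [(hL i).coeFn_toLp] with x hx
    rw [hx]
  have hpc := continuous_partialDeriv hφ i
  rw [h1, h2, integral_smul_fderiv_eq_neg_fderiv_smul_of_integrable, neg_neg]
  · rfl
  · exact (hpc.smul hg.continuous).integrable_of_hasCompactSupport hgc.smul_left
  · exact (hφ.continuous.smul (hd i)).integrable_of_hasCompactSupport (hdc i).smul_left
  · exact (hφ.continuous.smul hg.continuous).integrable_of_hasCompactSupport hgc.smul_left
  · exact fun x _ => (hφ.differentiable (by simp)).differentiableAt
  · exact fun x _ => (hg.differentiable (by simp)).differentiableAt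

/-- `u ∈ D(L)` and `Lu = w` if and only if `u ∈ W^{1,2}` and `t[u, v] = (w, v)` for all
`v ∈ W^{1,2}`. -/
lemma mem_op_graph_iff {u w : L2 n} :
    (u, w) ∈ A.op.graph ↔ u ∈ W12 n ∧ ∀ v ∈ W12 n, A.HasForm u v (inner ℂ v w) := by
  rw [op, Submodule.toLinearPMap_graph_eq]
  · exact Iff.rfl
  · rintro ⟨u, w⟩ ⟨_, h⟩ hu
    obtain rfl : u = 0 := hu
    have h0 : ∀ k v, A.truncForm k 0 v = 0 := fun k v => by
      have := A.truncForm_smul k 0 v (zero_mem (W12 n))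
      simpa using this
    refine dense_W12.eq_zero_of_inner_right ℂ fun v hv => ?_
    have := h v hv
    simp only [HasForm, h0] at this
    exact (tendsto_nhds_unique this tendsto_const_nhds)

end CoeffMatrix

/-! ### Analytic semigroups and off-diagonal estimates -/

/-- The open sector `Σ_θ = {z ≠ 0 : |arg z| < θ}`. -/
def sector (θ : ℝ) : Set ℂ := {z | z ≠ 0 ∧ |z.arg| < θ}

/-- `S(z) = e^{-zL}`, `z ∈ Σ_θ`, is the analytic semigroup generated by `-L` on `Σ_θ`. -/
structure IsAnalyticSemigroup {X : Type*} [NormedAddCommGroup X] [NormedSpace ℂ X]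
    (θ : ℝ) (L : X →ₗ.[ℂ] X) (S : ℂ → X →L[ℂ] X) : Prop where
  analytic : DifferentiableOn ℂ S (sector θ)
  map_add : ∀ z ∈ sector θ, ∀ w ∈ sector θ, S (z + w) = S z ∘L S w
  continuous_zero : ∀ f, Tendsto (fun z => S z f) (𝓝[sector θ] 0) (𝓝 f)
  generator : ∀ f g, (f, g) ∈ L.graph ↔
    Tendsto (fun t : ℝ => (t : ℂ)⁻¹ • (S (t : ℂ) f - f)) (𝓝[>] 0) (𝓝 (-g))

/-- The Euclidean distance `d(E, F) = inf {|x - y| : x ∈ E, y ∈ F}`. -/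
def setDist {n : ℕ} (E F : Set (Rn n)) : ℝ := ⨅ p : E × F, dist (p.1 : Rn n) (p.2 : Rn n)

/-- `L²` off-diagonal estimates with constants `C`, `α` for a family `(T_z)_{z ∈ Σ_μ}`:
`‖T_z h‖_{L²(F)} ≤ C exp(-α d(E,F)² / |z|) ‖h‖_{L²}` for closed `E`, `F` and `h` supported
in `E`. -/
def OffDiagonal {n : ℕ} {V : Type*} [NormedAddCommGroup V] (μ C α : ℝ)
    (T : sector μ → L2 n → Rn n → V) : Prop :=
  ∀ E F : Set (Rn n), IsClosed E → IsClosed F →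
    ∀ h : L2 n, (∀ᵐ x, x ∉ E → h x = 0) →
      ∀ z : sector μ,
        eLpNorm (T z h) 2 (volume.restrict F) ≤
          ENNReal.ofReal (C * Real.exp (-(α * setDist E F ^ 2 / ‖(z : ℂ)‖))) * eLpNorm h 2 volume

end GaffneyBMO

end

/-!
The proof has three parts: the form `t` is controlled by real variable methods, the semigroup is
constructed from resolvent bounds, and off-diagonal decay follows by Davies' perturbation method.

**The antisymmetric part of the form.** Since `Aᵃ` is antisymmetric, `∫ Aᵃ ∇f · ∇g` only involves
the null forms `∂ᵢf ∂ⱼg - ∂ⱼf ∂ᵢg` of real functions. These belong to the Hardy space `𝓗¹`, but the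
duality with `BMO` is not used. Instead, `∫ b (∂ᵢf ∂ⱼg - ∂ⱼf ∂ᵢg)` is differentiated while `b`, `f`
and `g` evolve by the heat flow. The algebraic structure of a null form lets an integration by
parts move one derivative onto `b` in each term (`nullForm_slice`), and what results is bounded by
the Cauchy–Schwarz inequality, the energy inequality `energy_le` and the Carleson estimate
`carleson_le`: if the Gaussian variances `β = e^{sΔ}(b²) - (e^{sΔ}b)²` are at most `K`, then
`∫∫ |∇e^{sΔ}b|² |e^{sΔ}g|² dx ds ≤ 6K ‖g‖²`. For functions with mean oscillation at most `Λ`, such a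
`K` is a multiple of `Λ²`, by an `L²` John–Nirenberg inequality (`MeanOscLe.sq_le`,
`MeanOscLe.heatVar_le`). This gives `abs_integral_nullForm_le`, with the bound `‖∇f‖ ‖∇g‖`, and
`abs_integral_nullForm_sq_le`, the bound `‖w‖ ‖∇w‖` for the null forms of `w²` and a Lipschitz
function. Truncation does not increase oscillation, so these bounds do not depend on its height, and
density of test functions makes the truncated forms converge on `W^{1,2}`
(`norm_antiForm_le`, `exists_tendsto_antiForm`).

**The semigroup.** The antisymmetric part contributes nothing to `Re t[u, u]` and at most a multiple
of `‖∇u‖²` to `Im t[u, u]`, while the symmetric part is real and at least `λ₀ ‖∇u‖²`. Hence `zL` is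
accretive for all `z` in a closed cone whose interior is the sector of half angle `π/2 - ω₀`, with
`tan ω₀` the quotient of the two constants, and `L + l` is onto for `l > 0` by the Lax–Milgram
theorem (`exists_resolvent`). The exponentials of the Yosida approximations of `L` converge to the
semigroup, which consists of contractions (`IsMaxAccretive.exists_isAnalyticSemigroup`).

**Off-diagonal estimates.** For bounded smooth `φ` with `|∂ₖφ| ≤ 1`, testing the equation for `u`
with `e^{2ρφ} u` leads to the form on the pair `e^{-ρφ} w`, `e^{ρφ} w`, where `w = e^{ρφ} u`. The
only terms of the antisymmetric part to be estimated are again null forms, of `|w|²` and `φ`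
(`abs_re_antiForm_mulGrad_le`), so that Gårding's inequality holds up to lower order terms
`ρ ‖w‖ ‖∇w‖ + ρ² ‖w‖²` (`le_re_inner_weightL`). Gronwall's inequality along rays bounds
`e^{ρφ} e^{-zL} e^{-ρφ}` by `exp (κ ρ² |z|)` (`norm_weightL_semigroup_le`); Cauchy's estimate and once
more Gårding's inequality give the bounds for `zL e^{-zL}` and `√z ∇e^{-zL}`. With `φ` close to the
distance to `E`, truncated at height `d(E, F)`, and `ρ = d(E, F) / (4κ|z|)`, this is the Gaussian
decay (`eLpNorm_restrict_le_gaussian`).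
-/

noncomputable section

namespace GaffneyBMO

section

/-! ### Smooth functions with bounded and `p`-integrable derivatives -/

variable {n : ℕ}

/-- The iterated partial derivative along a list of coordinate directions. -/
def iterPartial : List (Fin n) → (Rn n → ℝ) → Rn n → ℝ
  | [], f => f
  | i :: α, f => iterPartial α (partialDeriv i f)

/-- Smooth functions all of whose derivatives are bounded and lie in `Lᵖ`. Only `p = 1, 2, ∞`
are used. -/
structure SmoothLp (p : ℝ≥0∞) (f : Rn n → ℝ) : Prop where
  contDiff : ContDiff ℝ ∞ f
  bdd : ∀ α, ∃ C, ∀ x, |iterPartial α f x| ≤ C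
  memLp : ∀ α, MemLp (iterPartial α f) p volume

lemma contDiff_partialDeriv {f : Rn n → ℝ} (hf : ContDiff ℝ ∞ f) (i : Fin n) :
    ContDiff ℝ ∞ (partialDeriv i f) :=
  ((hf.fderiv_right (m := ∞) (by simp)).clm_apply contDiff_const)

lemma contDiff_iterPartial {f : Rn n → ℝ} (hf : ContDiff ℝ ∞ f) (α : List (Fin n)) :
    ContDiff ℝ ∞ (iterPartial α f) := by
  induction α generalizing f with
  | nil => exact hf
  | cons i α ih => exact ih (contDiff_partialDeriv hf i)

lemma partialDeriv_add {f g : Rn n → ℝ} (hf : Differentiable ℝ f) (hg : Differentiable ℝ g)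
    (i : Fin n) :
    partialDeriv i (fun x => f x + g x) = fun x => partialDeriv i f x + partialDeriv i g x := by
  funext x
  simp only [partialDeriv]
  rw [fderiv_fun_add (hf x) (hg x)]
  rfl

lemma partialDeriv_sub {f g : Rn n → ℝ} (hf : Differentiable ℝ f) (hg : Differentiable ℝ g)
    (i : Fin n) :
    partialDeriv i (fun x => f x - g x) = fun x => partialDeriv i f x - partialDeriv i g x := by
  funext x
  simp only [partialDeriv]
  rw [fderiv_fun_sub (hf x) (hg x)]
  rfl

lemma partialDeriv_const_mul (c : ℝ) {f : Rn n → ℝ} (hf : Differentiable ℝ f) (i : Fin n) :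
    partialDeriv i (fun x => c * f x) = fun x => c * partialDeriv i f x := by
  funext x
  simp only [partialDeriv]
  rw [fderiv_const_mul (hf x)]
  rfl

lemma partialDeriv_mul {f g : Rn n → ℝ} (hf : Differentiable ℝ f) (hg : Differentiable ℝ g)
    (i : Fin n) :
    partialDeriv i (fun x => f x * g x)
      = fun x => partialDeriv i f x * g x + f x * partialDeriv i g x := by
  funext x
  simp only [partialDeriv]
  rw [fderiv_fun_mul (hf x) (hg x)]
  simp only [add_apply, smul_apply, smul_eq_mul]
  ring

lemma partialDeriv_comm {f : Rn n → ℝ} (hf : ContDiff ℝ ∞ f) (i j : Fin n) :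
    partialDeriv i (partialDeriv j f) = partialDeriv j (partialDeriv i f) := by
  funext x
  have hd : DifferentiableAt ℝ (fderiv ℝ f) x :=
    ((hf.fderiv_right (m := ∞) (by simp)).differentiable (by simp)) x
  have h : ∀ v w : Rn n, fderiv ℝ (fun y => fderiv ℝ f y v) x w
      = fderiv ℝ (fderiv ℝ f) x w v := by
    intro v w
    rw [fderiv_clm_apply hd (by fun_prop)]
    simp
  have hs : IsSymmSndFDerivAt ℝ f x := hf.contDiffAt.isSymmSndFDerivAt (by
    simp only [minSmoothness_of_isRCLikeNormedField]; exact WithTop.coe_le_coe.2 le_top)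
  unfold partialDeriv
  rw [h, h]
  exact hs _ _

lemma iterPartial_add {f g : Rn n → ℝ} (hf : ContDiff ℝ ∞ f) (hg : ContDiff ℝ ∞ g)
    (α : List (Fin n)) :
    iterPartial α (fun x => f x + g x) = fun x => iterPartial α f x + iterPartial α g x := by
  induction α generalizing f g with
  | nil => rfl
  | cons i α ih =>
    simp only [iterPartial]
    rw [partialDeriv_add (hf.differentiable (by simp)) (hg.differentiable (by simp)),
      ih (contDiff_partialDeriv hf i) (contDiff_partialDeriv hg i)]

lemma iterPartial_const_mul (c : ℝ) {f : Rn n → ℝ} (hf : ContDiff ℝ ∞ f) (α : List (Fin n)) :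
    iterPartial α (fun x => c * f x) = fun x => c * iterPartial α f x := by
  induction α generalizing f with
  | nil => rfl
  | cons i α ih =>
    simp only [iterPartial]
    rw [partialDeriv_const_mul c (hf.differentiable (by simp)), ih (contDiff_partialDeriv hf i)]

namespace SmoothLp

variable {p q r : ℝ≥0∞} {f g : Rn n → ℝ}

lemma differentiable (hf : SmoothLp p f) : Differentiable ℝ f :=
  hf.contDiff.differentiable (by simp)

lemma continuous (hf : SmoothLp p f) : Continuous f := hf.contDiff.continuous

lemma bdd0 (hf : SmoothLp p f) : ∃ C, ∀ x, |f x| ≤ C := hf.bdd []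

lemma memLp0 (hf : SmoothLp p f) : MemLp f p volume := hf.memLp []

lemma partialDeriv (hf : SmoothLp p f) (i : Fin n) : SmoothLp p (partialDeriv i f) :=
  ⟨contDiff_partialDeriv hf.contDiff i, fun α => hf.bdd (i :: α), fun α => hf.memLp (i :: α)⟩

lemma add (hf : SmoothLp p f) (hg : SmoothLp p g) : SmoothLp p (fun x => f x + g x) := by
  refine ⟨hf.contDiff.add hg.contDiff, fun α => ?_, fun α => ?_⟩
  · obtain ⟨C, hC⟩ := hf.bdd α
    obtain ⟨C', hC'⟩ := hg.bdd α
    refine ⟨C + C', fun x => ?_⟩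
    rw [iterPartial_add hf.contDiff hg.contDiff]
    exact (abs_add_le _ _).trans (add_le_add (hC x) (hC' x))
  · rw [iterPartial_add hf.contDiff hg.contDiff]
    exact (hf.memLp α).add (hg.memLp α)

lemma const_mul (c : ℝ) (hf : SmoothLp p f) : SmoothLp p (fun x => c * f x) := by
  refine ⟨contDiff_const.mul hf.contDiff, fun α => ?_, fun α => ?_⟩
  · obtain ⟨C, hC⟩ := hf.bdd α
    refine ⟨|c| * C, fun x => ?_⟩
    rw [iterPartial_const_mul c hf.contDiff, abs_mul]
    exact mul_le_mul_of_nonneg_left (hC x) (abs_nonneg _)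
  · rw [iterPartial_const_mul c hf.contDiff]
    exact (hf.memLp α).const_mul c

lemma sub (hf : SmoothLp p f) (hg : SmoothLp p g) : SmoothLp p (fun x => f x - g x) := by
  have := hf.add (hg.const_mul (-1))
  refine (by simpa [sub_eq_add_neg] using this)

lemma sum {ι : Type*} (s : Finset ι) {F : ι → Rn n → ℝ} (hF : ∀ i, SmoothLp p (F i)) :
    SmoothLp p (fun x => ∑ i ∈ s, F i x) := by
  classical
  induction s using Finset.induction_on with
  | empty =>
    have h0 : ∀ α : List (Fin n), iterPartial α (fun _ : Rn n => (0 : ℝ)) = fun _ => 0 := by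
      intro α
      have := iterPartial_const_mul 0 (contDiff_const (c := (0 : ℝ)) (E := Rn n) (𝕜 := ℝ) (n := ∞)) α
      simpa using this
    simp only [Finset.sum_empty]
    refine ⟨contDiff_const, fun α => ⟨0, fun x => ?_⟩, fun α => ?_⟩
    · rw [h0]; simp
    · rw [h0]; exact MemLp.zero'
  | insert a s ha ih =>
    simp only [Finset.sum_insert ha]
    exact (hF a).add ih

lemma mul [p.HolderTriple q r] (hf : SmoothLp p f) (hg : SmoothLp q g) :
    SmoothLp r (fun x => f x * g x) := by
  have key : ∀ (α : List (Fin n)) (f g : Rn n → ℝ), SmoothLp p f → SmoothLp q g →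
      (∃ C, ∀ x, |iterPartial α (fun x => f x * g x) x| ≤ C) ∧
        MemLp (iterPartial α (fun x => f x * g x)) r volume := by
    intro α
    induction α with
    | nil =>
      intro f g hf hg
      obtain ⟨C, hC⟩ := hf.bdd0
      obtain ⟨C', hC'⟩ := hg.bdd0
      refine ⟨⟨C * C', fun x => ?_⟩, ?_⟩
      · simp only [iterPartial, abs_mul]
        exact mul_le_mul (hC x) (hC' x) (abs_nonneg _) ((abs_nonneg _).trans (hC x))
      · exact hg.memLp0.mul' hf.memLp0
    | cons i α ih =>
      intro f g hf hg
      simp only [iterPartial]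
      have h1 := (hf.partialDeriv i).contDiff.mul hg.contDiff
      have h2 := hf.contDiff.mul (hg.partialDeriv i).contDiff
      rw [partialDeriv_mul hf.differentiable hg.differentiable, iterPartial_add h1 h2]
      obtain ⟨⟨C, hC⟩, hm⟩ := ih _ _ (hf.partialDeriv i) hg
      obtain ⟨⟨C', hC'⟩, hm'⟩ := ih _ _ hf (hg.partialDeriv i)
      exact ⟨⟨C + C', fun x => (abs_add_le _ _).trans (add_le_add (hC x) (hC' x))⟩, hm.add hm'⟩
  exact ⟨hf.contDiff.mul hg.contDiff, fun α => (key α f g hf hg).1, fun α => (key α f g hf hg).2⟩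

lemma integrable (hf : SmoothLp 1 f) : Integrable f := memLp_one_iff_integrable.1 hf.memLp0

lemma of_hasCompactSupport (hf : ContDiff ℝ ∞ f) (hc : HasCompactSupport f) : SmoothLp p f := by
  have key : ∀ α : List (Fin n), HasCompactSupport (iterPartial α f) := by
    intro α
    induction α generalizing f with
    | nil => exact hc
    | cons i α ih => exact ih (contDiff_partialDeriv hf i) (hasCompactSupport_partialDeriv hc i)
  refine ⟨hf, fun α => ?_, fun α => ?_⟩
  · obtain ⟨C, hC⟩ := (contDiff_iterPartial hf α).continuous.bounded_above_of_compact_support (key α)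
    exact ⟨C, hC⟩
  · exact (contDiff_iterPartial hf α).continuous.memLp_of_hasCompactSupport (key α)

end SmoothLp

/-- The divergence theorem on `ℝⁿ` for integrable functions with integrable derivatives. -/
lemma integral_partialDeriv_eq_zero {W : Rn n → ℝ} (hW : SmoothLp 1 W) (i : Fin n) :
    ∫ x, partialDeriv i W x = 0 := by
  have := integral_mul_fderiv_eq_neg_fderiv_mul_of_integrable (μ := (volume : Measure (Rn n)))
    (f := fun _ => (1 : ℝ)) (g := W) (v := EuclideanSpace.single i 1)
    (by simp) (by simp only [one_mul]; exact (hW.partialDeriv i).integrable)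
    (by simpa using hW.integrable) (fun x _ => by fun_prop) (fun x _ => hW.differentiable x)
  simpa [partialDeriv] using this

lemma fderiv_apply_eq_sum (f : Rn n → ℝ) (x v : Rn n) :
    fderiv ℝ f x v = ∑ i, v i * partialDeriv i f x := by
  have hv : v = ∑ i, v i • EuclideanSpace.single i (1 : ℝ) := by
    ext j
    simp [Finset.sum_apply, Pi.single_apply]
  conv_lhs => rw [hv]
  rw [map_sum]
  simp [partialDeriv]

lemma SmoothLp.fderiv_bdd {p : ℝ≥0∞} {f : Rn n → ℝ} (hf : SmoothLp p f) :
    ∃ C, 0 ≤ C ∧ ∀ x, ‖fderiv ℝ f x‖ ≤ C := by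
  choose C hC using fun i => (hf.partialDeriv i).bdd0
  have hC0 : ∀ i, 0 ≤ C i := fun i => (abs_nonneg _).trans (hC i 0)
  refine ⟨∑ i, C i, Finset.sum_nonneg fun i _ => hC0 i, fun x => ?_⟩
  refine ContinuousLinearMap.opNorm_le_bound _ (Finset.sum_nonneg fun i _ => hC0 i) fun v => ?_
  rw [fderiv_apply_eq_sum, Finset.sum_mul]
  refine (Finset.abs_sum_le_sum_abs _ _).trans (Finset.sum_le_sum fun i _ => ?_)
  rw [abs_mul, mul_comm]
  exact mul_le_mul (hC i x) (by simpa using PiLp.norm_apply_le v i) (abs_nonneg _) (hC0 i)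

end

section

/-! ### The Gaussian measure and the heat semigroup -/

variable {n : ℕ}

/-- The density of the standard Gaussian measure on `ℝⁿ`. -/
def gaussDensity (z : Rn n) : ℝ := ((2 * Real.pi) ^ (n / 2 : ℝ))⁻¹ * Real.exp (-(1 / 2) * ‖z‖ ^ 2)

/-- The standard Gaussian measure on `ℝⁿ`. -/
def gauss (n : ℕ) : Measure (Rn n) :=
  volume.withDensity fun z => ENNReal.ofReal (gaussDensity z)

lemma gaussDensity_nonneg (z : Rn n) : 0 ≤ gaussDensity z := by unfold gaussDensity; positivity

lemma contDiff_gaussDensity : ContDiff ℝ ∞ (gaussDensity (n := n)) := by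
  unfold gaussDensity
  exact contDiff_const.mul (Real.contDiff_exp.comp (contDiff_const.mul (contDiff_norm_sq ℝ)))

lemma measurable_gaussDensity : Measurable (gaussDensity (n := n)) :=
  contDiff_gaussDensity.continuous.measurable

lemma integrable_exp_neg_mul_sq_norm {b : ℝ} (hb : 0 < b) :
    Integrable fun z : Rn n => Real.exp (-b * ‖z‖ ^ 2) := by
  by_contra h
  have h1 := GaussianFourier.integral_rexp_neg_mul_sq_norm (V := Rn n) hb
  rw [integral_undef h] at h1
  have : 0 < (Real.pi / b) ^ (Module.finrank ℝ (Rn n) / 2 : ℝ) := by positivity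
  linarith

lemma integrable_gaussDensity : Integrable (gaussDensity (n := n)) :=
  (integrable_exp_neg_mul_sq_norm (by norm_num)).const_mul _

lemma integral_gaussDensity : ∫ z : Rn n, gaussDensity z = 1 := by
  unfold gaussDensity
  rw [integral_const_mul, GaussianFourier.integral_rexp_neg_mul_sq_norm (by norm_num)]
  have : Real.pi / (1 / 2) = 2 * Real.pi := by ring
  rw [this, finrank_euclideanSpace_fin]
  exact inv_mul_cancel₀ (by positivity)

instance : IsProbabilityMeasure (gauss n) := by
  constructor
  rw [gauss, withDensity_apply _ MeasurableSet.univ, Measure.restrict_univ,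
    ← ofReal_integral_eq_lintegral_ofReal integrable_gaussDensity
      (Eventually.of_forall gaussDensity_nonneg), integral_gaussDensity, ENNReal.ofReal_one]

lemma integral_gauss (F : Rn n → ℝ) : ∫ z, F z ∂gauss n = ∫ z, gaussDensity z * F z := by
  rw [gauss, integral_withDensity_eq_integral_toReal_smul measurable_gaussDensity.ennreal_ofReal
    (Eventually.of_forall fun _ => ENNReal.ofReal_lt_top)]
  refine integral_congr_ae (Eventually.of_forall fun z => ?_)
  simp [ENNReal.toReal_ofReal (gaussDensity_nonneg z)]

lemma integrable_norm_mul_gaussDensity : Integrable fun z : Rn n => ‖z‖ * gaussDensity z := by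
  have h := (integrable_exp_neg_mul_sq_norm (n := n) (b := 1 / 4) (by norm_num)).const_mul
    ((2 * Real.pi) ^ (n / 2 : ℝ))⁻¹
  refine h.mono' (continuous_norm.mul contDiff_gaussDensity.continuous).aestronglyMeasurable
    (Eventually.of_forall fun z => ?_)
  have h1 : ‖z‖ ≤ Real.exp (1 / 4 * ‖z‖ ^ 2) := by
    nlinarith [Real.add_one_le_exp (1 / 4 * ‖z‖ ^ 2), sq_nonneg (‖z‖ / 2 - 1)]
  have h2 : Real.exp (-(1 / 4) * ‖z‖ ^ 2)
      = Real.exp (1 / 4 * ‖z‖ ^ 2) * Real.exp (-(1 / 2) * ‖z‖ ^ 2) := by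
    rw [← Real.exp_add]; ring_nf
  rw [Real.norm_of_nonneg (mul_nonneg (norm_nonneg _) (gaussDensity_nonneg z)), h2, gaussDensity]
  calc _ = ((2 * Real.pi) ^ (n / 2 : ℝ))⁻¹ * (‖z‖ * Real.exp (-(1 / 2) * ‖z‖ ^ 2)) := by ring
    _ ≤ _ := by gcongr

lemma integrable_norm_gauss : Integrable (fun z : Rn n => ‖z‖) (gauss n) := by
  rw [gauss, integrable_withDensity_iff measurable_gaussDensity.ennreal_ofReal
    (Eventually.of_forall fun _ => ENNReal.ofReal_lt_top)]
  simpa [ENNReal.toReal_ofReal (gaussDensity_nonneg _)] using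
    integrable_norm_mul_gaussDensity (n := n)

lemma partialDeriv_gaussDensity (i : Fin n) (z : Rn n) :
    fderiv ℝ gaussDensity z (EuclideanSpace.single i 1) = -z i * gaussDensity z := by
  have h1 : HasFDerivAt (fun z : Rn n => ‖z‖ ^ 2) (2 • innerSL ℝ z) z :=
    (hasStrictFDerivAt_norm_sq z).hasFDerivAt
  have h2 := (((h1.const_mul (-(1 / 2))).exp).const_mul ((2 * Real.pi) ^ (n / 2 : ℝ))⁻¹)
  have h3 : fderiv ℝ gaussDensity z = _ := h2.fderiv
  rw [h3]
  simp [gaussDensity, EuclideanSpace.inner_single_right]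
  ring

/-- Gaussian integration by parts. -/
lemma integral_coord_mul_gauss {F : Rn n → ℝ} (hF : Differentiable ℝ F) {C C' : ℝ}
    (hC : ∀ z, |F z| ≤ C) (i : Fin n) (hc : Continuous (partialDeriv i F))
    (hC' : ∀ z, |partialDeriv i F z| ≤ C') :
    ∫ z, z i * F z ∂gauss n = ∫ z, partialDeriv i F z ∂gauss n := by
  rw [integral_gauss, integral_gauss]
  have hz : ∀ z : Rn n, |z i| ≤ ‖z‖ := fun z => by simpa using PiLp.norm_apply_le z i
  have e1 : (fun z : Rn n => F z * fderiv ℝ gaussDensity z (EuclideanSpace.single i 1))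
      = fun z => -(gaussDensity z * (z i * F z)) := by
    funext z; rw [partialDeriv_gaussDensity]; ring
  have i1 : Integrable fun z : Rn n => gaussDensity z * (z i * F z) := by
    refine (integrable_norm_mul_gaussDensity.const_mul C).mono'
      (contDiff_gaussDensity.continuous.mul
        ((by fun_prop : Continuous fun z : Rn n => z i).mul hF.continuous)).aestronglyMeasurable
      (Eventually.of_forall fun z => ?_)
    rw [Real.norm_eq_abs, abs_mul, abs_mul, abs_of_nonneg (gaussDensity_nonneg z)]
    calc gaussDensity z * (|z i| * |F z|) ≤ gaussDensity z * (‖z‖ * C) := by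
          have := gaussDensity_nonneg z
          gcongr
          exacts [hz z, hC z]
      _ = _ := by ring
  have h := integral_mul_fderiv_eq_neg_fderiv_mul_of_integrable
    (μ := (volume : Measure (Rn n))) (f := F) (g := gaussDensity)
    (v := EuclideanSpace.single i 1) ?_ ?_ ?_ (fun x _ => hF x)
    (fun x _ => contDiff_gaussDensity.differentiable (by simp) x)
  · rw [e1, integral_neg, neg_inj] at h
    rw [h]
    exact integral_congr_ae (Eventually.of_forall fun z => mul_comm _ _)
  · exact integrable_gaussDensity.bdd_mul hc.aestronglyMeasurable (Eventually.of_forall hC')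
  · rw [e1]; exact i1.neg
  · exact integrable_gaussDensity.bdd_mul hF.continuous.aestronglyMeasurable
      (Eventually.of_forall hC)

/-- The heat semigroup `e^{sΔ} f`, written as a Gaussian average. For `s ≤ 0` it is `f`, as
`√(2s) = 0` there. -/
def heat (s : ℝ) (f : Rn n → ℝ) (x : Rn n) : ℝ := ∫ z, f (x + √(2 * s) • z) ∂gauss n

lemma heat_zero (f : Rn n → ℝ) : heat 0 f = f := by
  funext x; simp [heat]

lemma integrable_heat {f : Rn n → ℝ} (hf : Continuous f) {C : ℝ} (hC : ∀ x, |f x| ≤ C)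
    (s : ℝ) (x : Rn n) : Integrable (fun z => f (x + √(2 * s) • z)) (gauss n) :=
  (integrable_const C).mono' (by fun_prop) (Eventually.of_forall fun _ => hC _)

lemma abs_heat_le {f : Rn n → ℝ} {C : ℝ} (hC : ∀ x, |f x| ≤ C) (s : ℝ) (x : Rn n) :
    |heat s f x| ≤ C := by
  have := norm_integral_le_of_norm_le_const (μ := gauss n)
    (f := fun z => f (x + √(2 * s) • z)) (C := C) (Eventually.of_forall fun z => hC _)
  simpa [heat] using this

lemma continuous_heat {f : Rn n → ℝ} (hf : Continuous f) {C : ℝ} (hC : ∀ x, |f x| ≤ C) :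
    Continuous fun p : ℝ × Rn n => heat p.1 f p.2 := by
  unfold heat
  refine continuous_of_dominated (bound := fun _ => C) (fun p => ?_)
    (fun p => Eventually.of_forall fun z => hC _) (integrable_const C)
    (Eventually.of_forall fun z => ?_)
  · exact (by fun_prop : Continuous fun z => f (p.2 + √(2 * p.1) • z)).aestronglyMeasurable
  · fun_prop

variable {p : ℝ≥0∞} {f g : Rn n → ℝ}

lemma hasFDerivAt_heat (hf : SmoothLp p f) (s : ℝ) (x : Rn n) :
    HasFDerivAt (heat s f) (∫ z, fderiv ℝ f (x + √(2 * s) • z) ∂gauss n) x := by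
  obtain ⟨C, -, hC⟩ := hf.fderiv_bdd
  obtain ⟨C0, hC0⟩ := hf.bdd0
  have hc : Continuous (fderiv ℝ f) := hf.contDiff.continuous_fderiv (by simp)
  have hcf := hf.continuous
  unfold heat
  refine hasFDerivAt_integral_of_dominated_of_fderiv_le (s := Set.univ) (bound := fun _ => C)
    (F' := fun x z => fderiv ℝ f (x + √(2 * s) • z)) univ_mem (Eventually.of_forall fun y => ?_) (integrable_heat hf.continuous hC0 s x) ?_
    (Eventually.of_forall fun z y _ => hC _) (integrable_const C)
    (Eventually.of_forall fun z y _ => ?_)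
  · exact (by fun_prop : Continuous fun z => f (y + √(2 * s) • z)).aestronglyMeasurable
  · exact (by fun_prop : Continuous fun z => fderiv ℝ f (x + √(2 * s) • z)).aestronglyMeasurable
  · have h1 : HasFDerivAt (fun y : Rn n => y + √(2 * s) • z) (ContinuousLinearMap.id ℝ (Rn n)) y :=
      (hasFDerivAt_id y).add_const _
    simpa [Function.comp_def] using (hf.differentiable _).hasFDerivAt.comp y h1

lemma partialDeriv_heat (hf : SmoothLp p f) (s : ℝ) (i : Fin n) :
    partialDeriv i (heat s f) = heat s (partialDeriv i f) := by
  funext x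
  obtain ⟨C, -, hC⟩ := hf.fderiv_bdd
  have hc : Continuous (fderiv ℝ f) := hf.contDiff.continuous_fderiv (by simp)
  rw [partialDeriv, (hasFDerivAt_heat hf s x).fderiv, ContinuousLinearMap.integral_apply]
  · rfl
  · exact (integrable_const C).mono'
      (by fun_prop : Continuous fun z => fderiv ℝ f (x + √(2 * s) • z)).aestronglyMeasurable
      (Eventually.of_forall fun _ => hC _)

lemma iterPartial_heat (hf : SmoothLp p f) (s : ℝ) (α : List (Fin n)) :
    iterPartial α (heat s f) = heat s (iterPartial α f) := by
  induction α generalizing f with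
  | nil => rfl
  | cons i α ih =>
    simp only [iterPartial]
    rw [partialDeriv_heat hf, ih (hf.partialDeriv i)]

lemma contDiff_heat (hf : SmoothLp p f) (s : ℝ) : ContDiff ℝ ∞ (heat s f) := by
  rw [contDiff_infty]
  intro m
  induction m generalizing f with
  | zero =>
    rw [Nat.cast_zero, contDiff_zero]
    have hd : Differentiable ℝ (heat s f) := fun x => (hasFDerivAt_heat hf s x).differentiableAt
    exact hd.continuous
  | succ m ih =>
    rw [Nat.cast_succ, contDiff_succ_iff_fderiv_apply]
    refine ⟨fun x => (hasFDerivAt_heat hf s x).differentiableAt, by simp, fun y => ?_⟩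
    simp_rw [fderiv_apply_eq_sum]
    refine ContDiff.sum fun i _ => contDiff_const.mul ?_
    rw [partialDeriv_heat hf]
    exact ih (hf.partialDeriv i)

/-- The Laplacian. -/
def laplace (f : Rn n → ℝ) (x : Rn n) : ℝ := ∑ i, partialDeriv i (partialDeriv i f) x

lemma SmoothLp.laplace (hf : SmoothLp p f) : SmoothLp p (laplace f) :=
  SmoothLp.sum _ fun i => (hf.partialDeriv i).partialDeriv i

lemma laplace_heat (hf : SmoothLp p f) (s : ℝ) :
    laplace (heat s f) = heat s (laplace f) := by
  funext x
  unfold laplace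
  simp_rw [partialDeriv_heat hf, partialDeriv_heat (hf.partialDeriv _)]
  simp only [heat]
  rw [integral_finsetSum]
  intro i _
  obtain ⟨C, hC⟩ := ((hf.partialDeriv i).partialDeriv i).bdd0
  exact integrable_heat ((hf.partialDeriv i).partialDeriv i).continuous hC s x

/-- The heat equation. -/
lemma hasDerivAt_heat (hf : SmoothLp p f) {s : ℝ} (hs : 0 < s) (x : Rn n) :
    HasDerivAt (fun s => heat s f x) (laplace (heat s f) x) s := by
  obtain ⟨C, hC0, hC⟩ := hf.fderiv_bdd
  obtain ⟨C0, hC0'⟩ := hf.bdd0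
  have hc : Continuous (fderiv ℝ f) := hf.contDiff.continuous_fderiv (by simp)
  have hcf := hf.continuous
  have hd : ∀ t : ℝ, 0 < t → HasDerivAt (fun t : ℝ => √(2 * t)) (√(2 * t))⁻¹ t := by
    intro t ht
    have := ((hasDerivAt_id' t).const_mul 2).sqrt (by positivity)
    rwa [mul_one, div_mul_cancel_left₀ (two_ne_zero : (2 : ℝ) ≠ 0)] at this
  set σ : ℝ := √(2 * s) with hσ
  have hσ0 : 0 < σ := Real.sqrt_pos.2 (by positivity)
  have key : HasDerivAt (fun s => heat s f x)
      (∫ z, fderiv ℝ f (x + σ • z) (σ⁻¹ • z) ∂gauss n) s := by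
    unfold heat
    refine (hasDerivAt_integral_of_dominated_loc_of_deriv_le (s := Set.Ioi (s / 2))
      (F' := fun t z => fderiv ℝ f (x + √(2 * t) • z) ((√(2 * t))⁻¹ • z))
      (bound := fun z => C * ((√s)⁻¹ * ‖z‖)) (Ioi_mem_nhds (by linarith))
      (Eventually.of_forall fun t => ?_) (integrable_heat hf.continuous hC0' s x) ?_
      (Eventually.of_forall fun z t ht => ?_) ((integrable_norm_gauss.const_mul _).const_mul _)
      (Eventually.of_forall fun z t ht => ?_)).2
    · exact (by fun_prop : Continuous fun z => f (x + √(2 * t) • z)).aestronglyMeasurable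
    · exact (by fun_prop : Continuous fun z =>
        fderiv ℝ f (x + √(2 * s) • z) ((√(2 * s))⁻¹ • z)).aestronglyMeasurable
    · refine (ContinuousLinearMap.le_opNorm _ _).trans ?_
      rw [norm_smul, norm_inv, Real.norm_of_nonneg (Real.sqrt_nonneg _)]
      have ht' : s / 2 < t := ht
      have : √s ≤ √(2 * t) := Real.sqrt_le_sqrt (by linarith)
      have hs' : 0 < √s := Real.sqrt_pos.2 hs
      gcongr
      exact hC _
    · have ht' : s / 2 < t := ht
      have h1 := ((hd t (by linarith)).smul_const z).const_add x
      exact (hf.differentiable (x + √(2 * t) • z)).hasFDerivAt.comp_hasDerivAt t h1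
  convert key using 1
  rw [laplace_heat hf]
  have e : ∀ z : Rn n, fderiv ℝ f (x + σ • z) (σ⁻¹ • z)
      = ∑ i, σ⁻¹ * (z i * partialDeriv i f (x + σ • z)) := by
    intro z
    rw [fderiv_apply_eq_sum]
    exact Finset.sum_congr rfl fun i _ => by simp [mul_assoc]
  simp_rw [e]
  have hsh : ∀ i, ∀ z, HasFDerivAt (fun z => partialDeriv i f (x + σ • z))
      (σ • fderiv ℝ (partialDeriv i f) (x + σ • z)) z := by
    intro i z
    have h1 : HasFDerivAt (fun z : Rn n => x + σ • z) (σ • ContinuousLinearMap.id ℝ (Rn n)) z :=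
      ((hasFDerivAt_id z).const_smul σ).const_add x
    have := ((hf.partialDeriv i).differentiable (x + σ • z)).hasFDerivAt.comp z h1
    simpa [Function.comp_def] using this
  have hp : ∀ i, ∀ z, partialDeriv i (fun z => partialDeriv i f (x + σ • z)) z
      = σ * partialDeriv i (partialDeriv i f) (x + σ • z) := by
    intro i z
    rw [partialDeriv, (hsh i z).fderiv]
    rfl
  have hI : ∀ i, Integrable (fun z : Rn n => z i * partialDeriv i f (x + σ • z)) (gauss n) := by
    intro i
    obtain ⟨C', hC'⟩ := (hf.partialDeriv i).bdd0
    have hci := (hf.partialDeriv i).continuous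
    refine (integrable_norm_gauss.mul_const C').mono' (by fun_prop)
      (Eventually.of_forall fun z => ?_)
    rw [Real.norm_eq_abs, abs_mul]
    exact mul_le_mul (by simpa using PiLp.norm_apply_le z i) (hC' _) (abs_nonneg _) (norm_nonneg _)
  rw [integral_finsetSum _ fun i _ => (hI i).const_mul _]
  simp only [heat, GaffneyBMO.laplace]
  rw [integral_finsetSum]
  · refine Finset.sum_congr rfl fun i _ => ?_
    obtain ⟨C1, hC1⟩ := (hf.partialDeriv i).bdd0
    obtain ⟨C2, hC2⟩ := ((hf.partialDeriv i).partialDeriv i).bdd0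
    have hci := ((hf.partialDeriv i).partialDeriv i).continuous
    -- the chain rule in `√(2s)` produces the factor `zᵢ`, which integration by parts against the
    -- Gaussian turns into a second derivative
    rw [integral_const_mul, integral_coord_mul_gauss (C' := σ * C2)
      (fun z => (hsh i z).differentiableAt) (fun z => hC1 _) i]
    · simp_rw [hp]
      rw [integral_const_mul, ← mul_assoc, inv_mul_cancel₀ hσ0.ne', one_mul]
    · simp_rw [funext (hp i)]
      fun_prop
    · intro z
      rw [hp, abs_mul, abs_of_pos hσ0]
      exact mul_le_mul_of_nonneg_left (hC2 _) hσ0.le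
  · intro i _
    obtain ⟨C2, hC2⟩ := ((hf.partialDeriv i).partialDeriv i).bdd0
    exact integrable_heat ((hf.partialDeriv i).partialDeriv i).continuous hC2 s x

end

section

/-! ### Averages contract `L²` -/

variable {n : ℕ}

lemma enorm_integral_sq_le {Z E : Type*} [MeasurableSpace Z] [NormedAddCommGroup E]
    [NormedSpace ℝ E] (κ : Measure Z) [IsProbabilityMeasure κ] {F : Z → E}
    (hF : AEStronglyMeasurable F κ) : ‖∫ z, F z ∂κ‖ₑ ^ 2 ≤ ∫⁻ z, ‖F z‖ₑ ^ 2 ∂κ := by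
  have h1 : ‖∫ z, F z ∂κ‖ₑ ≤ eLpNorm F 1 κ := by
    rw [eLpNorm_one_eq_lintegral_enorm]; exact enorm_integral_le_lintegral_enorm _
  have h2 : eLpNorm F 1 κ ≤ eLpNorm F 2 κ := eLpNorm_le_eLpNorm_of_exponent_le (by norm_num) hF
  calc ‖∫ z, F z ∂κ‖ₑ ^ 2 ≤ eLpNorm F 2 κ ^ 2 := by gcongr; exact h1.trans h2
    _ = _ := by
      have := eLpNorm_nnreal_pow_eq_lintegral (μ := κ) (f := F) (p := 2) (by norm_num)
      simpa using this

/-- Minkowski's inequality for averages, in the form given by Jensen's inequality. -/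
lemma lintegral_enorm_integral_sq_le {Z E : Type*} [MeasurableSpace Z] [NormedAddCommGroup E]
    [NormedSpace ℝ E] (κ : Measure Z) [IsProbabilityMeasure κ] {F : Rn n → Z → E}
    (hF : StronglyMeasurable (Function.uncurry F)) :
    ∫⁻ x, ‖∫ z, F x z ∂κ‖ₑ ^ 2 ≤ ∫⁻ z, (∫⁻ x, ‖F x z‖ₑ ^ 2) ∂κ := by
  calc ∫⁻ x, ‖∫ z, F x z ∂κ‖ₑ ^ 2 ≤ ∫⁻ x, ∫⁻ z, ‖F x z‖ₑ ^ 2 ∂κ := by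
        refine lintegral_mono fun x => enorm_integral_sq_le κ ?_
        exact (hF.comp_measurable measurable_prodMk_left).aestronglyMeasurable
    _ = _ := lintegral_lintegral_swap (hF.enorm.pow_const 2).aemeasurable

lemma eLpNorm_two_sq {α E : Type*} [MeasurableSpace α] [NormedAddCommGroup E] (μ : Measure α)
    (f : α → E) : eLpNorm f 2 μ ^ 2 = ∫⁻ x, ‖f x‖ₑ ^ 2 ∂μ := by
  have := eLpNorm_nnreal_pow_eq_lintegral (μ := μ) (f := f) (p := 2) (by norm_num)
  simpa using this

lemma eLpNorm_average_le {Z E : Type*} [MeasurableSpace Z] [NormedAddCommGroup E]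
    [NormedSpace ℝ E] (κ : Measure Z) [IsProbabilityMeasure κ] {T : Z → Rn n} (hT : Measurable T)
    {f : Rn n → E} (hf : StronglyMeasurable f) :
    eLpNorm (fun x => ∫ z, f (x + T z) ∂κ) 2 volume ≤ eLpNorm f 2 volume := by
  rw [← ENNReal.pow_le_pow_left_iff (two_ne_zero), eLpNorm_two_sq, eLpNorm_two_sq]
  refine (lintegral_enorm_integral_sq_le κ (F := fun x z => f (x + T z)) ?_).trans ?_
  · exact hf.comp_measurable (measurable_fst.add (hT.comp measurable_snd))
  · have : ∀ z, ∫⁻ x, ‖f (x + T z)‖ₑ ^ 2 = ∫⁻ x, ‖f x‖ₑ ^ 2 := fun z =>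
      lintegral_add_right_eq_self (fun x => ‖f x‖ₑ ^ 2) (T z)
    simp [this]

lemma eLpNorm_heat_le {f : Rn n → ℝ} (hf : Continuous f) (s : ℝ) :
    eLpNorm (heat s f) 2 volume ≤ eLpNorm f 2 volume :=
  eLpNorm_average_le (gauss n) (T := fun z => √(2 * s) • z) (by fun_prop) hf.stronglyMeasurable

lemma SmoothLp.heat_top {p : ℝ≥0∞} {f : Rn n → ℝ} (hf : SmoothLp p f) (s : ℝ) :
    SmoothLp ∞ (heat s f) := by
  have hb : ∀ α, ∃ C, ∀ x, |iterPartial α (heat s f) x| ≤ C := fun α => by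
    obtain ⟨C, hC⟩ := hf.bdd α
    exact ⟨C, fun x => by rw [iterPartial_heat hf]; exact abs_heat_le hC s x⟩
  refine ⟨contDiff_heat hf s, hb, fun α => ?_⟩
  obtain ⟨C, hC⟩ := hb α
  exact memLp_top_of_bound
    (contDiff_iterPartial (contDiff_heat hf s) α).continuous.aestronglyMeasurable C
    (Eventually.of_forall hC)

lemma SmoothLp.heat_two {f : Rn n → ℝ} (hf : SmoothLp 2 f) (s : ℝ) : SmoothLp 2 (heat s f) := by
  refine ⟨contDiff_heat hf s, (hf.heat_top s).bdd, fun α => ?_⟩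
  refine ⟨(contDiff_iterPartial (contDiff_heat hf s) α).continuous.aestronglyMeasurable, ?_⟩
  rw [iterPartial_heat hf]
  exact (eLpNorm_heat_le (contDiff_iterPartial hf.contDiff α).continuous s).trans_lt
    (hf.memLp α).eLpNorm_lt_top

lemma integral_sq_eq_toReal {α : Type*} [MeasurableSpace α] {μ : Measure α} {f : α → ℝ}
    (hf : AEStronglyMeasurable f μ) : ∫ x, f x ^ 2 ∂μ = (eLpNorm f 2 μ ^ 2).toReal := by
  rw [eLpNorm_two_sq, integral_eq_lintegral_of_nonneg_ae (Eventually.of_forall fun x => sq_nonneg _)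
    (hf.pow 2)]
  congr 1
  refine lintegral_congr fun x => ?_
  rw [← ofReal_norm, ← ENNReal.ofReal_pow (norm_nonneg _), Real.norm_eq_abs, sq_abs]

lemma integral_heat_sq_le {f : Rn n → ℝ} (hf : SmoothLp 2 f) (s : ℝ) :
    ∫ x, heat s f x ^ 2 ≤ ∫ x, f x ^ 2 := by
  rw [integral_sq_eq_toReal hf.continuous.aestronglyMeasurable,
    integral_sq_eq_toReal (hf.heat_two s).continuous.aestronglyMeasurable]
  refine ENNReal.toReal_mono (by simpa using hf.memLp0.eLpNorm_ne_top) ?_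
  gcongr
  exact eLpNorm_heat_le hf.continuous s

end

section

/-! ### Space-time integrals along the heat flow -/

variable {n : ℕ}

/-- The measure `ds dx` on the slab `[0, S] × ℝⁿ`. -/
def slab (n : ℕ) (S : ℝ) : Measure (ℝ × Rn n) :=
  (volume.restrict (Set.Icc 0 S)).prod volume

/-- The heat extension of `f` to space-time. -/
def flow (f : Rn n → ℝ) (p : ℝ × Rn n) : ℝ := heat p.1 f p.2

variable {p : ℝ≥0∞} {f g : Rn n → ℝ} {S : ℝ}

lemma SmoothLp.continuous_flow (hf : SmoothLp p f) : Continuous (flow f) := by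
  obtain ⟨C, hC⟩ := hf.bdd0
  exact continuous_heat hf.continuous hC

lemma SmoothLp.flow_bdd (hf : SmoothLp p f) : ∃ C, ∀ q, |flow f q| ≤ C := by
  obtain ⟨C, hC⟩ := hf.bdd0
  exact ⟨C, fun q => abs_heat_le hC _ _⟩

lemma SmoothLp.memLp_top_flow (hf : SmoothLp p f) : MemLp (flow f) ∞ (slab n S) := by
  obtain ⟨C, hC⟩ := hf.flow_bdd
  exact memLp_top_of_bound hf.continuous_flow.aestronglyMeasurable C (Eventually.of_forall hC)

lemma SmoothLp.memLp_two_flow (hf : SmoothLp 2 f) : MemLp (flow f) 2 (slab n S) := by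
  refine ⟨hf.continuous_flow.aestronglyMeasurable, ?_⟩
  have h : eLpNorm (flow f) 2 (slab n S) ^ 2 ≤ ∫⁻ _ in Set.Icc 0 S, eLpNorm f 2 volume ^ 2 := by
    rw [eLpNorm_two_sq, slab, lintegral_prod _
      (hf.continuous_flow.enorm.measurable.pow_const 2).aemeasurable]
    refine lintegral_mono fun s => ?_
    have := eLpNorm_two_sq volume (heat s f)
    simp only [flow]
    rw [← this]
    gcongr
    exact eLpNorm_heat_le hf.continuous s
  have h2 : eLpNorm (flow f) 2 (slab n S) ^ 2 < ⊤ := by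
    refine h.trans_lt ?_
    rw [lintegral_const]
    refine ENNReal.mul_lt_top (ENNReal.pow_lt_top hf.memLp0.eLpNorm_lt_top) ?_
    simp
  by_contra hc
  rw [not_lt, top_le_iff] at hc
  simp [hc] at h2

lemma integral_slab {G : ℝ → Rn n → ℝ} (hG : Integrable (fun q : ℝ × Rn n => G q.1 q.2) (slab n S)) :
    ∫ q, G q.1 q.2 ∂slab n S = ∫ s in Set.Icc 0 S, ∫ x, G s x := by
  rw [slab, integral_prod _ hG]

/-- The fundamental theorem of calculus in time, integrated in space. -/
lemma integral_sub_integral_eq_slab {F F' : ℝ → Rn n → ℝ} (hS : 0 ≤ S)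
    (hc : ∀ x, Continuous fun s => F s x)
    (hd : ∀ s, 0 < s → ∀ x, HasDerivAt (fun s => F s x) (F' s x) s)
    (hF'c : Continuous fun q : ℝ × Rn n => F' q.1 q.2) (h0 : Integrable (F 0))
    (hS' : Integrable (F S)) (hF' : Integrable (fun q : ℝ × Rn n => F' q.1 q.2) (slab n S)) :
    (∫ x, F S x) - ∫ x, F 0 x = ∫ q, F' q.1 q.2 ∂slab n S := by
  rw [← integral_sub hS' h0, slab, integral_prod_symm _ hF']
  refine integral_congr_ae (Eventually.of_forall fun x => ?_)
  have hci : Continuous fun s => F' s x := hF'c.comp (by fun_prop : Continuous fun s => (s, x))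
  have := intervalIntegral.integral_eq_sub_of_hasDerivAt_of_le hS (hc x).continuousOn
    (fun s hs => hd s hs.1 x) (hci.intervalIntegrable _ _)
  rw [intervalIntegral.integral_of_le hS, ← integral_Icc_eq_integral_Ioc] at this
  exact this.symm

lemma integral_slab_congr {G R : ℝ → Rn n → ℝ}
    (hG : Integrable (fun q : ℝ × Rn n => G q.1 q.2) (slab n S))
    (hR : Integrable (fun q : ℝ × Rn n => R q.1 q.2) (slab n S))
    (h : ∀ s, ∫ x, G s x = ∫ x, R s x) :
    ∫ q, G q.1 q.2 ∂slab n S = ∫ q, R q.1 q.2 ∂slab n S := by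
  rw [integral_slab hG, integral_slab hR]
  simp_rw [h]

/-- The Cauchy–Schwarz inequality with prescribed bounds of the two factors. -/
lemma integral_abs_mul_le {α : Type*} [MeasurableSpace α] {μ : Measure α} {f g : α → ℝ} {A B : ℝ}
    (hf : MemLp f 2 μ) (hg : MemLp g 2 μ) (hA : 0 ≤ A) (hB : 0 ≤ B)
    (hfA : ∫ x, f x ^ 2 ∂μ ≤ A ^ 2) (hgB : ∫ x, g x ^ 2 ∂μ ≤ B ^ 2) :
    ∫ x, |f x * g x| ∂μ ≤ A * B := by
  have h := integral_mul_norm_le_Lp_mul_Lq (μ := μ) (f := f) (g := g) (p := 2) (q := 2)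
    (by constructor <;> norm_num) (by simpa using hf) (by simpa using hg)
  have e : ∀ h : α → ℝ, ∫ x, ‖h x‖ ^ (2 : ℝ) ∂μ = ∫ x, h x ^ 2 ∂μ := fun h => by
    refine integral_congr_ae (Eventually.of_forall fun x => ?_)
    simp
  rw [e, e] at h
  simp only [Real.norm_eq_abs, ← abs_mul] at h
  refine h.trans ?_
  rw [← Real.sqrt_eq_rpow, ← Real.sqrt_eq_rpow]
  exact mul_le_mul (Real.sqrt_le_iff.2 ⟨hA, hfA⟩) (Real.sqrt_le_iff.2 ⟨hB, hgB⟩)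
    (Real.sqrt_nonneg _) hA

lemma hasDerivAt_heat' (hf : SmoothLp p f) {s : ℝ} (hs : 0 < s) (x : Rn n) :
    HasDerivAt (fun s => heat s f x) (heat s (laplace f) x) s := by
  rw [← laplace_heat hf]
  exact hasDerivAt_heat hf hs x

lemma SmoothLp.continuous_heat_time (hf : SmoothLp p f) (x : Rn n) :
    Continuous fun s => heat s f x :=
  hf.continuous_flow.comp (by fun_prop : Continuous fun s : ℝ => (s, x))

lemma integrable_mul_of_memLp_two {α : Type*} [MeasurableSpace α] {μ : Measure α} {f g : α → ℝ}
    (hf : MemLp f 2 μ) (hg : MemLp g 2 μ) : Integrable (fun x => f x * g x) μ :=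
  MemLp.integrable_mul (p := 2) (q := 2) hf hg

/-- The energy inequality for the heat flow, from `d/ds ∫ g² = -2 ∫ |∇g|²`. -/
lemma energy_le (hg : SmoothLp 2 g) (hS : 0 ≤ S) :
    ∑ k, ∫ q, flow (partialDeriv k g) q ^ 2 ∂slab n S ≤ 1 / 2 * ∫ x, g x ^ 2 := by
  have hm : ∀ k, MemLp (flow (partialDeriv k g)) 2 (slab n S) :=
    fun k => (hg.partialDeriv k).memLp_two_flow
  have hi : Integrable (fun q : ℝ × Rn n => 2 * (flow g q * flow (laplace g) q)) (slab n S) :=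
    (integrable_mul_of_memLp_two hg.memLp_two_flow hg.laplace.memLp_two_flow).const_mul 2
  have hi2 : Integrable (fun q : ℝ × Rn n => -2 * ∑ k, flow (partialDeriv k g) q ^ 2)
      (slab n S) := (integrable_finsetSum _ fun k _ => (hm k).integrable_sq).const_mul _
  have hsq : ∀ s, Integrable fun x => heat s g x ^ 2 := fun s => (hg.heat_two s).memLp0.integrable_sq
  have h1 := integral_sub_integral_eq_slab (S := S) (F := fun s x => heat s g x ^ 2)
    (F' := fun s x => 2 * (heat s g x * heat s (laplace g) x)) hS
    (fun x => (hg.continuous_heat_time x).pow 2) (fun s hs x => ?_) ?_ (hsq 0) (hsq S) hi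
  · have h2 := integral_slab_congr (S := S)
      (G := fun s x => 2 * (heat s g x * heat s (laplace g) x))
      (R := fun s x => -2 * ∑ k, heat s (partialDeriv k g) x ^ 2) hi hi2 ?_
    · have h4 : ∫ q : ℝ × Rn n, ∑ k, heat q.1 (partialDeriv k g) q.2 ^ 2 ∂slab n S
          = ∑ k, ∫ q, flow (partialDeriv k g) q ^ 2 ∂slab n S :=
        integral_finsetSum _ fun k _ => (hm k).integrable_sq
      rw [h2, integral_const_mul, h4, heat_zero] at h1
      have h3 : 0 ≤ ∫ x, heat S g x ^ 2 := integral_nonneg fun x => sq_nonneg _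
      simp only [flow] at h1 ⊢
      linarith
    · intro s
      have hgs := hg.heat_two s
      have hW : ∀ k, SmoothLp 1 (fun x => heat s g x * partialDeriv k (heat s g) x) :=
        fun k => hgs.mul (hgs.partialDeriv k)
      rw [← sub_eq_zero, ← integral_sub]
      · have : ∀ x, 2 * (heat s g x * heat s (laplace g) x)
            - -2 * ∑ k, heat s (partialDeriv k g) x ^ 2
            = ∑ k, 2 * partialDeriv k
              (fun x => heat s g x * partialDeriv k (heat s g) x) x := by
          intro x
          simp_rw [partialDeriv_mul hgs.differentiable (hgs.partialDeriv _).differentiable,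
            ← partialDeriv_heat hg, ← laplace_heat hg, laplace, ← Finset.mul_sum,
            Finset.sum_add_distrib, ← Finset.mul_sum]
          simp_rw [sq]
          ring
        simp_rw [this]
        rw [integral_finsetSum _ fun k _ => ((hW k).partialDeriv k).integrable.const_mul 2]
        simp_rw [integral_const_mul, integral_partialDeriv_eq_zero (hW _)]
        simp
      · exact (integrable_mul_of_memLp_two hgs.memLp0 (hg.laplace.heat_two s).memLp0).const_mul 2
      · exact (integrable_finsetSum _ fun k _ =>
          ((hg.partialDeriv k).heat_two s).memLp0.integrable_sq).const_mul _
  · exact ((hasDerivAt_heat' hg hs x).fun_pow 2).congr_deriv (by simp [mul_assoc])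
  · have h1 := hg.continuous_flow
    have h2 := hg.laplace.continuous_flow
    exact continuous_const.mul (h1.mul h2)

/-- The Dirichlet energy along the heat flow is integrable in time, hence it is small at some time. -/
lemma exists_gradient_small (hg : SmoothLp 2 g) {ε : ℝ} (hε : 0 < ε) :
    ∃ S, 0 ≤ S ∧ ∑ k, ∫ x, heat S (partialDeriv k g) x ^ 2 < ε := by
  by_contra! h
  set N : ℝ := 1 / 2 * ∫ x, g x ^ 2
  have hN : 0 ≤ N := by
    have : 0 ≤ ∫ x, g x ^ 2 := integral_nonneg fun x => sq_nonneg _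
    positivity
  have hS : 0 ≤ (N + 1) / ε := by positivity
  have h1 := energy_le hg hS
  have hi : ∀ k, Integrable (fun q : ℝ × Rn n => flow (partialDeriv k g) q ^ 2)
      (slab n ((N + 1) / ε)) := fun k => (hg.partialDeriv k).memLp_two_flow.integrable_sq
  have hi' : ∀ k, Integrable (fun q : ℝ × Rn n => heat q.1 (partialDeriv k g) q.2 ^ 2)
      (slab n ((N + 1) / ε)) := hi
  have h2 : ∑ k, ∫ q, flow (partialDeriv k g) q ^ 2 ∂slab n ((N + 1) / ε)
      = ∫ s in Set.Icc 0 ((N + 1) / ε), ∑ k, ∫ x, heat s (partialDeriv k g) x ^ 2 := by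
    rw [integral_finsetSum]
    · exact Finset.sum_congr rfl fun k _ =>
        integral_slab (G := fun s x => heat s (partialDeriv k g) x ^ 2) (hi k)
    · exact fun k _ => (hi' k).integral_prod_left
  rw [h2] at h1
  have h3 : ∫ _ in Set.Icc 0 ((N + 1) / ε), ε
      ≤ ∫ s in Set.Icc 0 ((N + 1) / ε), ∑ k, ∫ x, heat s (partialDeriv k g) x ^ 2 := by
    refine setIntegral_mono_on (by simp) ?_ measurableSet_Icc fun s hs => h s hs.1
    exact integrable_finsetSum _ fun k _ => (hi' k).integral_prod_left
  rw [setIntegral_const, Real.volume_real_Icc_of_le hS, sub_zero, smul_eq_mul,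
    div_mul_cancel₀ _ hε.ne'] at h3
  have := h3.trans h1
  simp only [N] at this
  linarith

end

section

/-! ### The Carleson estimate for functions of bounded oscillation -/

variable {n : ℕ}

variable {p : ℝ≥0∞} {f g a : Rn n → ℝ} {S K : ℝ}

/-- The Gaussian variance `e^{sΔ}(a²) - (e^{sΔ}a)²`. -/
def heatVar (a : Rn n → ℝ) (s : ℝ) (x : Rn n) : ℝ :=
  heat s (fun y => a y * a y) x - heat s a x * heat s a x

lemma SmoothLp.sq_top (ha : SmoothLp ∞ a) : SmoothLp ∞ (fun y => a y * a y) := ha.mul ha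

lemma SmoothLp.heatVar (ha : SmoothLp ∞ a) (s : ℝ) : SmoothLp ∞ (heatVar a s) :=
  (ha.sq_top.heat_top s).sub ((ha.heat_top s).mul (ha.heat_top s))

lemma laplace_sub (hf : SmoothLp ∞ f) (hg : SmoothLp ∞ g) (x : Rn n) :
    laplace (fun x => f x - g x) x = laplace f x - laplace g x := by
  simp only [laplace]
  simp_rw [partialDeriv_sub hf.differentiable hg.differentiable,
    partialDeriv_sub (hf.partialDeriv _).differentiable (hg.partialDeriv _).differentiable,
    Finset.sum_sub_distrib]

lemma laplace_mul_self (hf : SmoothLp ∞ f) (x : Rn n) :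
    laplace (fun x => f x * f x) x
      = 2 * f x * laplace f x + 2 * ∑ k, partialDeriv k f x ^ 2 := by
  simp only [laplace]
  simp_rw [partialDeriv_mul hf.differentiable hf.differentiable]
  have : ∀ k, partialDeriv k (fun x => partialDeriv k f x * f x + f x * partialDeriv k f x) x
      = 2 * f x * partialDeriv k (partialDeriv k f) x + 2 * partialDeriv k f x ^ 2 := by
    intro k
    have h1 := (hf.partialDeriv k).differentiable
    have h2 := hf.differentiable
    rw [partialDeriv_add (h1.fun_mul h2) (h2.fun_mul h1), partialDeriv_mul h1 h2, partialDeriv_mul h2 h1]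
    ring
  simp_rw [this, Finset.sum_add_distrib, Finset.mul_sum]

/-- The Gaussian variance solves the heat equation with source `2|∇ e^{sΔ}a|²`. -/
lemma laplace_heatVar (ha : SmoothLp ∞ a) (s : ℝ) (x : Rn n) :
    heat s (laplace fun y => a y * a y) x - 2 * heat s a x * heat s (laplace a) x
      = laplace (heatVar a s) x + 2 * ∑ k, partialDeriv k (heat s a) x ^ 2 := by
  have h1 := laplace_sub (ha.sq_top.heat_top s) ((ha.heat_top s).mul (ha.heat_top s)) x
  rw [laplace_mul_self (ha.heat_top s)] at h1
  unfold heatVar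
  rw [h1, laplace_heat ha.sq_top, laplace_heat ha]
  ring

/-- The spatial integration by parts behind the Carleson estimate, for the function
`(4Kβ - β²) g²`. -/
lemma carleson_slice {β : Rn n → ℝ} (hβ : SmoothLp ∞ β) (ha : SmoothLp ∞ a) (hg : SmoothLp 2 g) :
    ∫ x, ((4 * K - 2 * β x) * (laplace β x + 2 * ∑ k, partialDeriv k a x ^ 2) * g x ^ 2
        + (4 * K * β x - β x ^ 2) * (2 * g x * laplace g x))
      = ∫ x, ∑ k, (2 * (4 * K - 2 * β x) * (partialDeriv k a x ^ 2 * g x ^ 2)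
          + 2 * (partialDeriv k β x ^ 2 * g x ^ 2)
          - 4 * (4 * K - 2 * β x) * (g x * partialDeriv k g x * partialDeriv k β x)
          - 2 * (4 * K * β x - β x ^ 2) * partialDeriv k g x ^ 2) := by
  have hc : SmoothLp ∞ (fun x => 4 * K - 2 * β x) := by
    have h0 : SmoothLp ∞ (fun _ : Rn n => 4 * K) := by
      have := SmoothLp.const_mul (4 * K) (f := fun _ : Rn n => (1 : ℝ)) (p := ∞) ?_
      · simpa using this
      · have h0 : ∀ α : List (Fin n), iterPartial α (fun _ : Rn n => (0 : ℝ)) = fun _ => 0 := by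
          intro α
          simpa using iterPartial_const_mul 0
            (contDiff_const (c := (0 : ℝ)) (E := Rn n) (𝕜 := ℝ) (n := ∞)) α
        have h1 : ∀ α : List (Fin n), ∃ c : ℝ, iterPartial α (fun _ : Rn n => (1 : ℝ))
            = fun _ => c := by
          intro α
          cases α with
          | nil => exact ⟨1, rfl⟩
          | cons i α =>
            refine ⟨0, ?_⟩
            have : partialDeriv i (fun _ : Rn n => (1 : ℝ)) = fun _ => 0 := by
              funext x; simp [partialDeriv]
            simp only [iterPartial]
            rw [this, h0]
        refine ⟨contDiff_const, fun α => ?_, fun α => ?_⟩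
        · obtain ⟨c, hc⟩ := h1 α
          exact ⟨|c|, fun x => by rw [hc]⟩
        · obtain ⟨c, hc⟩ := h1 α
          rw [hc]
          exact memLp_top_const c
    exact h0.sub (hβ.const_mul 2)
  have hψ : SmoothLp ∞ (fun x => 4 * K * β x - β x * β x) := (hβ.const_mul _).sub (hβ.mul hβ)
  have hgg : SmoothLp 1 (fun x => g x * g x) := hg.mul hg
  have hgk : ∀ k, SmoothLp 1 (fun x => g x * partialDeriv k g x) := fun k =>
    hg.mul (hg.partialDeriv k)
  have hkk : ∀ k, SmoothLp 1 (fun x => partialDeriv k g x * partialDeriv k g x) := fun k =>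
    (hg.partialDeriv k).mul (hg.partialDeriv k)
  have hW1 : ∀ k, SmoothLp 1 (fun x => ((4 * K - 2 * β x) * partialDeriv k β x) * (g x * g x)) :=
    fun k => (hc.mul (r := ∞) (hβ.partialDeriv k)).mul hgg
  have hW2 : ∀ k, SmoothLp 1 (fun x => (4 * K * β x - β x * β x) * (g x * partialDeriv k g x)) :=
    fun k => hψ.mul (hgk k)
  rw [← sub_eq_zero, ← integral_sub]
  · have : ∀ x, ((4 * K - 2 * β x) * (laplace β x + 2 * ∑ k, partialDeriv k a x ^ 2) * g x ^ 2
        + (4 * K * β x - β x ^ 2) * (2 * g x * laplace g x))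
        - ∑ k, (2 * (4 * K - 2 * β x) * (partialDeriv k a x ^ 2 * g x ^ 2)
          + 2 * (partialDeriv k β x ^ 2 * g x ^ 2)
          - 4 * (4 * K - 2 * β x) * (g x * partialDeriv k g x * partialDeriv k β x)
          - 2 * (4 * K * β x - β x ^ 2) * partialDeriv k g x ^ 2)
        = ∑ k, (partialDeriv k (fun x => ((4 * K - 2 * β x) * partialDeriv k β x) * (g x * g x)) x
          + 2 * partialDeriv k
            (fun x => (4 * K * β x - β x * β x) * (g x * partialDeriv k g x)) x) := by
      intro x
      have e0 : ((4 * K - 2 * β x) * (laplace β x + 2 * ∑ k, partialDeriv k a x ^ 2) * g x ^ 2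
        + (4 * K * β x - β x ^ 2) * (2 * g x * laplace g x))
        = ∑ k, ((4 * K - 2 * β x) * (partialDeriv k (partialDeriv k β) x
            + 2 * partialDeriv k a x ^ 2) * g x ^ 2
          + (4 * K * β x - β x ^ 2) * (2 * g x * partialDeriv k (partialDeriv k g) x)) := by
        simp only [laplace]
        rw [Finset.sum_add_distrib, ← Finset.sum_mul, ← Finset.mul_sum, Finset.sum_add_distrib,
          ← Finset.mul_sum, ← Finset.mul_sum, ← Finset.mul_sum]
      rw [e0, ← Finset.sum_sub_distrib]
      refine Finset.sum_congr rfl fun k _ => ?_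
      have d1 := hβ.differentiable
      have d2 := hg.differentiable
      have d3 := (hβ.partialDeriv k).differentiable
      have d4 := (hg.partialDeriv k).differentiable
      have d5 := hc.differentiable
      have e1 : partialDeriv k (fun x => 4 * K - 2 * β x) x = - (2 * partialDeriv k β x) := by
        rw [partialDeriv_sub (differentiable_const _) (d1.const_mul 2), partialDeriv_const_mul 2 d1]
        simp [partialDeriv]
      have e2 : partialDeriv k (fun x => 4 * K * β x - β x * β x) x
          = (4 * K - 2 * β x) * partialDeriv k β x := by
        rw [partialDeriv_sub (d1.const_mul _) (d1.fun_mul d1), partialDeriv_const_mul _ d1,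
          partialDeriv_mul d1 d1]
        ring
      rw [partialDeriv_mul (d5.fun_mul d3) (d2.fun_mul d2), partialDeriv_mul d5 d3, partialDeriv_mul d2 d2,
        partialDeriv_mul hψ.differentiable (d2.fun_mul d4), partialDeriv_mul d2 d4]
      simp only [e1, e2]
      ring
    simp_rw [this]
    rw [integral_finsetSum]
    · refine Finset.sum_eq_zero fun k _ => ?_
      rw [integral_add ((hW1 k).partialDeriv k).integrable
        (((hW2 k).partialDeriv k).integrable.const_mul 2), integral_const_mul,
        integral_partialDeriv_eq_zero (hW1 k), integral_partialDeriv_eq_zero (hW2 k)]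
      simp
    · exact fun k _ => ((hW1 k).partialDeriv k).integrable.add
        (((hW2 k).partialDeriv k).integrable.const_mul 2)
  · have h1 : SmoothLp ∞ (fun x => laplace β x + 2 * ∑ k, partialDeriv k a x * partialDeriv k a x) :=
      hβ.laplace.add ((SmoothLp.sum _ fun k => (ha.partialDeriv k).mul (ha.partialDeriv k)).const_mul 2)
    have h2 := ((hc.mul (r := ∞) h1).mul (r := 1) hgg).add
      (hψ.mul (r := 1) ((hg.mul (r := 1) hg.laplace).const_mul 2))
    refine h2.integrable.congr (Eventually.of_forall fun x => ?_)
    simp only [sq]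
    ring
  · refine integrable_finsetSum _ fun k _ => ?_
    have hak := ha.partialDeriv k
    have hβk := hβ.partialDeriv k
    have h2 := ((((hc.mul (r := ∞) (hak.mul (r := ∞) hak)).mul (r := 1) hgg).const_mul 2).add
      (((hβk.mul (r := ∞) hβk).mul (r := 1) hgg).const_mul 2)).sub
      ((((hc.mul (r := ∞) hβk).mul (r := 1) (hgk k)).const_mul 4).add
        ((hψ.mul (r := 1) (hkk k)).const_mul 2))
    refine h2.integrable.congr (Eventually.of_forall fun x => ?_)
    simp only [sq]
    ring

/-- If the Gaussian variance of `a` is at most `K`, then `|∇ e^{sΔ}a|² ds dx` is a Carleson measure: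
it embeds the heat extension of `L²`. The proof differentiates `∫ (4Kβ - β²) g²` along the heat
flow, where `β` is the variance. -/
lemma carleson_le (ha : SmoothLp ∞ a) (hK : 0 < K) (hβ : ∀ s x, heatVar a s x ≤ K)
    (hβ0 : ∀ s x, 0 ≤ heatVar a s x) (hg : SmoothLp 2 g) (hS : 0 ≤ S) :
    ∑ k, ∫ q, (flow (partialDeriv k a) q * flow g q) ^ 2 ∂slab n S ≤ 6 * K * ∫ x, g x ^ 2 := by
  -- the time derivatives of the variance `β` and of `(4Kβ - β²) g²`
  set β' : ℝ → Rn n → ℝ := fun s x =>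
    heat s (laplace fun y => a y * a y) x - 2 * heat s a x * heat s (laplace a) x with hβ'
  set F' : ℝ → Rn n → ℝ := fun s x =>
    (4 * K - 2 * heatVar a s x) * β' s x * heat s g x ^ 2
      + (4 * K * heatVar a s x - heatVar a s x ^ 2) * (2 * heat s g x * heat s (laplace g) x) with hF'
  set R : ℝ → Rn n → ℝ := fun s x =>
    ∑ k, (2 * (4 * K - 2 * heatVar a s x) * (heat s (partialDeriv k a) x ^ 2 * heat s g x ^ 2)
          + 2 * (partialDeriv k (heatVar a s) x ^ 2 * heat s g x ^ 2)
          - 4 * (4 * K - 2 * heatVar a s x)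
            * (heat s g x * heat s (partialDeriv k g) x * partialDeriv k (heatVar a s) x)
          - 2 * (4 * K * heatVar a s x - heatVar a s x ^ 2) * heat s (partialDeriv k g) x ^ 2)
    with hR
  have c1 := ha.continuous_flow
  have c2 := ha.sq_top.continuous_flow
  have c3 := ha.laplace.continuous_flow
  have c4 := ha.sq_top.laplace.continuous_flow
  have c5 := hg.continuous_flow
  have c6 := hg.laplace.continuous_flow
  have c7 : ∀ k, Continuous (flow (partialDeriv k a)) := fun k => (ha.partialDeriv k).continuous_flow
  have c8 : ∀ k, Continuous (flow (partialDeriv k g)) := fun k => (hg.partialDeriv k).continuous_flow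
  have c9 : ∀ k, Continuous (flow (partialDeriv k fun y => a y * a y)) :=
    fun k => (ha.sq_top.partialDeriv k).continuous_flow
  have hdβ : ∀ k s x, partialDeriv k (heatVar a s) x
      = heat s (partialDeriv k fun y => a y * a y) x
        - 2 * (heat s (partialDeriv k a) x * heat s a x) := by
    intro k s x
    have d1 := (ha.heat_top s).differentiable
    unfold heatVar
    rw [partialDeriv_sub (ha.sq_top.heat_top s).differentiable (d1.fun_mul d1),
      partialDeriv_heat ha.sq_top, partialDeriv_mul d1 d1, partialDeriv_heat ha]
    ring
  -- continuity and boundedness of the space-time coefficients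
  have cβ : Continuous fun q : ℝ × Rn n => heatVar a q.1 q.2 := c2.sub (c1.mul c1)
  have cβ' : Continuous fun q : ℝ × Rn n => β' q.1 q.2 :=
    c4.sub ((continuous_const.mul c1).mul c3)
  have cdβ : ∀ k, Continuous fun q : ℝ × Rn n => partialDeriv k (heatVar a q.1) q.2 := by
    intro k
    simp_rw [hdβ]
    exact (c9 k).sub (continuous_const.mul ((c7 k).mul c1))
  have b1 := ha.memLp_top_flow (S := S)
  have mβ : MemLp (fun q : ℝ × Rn n => heatVar a q.1 q.2) ∞ (slab n S) :=
    ha.sq_top.memLp_top_flow.sub (b1.mul b1)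
  have mβ' : MemLp (fun q : ℝ × Rn n => β' q.1 q.2) ∞ (slab n S) := by
    refine (ha.sq_top.laplace.memLp_top_flow.sub
      ((ha.laplace.memLp_top_flow.mul b1 (r := ∞)).const_mul 2)).congr_norm
      cβ'.aestronglyMeasurable (Eventually.of_forall fun q => ?_)
    simp [hβ', flow, mul_assoc]
  have mdβ : ∀ k, MemLp (fun q : ℝ × Rn n => partialDeriv k (heatVar a q.1) q.2) ∞ (slab n S) := by
    intro k
    simp_rw [hdβ]
    exact (ha.sq_top.partialDeriv k).memLp_top_flow.sub
      ((b1.mul (ha.partialDeriv k).memLp_top_flow (r := ∞)).const_mul 2)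
  have mc : MemLp (fun q : ℝ × Rn n => 4 * K - 2 * heatVar a q.1 q.2) ∞ (slab n S) :=
    (memLp_top_const _).sub (mβ.const_mul 2)
  have mψ : MemLp (fun q : ℝ × Rn n => 4 * K * heatVar a q.1 q.2 - heatVar a q.1 q.2 ^ 2) ∞
      (slab n S) := by
    simp_rw [sq]
    exact (mβ.const_mul _).sub (mβ.mul mβ)
  have mg := hg.memLp_two_flow (S := S)
  have mgk : ∀ k, MemLp (flow (partialDeriv k g)) 2 (slab n S) :=
    fun k => (hg.partialDeriv k).memLp_two_flow
  have hI : ∀ {c u v : ℝ × Rn n → ℝ}, MemLp c ∞ (slab n S) → MemLp u 2 (slab n S) →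
      MemLp v 2 (slab n S) → Integrable (fun q => c q * (u q * v q)) (slab n S) :=
    fun hc hu hv => memLp_one_iff_integrable.1
      ((memLp_one_iff_integrable.2 (integrable_mul_of_memLp_two hu hv)).mul' hc)
  have iF' : Integrable (fun q : ℝ × Rn n => F' q.1 q.2) (slab n S) := by
    refine ((hI (mβ'.mul' mc (r := ∞)) mg mg).add
      ((hI mψ mg hg.laplace.memLp_two_flow).const_mul 2)).congr (Eventually.of_forall fun q => ?_)
    simp only [hF', flow, Pi.add_apply]
    ring
  have iR : Integrable (fun q : ℝ × Rn n => R q.1 q.2) (slab n S) := by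
    refine integrable_finsetSum _ fun k _ => ?_
    have mak := (ha.partialDeriv k).memLp_top_flow (S := S)
    refine (((((hI ((mak.mul' mak (r := ∞)).mul' mc (r := ∞)) mg mg).const_mul 2).add
      ((hI ((mdβ k).mul' (mdβ k) (r := ∞)) mg mg).const_mul 2)).sub
      ((hI ((mdβ k).mul' mc (r := ∞)) mg (mgk k)).const_mul 4)).sub
      ((hI mψ (mgk k) (mgk k)).const_mul 2)).congr (Eventually.of_forall fun q => ?_)
    simp only [flow, Pi.add_apply, Pi.sub_apply]
    ring
  -- the weight `4Kβ - β²` lies in `[0, 3K²]`, as `0 ≤ β ≤ K`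
  have ψle : ∀ s x, 0 ≤ 4 * K * heatVar a s x - heatVar a s x ^ 2 ∧
      4 * K * heatVar a s x - heatVar a s x ^ 2 ≤ 3 * K ^ 2 := by
    intro s x
    have h1 := hβ s x
    have h2 := hβ0 s x
    constructor <;> nlinarith
  have iF : ∀ s, Integrable fun x =>
      (4 * K * heatVar a s x - heatVar a s x ^ 2) * heat s g x ^ 2 := by
    intro s
    refine (hg.heat_two s).memLp0.integrable_sq.bdd_mul (c := 3 * K ^ 2) ?_
      (Eventually.of_forall fun x => ?_)
    · have := (ha.heatVar s).continuous
      exact ((continuous_const.mul this).sub (this.pow 2)).aestronglyMeasurable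
    · rw [Real.norm_of_nonneg (ψle s x).1]
      exact (ψle s x).2
  have ftc := integral_sub_integral_eq_slab (S := S) (F' := F')
    (F := fun s x => (4 * K * heatVar a s x - heatVar a s x ^ 2) * heat s g x ^ 2) hS
    (fun x => ?_) (fun s hs x => ?_) ?_ (iF 0) (iF S) iF'
  · have hslice := integral_slab_congr (G := F') (R := R) iF' iR fun s => by
      have := carleson_slice (K := K) (ha.heatVar s) (ha.heat_top s) (hg.heat_two s)
      simp only [hF', hβ', hR]
      simp_rw [laplace_heatVar ha, ← laplace_heat hg, ← partialDeriv_heat ha,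
        ← partialDeriv_heat hg]
      exact this
    rw [hslice] at ftc
    -- completing the square in `g ∇β`
    have hlow : ∑ k, (4 * K * ∫ q, (flow (partialDeriv k a) q * flow g q) ^ 2 ∂slab n S
        - 38 * K ^ 2 * ∫ q, flow (partialDeriv k g) q ^ 2 ∂slab n S) ≤ ∫ q, R q.1 q.2 ∂slab n S := by
      have i1 : ∀ k, Integrable (fun q => 4 * K * (flow (partialDeriv k a) q * flow g q) ^ 2)
          (slab n S) := by
        intro k
        have mak := (ha.partialDeriv k).memLp_top_flow (S := S)
        refine ((hI (mak.mul' mak (r := ∞)) mg mg).const_mul (4 * K)).congr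
          (Eventually.of_forall fun q => ?_)
        simp only
        ring
      have i2 : ∀ k, Integrable (fun q => 38 * K ^ 2 * flow (partialDeriv k g) q ^ 2) (slab n S) :=
        fun k => (mgk k).integrable_sq.const_mul _
      have i3 : ∀ k, Integrable (fun q => 4 * K * (flow (partialDeriv k a) q * flow g q) ^ 2
          - 38 * K ^ 2 * flow (partialDeriv k g) q ^ 2) (slab n S) := fun k => (i1 k).sub (i2 k)
      have e : ∑ k, (4 * K * ∫ q, (flow (partialDeriv k a) q * flow g q) ^ 2 ∂slab n S
          - 38 * K ^ 2 * ∫ q, flow (partialDeriv k g) q ^ 2 ∂slab n S)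
          = ∫ q, ∑ k, (4 * K * (flow (partialDeriv k a) q * flow g q) ^ 2
            - 38 * K ^ 2 * flow (partialDeriv k g) q ^ 2) ∂slab n S := by
        rw [integral_finsetSum _ fun k _ => i3 k]
        refine Finset.sum_congr rfl fun k _ => ?_
        rw [integral_sub (i1 k) (i2 k), integral_const_mul, integral_const_mul]
      rw [e]
      refine integral_mono (integrable_finsetSum _ fun k _ => (i1 k).sub (i2 k)) iR fun q => ?_
      refine Finset.sum_le_sum fun k _ => ?_
      have h1 := hβ q.1 q.2
      have h2 := hβ0 q.1 q.2
      have h3 := (ψle q.1 q.2).2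
      simp only [flow]
      set A := heat q.1 (partialDeriv k a) q.2
      set G := heat q.1 g q.2
      set D := heat q.1 (partialDeriv k g) q.2
      set B := partialDeriv k (heatVar a q.1) q.2
      set v := heatVar a q.1 q.2
      have t1 : 0 ≤ (2 * (4 * K - 2 * v) - 4 * K) * (A * G) ^ 2 := by
        have : 0 ≤ 2 * (4 * K - 2 * v) - 4 * K := by linarith
        positivity
      have t2 : 0 ≤ 2 * (B * G - (4 * K - 2 * v) * D) ^ 2 := by positivity
      have t3 : 0 ≤ (6 * K ^ 2 - 2 * (4 * K * v - v ^ 2)) * D ^ 2 := by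
        have : 0 ≤ 6 * K ^ 2 - 2 * (4 * K * v - v ^ 2) := by linarith
        positivity
      have t4 : 0 ≤ (32 * K ^ 2 - 2 * (4 * K - 2 * v) ^ 2) * D ^ 2 := by
        have : 0 ≤ 32 * K ^ 2 - 2 * (4 * K - 2 * v) ^ 2 := by nlinarith
        positivity
      linarith
    have hen := energy_le hg hS
    have hSle : ∫ x, (4 * K * heatVar a S x - heatVar a S x ^ 2) * heat S g x ^ 2
        ≤ 3 * K ^ 2 * ∫ x, g x ^ 2 := by
      calc _ ≤ ∫ x, 3 * K ^ 2 * heat S g x ^ 2 :=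
            integral_mono (iF S) ((hg.heat_two S).memLp0.integrable_sq.const_mul _) fun x =>
              mul_le_mul_of_nonneg_right (ψle S x).2 (sq_nonneg _)
        _ = 3 * K ^ 2 * ∫ x, heat S g x ^ 2 := integral_const_mul _ _
        _ ≤ _ := by gcongr ?_ * ?_; exact integral_heat_sq_le hg S
    have h0 : 0 ≤ ∫ x, (4 * K * heatVar a 0 x - heatVar a 0 x ^ 2) * heat 0 g x ^ 2 :=
      integral_nonneg fun x => mul_nonneg (ψle 0 x).1 (sq_nonneg _)
    rw [Finset.sum_sub_distrib, ← Finset.mul_sum, ← Finset.mul_sum] at hlow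
    have hN : 0 ≤ ∫ x, g x ^ 2 := integral_nonneg fun x => sq_nonneg _
    have hfin : 4 * K * ∑ k, ∫ q, (flow (partialDeriv k a) q * flow g q) ^ 2 ∂slab n S
        ≤ 4 * K * (6 * K * ∫ x, g x ^ 2) := by
      have : 38 * K ^ 2 * ∑ k, ∫ q, flow (partialDeriv k g) q ^ 2 ∂slab n S
          ≤ 38 * K ^ 2 * (1 / 2 * ∫ x, g x ^ 2) := by gcongr
      nlinarith [mul_nonneg (sq_nonneg K) hN]
    exact le_of_mul_le_mul_left hfin (by positivity)
  · have e1 := cβ.comp (by fun_prop : Continuous fun s : ℝ => (s, x))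
    have e2 := hg.continuous_heat_time x
    exact ((continuous_const.mul e1).sub (e1.pow 2)).mul (e2.pow 2)
  · have d1 : HasDerivAt (fun s => heatVar a s x) (β' s x) s := by
      have h1 := hasDerivAt_heat' ha hs x
      refine ((hasDerivAt_heat' ha.sq_top hs x).sub (h1.mul h1)).congr_deriv ?_
      simp only [hβ']
      ring
    have d2 := hasDerivAt_heat' hg hs x
    refine (((d1.const_mul (4 * K)).fun_sub (d1.fun_pow 2)).fun_mul (d2.fun_pow 2)).congr_deriv ?_
    simp only [hF', Nat.add_one_sub_one, pow_one, Nat.cast_ofNat]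
    ring
  · exact (((continuous_const.sub (continuous_const.mul cβ)).mul cβ').mul (c5.pow 2)).add
      (((continuous_const.mul cβ).sub (cβ.pow 2)).mul ((continuous_const.mul c5).mul c6))

end

section

/-! ### Null-form estimates -/

variable {n : ℕ}

variable {p q : ℝ≥0∞} {f g a b u v w φ : Rn n → ℝ} {S K : ℝ}

/-- The variance is the second moment about any point `c`, less the square of the distance from `c`
to the mean. -/
lemma heatVar_eq (ha : SmoothLp ∞ a) (c s : ℝ) (x : Rn n) :
    heatVar a s x = ∫ z, (a (x + √(2 * s) • z) - c) ^ 2 ∂gauss n - (heat s a x - c) ^ 2 := by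
  obtain ⟨C, hC⟩ := ha.bdd0
  obtain ⟨C', hC'⟩ := ha.sq_top.bdd0
  have h1 := integrable_heat ha.continuous hC s x
  have h2 := integrable_heat ha.sq_top.continuous hC' s x
  have e : ∀ z, (a (x + √(2 * s) • z) - c) ^ 2 = a (x + √(2 * s) • z) * a (x + √(2 * s) • z)
      - 2 * c * a (x + √(2 * s) • z) + c ^ 2 := fun z => by ring
  have h3 : Integrable (fun z => 2 * c * a (x + √(2 * s) • z)) (gauss n) := h1.const_mul _
  simp_rw [e]
  have h4 : Integrable (fun z => a (x + √(2 * s) • z) * a (x + √(2 * s) • z)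
      - 2 * c * a (x + √(2 * s) • z)) (gauss n) := h2.sub h3
  rw [integral_add h4 (integrable_const _), integral_sub h2 h3, integral_const_mul]
  simp only [heatVar, heat, integral_const, probReal_univ, one_smul]
  ring

lemma heatVar_nonneg (ha : SmoothLp ∞ a) (s : ℝ) (x : Rn n) : 0 ≤ heatVar a s x := by
  rw [heatVar_eq ha (heat s a x), sub_self, zero_pow two_ne_zero, sub_zero]
  exact integral_nonneg fun z => sq_nonneg _

lemma heatVar_le_of_abs_le {C : ℝ} (hC : ∀ x, |a x| ≤ C) (s : ℝ) (x : Rn n) :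
    heatVar a s x ≤ C ^ 2 := by
  have h0 : ∀ y, |a y * a y| ≤ C ^ 2 := fun y => by
    rw [abs_mul, sq]
    exact mul_le_mul (hC y) (hC y) (abs_nonneg _) ((abs_nonneg _).trans (hC y))
  have h1 := (abs_le.1 (abs_heat_le h0 s x)).2
  have h2 := mul_self_nonneg (heat s a x)
  unfold heatVar
  linarith

/-- The null form `∂ᵢf ∂ⱼg - ∂ⱼf ∂ᵢg`. -/
def nullForm (i j : Fin n) (f g : Rn n → ℝ) (x : Rn n) : ℝ :=
  partialDeriv i f x * partialDeriv j g x - partialDeriv j f x * partialDeriv i g x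

/-- The Dirichlet energy `‖∇f‖²`. -/
def dirichlet (f : Rn n → ℝ) : ℝ := ∑ k, ∫ x, partialDeriv k f x ^ 2

lemma dirichlet_nonneg (f : Rn n → ℝ) : 0 ≤ dirichlet f :=
  Finset.sum_nonneg fun _ _ => integral_nonneg fun _ => sq_nonneg _

lemma SmoothLp.nullForm {r : ℝ≥0∞} [p.HolderTriple q r] (hf : SmoothLp p f) (hg : SmoothLp q g)
    (i j : Fin n) : SmoothLp r (nullForm i j f g) :=
  ((hf.partialDeriv i).mul (hg.partialDeriv j)).sub ((hf.partialDeriv j).mul (hg.partialDeriv i))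

lemma partialDeriv_sum {ι : Type*} (s : Finset ι) {F : ι → Rn n → ℝ}
    (hF : ∀ k, Differentiable ℝ (F k)) (i : Fin n) (x : Rn n) :
    partialDeriv i (fun x => ∑ k ∈ s, F k x) x = ∑ k ∈ s, partialDeriv i (F k) x := by
  simp only [partialDeriv]
  rw [fderiv_fun_sum fun k _ => hF k x]
  simp

lemma partialDeriv_laplace (hf : SmoothLp p f) (i : Fin n) :
    partialDeriv i (laplace f) = laplace (partialDeriv i f) := by
  funext x
  unfold laplace
  rw [partialDeriv_sum _ fun k => ((hf.partialDeriv k).partialDeriv k).differentiable]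
  refine Finset.sum_congr rfl fun k _ => ?_
  rw [partialDeriv_comm (hf.partialDeriv k).contDiff, partialDeriv_comm hf.contDiff i k]

lemma partialDeriv_nullForm (hf : SmoothLp p f) (hg : SmoothLp q g) (i j k : Fin n) (x : Rn n) :
    partialDeriv k (nullForm i j f g) x
      = nullForm i j (partialDeriv k f) g x + nullForm i j f (partialDeriv k g) x := by
  have d1 := fun l => (hf.partialDeriv l).differentiable
  have d2 := fun l => (hg.partialDeriv l).differentiable
  unfold nullForm
  rw [partialDeriv_sub ((d1 i).fun_mul (d2 j)) ((d1 j).fun_mul (d2 i)),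
    partialDeriv_mul (d1 i) (d2 j), partialDeriv_mul (d1 j) (d2 i),
    partialDeriv_comm hf.contDiff k i, partialDeriv_comm hf.contDiff k j,
    partialDeriv_comm hg.contDiff k i, partialDeriv_comm hg.contDiff k j]
  ring

/-- Spatial integration by parts for null forms: all second derivatives are moved away from the
factor `B`, and at least one derivative falls on `B`. -/
lemma nullForm_slice [p.HolderTriple q 1] {B U V h k : Rn n → ℝ} (hB : SmoothLp ∞ B)
    (hU : SmoothLp p U) (hV : SmoothLp q V) (hh : SmoothLp p h) (hk : SmoothLp q k) (i j : Fin n) :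
    ∫ x, (laplace B x * nullForm i j U V x + B x * nullForm i j h V x + B x * nullForm i j U k x)
      = ∫ x, (-(∑ l, partialDeriv l B x
          * (nullForm i j (partialDeriv l U) V x + nullForm i j U (partialDeriv l V) x))
        - h x * nullForm i j B V x + k x * nullForm i j B U x) := by
  have hUV : SmoothLp 1 (nullForm i j U V) := hU.nullForm hV i j
  have hW : ∀ l, SmoothLp 1 (fun x => partialDeriv l B x * nullForm i j U V x) :=
    fun l => (hB.partialDeriv l).mul hUV
  have hP : ∀ l, SmoothLp 1 (fun x => B x * (h x * partialDeriv l V x)) :=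
    fun l => hB.mul (r := 1) (hh.mul (r := 1) (hV.partialDeriv l))
  have hQ : ∀ l, SmoothLp 1 (fun x => B x * (partialDeriv l U x * k x)) :=
    fun l => hB.mul (r := 1) ((hU.partialDeriv l).mul (r := 1) hk)
  have hsum : ∀ x, (laplace B x * nullForm i j U V x + B x * nullForm i j h V x
        + B x * nullForm i j U k x)
      - (-(∑ l, partialDeriv l B x
          * (nullForm i j (partialDeriv l U) V x + nullForm i j U (partialDeriv l V) x))
        - h x * nullForm i j B V x + k x * nullForm i j B U x)
      = (∑ l, partialDeriv l (fun x => partialDeriv l B x * nullForm i j U V x) x)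
        + (partialDeriv i (fun x => B x * (h x * partialDeriv j V x)) x
          - partialDeriv j (fun x => B x * (h x * partialDeriv i V x)) x
          - partialDeriv i (fun x => B x * (partialDeriv j U x * k x)) x
          + partialDeriv j (fun x => B x * (partialDeriv i U x * k x)) x) := by
    intro x
    have dB := hB.differentiable
    have dh := hh.differentiable
    have dk := hk.differentiable
    have dB' := fun l => (hB.partialDeriv l).differentiable
    have dU := fun l => (hU.partialDeriv l).differentiable
    have dV := fun l => (hV.partialDeriv l).differentiable
    have e1 : ∀ l, partialDeriv l (fun x => partialDeriv l B x * nullForm i j U V x) x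
        = partialDeriv l (partialDeriv l B) x * nullForm i j U V x + partialDeriv l B x
          * (nullForm i j (partialDeriv l U) V x + nullForm i j U (partialDeriv l V) x) := by
      intro l
      simp only [partialDeriv_mul (dB' l) hUV.differentiable, partialDeriv_nullForm hU hV]
    have e2 : ∀ l m, partialDeriv l (fun x => B x * (h x * partialDeriv m V x)) x
        = partialDeriv l B x * (h x * partialDeriv m V x) + B x * (partialDeriv l h x
          * partialDeriv m V x + h x * partialDeriv l (partialDeriv m V) x) := by
      intro l m
      rw [partialDeriv_mul dB (dh.fun_mul (dV m)), partialDeriv_mul dh (dV m)]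
    have e3 : ∀ l m, partialDeriv l (fun x => B x * (partialDeriv m U x * k x)) x
        = partialDeriv l B x * (partialDeriv m U x * k x) + B x * (partialDeriv l (partialDeriv m U) x
          * k x + partialDeriv m U x * partialDeriv l k x) := by
      intro l m
      rw [partialDeriv_mul dB ((dU m).fun_mul dk), partialDeriv_mul (dU m) dk]
    simp_rw [e1, e2, e3, Finset.sum_add_distrib, ← Finset.sum_mul, partialDeriv_comm hV.contDiff j i,
      partialDeriv_comm hU.contDiff j i]
    simp only [laplace, nullForm]
    ring
  rw [← sub_eq_zero, ← integral_sub]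
  · simp_rw [hsum]
    have hadd : ∀ {f g : Rn n → ℝ}, (Integrable f ∧ ∫ x, f x = 0) → (Integrable g ∧ ∫ x, g x = 0) →
        (Integrable fun x => f x + g x) ∧ ∫ x, (f x + g x) = 0 := fun hf hg =>
      ⟨hf.1.add hg.1, by rw [integral_add hf.1 hg.1, hf.2, hg.2, add_zero]⟩
    have hsub : ∀ {f g : Rn n → ℝ}, (Integrable f ∧ ∫ x, f x = 0) → (Integrable g ∧ ∫ x, g x = 0) →
        (Integrable fun x => f x - g x) ∧ ∫ x, (f x - g x) = 0 := fun hf hg =>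
      ⟨hf.1.sub hg.1, by rw [integral_sub hf.1 hg.1, hf.2, hg.2, sub_zero]⟩
    have hz : ∀ {f : Rn n → ℝ} (m), SmoothLp 1 f →
        Integrable (partialDeriv m f) ∧ ∫ x, partialDeriv m f x = 0 := fun m hf =>
      ⟨(hf.partialDeriv m).integrable, integral_partialDeriv_eq_zero hf m⟩
    refine (hadd ⟨integrable_finsetSum _ fun l _ => (hz l (hW l)).1, ?_⟩ (hadd (hsub (hsub
      (hz i (hP j)) (hz j (hP i))) (hz i (hQ j))) (hz j (hQ i)))).2
    rw [integral_finsetSum _ fun l _ => (hz l (hW l)).1]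
    exact Finset.sum_eq_zero fun l _ => (hz l (hW l)).2
  · exact (((hB.laplace.mul (r := 1) hUV).add (hB.mul (r := 1) (hh.nullForm hV i j (r := 1)))).add
      (hB.mul (r := 1) (hU.nullForm hk i j (r := 1)))).integrable
  · have h1 : SmoothLp 1 (fun x => ∑ l, partialDeriv l B x
          * (nullForm i j (partialDeriv l U) V x + nullForm i j U (partialDeriv l V) x)) :=
      SmoothLp.sum _ fun l => (hB.partialDeriv l).mul (r := 1)
        (((hU.partialDeriv l).nullForm hV i j (r := 1)).add
          (hU.nullForm (hV.partialDeriv l) i j (r := 1)))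
    have h2 : SmoothLp 1 (fun x => h x * nullForm i j B V x) :=
      hh.mul (hB.nullForm hV i j (r := q))
    have h3 : SmoothLp 1 (fun x => nullForm i j B U x * k x) :=
      (hB.nullForm hU i j (r := p)).mul hk
    refine (((h1.const_mul (-1)).sub h2).add h3).integrable.congr (Eventually.of_forall fun x => ?_)
    simp only
    ring

/-- The `ℓ¹` size of the gradient of the heat extension. -/
def grad1 (f : Rn n → ℝ) (q : ℝ × Rn n) : ℝ := ∑ k, |flow (partialDeriv k f) q|

/-- The `ℓ¹` size of the Hessian of the heat extension. -/
def grad2 (f : Rn n → ℝ) (q : ℝ × Rn n) : ℝ := ∑ l, grad1 (partialDeriv l f) q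

lemma grad1_nonneg (f : Rn n → ℝ) (q : ℝ × Rn n) : 0 ≤ grad1 f q :=
  Finset.sum_nonneg fun _ _ => abs_nonneg _

lemma grad2_nonneg (f : Rn n → ℝ) (q : ℝ × Rn n) : 0 ≤ grad2 f q :=
  Finset.sum_nonneg fun _ _ => grad1_nonneg _ _

lemma abs_flow_le_grad1 (f : Rn n → ℝ) (k : Fin n) (q : ℝ × Rn n) :
    |flow (partialDeriv k f) q| ≤ grad1 f q :=
  Finset.single_le_sum (f := fun k => |flow (partialDeriv k f) q|) (fun _ _ => abs_nonneg _)
    (Finset.mem_univ k)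

lemma grad1_le_grad2 (f : Rn n → ℝ) (k : Fin n) (q : ℝ × Rn n) :
    grad1 (partialDeriv k f) q ≤ grad2 f q :=
  Finset.single_le_sum (f := fun k => grad1 (partialDeriv k f) q) (fun _ _ => grad1_nonneg _ _)
    (Finset.mem_univ k)

lemma abs_flow_le_grad2 (f : Rn n → ℝ) (k l : Fin n) (q : ℝ × Rn n) :
    |flow (partialDeriv l (partialDeriv k f)) q| ≤ grad2 f q :=
  (abs_flow_le_grad1 _ _ _).trans (grad1_le_grad2 _ _ _)

lemma sq_sum_fin_le (c : Fin n → ℝ) : (∑ k, c k) ^ 2 ≤ n * ∑ k, c k ^ 2 := by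
  simpa using sq_sum_le_card_mul_sum_sq (s := Finset.univ) (f := c)

lemma sq_grad1_le (f : Rn n → ℝ) (q : ℝ × Rn n) :
    grad1 f q ^ 2 ≤ n * ∑ k, flow (partialDeriv k f) q ^ 2 := by
  simpa [grad1, sq_abs] using sq_sum_fin_le fun k => |flow (partialDeriv k f) q|

lemma SmoothLp.memLp_grad1_top (hf : SmoothLp p f) : MemLp (grad1 f) ∞ (slab n S) :=
  memLp_finsetSum _ fun k _ => (hf.partialDeriv k).memLp_top_flow.abs

lemma SmoothLp.memLp_grad1 (hf : SmoothLp 2 f) : MemLp (grad1 f) 2 (slab n S) :=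
  memLp_finsetSum _ fun k _ => (hf.partialDeriv k).memLp_two_flow.abs

lemma SmoothLp.memLp_grad2_top (hf : SmoothLp p f) : MemLp (grad2 f) ∞ (slab n S) :=
  memLp_finsetSum _ fun k _ => (hf.partialDeriv k).memLp_grad1_top

lemma SmoothLp.memLp_grad2 (hf : SmoothLp 2 f) : MemLp (grad2 f) 2 (slab n S) :=
  memLp_finsetSum _ fun k _ => (hf.partialDeriv k).memLp_grad1

lemma integral_grad1_sq_le (hf : SmoothLp 2 f) (hS : 0 ≤ S) :
    ∫ q, grad1 f q ^ 2 ∂slab n S ≤ n * ∫ x, f x ^ 2 := by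
  have hi : ∀ k, Integrable (fun q => flow (partialDeriv k f) q ^ 2) (slab n S) :=
    fun k => (hf.partialDeriv k).memLp_two_flow.integrable_sq
  have h0 : 0 ≤ ∫ x, f x ^ 2 := integral_nonneg fun x => sq_nonneg _
  calc ∫ q, grad1 f q ^ 2 ∂slab n S
      ≤ ∫ q, n * ∑ k, flow (partialDeriv k f) q ^ 2 ∂slab n S :=
        integral_mono hf.memLp_grad1.integrable_sq
          ((integrable_finsetSum _ fun k _ => hi k).const_mul _) fun q => sq_grad1_le f q
    _ = n * ∑ k, ∫ q, flow (partialDeriv k f) q ^ 2 ∂slab n S := by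
        rw [integral_const_mul, integral_finsetSum _ fun k _ => hi k]
    _ ≤ n * ∫ x, f x ^ 2 := by
        gcongr
        exact (energy_le hf hS).trans (by linarith)

lemma integral_grad2_sq_le (hf : SmoothLp 2 f) (hS : 0 ≤ S) :
    ∫ q, grad2 f q ^ 2 ∂slab n S ≤ n ^ 2 * dirichlet f := by
  have hi : ∀ k, Integrable (fun q => grad1 (partialDeriv k f) q ^ 2) (slab n S) :=
    fun k => (hf.partialDeriv k).memLp_grad1.integrable_sq
  calc ∫ q, grad2 f q ^ 2 ∂slab n S
      ≤ ∫ q, n * ∑ k, grad1 (partialDeriv k f) q ^ 2 ∂slab n S :=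
        integral_mono hf.memLp_grad2.integrable_sq
          ((integrable_finsetSum _ fun k _ => hi k).const_mul _) fun q => sq_sum_fin_le _
    _ = n * ∑ k, ∫ q, grad1 (partialDeriv k f) q ^ 2 ∂slab n S := by
        rw [integral_const_mul, integral_finsetSum _ fun k _ => hi k]
    _ ≤ n * ∑ k, n * ∫ x, partialDeriv k f x ^ 2 := by
        gcongr with k
        exact integral_grad1_sq_le (hf.partialDeriv k) hS
    _ = _ := by rw [← Finset.mul_sum, dirichlet]; ring

lemma memLp_mul_top {α : Type*} [MeasurableSpace α] {μ : Measure α} {f g : α → ℝ}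
    (hf : MemLp f ∞ μ) (hg : MemLp g p μ) : MemLp (fun x => f x * g x) p μ :=
  hg.mul' hf

lemma integral_grad1_flow_sq_le (ha : SmoothLp ∞ a) (hK : 0 < K) (hβ : ∀ s x, heatVar a s x ≤ K)
    (hg : SmoothLp 2 g) (hS : 0 ≤ S) :
    ∫ q, (grad1 a q * flow g q) ^ 2 ∂slab n S ≤ 6 * n * K * ∫ x, g x ^ 2 := by
  have hi : ∀ k, Integrable (fun q => (flow (partialDeriv k a) q * flow g q) ^ 2) (slab n S) :=
    fun k => (memLp_mul_top (ha.partialDeriv k).memLp_top_flow hg.memLp_two_flow).integrable_sq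
  calc ∫ q, (grad1 a q * flow g q) ^ 2 ∂slab n S
      ≤ ∫ q, n * ∑ k, (flow (partialDeriv k a) q * flow g q) ^ 2 ∂slab n S := by
        refine integral_mono (memLp_mul_top ha.memLp_grad1_top hg.memLp_two_flow).integrable_sq
          ((integrable_finsetSum _ fun k _ => hi k).const_mul _) fun q => ?_
        simp only [mul_pow, ← Finset.sum_mul, ← mul_assoc]
        gcongr
        exact sq_grad1_le a q
    _ = n * ∑ k, ∫ q, (flow (partialDeriv k a) q * flow g q) ^ 2 ∂slab n S := by
        rw [integral_const_mul, integral_finsetSum _ fun k _ => hi k]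
    _ ≤ n * (6 * K * ∫ x, g x ^ 2) := by
        gcongr
        exact carleson_le ha hK hβ (heatVar_nonneg ha) hg hS
    _ = _ := by ring

lemma integral_grad1_grad1_sq_le (ha : SmoothLp ∞ a) (hK : 0 < K)
    (hβ : ∀ s x, heatVar a s x ≤ K) (hg : SmoothLp 2 g) (hS : 0 ≤ S) :
    ∫ q, (grad1 a q * grad1 g q) ^ 2 ∂slab n S ≤ 6 * n ^ 2 * K * dirichlet g := by
  have hi : ∀ k, Integrable (fun q => (grad1 a q * flow (partialDeriv k g) q) ^ 2) (slab n S) :=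
    fun k => (memLp_mul_top ha.memLp_grad1_top (hg.partialDeriv k).memLp_two_flow).integrable_sq
  calc ∫ q, (grad1 a q * grad1 g q) ^ 2 ∂slab n S
      ≤ ∫ q, n * ∑ k, (grad1 a q * flow (partialDeriv k g) q) ^ 2 ∂slab n S := by
        refine integral_mono (memLp_mul_top ha.memLp_grad1_top hg.memLp_grad1).integrable_sq
          ((integrable_finsetSum _ fun k _ => hi k).const_mul _) fun q => ?_
        simp only [mul_pow, ← Finset.mul_sum]
        rw [mul_left_comm]
        gcongr
        exact sq_grad1_le g q
    _ = n * ∑ k, ∫ q, (grad1 a q * flow (partialDeriv k g) q) ^ 2 ∂slab n S := by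
        rw [integral_const_mul, integral_finsetSum _ fun k _ => hi k]
    _ ≤ n * ∑ k, 6 * n * K * ∫ x, partialDeriv k g x ^ 2 := by
        gcongr with k
        exact integral_grad1_flow_sq_le ha hK hβ (hg.partialDeriv k) hS
    _ = _ := by rw [← Finset.mul_sum, dirichlet]; ring

/-- The Carleson estimate for the functions `∂ₖφ`, whose variance is at most `1` because
`|∂ₖφ| ≤ 1`. -/
lemma integral_grad2_grad1_sq_le (hφ : SmoothLp ∞ φ) (hφ1 : ∀ k x, |partialDeriv k φ x| ≤ 1)
    (hg : SmoothLp 2 g) (hS : 0 ≤ S) :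
    ∫ q, (grad2 φ q * grad1 g q) ^ 2 ∂slab n S ≤ 6 * n ^ 4 * dirichlet g := by
  have hi : ∀ k, Integrable (fun q => (grad1 (partialDeriv k φ) q * grad1 g q) ^ 2) (slab n S) :=
    fun k => (memLp_mul_top (hφ.partialDeriv k).memLp_grad1_top hg.memLp_grad1).integrable_sq
  calc ∫ q, (grad2 φ q * grad1 g q) ^ 2 ∂slab n S
      ≤ ∫ q, n * ∑ k, (grad1 (partialDeriv k φ) q * grad1 g q) ^ 2 ∂slab n S := by
        refine integral_mono (memLp_mul_top hφ.memLp_grad2_top hg.memLp_grad1).integrable_sq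
          ((integrable_finsetSum _ fun k _ => hi k).const_mul _) fun q => ?_
        simp only [mul_pow, ← Finset.sum_mul, ← mul_assoc]
        gcongr
        exact sq_sum_fin_le _
    _ = n * ∑ k, ∫ q, (grad1 (partialDeriv k φ) q * grad1 g q) ^ 2 ∂slab n S := by
        rw [integral_const_mul, integral_finsetSum _ fun k _ => hi k]
    _ ≤ n * ∑ _k : Fin n, 6 * n ^ 2 * 1 * dirichlet g := by
        gcongr with k
        refine integral_grad1_grad1_sq_le (hφ.partialDeriv k) one_pos (fun s x => ?_) hg hS
        simpa using heatVar_le_of_abs_le (hφ1 k) s x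
    _ = _ := by
        simp only [Finset.sum_const, Finset.card_univ, Fintype.card_fin, nsmul_eq_mul]; ring

end

section

variable {n : ℕ}

variable {f g a b u v w φ : Rn n → ℝ} {S K : ℝ} {p : ℝ≥0∞}

lemma abs_flow_laplace_le_grad2 (hf : SmoothLp p f) (q : ℝ × Rn n) :
    |flow (laplace f) q| ≤ grad2 f q := by
  have : flow (laplace f) q = ∑ k, flow (partialDeriv k (partialDeriv k f)) q := by
    have h := congrFun (laplace_heat hf q.1) q.2
    simp only [laplace, partialDeriv_heat hf, partialDeriv_heat (hf.partialDeriv _)] at h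
    exact h.symm
  rw [this]
  refine (Finset.abs_sum_le_sum_abs _ _).trans (Finset.sum_le_sum fun k _ => ?_)
  exact abs_flow_le_grad1 _ _ _

lemma le_of_forall_sqrt {x c d : ℝ} (hd : 0 ≤ d) (h : ∀ ε > 0, x ≤ c + d * √ε) : x ≤ c := by
  refine le_of_forall_pos_le_add fun δ hδ => ?_
  have h1 := h ((δ / (d + 1)) ^ 2) (by positivity)
  rw [Real.sqrt_sq (by positivity)] at h1
  have h2 : d * (δ / (d + 1)) ≤ δ := by
    rw [mul_div_assoc', div_le_iff₀ (by positivity)]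
    nlinarith
  linarith

lemma integrable_top_two_two {α : Type*} [MeasurableSpace α] {μ : Measure α} {c f g : α → ℝ}
    (hc : MemLp c ∞ μ) (hf : MemLp f 2 μ) (hg : MemLp g 2 μ) :
    Integrable (fun x => c x * (f x * g x)) μ :=
  memLp_one_iff_integrable.1
    ((memLp_one_iff_integrable.2 (integrable_mul_of_memLp_two hf hg)).mul' hc)

lemma abs_nullForm_le {a b c d A B : ℝ} (ha : |a| ≤ A) (hb : |b| ≤ A) (hc : |c| ≤ B)
    (hd : |d| ≤ B) : |a * d - b * c| ≤ 2 * (A * B) := by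
  have hA := (abs_nonneg a).trans ha
  calc |a * d - b * c| ≤ |a * d| + |b * c| := abs_sub _ _
    _ = |a| * |d| + |b| * |c| := by rw [abs_mul, abs_mul]
    _ ≤ A * B + A * B := by gcongr
    _ = _ := by ring

lemma integral_sq_partialDeriv_le_dirichlet (u : Rn n → ℝ) (k : Fin n) :
    ∫ x, partialDeriv k u x ^ 2 ≤ dirichlet u :=
  Finset.single_le_sum (f := fun k => ∫ x, partialDeriv k u x ^ 2)
    (fun _ _ => integral_nonneg fun _ => sq_nonneg _) (Finset.mem_univ k)

/-- The `div`-`curl` estimate of Coifman, Lions, Meyer and Semmes: null forms of gradients pair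
boundedly with functions whose Gaussian variance is bounded. -/
lemma abs_integral_nullForm_le (hb : SmoothLp ∞ b) (hK : 0 < K) (hβ : ∀ s x, heatVar b s x ≤ K)
    (hu : SmoothLp 2 u) (hv : SmoothLp 2 v) (i j : Fin n) :
    |∫ x, b x * nullForm i j u v x| ≤ 8 * n ^ 2 * √(6 * K) * (√(dirichlet u) * √(dirichlet v)) := by
  obtain ⟨M, hM⟩ := hb.bdd0
  have hM0 : 0 ≤ M := (abs_nonneg _).trans (hM 0)
  refine le_of_forall_sqrt (d := 2 * M * √(dirichlet u)) (by positivity) fun ε hε => ?_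
  -- run the heat flow until `∇v` is small, so that the pairing at time `S` is negligible
  obtain ⟨S, hS, hSε⟩ := exists_gradient_small hv hε
  set N : ℝ → Rn n → ℝ := fun s x =>
    heat s (partialDeriv i u) x * heat s (partialDeriv j v) x
      - heat s (partialDeriv j u) x * heat s (partialDeriv i v) x with hN
  -- the time derivative of `b` times the null form, all functions following the heat flow
  set F' : ℝ → Rn n → ℝ := fun s x =>
    heat s (laplace b) x * N s x
      + heat s b x * (heat s (laplace (partialDeriv i u)) x * heat s (partialDeriv j v) x
        - heat s (laplace (partialDeriv j u)) x * heat s (partialDeriv i v) x)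
      + heat s b x * (heat s (partialDeriv i u) x * heat s (laplace (partialDeriv j v)) x
        - heat s (partialDeriv j u) x * heat s (laplace (partialDeriv i v)) x) with hF'
  -- its integral rewritten by `nullForm_slice`: each term is a first derivative of `b` times a first
  -- and a second derivative of `u` and `v`, within the reach of the Carleson estimate
  set R : ℝ → Rn n → ℝ := fun s x =>
    -(∑ l, heat s (partialDeriv l b) x
      * ((heat s (partialDeriv i (partialDeriv l u)) x * heat s (partialDeriv j v) x
          - heat s (partialDeriv j (partialDeriv l u)) x * heat s (partialDeriv i v) x)
        + (heat s (partialDeriv i u) x * heat s (partialDeriv j (partialDeriv l v)) x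
          - heat s (partialDeriv j u) x * heat s (partialDeriv i (partialDeriv l v)) x)))
      - heat s (laplace u) x * (heat s (partialDeriv i b) x * heat s (partialDeriv j v) x
          - heat s (partialDeriv j b) x * heat s (partialDeriv i v) x)
      + heat s (laplace v) x * (heat s (partialDeriv i b) x * heat s (partialDeriv j u) x
          - heat s (partialDeriv j b) x * heat s (partialDeriv i u) x) with hR
  have hui := hu.partialDeriv
  have hvi := hv.partialDeriv
  have hbi := hb.partialDeriv
  have T1 := hb.memLp_top_flow (S := S)
  have T2 := hb.laplace.memLp_top_flow (S := S)
  have T3 := fun l => (hbi l).memLp_top_flow (S := S)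
  have U1 := fun l => (hui l).memLp_two_flow (S := S)
  have U2 := hu.laplace.memLp_two_flow (S := S)
  have U3 := fun l => (hui l).laplace.memLp_two_flow (S := S)
  have U4 := fun l k => ((hui l).partialDeriv k).memLp_two_flow (S := S)
  have V1 := fun l => (hvi l).memLp_two_flow (S := S)
  have V2 := hv.laplace.memLp_two_flow (S := S)
  have V3 := fun l => (hvi l).laplace.memLp_two_flow (S := S)
  have V4 := fun l k => ((hvi l).partialDeriv k).memLp_two_flow (S := S)
  have iF' : Integrable (fun q : ℝ × Rn n => F' q.1 q.2) (slab n S) := by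
    refine ((((integrable_top_two_two T2 (U1 i) (V1 j)).sub
      (integrable_top_two_two T2 (U1 j) (V1 i))).add
      ((integrable_top_two_two T1 (U3 i) (V1 j)).sub
      (integrable_top_two_two T1 (U3 j) (V1 i)))).add
      ((integrable_top_two_two T1 (U1 i) (V3 j)).sub
      (integrable_top_two_two T1 (U1 j) (V3 i)))).congr (Eventually.of_forall fun q => ?_)
    simp only [hF', hN, flow, Pi.add_apply, Pi.sub_apply]
    ring
  have iR : Integrable (fun q : ℝ × Rn n => R q.1 q.2) (slab n S) := by
    refine ((((integrable_finsetSum Finset.univ fun l _ =>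
      ((integrable_top_two_two (T3 l) (U4 l i) (V1 j)).sub
        (integrable_top_two_two (T3 l) (U4 l j) (V1 i))).add
      ((integrable_top_two_two (T3 l) (U1 i) (V4 l j)).sub
        (integrable_top_two_two (T3 l) (U1 j) (V4 l i)))).neg).sub
      ((integrable_top_two_two (T3 i) U2 (V1 j)).sub
        (integrable_top_two_two (T3 j) U2 (V1 i)))).add
      ((integrable_top_two_two (T3 i) V2 (U1 j)).sub
        (integrable_top_two_two (T3 j) V2 (U1 i)))).congr (Eventually.of_forall fun q => ?_)
    simp only [hR, flow, Pi.add_apply, Pi.sub_apply, Pi.neg_apply]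
    congr 1
    · congr 1
      · congr 1
        exact Finset.sum_congr rfl fun l _ => by ring
      · ring
    · ring
  have hNF : ∀ s, N s = nullForm i j (heat s u) (heat s v) := by
    intro s
    funext x
    simp only [hN, nullForm, partialDeriv_heat hu, partialDeriv_heat hv]
  have iF : ∀ s, Integrable fun x => heat s b x * N s x := fun s => by
    rw [hNF]
    exact ((hb.heat_top s).mul (r := 1)
      ((hu.heat_two s).nullForm (hv.heat_two s) i j (r := 1))).integrable
  have ftc := integral_sub_integral_eq_slab (S := S) (F' := F')
    (F := fun s x => heat s b x * N s x) hS (fun x => ?_) (fun s hs x => ?_) ?_ (iF 0) (iF S) iF'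
  · have hslice := integral_slab_congr (G := F') (R := R) iF' iR fun s => by
      have := nullForm_slice (hb.heat_top s) (hu.heat_two s) (hv.heat_two s)
        (hu.laplace.heat_two s) (hv.laplace.heat_two s) i j
      simp only [nullForm, laplace_heat hb, partialDeriv_heat hb, partialDeriv_heat hu,
        partialDeriv_heat hv, partialDeriv_heat (hu.partialDeriv _),
        partialDeriv_heat (hv.partialDeriv _), partialDeriv_heat hu.laplace,
        partialDeriv_heat hv.laplace, partialDeriv_laplace hu, partialDeriv_laplace hv] at this
      exact this
    rw [hslice] at ftc
    have hRle : ∀ q, |R q.1 q.2| ≤ 4 * |grad1 b q * grad1 u q * grad2 v q|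
        + 4 * |grad1 b q * grad1 v q * grad2 u q| := by
      intro q
      have p1 := grad1_nonneg b q
      have p2 := grad1_nonneg u q
      have p3 := grad1_nonneg v q
      have p4 := grad2_nonneg u q
      have p5 := grad2_nonneg v q
      rw [abs_of_nonneg (mul_nonneg (mul_nonneg p1 p2) p5),
        abs_of_nonneg (mul_nonneg (mul_nonneg p1 p3) p4)]
      have q1 := fun k => abs_flow_le_grad1 b k q
      have q2 := fun k => abs_flow_le_grad1 u k q
      have q3 := fun k => abs_flow_le_grad1 v k q
      have q4 := fun k l => abs_flow_le_grad2 u k l q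
      have q5 := fun k l => abs_flow_le_grad2 v k l q
      have s1 := abs_nullForm_le (q1 i) (q1 j) (q3 i) (q3 j)
      have s2 := abs_nullForm_le (q1 i) (q1 j) (q2 i) (q2 j)
      have t1 := mul_le_mul (abs_flow_laplace_le_grad2 hu q) s1 (abs_nonneg _) p4
      have t2 := mul_le_mul (abs_flow_laplace_le_grad2 hv q) s2 (abs_nonneg _) p5
      rw [← abs_mul] at t1 t2
      have t3 : |∑ l, flow (partialDeriv l b) q
        * ((flow (partialDeriv i (partialDeriv l u)) q * flow (partialDeriv j v) q
          - flow (partialDeriv j (partialDeriv l u)) q * flow (partialDeriv i v) q)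
        + (flow (partialDeriv i u) q * flow (partialDeriv j (partialDeriv l v)) q
          - flow (partialDeriv j u) q * flow (partialDeriv i (partialDeriv l v)) q))|
          ≤ grad1 b q * (2 * (grad2 u q * grad1 v q) + 2 * (grad1 u q * grad2 v q)) := by
        refine (Finset.abs_sum_le_sum_abs _ _).trans ?_
        rw [grad1, Finset.sum_mul]
        refine Finset.sum_le_sum fun l _ => ?_
        rw [abs_mul]
        refine mul_le_mul_of_nonneg_left ((abs_add_le _ _).trans (add_le_add ?_ ?_)) (abs_nonneg _)
        · exact abs_nullForm_le (q4 l i) (q4 l j) (q3 i) (q3 j)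
        · exact abs_nullForm_le (q2 i) (q2 j) (q5 l i) (q5 l j)
      simp only [hR]
      refine (abs_add_le _ _).trans ((add_le_add (abs_sub _ _) le_rfl).trans ?_)
      rw [abs_neg]
      refine (add_le_add (add_le_add t3 t1) t2).trans (le_of_eq ?_)
      ring
    have hcs : ∀ {f g : Rn n → ℝ}, SmoothLp 2 f → SmoothLp 2 g →
        MemLp (fun q => grad1 b q * grad1 f q) 2 (slab n S) ∧
        ∫ q, |grad1 b q * grad1 f q * grad2 g q| ∂slab n S
          ≤ n ^ 2 * √(6 * K) * (√(dirichlet f) * √(dirichlet g)) := by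
      intro f g hf hg
      have hm := memLp_mul_top (hb.memLp_grad1_top (S := S)) (hf.memLp_grad1 (S := S))
      refine ⟨hm, ?_⟩
      have h := integral_abs_mul_le (A := n * √(6 * K) * √(dirichlet f))
        (B := n * √(dirichlet g)) hm (hg.memLp_grad2 (S := S)) (by positivity) (by positivity) ?_ ?_
      · refine h.trans (le_of_eq (by ring))
      · rw [mul_pow, mul_pow, Real.sq_sqrt (by positivity), Real.sq_sqrt (dirichlet_nonneg f)]
        exact (integral_grad1_grad1_sq_le hb hK hβ hf hS).trans (le_of_eq (by ring))
      · rw [mul_pow, Real.sq_sqrt (dirichlet_nonneg g)]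
        exact integral_grad2_sq_le hg hS
    have hRint : |∫ q, R q.1 q.2 ∂slab n S|
        ≤ 8 * n ^ 2 * √(6 * K) * (√(dirichlet u) * √(dirichlet v)) := by
      have j1 := (integrable_mul_of_memLp_two (hcs hu hv).1 (hv.memLp_grad2 (S := S))).abs
      have j2 := (integrable_mul_of_memLp_two (hcs hv hu).1 (hu.memLp_grad2 (S := S))).abs
      calc |∫ q, R q.1 q.2 ∂slab n S| ≤ ∫ q, |R q.1 q.2| ∂slab n S := abs_integral_le_integral_abs
        _ ≤ ∫ q, (4 * |grad1 b q * grad1 u q * grad2 v q|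
              + 4 * |grad1 b q * grad1 v q * grad2 u q|) ∂slab n S :=
            integral_mono iR.abs ((j1.const_mul 4).add (j2.const_mul 4)) hRle
        _ ≤ 4 * (n ^ 2 * √(6 * K) * (√(dirichlet u) * √(dirichlet v)))
            + 4 * (n ^ 2 * √(6 * K) * (√(dirichlet v) * √(dirichlet u))) := by
            rw [integral_add (j1.const_mul 4) (j2.const_mul 4), integral_const_mul,
              integral_const_mul]
            gcongr
            exacts [(hcs hu hv).2, (hcs hv hu).2]
        _ = _ := by ring
    have hend : |∫ x, heat S b x * N S x| ≤ 2 * M * √(dirichlet u) * √ε := by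
      have hx : ∀ k l, MemLp (fun x => heat S (partialDeriv k u) x) 2 volume ∧
          MemLp (fun x => heat S (partialDeriv l v) x) 2 volume ∧
          ∫ x, |heat S (partialDeriv k u) x * heat S (partialDeriv l v) x|
            ≤ √(dirichlet u) * √ε := by
        intro k l
        have m1 := ((hui k).heat_two S).memLp0
        have m2 := ((hvi l).heat_two S).memLp0
        refine ⟨m1, m2, integral_abs_mul_le m1 m2 (Real.sqrt_nonneg _) (Real.sqrt_nonneg _) ?_ ?_⟩
        · rw [Real.sq_sqrt (dirichlet_nonneg u)]
          exact (integral_heat_sq_le (hui k) S).trans (integral_sq_partialDeriv_le_dirichlet u k)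
        · rw [Real.sq_sqrt hε.le]
          exact (Finset.single_le_sum (f := fun k => ∫ x, heat S (partialDeriv k v) x ^ 2)
            (fun _ _ => integral_nonneg fun _ => sq_nonneg _) (Finset.mem_univ l)).trans hSε.le
      have k1 := (integrable_mul_of_memLp_two (hx i j).1 (hx i j).2.1).abs
      have k2 := (integrable_mul_of_memLp_two (hx j i).1 (hx j i).2.1).abs
      calc |∫ x, heat S b x * N S x| ≤ ∫ x, |heat S b x * N S x| := abs_integral_le_integral_abs
        _ ≤ ∫ x, M * (|heat S (partialDeriv i u) x * heat S (partialDeriv j v) x|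
              + |heat S (partialDeriv j u) x * heat S (partialDeriv i v) x|) := by
            refine integral_mono (iF S).abs ((k1.add k2).const_mul M) fun x => ?_
            simp only [abs_mul (heat S b x)]
            exact mul_le_mul (abs_heat_le hM S x) (abs_sub _ _) (abs_nonneg _) hM0
        _ ≤ M * (√(dirichlet u) * √ε + √(dirichlet u) * √ε) := by
            rw [integral_const_mul, integral_add k1 k2]
            gcongr
            exacts [(hx i j).2.2, (hx j i).2.2]
        _ = _ := by ring
    have h0 : ∫ x, b x * nullForm i j u v x = ∫ x, heat 0 b x * N 0 x := by
      rw [hNF, heat_zero, heat_zero, heat_zero]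
    rw [h0]
    have e : ∫ x, heat 0 b x * N 0 x = (∫ x, heat S b x * N S x) - ∫ q, R q.1 q.2 ∂slab n S := by
      linarith
    rw [e]
    refine (abs_sub _ _).trans ?_
    linarith
  · exact (hb.continuous_heat_time x).mul
      ((((hui i).continuous_heat_time x).mul ((hvi j).continuous_heat_time x)).sub
      (((hui j).continuous_heat_time x).mul ((hvi i).continuous_heat_time x)))
  · refine ((hasDerivAt_heat' hb hs x).mul (((hasDerivAt_heat' (hui i) hs x).mul
      (hasDerivAt_heat' (hvi j) hs x)).sub ((hasDerivAt_heat' (hui j) hs x).mul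
      (hasDerivAt_heat' (hvi i) hs x)))).congr_deriv ?_
    simp only [hF', hN, Pi.mul_apply, Pi.sub_apply]
    ring
  · have c1 := hb.continuous_flow
    have c2 := hb.laplace.continuous_flow
    have c3 := fun k => (hui k).continuous_flow
    have c4 := fun k => (hvi k).continuous_flow
    have c5 := fun k => (hui k).laplace.continuous_flow
    have c6 := fun k => (hvi k).laplace.continuous_flow
    exact ((c2.mul (((c3 i).mul (c4 j)).sub ((c3 j).mul (c4 i)))).add
      (c1.mul (((c5 i).mul (c4 j)).sub ((c5 j).mul (c4 i))))).add
      (c1.mul (((c3 i).mul (c6 j)).sub ((c3 j).mul (c6 i))))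

end

section

variable {n : ℕ}

variable {f g a b u v w φ : Rn n → ℝ} {S K : ℝ} {p : ℝ≥0∞}

/-- The commutator estimate behind exponential weights: the null form of `w²` with a Lipschitz
function `φ` is controlled by `‖w‖ ‖∇w‖`. No second derivative of `φ` enters the bound: along the
heat flow the Hessian of `φ` is handled by the Carleson estimate for the bounded functions `∂ₖφ`. -/
lemma abs_integral_nullForm_sq_le (hb : SmoothLp ∞ b) (hK : 0 < K)
    (hβ : ∀ s x, heatVar b s x ≤ K) (hw : SmoothLp 2 w) (hφ : SmoothLp ∞ φ)
    (hφ1 : ∀ k x, |partialDeriv k φ x| ≤ 1) (i j : Fin n) :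
    |∫ x, b x * nullForm i j (fun x => w x * w x) φ x|
      ≤ (4 * n ^ 2 + 8 * n ^ 2 + 48 * n ^ 3) * √(6 * K) * (√(∫ x, w x ^ 2) * √(dirichlet w)) := by
  obtain ⟨M, hM⟩ := hb.bdd0
  have hM0 : 0 ≤ M := (abs_nonneg _).trans (hM 0)
  have hw0 : 0 ≤ ∫ x, w x ^ 2 := integral_nonneg fun x => sq_nonneg _
  have hdw := dirichlet_nonneg w
  refine le_of_forall_sqrt (d := 4 * M * √(∫ x, w x ^ 2)) (by positivity) fun ε hε => ?_
  -- run the heat flow until `∇w` is small, so that the pairing at time `S` is negligible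
  obtain ⟨S, hS, hSε⟩ := exists_gradient_small hw hε
  set N : ℝ → Rn n → ℝ := fun s x =>
    2 * (heat s w x * heat s (partialDeriv i w) x) * heat s (partialDeriv j φ) x
      - 2 * (heat s w x * heat s (partialDeriv j w) x) * heat s (partialDeriv i φ) x with hN
  -- the time derivative of `b` times the null form of the square of the flow of `w` and of the flow
  -- of `φ`
  set F' : ℝ → Rn n → ℝ := fun s x =>
    heat s (laplace b) x * N s x
      + heat s b x * (2 * (heat s (partialDeriv i w) x * heat s (laplace w) x
          + heat s w x * heat s (laplace (partialDeriv i w)) x) * heat s (partialDeriv j φ) x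
        - 2 * (heat s (partialDeriv j w) x * heat s (laplace w) x
          + heat s w x * heat s (laplace (partialDeriv j w)) x) * heat s (partialDeriv i φ) x)
      + heat s b x * (2 * (heat s w x * heat s (partialDeriv i w) x)
          * heat s (laplace (partialDeriv j φ)) x
        - 2 * (heat s w x * heat s (partialDeriv j w) x)
          * heat s (laplace (partialDeriv i φ)) x) with hF'
  -- `D s x k l` is `½ ∂ₖ∂ₗ(w²)`
  set D : ℝ → Rn n → Fin n → Fin n → ℝ := fun s x k l =>
    heat s (partialDeriv k w) x * heat s (partialDeriv l w) x
      + heat s w x * heat s (partialDeriv k (partialDeriv l w)) x with hD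
  -- its integral rewritten by `nullForm_slice`, so that only first derivatives of `b` occur
  set R : ℝ → Rn n → ℝ := fun s x =>
    -(∑ l, heat s (partialDeriv l b) x
      * ((2 * D s x i l * heat s (partialDeriv j φ) x
          - 2 * D s x j l * heat s (partialDeriv i φ) x)
        + (2 * (heat s w x * heat s (partialDeriv i w) x)
            * heat s (partialDeriv j (partialDeriv l φ)) x
          - 2 * (heat s w x * heat s (partialDeriv j w) x)
            * heat s (partialDeriv i (partialDeriv l φ)) x)))
      - 2 * (heat s w x * heat s (laplace w) x)
        * (heat s (partialDeriv i b) x * heat s (partialDeriv j φ) x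
          - heat s (partialDeriv j b) x * heat s (partialDeriv i φ) x)
      + heat s (laplace φ) x
        * (heat s (partialDeriv i b) x * (2 * (heat s w x * heat s (partialDeriv j w) x))
          - heat s (partialDeriv j b) x * (2 * (heat s w x * heat s (partialDeriv i w) x))) with hR
  have hwi := hw.partialDeriv
  have hφi := hφ.partialDeriv
  have hbi := hb.partialDeriv
  have T1 := hb.memLp_top_flow (S := S)
  have T2 := hb.laplace.memLp_top_flow (S := S)
  have T3 := fun l => (hbi l).memLp_top_flow (S := S)
  have P1 := fun l => (hφi l).memLp_top_flow (S := S)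
  have P2 := hφ.laplace.memLp_top_flow (S := S)
  have P3 := fun l => (hφi l).laplace.memLp_top_flow (S := S)
  have P4 := fun l k => ((hφi l).partialDeriv k).memLp_top_flow (S := S)
  have W0 := hw.memLp_two_flow (S := S)
  have W1 := fun l => (hwi l).memLp_two_flow (S := S)
  have W2 := hw.laplace.memLp_two_flow (S := S)
  have W3 := fun l => (hwi l).laplace.memLp_two_flow (S := S)
  have W4 := fun l k => ((hwi l).partialDeriv k).memLp_two_flow (S := S)
  have iF' : Integrable (fun q : ℝ × Rn n => F' q.1 q.2) (slab n S) := by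
    refine (((((integrable_top_two_two (memLp_mul_top T2 (P1 j)) W0 (W1 i)).const_mul 2).sub
      ((integrable_top_two_two (memLp_mul_top T2 (P1 i)) W0 (W1 j)).const_mul 2)).add
      ((((integrable_top_two_two (memLp_mul_top T1 (P1 j)) (W1 i) W2).add
        (integrable_top_two_two (memLp_mul_top T1 (P1 j)) W0 (W3 i))).const_mul 2).sub
      (((integrable_top_two_two (memLp_mul_top T1 (P1 i)) (W1 j) W2).add
        (integrable_top_two_two (memLp_mul_top T1 (P1 i)) W0 (W3 j))).const_mul 2))).add
      (((integrable_top_two_two (memLp_mul_top T1 (P3 j)) W0 (W1 i)).const_mul 2).sub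
      ((integrable_top_two_two (memLp_mul_top T1 (P3 i)) W0 (W1 j)).const_mul 2))).congr
      (Eventually.of_forall fun q => ?_)
    simp only [hF', hN, flow, Pi.add_apply, Pi.sub_apply]
    ring
  have iR : Integrable (fun q : ℝ × Rn n => R q.1 q.2) (slab n S) := by
    refine (((((integrable_finsetSum Finset.univ fun l _ =>
      (((integrable_top_two_two (memLp_mul_top (T3 l) (P1 j)) (W1 i) (W1 l)).add
        (integrable_top_two_two (memLp_mul_top (T3 l) (P1 j)) W0 (W4 l i))).sub
      ((integrable_top_two_two (memLp_mul_top (T3 l) (P1 i)) (W1 j) (W1 l)).add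
        (integrable_top_two_two (memLp_mul_top (T3 l) (P1 i)) W0 (W4 l j)))).add
      ((integrable_top_two_two (memLp_mul_top (T3 l) (P4 l j)) W0 (W1 i)).sub
        (integrable_top_two_two (memLp_mul_top (T3 l) (P4 l i)) W0 (W1 j)))).const_mul 2).neg).sub
      (((integrable_top_two_two (memLp_mul_top (T3 i) (P1 j)) W0 W2).sub
        (integrable_top_two_two (memLp_mul_top (T3 j) (P1 i)) W0 W2)).const_mul 2)).add
      (((integrable_top_two_two (memLp_mul_top P2 (T3 i)) W0 (W1 j)).sub
        (integrable_top_two_two (memLp_mul_top P2 (T3 j)) W0 (W1 i))).const_mul 2)).congr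
      (Eventually.of_forall fun q => ?_)
    simp only [hR, hD, flow, Pi.add_apply, Pi.sub_apply, Pi.neg_apply, Finset.mul_sum]
    congr 1
    · congr 1
      · congr 1
        exact Finset.sum_congr rfl fun l _ => by ring
      · ring
    · ring
  have hsq : ∀ s, SmoothLp 1 (fun x => heat s w x * heat s w x) := fun s =>
    (hw.heat_two s).mul (hw.heat_two s)
  have hdsq : ∀ s k, partialDeriv k (fun x => heat s w x * heat s w x)
      = fun x => 2 * (heat s w x * heat s (partialDeriv k w) x) := by
    intro s k
    have d := (hw.heat_two s).differentiable
    rw [partialDeriv_mul d d, partialDeriv_heat hw]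
    funext x
    ring
  have hdd : ∀ s k l x, partialDeriv k
      (fun x => 2 * (heat s w x * heat s (partialDeriv l w) x)) x = 2 * D s x k l := by
    intro s k l x
    have d := (hw.heat_two s).differentiable
    have d' := ((hwi l).heat_two s).differentiable
    rw [partialDeriv_const_mul 2 (d.fun_mul d'), partialDeriv_mul d d', partialDeriv_heat hw,
      partialDeriv_heat (hwi l)]
  have hNF : ∀ s, N s = nullForm i j (fun x => heat s w x * heat s w x) (heat s φ) := by
    intro s
    funext x
    simp only [hN, nullForm, hdsq, partialDeriv_heat hφ]
  have iF : ∀ s, Integrable fun x => heat s b x * N s x := fun s => by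
    rw [hNF]
    exact ((hb.heat_top s).mul (r := 1)
      ((hsq s).nullForm (hφ.heat_top s) i j (r := 1))).integrable
  have ftc := integral_sub_integral_eq_slab (S := S) (F' := F')
    (F := fun s x => heat s b x * N s x) hS (fun x => ?_) (fun s hs x => ?_) ?_ (iF 0) (iF S) iF'
  · have hslice := integral_slab_congr (G := F') (R := R) iF' iR fun s => by
      -- the time derivative `2 w Δw` of the squared flow is not the Laplacian of the square; it plays
      -- the part of `h` in `nullForm_slice`
      have hh : SmoothLp 1 (fun x => 2 * (heat s w x * heat s (laplace w) x)) :=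
        ((hw.heat_two s).mul (hw.laplace.heat_two s) (r := 1)).const_mul 2
      have hdh : ∀ k x, partialDeriv k (fun x => 2 * (heat s w x * heat s (laplace w) x)) x
          = 2 * (heat s (partialDeriv k w) x * heat s (laplace w) x
            + heat s w x * heat s (laplace (partialDeriv k w)) x) := by
        intro k x
        have d := (hw.heat_two s).differentiable
        have d' := (hw.laplace.heat_two s).differentiable
        rw [partialDeriv_const_mul 2 (d.fun_mul d'), partialDeriv_mul d d', partialDeriv_heat hw,
          partialDeriv_heat hw.laplace, partialDeriv_laplace hw]
      have := nullForm_slice (hb.heat_top s) (hsq s) (hφ.heat_top s) hh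
        (hφ.laplace.heat_top s) i j
      simp only [nullForm, laplace_heat hb, partialDeriv_heat hb, hdsq, hdd, hdh,
        partialDeriv_heat hφ, partialDeriv_heat (hφ.partialDeriv _),
        partialDeriv_heat hφ.laplace, partialDeriv_laplace hφ] at this
      exact this
    rw [hslice] at ftc
    have hRle : ∀ q, |R q.1 q.2| ≤ 4 * |grad1 b q * grad1 w q * grad1 w q|
        + 8 * |grad1 b q * flow w q * grad2 w q|
        + 8 * |grad1 b q * flow w q * (grad2 φ q * grad1 w q)| := by
      intro q
      have p1 := grad1_nonneg b q
      have p2 := grad1_nonneg w q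
      have p4 := grad2_nonneg w q
      have p5 := grad2_nonneg φ q
      have p6 := abs_nonneg (flow w q)
      have q1 := fun k => abs_flow_le_grad1 b k q
      have q2 := fun k => abs_flow_le_grad1 w k q
      have q3 : ∀ k, |flow (partialDeriv k φ) q| ≤ 1 := fun k => abs_heat_le (hφ1 k) _ _
      have q4 := fun k l => abs_flow_le_grad2 w k l q
      have q5 := fun k l => abs_flow_le_grad2 φ k l q
      have r1 : ∀ k, |2 * (flow w q * flow (partialDeriv k w) q)| ≤ 2 * (|flow w q| * grad1 w q) := by
        intro k
        rw [abs_mul, abs_mul, abs_two]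
        gcongr
        exact q2 k
      have r2 : ∀ k l, |2 * D q.1 q.2 k l|
          ≤ 2 * (grad1 w q * grad1 w q + |flow w q| * grad2 w q) := by
        intro k l
        rw [abs_mul, abs_two]
        refine mul_le_mul_of_nonneg_left ((abs_add_le _ _).trans ?_) two_pos.le
        rw [abs_mul, abs_mul]
        exact add_le_add (mul_le_mul (q2 k) (q2 l) (abs_nonneg _) p2)
          (mul_le_mul le_rfl (q4 l k) (abs_nonneg _) p6)
      have r3 : |2 * (flow w q * flow (laplace w) q)| ≤ 2 * (|flow w q| * grad2 w q) := by
        rw [abs_mul, abs_mul, abs_two]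
        gcongr
        exact abs_flow_laplace_le_grad2 hw q
      have s1 := abs_nullForm_le (q1 i) (q1 j) (q3 i) (q3 j)
      have s2 := abs_nullForm_le (q1 i) (q1 j) (r1 i) (r1 j)
      have t1 := mul_le_mul r3 s1 (abs_nonneg _) (by positivity)
      have t2 := mul_le_mul (abs_flow_laplace_le_grad2 hφ q) s2 (abs_nonneg _) p5
      rw [← abs_mul] at t1 t2
      have t3 : |∑ l, flow (partialDeriv l b) q
        * ((2 * D q.1 q.2 i l * flow (partialDeriv j φ) q
          - 2 * D q.1 q.2 j l * flow (partialDeriv i φ) q)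
        + (2 * (flow w q * flow (partialDeriv i w) q) * flow (partialDeriv j (partialDeriv l φ)) q
          - 2 * (flow w q * flow (partialDeriv j w) q)
            * flow (partialDeriv i (partialDeriv l φ)) q))|
          ≤ grad1 b q * (2 * (2 * (grad1 w q * grad1 w q + |flow w q| * grad2 w q) * 1)
            + 2 * (2 * (|flow w q| * grad1 w q) * grad2 φ q)) := by
        refine (Finset.abs_sum_le_sum_abs _ _).trans ?_
        nth_rw 1 [grad1]
        rw [Finset.sum_mul]
        refine Finset.sum_le_sum fun l _ => ?_
        rw [abs_mul]
        refine mul_le_mul_of_nonneg_left ((abs_add_le _ _).trans (add_le_add ?_ ?_)) (abs_nonneg _)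
        · exact abs_nullForm_le (r2 i l) (r2 j l) (q3 i) (q3 j)
        · exact abs_nullForm_le (r1 i) (r1 j) (q5 l i) (q5 l j)
      simp only [hR]
      refine (abs_add_le _ _).trans ((add_le_add (abs_sub _ _) le_rfl).trans ?_)
      rw [abs_neg]
      refine (add_le_add (add_le_add t3 t1) t2).trans (le_of_eq ?_)
      simp only [abs_mul, abs_of_nonneg p1, abs_of_nonneg p2, abs_of_nonneg p4, abs_of_nonneg p5]
      ring
    have m0 := memLp_mul_top (hb.memLp_grad1_top (S := S)) W0
    have m1 := memLp_mul_top (hb.memLp_grad1_top (S := S)) (hw.memLp_grad1 (S := S))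
    have m2 := memLp_mul_top (hφ.memLp_grad2_top (S := S)) (hw.memLp_grad1 (S := S))
    have b0 : ∫ q, (grad1 b q * flow w q) ^ 2 ∂slab n S
        ≤ (√n * √(6 * K) * √(∫ x, w x ^ 2)) ^ 2 := by
      rw [mul_pow, mul_pow, Real.sq_sqrt (Nat.cast_nonneg n), Real.sq_sqrt (by positivity),
        Real.sq_sqrt hw0]
      exact (integral_grad1_flow_sq_le hb hK hβ hw hS).trans (le_of_eq (by ring))
    have b1 : ∫ q, (grad1 b q * grad1 w q) ^ 2 ∂slab n S
        ≤ (n * √(6 * K) * √(dirichlet w)) ^ 2 := by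
      rw [mul_pow, mul_pow, Real.sq_sqrt (by positivity), Real.sq_sqrt hdw]
      exact (integral_grad1_grad1_sq_le hb hK hβ hw hS).trans (le_of_eq (by ring))
    have b2 : ∫ q, (grad2 φ q * grad1 w q) ^ 2 ∂slab n S ≤ (6 * n ^ 2 * √(dirichlet w)) ^ 2 := by
      rw [mul_pow, Real.sq_sqrt hdw]
      refine (integral_grad2_grad1_sq_le hφ hφ1 hw hS).trans ?_
      have : 0 ≤ (n : ℝ) ^ 4 * dirichlet w := by positivity
      nlinarith
    have b3 : ∫ q, grad1 w q ^ 2 ∂slab n S ≤ (√n * √(∫ x, w x ^ 2)) ^ 2 := by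
      rw [mul_pow, Real.sq_sqrt (Nat.cast_nonneg n), Real.sq_sqrt hw0]
      exact integral_grad1_sq_le hw hS
    have b4 : ∫ q, grad2 w q ^ 2 ∂slab n S ≤ (n * √(dirichlet w)) ^ 2 := by
      rw [mul_pow, Real.sq_sqrt hdw]
      exact integral_grad2_sq_le hw hS
    have k1 := integral_abs_mul_le m1 (hw.memLp_grad1 (S := S)) (by positivity) (by positivity) b1 b3
    have k2 := integral_abs_mul_le m0 (hw.memLp_grad2 (S := S)) (by positivity) (by positivity) b0 b4
    have k3 := integral_abs_mul_le m0 m2 (by positivity) (by positivity) b0 b2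
    have hn : √(n : ℝ) ≤ n := by
      rcases Nat.eq_zero_or_pos n with h | h
      · simp [h]
      · rw [Real.sqrt_le_iff]
        have : (1 : ℝ) ≤ n := by exact_mod_cast h
        exact ⟨by positivity, by nlinarith⟩
    have hRint : |∫ q, R q.1 q.2 ∂slab n S|
        ≤ (4 * n ^ 2 + 8 * n ^ 2 + 48 * n ^ 3) * √(6 * K)
          * (√(∫ x, w x ^ 2) * √(dirichlet w)) := by
      have j1 := (integrable_mul_of_memLp_two m1 (hw.memLp_grad1 (S := S))).abs
      have j2 := (integrable_mul_of_memLp_two m0 (hw.memLp_grad2 (S := S))).abs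
      have j3 := (integrable_mul_of_memLp_two m0 m2).abs
      have j12 : Integrable (fun q => 4 * |grad1 b q * grad1 w q * grad1 w q|
        + 8 * |grad1 b q * flow w q * grad2 w q|) (slab n S) := (j1.const_mul 4).add (j2.const_mul 8)
      calc |∫ q, R q.1 q.2 ∂slab n S| ≤ ∫ q, |R q.1 q.2| ∂slab n S := abs_integral_le_integral_abs
        _ ≤ ∫ q, (4 * |grad1 b q * grad1 w q * grad1 w q|
              + 8 * |grad1 b q * flow w q * grad2 w q|
              + 8 * |grad1 b q * flow w q * (grad2 φ q * grad1 w q)|) ∂slab n S :=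
            integral_mono iR.abs (j12.add (j3.const_mul 8)) hRle
        _ ≤ 4 * (n * √(6 * K) * √(dirichlet w) * (√n * √(∫ x, w x ^ 2)))
            + 8 * (√n * √(6 * K) * √(∫ x, w x ^ 2) * (n * √(dirichlet w)))
            + 8 * (√n * √(6 * K) * √(∫ x, w x ^ 2) * (6 * n ^ 2 * √(dirichlet w))) := by
            rw [integral_add j12 (j3.const_mul 8),
              integral_add (j1.const_mul 4) (j2.const_mul 8), integral_const_mul,
              integral_const_mul, integral_const_mul]
            gcongr
        _ = √n * ((4 * n + 8 * n + 48 * n ^ 2) * √(6 * K)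
              * (√(∫ x, w x ^ 2) * √(dirichlet w))) := by ring
        _ ≤ n * ((4 * n + 8 * n + 48 * n ^ 2) * √(6 * K)
              * (√(∫ x, w x ^ 2) * √(dirichlet w))) := by gcongr
        _ = _ := by ring
    have hend : |∫ x, heat S b x * N S x| ≤ 4 * M * √(∫ x, w x ^ 2) * √ε := by
      have m1 := (hw.heat_two S).memLp0
      have hx : ∀ k, MemLp (fun x => heat S (partialDeriv k w) x) 2 volume ∧
          ∫ x, |heat S w x * heat S (partialDeriv k w) x| ≤ √(∫ x, w x ^ 2) * √ε := by
        intro k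
        have m2 := ((hwi k).heat_two S).memLp0
        refine ⟨m2, integral_abs_mul_le m1 m2 (Real.sqrt_nonneg _) (Real.sqrt_nonneg _) ?_ ?_⟩
        · rw [Real.sq_sqrt hw0]
          exact integral_heat_sq_le hw S
        · rw [Real.sq_sqrt hε.le]
          exact (Finset.single_le_sum (f := fun k => ∫ x, heat S (partialDeriv k w) x ^ 2)
            (fun _ _ => integral_nonneg fun _ => sq_nonneg _) (Finset.mem_univ k)).trans hSε.le
      have k1 := (integrable_mul_of_memLp_two m1 (hx i).1).abs
      have k2 := (integrable_mul_of_memLp_two m1 (hx j).1).abs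
      calc |∫ x, heat S b x * N S x| ≤ ∫ x, |heat S b x * N S x| := abs_integral_le_integral_abs
        _ ≤ ∫ x, M * (2 * |heat S w x * heat S (partialDeriv i w) x|
              + 2 * |heat S w x * heat S (partialDeriv j w) x|) := by
            refine integral_mono (iF S).abs (((k1.const_mul 2).add (k2.const_mul 2)).const_mul M)
              fun x => ?_
            simp only [abs_mul (heat S b x)]
            refine mul_le_mul (abs_heat_le hM S x) ((abs_sub _ _).trans (add_le_add ?_ ?_))
              (abs_nonneg _) hM0
            · rw [abs_mul, abs_mul 2, abs_two]
              exact mul_le_of_le_one_right (by positivity) (abs_heat_le (hφ1 j) S x)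
            · rw [abs_mul, abs_mul 2, abs_two]
              exact mul_le_of_le_one_right (by positivity) (abs_heat_le (hφ1 i) S x)
        _ ≤ M * (2 * (√(∫ x, w x ^ 2) * √ε) + 2 * (√(∫ x, w x ^ 2) * √ε)) := by
            rw [integral_const_mul, integral_add (k1.const_mul 2) (k2.const_mul 2),
              integral_const_mul, integral_const_mul]
            gcongr
            exacts [(hx i).2, (hx j).2]
        _ = _ := by ring
    have h0 : ∫ x, b x * nullForm i j (fun x => w x * w x) φ x = ∫ x, heat 0 b x * N 0 x := by
      rw [hNF, heat_zero, heat_zero, heat_zero]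
    rw [h0]
    have e : ∫ x, heat 0 b x * N 0 x = (∫ x, heat S b x * N S x) - ∫ q, R q.1 q.2 ∂slab n S := by
      linarith
    rw [e]
    refine (abs_sub _ _).trans ?_
    linarith
  · have c1 := hw.continuous_heat_time x
    have c2 := fun k => (hwi k).continuous_heat_time x
    have c3 := fun k => (hφi k).continuous_heat_time x
    exact (hb.continuous_heat_time x).mul
      (((continuous_const.mul (c1.mul (c2 i))).mul (c3 j)).sub
      ((continuous_const.mul (c1.mul (c2 j))).mul (c3 i)))
  · have e1 := hasDerivAt_heat' hw hs x
    have e2 := fun k => hasDerivAt_heat' (hwi k) hs x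
    have e3 := fun k => hasDerivAt_heat' (hφi k) hs x
    refine ((hasDerivAt_heat' hb hs x).fun_mul ((((e1.fun_mul (e2 i)).const_mul 2).fun_mul
      (e3 j)).fun_sub (((e1.fun_mul (e2 j)).const_mul 2).fun_mul (e3 i)))).congr_deriv ?_
    simp only [hF', hN]
    ring
  · have c1 := hb.continuous_flow
    have c2 := hb.laplace.continuous_flow
    have c3 := hw.continuous_flow
    have c3' := hw.laplace.continuous_flow
    have c4 := fun k => (hwi k).continuous_flow
    have c5 := fun k => (hφi k).continuous_flow
    have c6 := fun k => (hφi k).laplace.continuous_flow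
    have c7 := fun k => (hwi k).laplace.continuous_flow
    have c0 : Continuous fun _ : ℝ × Rn n => (2 : ℝ) := continuous_const
    exact ((c2.mul (((c0.mul (c3.mul (c4 i))).mul (c5 j)).sub
      ((c0.mul (c3.mul (c4 j))).mul (c5 i)))).add
      (c1.mul (((c0.mul (((c4 i).mul c3').add (c3.mul (c7 i)))).mul (c5 j)).sub
        ((c0.mul (((c4 j).mul c3').add (c3.mul (c7 j)))).mul (c5 i))))).add
      (c1.mul (((c0.mul (c3.mul (c4 i))).mul (c6 j)).sub
        ((c0.mul (c3.mul (c4 j))).mul (c6 i))))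

end

section

/-! ### Mean oscillation on cubes: an `L²` John–Nirenberg inequality -/

variable {n : ℕ}

lemma isClosed_cube (c : Rn n) (r : ℝ) : IsClosed (cube c r) := by
  simp only [cube, Set.ofPred_forall]
  refine isClosed_iInter fun i => isClosed_le ?_ continuous_const
  fun_prop

lemma measurableSet_cube (c : Rn n) (r : ℝ) : MeasurableSet (cube c r) :=
  (isClosed_cube c r).measurableSet

lemma volume_cube (c : Rn n) {r : ℝ} (hr : 0 ≤ r) :
    volume (cube c r) = ENNReal.ofReal ((2 * r) ^ n) := by
  have h : cube c r = (WithLp.ofLp : Rn n → Fin n → ℝ) ⁻¹' Metric.closedBall (WithLp.ofLp c) r := by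
    ext x
    simp [cube, dist_pi_le_iff hr, Real.dist_eq]
  rw [h, (PiLp.volume_preserving_ofLp (Fin n)).measure_preimage
    Metric.isClosed_closedBall.measurableSet.nullMeasurableSet, Real.volume_pi_closedBall _ hr]
  simp

lemma volume_real_cube (c : Rn n) {r : ℝ} (hr : 0 ≤ r) : volume.real (cube c r) = (2 * r) ^ n := by
  rw [measureReal_def, volume_cube c hr, ENNReal.toReal_ofReal (by positivity)]

lemma isCompact_cube (c : Rn n) (r : ℝ) : IsCompact (cube c r) := by
  have h : cube c r = (WithLp.ofLp : Rn n → Fin n → ℝ) ⁻¹'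
      Set.univ.pi fun i => Metric.closedBall (c i) r := by
    ext x
    simp [cube, Real.dist_eq]
  rw [h]
  exact (PiLp.homeomorph 2 fun _ : Fin n => ℝ).isCompact_preimage.2
    (isCompact_univ_pi fun i => isCompact_closedBall _ _)

lemma continuous_integrableOn_cube {f : Rn n → ℝ} (hf : Continuous f) (c : Rn n) (r : ℝ) :
    IntegrableOn f (cube c r) := hf.continuousOn.integrableOn_compact (isCompact_cube c r)

lemma volume_hyperplane (i : Fin n) (t : ℝ) : volume {x : Rn n | x i = t} = 0 := by
  have h : {x : Rn n | x i = t} = (WithLp.ofLp : Rn n → Fin n → ℝ) ⁻¹' {x | x i = t} := rfl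
  rw [h, (PiLp.volume_preserving_ofLp (Fin n)).measure_preimage]
  · exact Measure.pi_hyperplane (fun _ : Fin n => (volume : Measure ℝ)) i t
  · exact (measurableSet_eq_fun (measurable_pi_apply i) measurable_const).nullMeasurableSet

/-- The centre of one of the `2ⁿ` subcubes of `cube c r` of half the side length. -/
def childCentre (c : Rn n) (r : ℝ) (σ : Fin n → Bool) : Rn n :=
  c + WithLp.toLp 2 fun i => if σ i then r / 2 else -(r / 2)

lemma childCentre_apply (c : Rn n) (r : ℝ) (σ : Fin n → Bool) (i : Fin n) :
    childCentre c r σ i = c i + if σ i then r / 2 else -(r / 2) := rfl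

lemma child_subset (c : Rn n) {r : ℝ} (hr : 0 ≤ r) (σ : Fin n → Bool) :
    cube (childCentre c r σ) (r / 2) ⊆ cube c r := by
  intro x hx i
  have h := hx i
  rw [childCentre_apply, abs_le] at h
  rw [abs_le]
  split_ifs at h <;> constructor <;> linarith [h.1, h.2]

lemma iUnion_child (c : Rn n) {r : ℝ} (hr : 0 ≤ r) :
    ⋃ σ, cube (childCentre c r σ) (r / 2) = cube c r := by
  refine Set.Subset.antisymm (Set.iUnion_subset fun σ => child_subset c hr σ) fun x hx => ?_
  refine Set.mem_iUnion.2 ⟨fun i => decide (c i ≤ x i), fun i => ?_⟩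
  have h := abs_le.1 (hx i)
  rw [childCentre_apply, abs_le]
  by_cases hi : c i ≤ x i
  · simp only [hi, decide_true, if_true]; constructor <;> linarith [h.1, h.2]
  · simp only [hi, decide_false, Bool.false_eq_true, if_false]
    constructor <;> linarith [h.1, h.2]

lemma integral_cube_eq_sum_child {f : Rn n → ℝ} (hf : Continuous f) (c : Rn n) {r : ℝ}
    (hr : 0 ≤ r) :
    ∫ x in cube c r, f x = ∑ σ, ∫ x in cube (childCentre c r σ) (r / 2), f x := by
  have hd : Pairwise (Function.onFun (AEDisjoint volume)
      fun σ => cube (childCentre c r σ) (r / 2)) := by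
    intro σ τ h
    obtain ⟨i, hi⟩ := Function.ne_iff.1 h
    refine measure_mono_null ?_ (volume_hyperplane i (c i))
    rintro x ⟨h1, h2⟩
    have h1 := h1 i
    have h2 := h2 i
    rw [childCentre_apply, abs_le] at h1 h2
    show x i = c i
    rcases hσ : σ i <;> rcases hτ : τ i <;> simp [hσ, hτ] at h1 h2 hi <;> linarith [h1.1, h1.2, h2.1, h2.2]
  have := integral_iUnion_ae (f := f) (μ := (volume : Measure (Rn n)))
    (fun σ => (measurableSet_cube (childCentre c r σ) (r / 2)).nullMeasurableSet) hd
    (by rw [iUnion_child c hr]; exact continuous_integrableOn_cube hf c r)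
  rw [iUnion_child c hr, tsum_fintype] at this
  exact this

/-- The mean of `f` over `cube c r`, with the volume written out. -/
def cubeMean (f : Rn n → ℝ) (c : Rn n) (r : ℝ) : ℝ := ((2 * r) ^ n)⁻¹ * ∫ x in cube c r, f x

variable {f g b : Rn n → ℝ} {c : Rn n} {r : ℝ}

lemma cubeMean_const (c : Rn n) (hr : 0 < r) (a : ℝ) : cubeMean (fun _ => a) c r = a := by
  rw [cubeMean, setIntegral_const, volume_real_cube c hr.le, smul_eq_mul,
    inv_mul_cancel_left₀ (by positivity)]

lemma cubeMean_add (hf : Continuous f) (hg : Continuous g) (c : Rn n) (r : ℝ) :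
    cubeMean (fun x => f x + g x) c r = cubeMean f c r + cubeMean g c r := by
  rw [cubeMean, integral_add (continuous_integrableOn_cube hf c r)
    (continuous_integrableOn_cube hg c r), mul_add]
  rfl

lemma cubeMean_const_mul (a : ℝ) (c : Rn n) (r : ℝ) :
    cubeMean (fun x => a * f x) c r = a * cubeMean f c r := by
  rw [cubeMean, integral_const_mul, cubeMean]; ring

lemma cubeMean_mono (hf : Continuous f) (hg : Continuous g) (hr : 0 ≤ r)
    (h : ∀ x ∈ cube c r, f x ≤ g x) : cubeMean f c r ≤ cubeMean g c r :=
  mul_le_mul_of_nonneg_left (setIntegral_mono_on (continuous_integrableOn_cube hf c r)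
    (continuous_integrableOn_cube hg c r) (measurableSet_cube c r) h) (by positivity)

lemma cubeMean_eq_sum_child (hf : Continuous f) (c : Rn n) (hr : 0 < r) :
    cubeMean f c r = (2 ^ n)⁻¹ * ∑ σ, cubeMean f (childCentre c r σ) (r / 2) := by
  simp only [cubeMean, ← Finset.mul_sum]
  rw [integral_cube_eq_sum_child hf c hr.le, ← mul_assoc, ← mul_inv, ← mul_pow]
  congr 3
  ring

lemma abs_cubeMean_sub_le (hb : Continuous b) (c : Rn n) (hr : 0 < r) (a : ℝ) :
    |cubeMean b c r - a| ≤ cubeMean (fun x => |b x - a|) c r := by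
  have h1 : cubeMean b c r - a = cubeMean (fun x => b x - a) c r := by
    have := cubeMean_add hb (continuous_const (y := -a)) c r
    rw [cubeMean_const c hr] at this
    simpa [sub_eq_add_neg] using this.symm
  rw [h1, cubeMean, abs_mul, abs_of_nonneg (by positivity : (0 : ℝ) ≤ ((2 * r) ^ n)⁻¹), cubeMean]
  gcongr
  exact abs_integral_le_integral_abs

lemma cubeMean_sub_sq (hb : Continuous b) (c : Rn n) (hr : 0 < r) (a : ℝ) :
    cubeMean (fun x => (b x - a) ^ 2) c r
      = cubeMean (fun x => (b x - cubeMean b c r) ^ 2) c r + (cubeMean b c r - a) ^ 2 := by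
  have h : ∀ a, cubeMean (fun x => (b x - a) ^ 2) c r
      = cubeMean (fun x => b x ^ 2) c r - 2 * a * cubeMean b c r + a ^ 2 := by
    intro a
    have e : (fun x => (b x - a) ^ 2) = fun x => (b x ^ 2 + (-2 * a) * b x) + a ^ 2 := by
      funext x; ring
    rw [e, cubeMean_add (by fun_prop) continuous_const, cubeMean_add (by fun_prop) (by fun_prop),
      cubeMean_const c hr, cubeMean_const_mul]
    ring
  rw [h, h]
  ring

lemma cubeMean_le_of_subset (hf : Continuous f) (hf0 : ∀ x, 0 ≤ f x) {c' : Rn n} (hr : 0 < r)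
    (h : cube c' (r / 2) ⊆ cube c r) : cubeMean f c' (r / 2) ≤ 2 ^ n * cubeMean f c r := by
  rw [cubeMean, cubeMean, ← mul_assoc]
  have e : ((2 * (r / 2)) ^ n)⁻¹ = 2 ^ n * ((2 * r) ^ n)⁻¹ := by
    rw [mul_pow 2 r, mul_inv, mul_inv_cancel_left₀ (by positivity)]
    congr 2; ring
  rw [e]
  gcongr
  · exact Eventually.of_forall hf0
  · exact continuous_integrableOn_cube hf c r

/-- Mean oscillation at most `Λ` on all cubes, for continuous functions. -/
def MeanOscLe (b : Rn n → ℝ) (Λ : ℝ) : Prop :=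
  ∀ c r, 0 < r → cubeMean (fun x => |b x - cubeMean b c r|) c r ≤ Λ

lemma MeanOscLe.abs_sub_le {Λ : ℝ} (h : MeanOscLe b Λ) (hb : Continuous b) {c' : Rn n} (hr : 0 < r)
    (hs : cube c' (r / 2) ⊆ cube c r) :
    |cubeMean b c' (r / 2) - cubeMean b c r| ≤ 2 ^ n * Λ :=
  (abs_cubeMean_sub_le hb c' (half_pos hr) _).trans
    ((cubeMean_le_of_subset (by fun_prop) (fun _ => abs_nonneg _) hr hs).trans
      (mul_le_mul_of_nonneg_left (h c r hr) (by positivity)))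

/-- One step of the self-improvement of mean oscillation bounds. The induction over dyadic
generations replaces the Calderón–Zygmund stopping time: a child whose mean is `2Λ` away from
`a` is not subdivided further. -/
lemma MeanOscLe.sq_le_aux {Λ δ X : ℝ} (h : MeanOscLe b Λ) (hb : Continuous b) (hΛ : 0 < Λ)
    (hδ : ∀ x y : Rn n, (∀ i, |x i - y i| ≤ 2 * δ) → |b x - b y| ≤ Λ) (hX0 : 0 ≤ X)
    (hX : ∀ c r, 0 < r → cubeMean (fun x => (b x - cubeMean b c r) ^ 2) c r ≤ X) (m : ℕ) :
    ∀ c r, 0 < r → r ≤ 2 ^ m * δ → ∀ a, |cubeMean b c r - a| ≤ 2 * Λ →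
      cubeMean (fun x => (b x - a) ^ 2) c r
        ≤ ((2 + 2 ^ n) * Λ) ^ 2 + X / (2 * Λ) * cubeMean (fun x => |b x - a|) c r := by
  have h2n : (1 : ℝ) ≤ 2 ^ n := one_le_pow₀ (by norm_num)
  have hpos : ∀ c r, 0 < r → ∀ a, 0 ≤ cubeMean (fun x => |b x - a|) c r := fun c r hr a =>
    (abs_nonneg _).trans (abs_cubeMean_sub_le hb c hr a)
  induction m with
  | zero =>
    -- on cubes this small `b` differs from its mean by at most `Λ`
    intro c r hr hrδ a ha
    rw [pow_zero, one_mul] at hrδ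
    have h1 : ∀ x ∈ cube c r, |b x - cubeMean b c r| ≤ Λ := by
      intro x hx
      rw [abs_sub_comm]
      refine (abs_cubeMean_sub_le hb c hr (b x)).trans ?_
      rw [← cubeMean_const (n := n) c hr Λ]
      refine cubeMean_mono (by fun_prop) continuous_const hr.le fun y hy => hδ y x fun i => ?_
      have e1 := abs_le.1 (hx i)
      have e2 := abs_le.1 (hy i)
      rw [abs_le]
      constructor <;> linarith [e1.1, e1.2, e2.1, e2.2]
    have h2 : cubeMean (fun x => (b x - a) ^ 2) c r ≤ ((2 + 2 ^ n) * Λ) ^ 2 := by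
      rw [← cubeMean_const (n := n) c hr (((2 + 2 ^ n) * Λ) ^ 2)]
      refine cubeMean_mono (by fun_prop) continuous_const hr.le fun x hx => ?_
      refine sq_le_sq' ?_ ?_ <;>
      · have e1 := abs_le.1 (h1 x hx)
        have e2 := abs_le.1 ha
        nlinarith
    have h3 : 0 ≤ X / (2 * Λ) * cubeMean (fun x => |b x - a|) c r :=
      mul_nonneg (by positivity) (hpos c r hr a)
    linarith
  | succ m ih =>
    intro c r hr hrδ a ha
    have hchild : ∀ σ, cubeMean (fun x => (b x - a) ^ 2) (childCentre c r σ) (r / 2)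
        ≤ ((2 + 2 ^ n) * Λ) ^ 2
          + X / (2 * Λ) * cubeMean (fun x => |b x - a|) (childCentre c r σ) (r / 2) := by
      intro σ
      have hr2 := half_pos hr
      by_cases hσ : |cubeMean b (childCentre c r σ) (r / 2) - a| ≤ 2 * Λ
      · refine ih _ _ hr2 ?_ a hσ
        rw [pow_succ] at hrδ
        linarith
      -- the mean of this child is far from `a`: the variance `X` is absorbed by the `L¹` term
      · rw [not_le] at hσ
        rw [cubeMean_sub_sq hb _ hr2]
        have e1 := hX (childCentre c r σ) (r / 2) hr2
        have e2 : |cubeMean b (childCentre c r σ) (r / 2) - a| ≤ (2 + 2 ^ n) * Λ := by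
          have := h.abs_sub_le hb hr (child_subset c hr.le σ)
          have t := _root_.abs_sub_le (cubeMean b (childCentre c r σ) (r / 2)) (cubeMean b c r) a
          linarith
        have e3 := abs_cubeMean_sub_le hb (childCentre c r σ) hr2 a
        have e4 : (cubeMean b (childCentre c r σ) (r / 2) - a) ^ 2 ≤ ((2 + 2 ^ n) * Λ) ^ 2 := by
          rw [← sq_abs]; gcongr
        have e5 : X ≤ X / (2 * Λ) * cubeMean (fun x => |b x - a|) (childCentre c r σ) (r / 2) := by
          calc X = X / (2 * Λ) * (2 * Λ) := by field_simp
            _ ≤ _ := by gcongr; linarith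
        linarith
    rw [cubeMean_eq_sum_child (by fun_prop) c hr,
      cubeMean_eq_sum_child (f := fun x => |b x - a|) (by fun_prop) c hr]
    calc (2 ^ n : ℝ)⁻¹ * ∑ σ, cubeMean (fun x => (b x - a) ^ 2) (childCentre c r σ) (r / 2)
        ≤ (2 ^ n)⁻¹ * ∑ σ, (((2 + 2 ^ n) * Λ) ^ 2
          + X / (2 * Λ) * cubeMean (fun x => |b x - a|) (childCentre c r σ) (r / 2)) := by
          gcongr with σ
          exact hchild σ
      _ = _ := by
          rw [Finset.sum_add_distrib, ← Finset.mul_sum, mul_add]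
          simp only [Finset.sum_const, Finset.card_univ, Fintype.card_fun, Fintype.card_bool,
            Fintype.card_fin, nsmul_eq_mul, Nat.cast_pow, Nat.cast_ofNat]
          rw [inv_mul_cancel_left₀ (by positivity)]
          ring

/-- The `L²` John–Nirenberg inequality, for bounded uniformly continuous functions. Boundedness makes
the supremum of the variances over all cubes finite, so that half of it can be absorbed; uniform
continuity starts the induction in `sq_le_aux`. -/
lemma MeanOscLe.sq_le {Λ M : ℝ} (h : MeanOscLe b Λ) (hb : UniformContinuous b) (hΛ : 0 < Λ)
    (hM : ∀ x, |b x| ≤ M) (c : Rn n) (hr : 0 < r) :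
    cubeMean (fun x => (b x - cubeMean b c r) ^ 2) c r ≤ 2 * ((2 + 2 ^ n) * Λ) ^ 2 := by
  have hbc := hb.continuous
  obtain ⟨δ, hδ0, hδ⟩ : ∃ δ > 0, ∀ x y : Rn n, (∀ i, |x i - y i| ≤ 2 * δ) → |b x - b y| ≤ Λ := by
    obtain ⟨ε, hε, hεb⟩ := Metric.uniformContinuous_iff.1 hb Λ hΛ
    refine ⟨ε / (4 * (n + 1)), by positivity, fun x y hxy => ?_⟩
    have : dist x y < ε := by
      rw [dist_eq_norm]
      have h1 : ‖x - y‖ ≤ ∑ i, |x i - y i| := by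
        have e : x - y = ∑ i, (x i - y i) • EuclideanSpace.single i (1 : ℝ) := by
          ext j
          simp [Finset.sum_apply, Pi.single_apply]
        conv_lhs => rw [e]
        refine (norm_sum_le _ _).trans (le_of_eq ?_)
        refine Finset.sum_congr rfl fun i _ => ?_
        simp [norm_smul]
      have h2 : ∑ i, |x i - y i| ≤ ∑ _i : Fin n, 2 * (ε / (4 * (n + 1))) :=
        Finset.sum_le_sum fun i _ => hxy i
      simp only [Finset.sum_const, Finset.card_univ, Fintype.card_fin, nsmul_eq_mul] at h2
      have h3 : n * (2 * (ε / (4 * (n + 1)))) < ε := by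
        rw [show (n : ℝ) * (2 * (ε / (4 * (n + 1)))) = (2 * n * ε) / (4 * (n + 1)) by ring,
          div_lt_iff₀ (by positivity)]
        nlinarith [(Nat.cast_nonneg n : (0 : ℝ) ≤ n)]
      linarith
    have := hεb this
    rw [Real.dist_eq] at this
    exact this.le
  have hM0 : 0 ≤ M := (abs_nonneg _).trans (hM 0)
  set T : Set ℝ := {v | ∃ c r, 0 < r ∧ v = cubeMean (fun x => (b x - cubeMean b c r) ^ 2) c r}
    with hT
  have hTb : BddAbove T := by
    refine ⟨M ^ 2, ?_⟩
    rintro v ⟨c, r, hr, rfl⟩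
    have h1 := cubeMean_sub_sq hbc c hr 0
    have h2 : cubeMean (fun x => (b x - 0) ^ 2) c r ≤ M ^ 2 := by
      rw [← cubeMean_const (n := n) c hr (M ^ 2)]
      refine cubeMean_mono (by fun_prop) continuous_const hr.le fun x _ => ?_
      rw [sub_zero, ← sq_abs]
      have := hM x
      gcongr
    have h3 : 0 ≤ (cubeMean b c r - 0) ^ 2 := sq_nonneg _
    linarith
  have hTX : ∀ c r, 0 < r → cubeMean (fun x => (b x - cubeMean b c r) ^ 2) c r ≤ sSup T :=
    fun c r hr => le_csSup hTb ⟨c, r, hr, rfl⟩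
  have hX0 : 0 ≤ sSup T := by
    refine le_trans ?_ (hTX 0 1 one_pos)
    exact mul_nonneg (by positivity) (integral_nonneg fun _ => sq_nonneg _)
  have hstep : sSup T ≤ ((2 + 2 ^ n) * Λ) ^ 2 + sSup T / 2 := by
    refine csSup_le ⟨_, 0, 1, one_pos, rfl⟩ ?_
    rintro v ⟨c, r, hr, rfl⟩
    obtain ⟨m, hm⟩ := pow_unbounded_of_one_lt (r / δ) (one_lt_two)
    have h1 := h.sq_le_aux hbc hΛ hδ hX0 hTX m c r hr ((div_le_iff₀ hδ0).1 hm.le)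
      (cubeMean b c r) (by rw [sub_self, abs_zero]; positivity)
    have h2 : sSup T / (2 * Λ) * cubeMean (fun x => |b x - cubeMean b c r|) c r ≤ sSup T / 2 := by
      calc _ ≤ sSup T / (2 * Λ) * Λ := by gcongr; exact h c r hr
        _ = _ := by field_simp
    linarith
  have := hTX c r hr
  linarith

end

section

/-! ### Gaussian oscillation of functions of bounded mean oscillation -/

open scoped Pointwise

variable {n : ℕ} {b f : Rn n → ℝ}

lemma setIntegral_cube_comp_affine (f : Rn n → ℝ) (x : Rn n) {σ r : ℝ} (hσ : 0 < σ) (hr : 0 < r) :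
    ∫ z in cube 0 r, f (x + σ • z) = (2 * r) ^ n * cubeMean f x (σ * r) := by
  have h1 := Measure.setIntegral_comp_smul_of_pos (volume : Measure (Rn n))
    (fun y => f (x + y)) (cube 0 r) hσ
  have h2 : σ • cube (0 : Rn n) r = (fun y => x + y) ⁻¹' cube x (σ * r) := by
    ext y
    rw [Set.mem_smul_set_iff_inv_smul_mem₀ hσ.ne']
    simp only [cube, Set.mem_ofPred_eq, Set.mem_preimage, PiLp.smul_apply, PiLp.zero_apply, sub_zero,
      smul_eq_mul, PiLp.add_apply, add_sub_cancel_left]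
    refine forall_congr' fun i => ?_
    rw [abs_mul, abs_of_pos (inv_pos.2 hσ), inv_mul_le_iff₀ hσ]
  have h3 := (measurePreserving_add_left (volume : Measure (Rn n)) x).setIntegral_preimage_emb
    (measurableEmbedding_addLeft x) f (cube x (σ * r))
  rw [h1, h2, h3, cubeMean, finrank_euclideanSpace_fin, smul_eq_mul, ← mul_assoc]
  congr 1
  field_simp
  ring

/-- Outside the cube of radius `2^(k-1)` the Gaussian is at most a constant times `4^(-kn)`, since
`exp t ≥ tⁿ / n!`. -/
lemma gaussDensity_le (z : Rn n) (k : ℕ) (hz : k ≠ 0 → z ∉ cube 0 ((2 : ℝ) ^ (k - 1))) :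
    gaussDensity z ≤ (n.factorial * 8 ^ n : ℝ) / 4 ^ (k * n) := by
  have h1 : gaussDensity z ≤ Real.exp (-(‖z‖ ^ 2 / 2)) := by
    have : (1 : ℝ) ≤ (2 * Real.pi) ^ (n / 2 : ℝ) :=
      Real.one_le_rpow (by linarith [Real.pi_gt_three]) (by positivity)
    calc gaussDensity z = ((2 * Real.pi) ^ (n / 2 : ℝ))⁻¹ * Real.exp (-(‖z‖ ^ 2 / 2)) := by
          rw [gaussDensity]; ring_nf
      _ ≤ 1 * Real.exp (-(‖z‖ ^ 2 / 2)) := by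
          gcongr
          exact inv_le_one_of_one_le₀ this
      _ = _ := one_mul _
  refine h1.trans ?_
  rcases Nat.eq_zero_or_pos k with rfl | hk
  · have e1 : (1 : ℝ) ≤ n.factorial := by exact_mod_cast n.factorial_pos
    have e2 : (1 : ℝ) ≤ 8 ^ n := one_le_pow₀ (by norm_num)
    have e3 : Real.exp (-(‖z‖ ^ 2 / 2)) ≤ 1 := Real.exp_le_one_iff.2 (by
      have := sq_nonneg ‖z‖; linarith)
    simp only [zero_mul, pow_zero, div_one]
    nlinarith
  · obtain ⟨m, rfl⟩ : ∃ m, k = m + 1 := ⟨k - 1, by omega⟩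
    have hz := hz (by omega)
    rw [Nat.add_sub_cancel] at hz
    simp only [cube, Set.mem_ofPred_eq, not_forall, not_le, PiLp.zero_apply, sub_zero] at hz
    obtain ⟨i, hi⟩ := hz
    have h2 : (2 : ℝ) ^ m ≤ ‖z‖ := hi.le.trans (by simpa using PiLp.norm_apply_le z i)
    have h3 : (4 : ℝ) ^ (m + 1) / 8 ≤ ‖z‖ ^ 2 / 2 := by
      have : (4 : ℝ) ^ (m + 1) / 8 = (2 ^ m) ^ 2 / 2 := by
        rw [← pow_mul, mul_comm m 2, pow_mul]; norm_num [pow_succ]; ring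
      rw [this]; gcongr
    have h4 := Real.pow_div_factorial_le_exp (x := (4 : ℝ) ^ (m + 1) / 8) (by positivity) n
    have h5 : (n.factorial * 8 ^ n : ℝ) / 4 ^ ((m + 1) * n)
        = (((4 : ℝ) ^ (m + 1) / 8) ^ n / n.factorial)⁻¹ := by
      rw [inv_div, div_pow, ← pow_mul]
      field_simp
    rw [h5]
    calc Real.exp (-(‖z‖ ^ 2 / 2)) ≤ Real.exp (-((4 : ℝ) ^ (m + 1) / 8)) := by gcongr
      _ ≤ _ := by
        rw [Real.exp_neg]
        exact inv_anti₀ (by positivity) h4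

/-- Means over concentric cubes grow at most linearly in the number of doublings. -/
lemma MeanOscLe.abs_cubeMean_sub_le {Λ : ℝ} (h : MeanOscLe b Λ) (hb : Continuous b) (x : Rn n)
    {σ : ℝ} (hσ : 0 < σ) (k : ℕ) :
    |cubeMean b x (σ * 2 ^ k) - cubeMean b x σ| ≤ k * (2 ^ n * Λ) := by
  induction k with
  | zero => simp
  | succ k ih =>
    have h1 := h.abs_sub_le hb (c := x) (c' := x) (r := σ * 2 ^ (k + 1)) (by positivity) (by
      intro y hy i
      have e : (0 : ℝ) ≤ σ * 2 ^ (k + 1) := by positivity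
      exact (hy i).trans (by linarith))
    have e : σ * 2 ^ (k + 1) / 2 = σ * 2 ^ k := by rw [pow_succ]; ring
    rw [e, abs_sub_comm] at h1
    have h2 := _root_.abs_sub_le (cubeMean b x (σ * 2 ^ (k + 1))) (cubeMean b x (σ * 2 ^ k))
      (cubeMean b x σ)
    push_cast
    linarith

/-- The constant in `MeanOscLe.heatVar_le`. -/
def heatVarConst (n : ℕ) : ℝ :=
  ∑' k : ℕ, n.factorial * 16 ^ n * ((1 / 2) ^ k * (2 * (2 + 2 ^ n) ^ 2 + k ^ 2 * 4 ^ n))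

lemma summable_heatVarConst (n : ℕ) : Summable fun k : ℕ =>
    (n.factorial * 16 ^ n * ((1 / 2) ^ k * (2 * (2 + 2 ^ n) ^ 2 + k ^ 2 * 4 ^ n)) : ℝ) := by
  refine Summable.mul_left _ ?_
  have h1 := summable_geometric_two.mul_right (2 * (2 + 2 ^ n) ^ 2 : ℝ)
  have h2 := (summable_pow_mul_geometric_of_norm_lt_one (R := ℝ) 2 (r := 1 / 2)
    (by norm_num)).mul_right (4 ^ n)
  refine (h1.add h2).congr fun k => ?_
  ring

lemma heatVarConst_pos (n : ℕ) : 0 < heatVarConst n :=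
  (summable_heatVarConst n).tsum_pos (fun k => by positivity) 0 (by positivity)

/-- Functions of bounded mean oscillation have bounded variance with respect to all Gaussians:
the Gaussian is dominated by a sum of multiples of indicators of the cubes of radius `2ᵏ`. -/
lemma MeanOscLe.heatVar_le {Λ : ℝ} (hn : n ≠ 0) (h : MeanOscLe b Λ) (hb : SmoothLp ∞ b)
    (hΛ : 0 < Λ) (s : ℝ) (x : Rn n) : heatVar b s x ≤ heatVarConst n * Λ ^ 2 := by
  obtain ⟨M, hM⟩ := hb.bdd0
  have hbc := hb.continuous
  have hbu : UniformContinuous b := by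
    obtain ⟨C, hC0, hC⟩ := hb.fderiv_bdd
    exact (lipschitzWith_of_nnnorm_fderiv_le (C := ⟨C, hC0⟩) hb.differentiable
      fun x => hC x).uniformContinuous
  set a := cubeMean b x (√(2 * s)) with ha
  have hle : heatVar b s x ≤ ∫ z, gaussDensity z * (b (x + √(2 * s) • z) - a) ^ 2 := by
    rw [heatVar_eq hb a, integral_gauss]
    linarith [sq_nonneg (heat s b x - a)]
  -- if `√(2s) = 0`, which includes `s < 0`, then the average is over a point and the variance is `0`
  rcases (Real.sqrt_nonneg (2 * s)).eq_or_lt with h0 | hσ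
  · rw [heatVar_eq hb (b x)]
    simp only [heat, ← h0, zero_smul, add_zero, sub_self, integral_const, smul_eq_mul,
      probReal_univ, one_mul, ne_eq, OfNat.ofNat_ne_zero, not_false_eq_true, zero_pow]
    have := heatVarConst_pos n
    positivity
  refine hle.trans ?_
  set σ := √(2 * s) with hσdef
  set f : Rn n → ℝ := fun y => (b y - a) ^ 2 with hf
  have hfc : Continuous f := by fun_prop
  have hf0 : ∀ y, 0 ≤ f y := fun y => sq_nonneg _
  have hτ0 : ∀ k : ℕ, (0 : ℝ) ≤ n.factorial * 16 ^ n *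
      ((1 / 2) ^ k * (2 * (2 + 2 ^ n) ^ 2 + k ^ 2 * 4 ^ n)) := fun k => by positivity
  have hcube : ∀ k : ℕ, (n.factorial * 8 ^ n : ℝ) / 4 ^ (k * n) *
      ∫ z in cube 0 (2 ^ k), f (x + σ • z) ≤ n.factorial * 16 ^ n *
        ((1 / 2) ^ k * (2 * (2 + 2 ^ n) ^ 2 + k ^ 2 * 4 ^ n)) * Λ ^ 2 := by
    intro k
    rw [setIntegral_cube_comp_affine f x hσ (by positivity), hf,
      cubeMean_sub_sq hbc x (by positivity)]
    have e1 := h.sq_le hbu hΛ hM x (r := σ * 2 ^ k) (by positivity)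
    have e2 : (cubeMean b x (σ * 2 ^ k) - a) ^ 2 ≤ (k * (2 ^ n * Λ)) ^ 2 := by
      rw [← sq_abs]
      have := h.abs_cubeMean_sub_le hbc x hσ k
      gcongr
    have e3 : (n.factorial * 8 ^ n : ℝ) / 4 ^ (k * n) * (2 * 2 ^ k) ^ n
        = n.factorial * 16 ^ n * (1 / 2) ^ (k * n) := by
      rw [mul_pow, ← pow_mul, show (16 : ℝ) = 8 * 2 by norm_num, mul_pow 8,
        show (4 : ℝ) = 2 * 2 by norm_num, mul_pow 2 2, one_div, inv_pow]
      field_simp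
    have e4 : ((1 : ℝ) / 2) ^ (k * n) ≤ (1 / 2) ^ k :=
      pow_le_pow_of_le_one (by norm_num) (by norm_num)
        (Nat.le_mul_of_pos_right k (Nat.pos_of_ne_zero hn))
    rw [← mul_assoc, e3]
    calc _ ≤ (n.factorial * 16 ^ n : ℝ) * (1 / 2) ^ k *
          (2 * ((2 + 2 ^ n) * Λ) ^ 2 + (k * (2 ^ n * Λ)) ^ 2) := by
          refine mul_le_mul (by gcongr) (add_le_add e1 e2) (add_nonneg ?_ (sq_nonneg _))
            (by positivity)
          exact mul_nonneg (by positivity) (integral_nonneg fun _ => sq_nonneg _)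
      _ = _ := by
        rw [show (4 : ℝ) = 2 * 2 by norm_num, mul_pow 2 2]
        ring
  have hint : Integrable fun z => gaussDensity z * f (x + σ • z) := by
    refine (integrable_gaussDensity.mul_const ((M + |a|) ^ 2)).mono'
      (contDiff_gaussDensity.continuous.mul (by fun_prop)).aestronglyMeasurable
      (Eventually.of_forall fun z => ?_)
    rw [Real.norm_of_nonneg (mul_nonneg (gaussDensity_nonneg z) (hf0 _))]
    refine mul_le_mul_of_nonneg_left ?_ (gaussDensity_nonneg z)
    rw [hf]
    dsimp only
    rw [← sq_abs]
    have := hM (x + σ • z)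
    gcongr
    exact (abs_sub _ _).trans (by gcongr)
  rw [← ENNReal.ofReal_le_ofReal_iff
    (mul_nonneg (heatVarConst_pos n).le (sq_nonneg Λ)),
    ofReal_integral_eq_lintegral_ofReal hint
    (Eventually.of_forall fun z => mul_nonneg (gaussDensity_nonneg z) (hf0 _))]
  calc ∫⁻ z, ENNReal.ofReal (gaussDensity z * f (x + σ • z))
      ≤ ∫⁻ z, ∑' k : ℕ, (cube (0 : Rn n) (2 ^ k)).indicator (fun z => ENNReal.ofReal
          ((n.factorial * 8 ^ n : ℝ) / 4 ^ (k * n) * f (x + σ • z))) z := by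
        refine lintegral_mono fun z => ?_
        have hex : ∃ k : ℕ, z ∈ cube (0 : Rn n) (2 ^ k) := by
          obtain ⟨k, hk⟩ := pow_unbounded_of_one_lt ‖z‖ (one_lt_two)
          refine ⟨k, fun i => ?_⟩
          have := PiLp.norm_apply_le z i
          rw [Real.norm_eq_abs] at this
          simpa using this.trans hk.le
        classical
        -- the term of the smallest of these cubes that contains `z` already dominates
        refine le_trans ?_ (ENNReal.le_tsum (Nat.find hex))
        rw [Set.indicator_of_mem (Nat.find_spec hex)]
        refine ENNReal.ofReal_le_ofReal (mul_le_mul_of_nonneg_right ?_ (hf0 _))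
        exact gaussDensity_le z _ fun hk => Nat.find_min hex (by omega)
    _ = ∑' k : ℕ, ENNReal.ofReal ((n.factorial * 8 ^ n : ℝ) / 4 ^ (k * n) *
          ∫ z in cube 0 (2 ^ k), f (x + σ • z)) := by
        rw [lintegral_tsum fun k => ((by fun_prop : Measurable fun z : Rn n => ENNReal.ofReal
          ((n.factorial * 8 ^ n : ℝ) / 4 ^ (k * n) * f (x + σ • z))).indicator
            (measurableSet_cube _ _)).aemeasurable]
        refine tsum_congr fun k => ?_
        rw [lintegral_indicator (measurableSet_cube _ _), ← integral_const_mul,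
          ofReal_integral_eq_lintegral_ofReal]
        · exact continuous_integrableOn_cube (by fun_prop) _ _
        · exact Eventually.of_forall fun z => mul_nonneg (by positivity) (hf0 _)
    _ ≤ ∑' k : ℕ, ENNReal.ofReal (n.factorial * 16 ^ n *
        ((1 / 2) ^ k * (2 * (2 + 2 ^ n) ^ 2 + k ^ 2 * 4 ^ n)) * Λ ^ 2) :=
        ENNReal.tsum_le_tsum fun k => ENNReal.ofReal_le_ofReal (hcube k)
    _ = ENNReal.ofReal (heatVarConst n * Λ ^ 2) := by
        rw [← ENNReal.ofReal_tsum_of_nonneg (fun k => mul_nonneg (hτ0 k) (sq_nonneg _))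
          ((summable_heatVarConst n).mul_right _), tsum_mul_right, heatVarConst]

end

section

/-! ### Mollification and the null form estimates for bounded functions in `BMO` -/

open Convolution

variable {n : ℕ} {E : Type*} [NormedAddCommGroup E] [NormedSpace ℝ E]

/-- The convolution of a scalar kernel `ψ` with `u`. -/
def mollify (ψ : Rn n → ℝ) (u : Rn n → E) : Rn n → E :=
  ψ ⋆[ContinuousLinearMap.lsmul ℝ ℝ, volume] u

lemma mollify_apply (ψ : Rn n → ℝ) (u : Rn n → E) (x : Rn n) :
    mollify ψ u x = ∫ t, ψ t • u (x - t) := rfl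

lemma contDiff_mollify [CompleteSpace E] {ψ : Rn n → ℝ} (hψ : ContDiff ℝ ∞ ψ)
    (hc : HasCompactSupport ψ) {u : Rn n → E} (hu : LocallyIntegrable u) :
    ContDiff ℝ ∞ (mollify ψ u) :=
  hc.contDiff_convolution_left _ hψ hu

lemma fderiv_mollify_apply [CompleteSpace E] {ψ : Rn n → ℝ} (hψ : ContDiff ℝ ∞ ψ)
    (hc : HasCompactSupport ψ) {u : Rn n → E} (hu : LocallyIntegrable u) (x v : Rn n) :
    fderiv ℝ (mollify ψ u) x v = mollify (fun y => fderiv ℝ ψ y v) u x := by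
  have h := hc.hasFDerivAt_convolution_left (ContinuousLinearMap.lsmul ℝ ℝ : ℝ →L[ℝ] E →L[ℝ] E)
    (hψ.of_le (by simp)) hu x
  rw [mollify, h.fderiv, mollify_apply, convolution_def, ContinuousLinearMap.integral_apply]
  · rfl
  · exact ((hc.fderiv ℝ).convolutionExists_left _ (hψ.continuous_fderiv (by simp)) hu) x

lemma SmoothLp.mollify {ψ b : Rn n → ℝ} (hψ : ContDiff ℝ ∞ ψ) (hc : HasCompactSupport ψ)
    (hb : Measurable b) {M : ℝ} (hM : ∀ x, |b x| ≤ M) : SmoothLp ∞ (mollify ψ b) := by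
  have hbl : LocallyIntegrable b :=
    (memLp_top_of_bound hb.aestronglyMeasurable M (Eventually.of_forall hM)).locallyIntegrable le_top
  have hbound : ∀ ψ : Rn n → ℝ, ContDiff ℝ ∞ ψ → HasCompactSupport ψ →
      ∃ C, ∀ x, |GaffneyBMO.mollify ψ b x| ≤ C := by
    intro ψ hψ hc
    refine ⟨∫ t, |ψ t| * M, fun x => ?_⟩
    rw [mollify_apply, ← Real.norm_eq_abs]
    refine norm_integral_le_of_norm_le
      ((hψ.continuous.integrable_of_hasCompactSupport hc).abs.mul_const M)
      (Eventually.of_forall fun t => ?_)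
    rw [norm_smul, Real.norm_eq_abs, Real.norm_eq_abs]
    have := hM (x - t)
    gcongr
  have key : ∀ α, ∃ C, ∀ x, |iterPartial α (GaffneyBMO.mollify ψ b) x| ≤ C := by
    intro α
    induction α generalizing ψ with
    | nil => exact hbound ψ hψ hc
    | cons i α ih =>
      have e : GaffneyBMO.partialDeriv i (GaffneyBMO.mollify ψ b)
          = GaffneyBMO.mollify (GaffneyBMO.partialDeriv i ψ) b :=
        funext fun x => fderiv_mollify_apply hψ hc hbl x _
      rw [iterPartial, e]
      exact ih (contDiff_partialDeriv hψ i) (hasCompactSupport_partialDeriv hc i)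
  refine ⟨contDiff_mollify hψ hc hbl, key, fun α => ?_⟩
  obtain ⟨C, hC⟩ := key α
  exact memLp_top_of_bound
    (contDiff_iterPartial (contDiff_mollify hψ hc hbl) α).continuous.aestronglyMeasurable C
    (Eventually.of_forall hC)

/-- A sequence of bump functions shrinking to the origin. -/
def bump (n k : ℕ) : ContDiffBump (0 : Rn n) where
  rIn := 1 / (2 * (k + 1))
  rOut := 1 / (k + 1)
  rIn_pos := by positivity
  rIn_lt_rOut := by
    have : (0 : ℝ) < k + 1 := by positivity
    rw [div_lt_div_iff₀ (by positivity) this]; linarith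

/-- The mollifier obtained by normalising `bump n k`. -/
def bumpKernel (n k : ℕ) : Rn n → ℝ := (bump n k).normed volume

lemma contDiff_bumpKernel (k : ℕ) : ContDiff ℝ ∞ (bumpKernel n k) := (bump n k).contDiff_normed

lemma hasCompactSupport_bumpKernel (k : ℕ) : HasCompactSupport (bumpKernel n k) :=
  (bump n k).hasCompactSupport_normed

lemma bumpKernel_nonneg (k : ℕ) (x : Rn n) : 0 ≤ bumpKernel n k x := (bump n k).nonneg_normed x

lemma tendsto_bump_rOut (n : ℕ) : Tendsto (fun k => (bump n k).rOut) atTop (𝓝 0) :=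
  tendsto_one_div_add_atTop_nhds_zero_nat

/-- The probability measure with density `bumpKernel n k`. -/
def bumpMeasure (n k : ℕ) : Measure (Rn n) :=
  volume.withDensity fun x => ENNReal.ofReal (bumpKernel n k x)

instance (k : ℕ) : IsProbabilityMeasure (bumpMeasure n k) := by
  constructor
  rw [bumpMeasure, withDensity_apply _ MeasurableSet.univ, Measure.restrict_univ,
    ← ofReal_integral_eq_lintegral_ofReal (f := bumpKernel n k) (bump n k).integrable_normed
      (Eventually.of_forall (bumpKernel_nonneg k)), bumpKernel, (bump n k).integral_normed,
      ENNReal.ofReal_one]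

lemma integral_bumpMeasure (k : ℕ) (F : Rn n → E) :
    ∫ z, F z ∂bumpMeasure n k = ∫ z, bumpKernel n k z • F z := by
  rw [bumpMeasure, integral_withDensity_eq_integral_toReal_smul
    (contDiff_bumpKernel k).continuous.measurable.ennreal_ofReal
    (Eventually.of_forall fun _ => ENNReal.ofReal_lt_top)]
  refine integral_congr_ae (Eventually.of_forall fun z => ?_)
  simp [ENNReal.toReal_ofReal (bumpKernel_nonneg k z)]

lemma mollify_bumpKernel (k : ℕ) (u : Rn n → E) (x : Rn n) :
    mollify (bumpKernel n k) u x = ∫ t, u (x - t) ∂bumpMeasure n k := by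
  rw [mollify_apply, integral_bumpMeasure]

lemma norm_mollify_le (k : ℕ) {u : Rn n → E} {M : ℝ} (hM : ∀ x, ‖u x‖ ≤ M) (x : Rn n) :
    ‖mollify (bumpKernel n k) u x‖ ≤ M := by
  rw [mollify_bumpKernel]
  simpa using norm_integral_le_of_norm_le_const (μ := bumpMeasure n k)
    (f := fun t => u (x - t)) (C := M) (Eventually.of_forall fun t => hM (x - t))

/-- Mean oscillation bounded by `Λ` in terms of double averages, which behaves well under
Lipschitz truncation, mollification and change on null sets. -/
def OscLe (b : Rn n → ℝ) (Λ : ℝ) : Prop :=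
  ∀ (c : Rn n) (r : ℝ), 0 < r → ∫⁻ x in cube c r, (∫⁻ y in cube c r, ‖b x - b y‖ₑ) ≤
    ENNReal.ofReal (Λ * ((2 * r) ^ n * (2 * r) ^ n))

lemma OscLe.congr {b b' : Rn n → ℝ} {Λ : ℝ} (h : OscLe b Λ) (hbb : b =ᵐ[volume] b') :
    OscLe b' Λ := by
  intro c r hr
  refine le_trans (le_of_eq ?_) (h c r hr)
  refine lintegral_congr_ae ?_
  filter_upwards [ae_restrict_of_ae hbb] with x hx
  refine lintegral_congr_ae ?_
  filter_upwards [ae_restrict_of_ae hbb] with y hy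
  rw [hx, hy]

lemma OscLe.trunc {b : Rn n → ℝ} {Λ : ℝ} (h : OscLe b Λ) (k : ℝ) :
    OscLe (fun x => max (-k) (min k (b x))) Λ := by
  intro c r hr
  refine le_trans (lintegral_mono fun x => lintegral_mono fun y => ?_) (h c r hr)
  rw [enorm_le_iff_norm_le]
  refine (abs_max_sub_max_le_max _ _ _ _).trans ?_
  rw [sub_self, abs_zero, max_eq_right (abs_nonneg _)]
  refine (abs_min_sub_min_le_max _ _ _ _).trans ?_
  rw [sub_self, abs_zero, max_eq_right (abs_nonneg _), Real.norm_eq_abs]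

/-- Passing from the mean to double averages doubles the constant. -/
lemma IsBMOWith.oscLe {b : Rn n → ℝ} {Λ : ℝ} (h : IsBMOWith b Λ) : OscLe b (2 * Λ) := by
  intro c r hr
  obtain ⟨hb, h⟩ := h
  set m := ⨍ y in cube c r, b y with hm
  have hbi : IntegrableOn b (cube c r) := hb.integrableOn_isCompact (isCompact_cube c r)
  have hfin : volume (cube c r) ≠ ⊤ := (isCompact_cube c r).measure_lt_top.ne
  have hsub : IntegrableOn (fun x => b x - m) (cube c r) :=
    hbi.sub (integrableOn_const hfin)
  have hI : ∫⁻ x in cube c r, ‖b x - m‖ₑ ≤ ENNReal.ofReal (Λ * (2 * r) ^ n) := by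
    rw [← ofReal_integral_norm_eq_lintegral_enorm hsub]
    refine ENNReal.ofReal_le_ofReal ?_
    have := h c r hr
    rw [setAverage_eq, volume_real_cube c hr.le, smul_eq_mul,
      inv_mul_le_iff₀ (by positivity)] at this
    simpa [mul_comm] using this
  have hmeas : AEMeasurable (fun x => ‖b x - m‖ₑ) (volume.restrict (cube c r)) :=
    hsub.aestronglyMeasurable.enorm
  have hΛ : 0 ≤ Λ := by
    refine le_trans ?_ (h c r hr)
    exact integral_nonneg fun _ => abs_nonneg _
  calc ∫⁻ x in cube c r, (∫⁻ y in cube c r, ‖b x - b y‖ₑ)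
      ≤ ∫⁻ x in cube c r, (∫⁻ y in cube c r, (‖b x - m‖ₑ + ‖b y - m‖ₑ)) := by
        refine lintegral_mono fun x => lintegral_mono fun y => ?_
        have e : b x - b y = (b x - m) - (b y - m) := by ring
        rw [e]
        exact enorm_sub_le
    _ = 2 * ((∫⁻ x in cube c r, ‖b x - m‖ₑ) * volume (cube c r)) := by
        simp_rw [lintegral_add_left measurable_const]
        rw [lintegral_add_right' _ aemeasurable_const]
        simp only [lintegral_const, Measure.restrict_apply_univ]
        rw [lintegral_mul_const'' _ hmeas]
        ring
    _ ≤ 2 * (ENNReal.ofReal (Λ * (2 * r) ^ n) * ENNReal.ofReal ((2 * r) ^ n)) := by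
        rw [volume_cube c hr.le]; gcongr
    _ = _ := by
        rw [← ENNReal.ofReal_mul (by positivity), ← ENNReal.ofReal_ofNat 2,
          ← ENNReal.ofReal_mul (by norm_num)]
        congr 1; ring

lemma OscLe.meanOscLe {b : Rn n → ℝ} {Λ : ℝ} (hΛ : 0 ≤ Λ) (h : OscLe b Λ) (hb : Continuous b) :
    MeanOscLe b Λ := by
  intro c r hr
  set m := cubeMean b c r with hm
  have hv : (0 : ℝ) < (2 * r) ^ n := by positivity
  have h1 : ∀ x, ‖b x - m‖ₑ ≤ ENNReal.ofReal ((2 * r) ^ n)⁻¹ * ∫⁻ y in cube c r, ‖b x - b y‖ₑ := by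
    intro x
    have e : b x - m = ((2 * r) ^ n)⁻¹ * ∫ y in cube c r, (b x - b y) := by
      rw [integral_sub (continuous_integrableOn_cube continuous_const c r)
        (continuous_integrableOn_cube hb c r), mul_sub]
      congr 1
      exact (cubeMean_const c hr (b x)).symm
    rw [e, enorm_mul, Real.enorm_eq_ofReal (inv_nonneg.2 hv.le)]
    gcongr
    exact enorm_integral_le_lintegral_enorm _
  have h2 : ENNReal.ofReal (∫ x in cube c r, |b x - m|) ≤ ENNReal.ofReal (Λ * (2 * r) ^ n) := by
    have := ofReal_integral_norm_eq_lintegral_enorm (f := fun x => b x - m)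
      (continuous_integrableOn_cube (by fun_prop) c r)
    simp only [Real.norm_eq_abs] at this
    rw [this]
    calc _ ≤ ∫⁻ x in cube c r, (ENNReal.ofReal ((2 * r) ^ n)⁻¹ *
          ∫⁻ y in cube c r, ‖b x - b y‖ₑ) := lintegral_mono fun x => h1 x
      _ ≤ ENNReal.ofReal ((2 * r) ^ n)⁻¹ * ENNReal.ofReal (Λ * ((2 * r) ^ n * (2 * r) ^ n)) := by
          rw [lintegral_const_mul' _ _ ENNReal.ofReal_ne_top]
          gcongr
          exact h c r hr
      _ = _ := by
          rw [← ENNReal.ofReal_mul (by positivity)]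
          congr 1; field_simp
  rw [ENNReal.ofReal_le_ofReal_iff (by positivity)] at h2
  rw [cubeMean, inv_mul_le_iff₀ hv, mul_comm]
  exact h2

/-- Mollification averages translates, and the condition on all cubes is translation invariant. -/
lemma OscLe.mollify {b : Rn n → ℝ} {Λ M : ℝ} (h : OscLe b Λ) (hb : Measurable b)
    (hM : ∀ x, |b x| ≤ M) (k : ℕ) : OscLe (mollify (bumpKernel n k) b) Λ := by
  intro c r hr
  have hint : ∀ x, Integrable (fun t => b (x - t)) (bumpMeasure n k) := fun x =>
    Integrable.of_bound (by fun_prop : Measurable fun t => b (x - t)).aestronglyMeasurable M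
      (Eventually.of_forall fun t => hM _)
  have hm : Measurable fun p : (Rn n × Rn n) × Rn n => ‖b (p.1.1 - p.2) - b (p.1.2 - p.2)‖ₑ := by
    fun_prop
  have h1 : ∀ x y, ‖GaffneyBMO.mollify (bumpKernel n k) b x - GaffneyBMO.mollify (bumpKernel n k) b y‖ₑ
      ≤ ∫⁻ t, ‖b (x - t) - b (y - t)‖ₑ ∂bumpMeasure n k := by
    intro x y
    rw [mollify_bumpKernel, mollify_bumpKernel, ← integral_sub (hint x) (hint y)]
    exact enorm_integral_le_lintegral_enorm _
  calc _ ≤ ∫⁻ x in cube c r, (∫⁻ y in cube c r, (∫⁻ t, ‖b (x - t) - b (y - t)‖ₑ ∂bumpMeasure n k)) :=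
        lintegral_mono fun x => lintegral_mono fun y => h1 x y
    _ = ∫⁻ x in cube c r, (∫⁻ t, (∫⁻ y in cube c r, ‖b (x - t) - b (y - t)‖ₑ) ∂bumpMeasure n k) := by
        refine lintegral_congr fun x => ?_
        rw [lintegral_lintegral_swap]
        exact (hm.comp (by fun_prop :
          Measurable fun p : Rn n × Rn n => ((x, p.1), p.2))).aemeasurable
    _ = ∫⁻ t, (∫⁻ x in cube c r, (∫⁻ y in cube c r, ‖b (x - t) - b (y - t)‖ₑ)) ∂bumpMeasure n k := by
        rw [lintegral_lintegral_swap]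
        refine Measurable.aemeasurable ?_
        exact Measurable.lintegral_prod_right' (f := fun p : (Rn n × Rn n) × Rn n =>
          ‖b (p.1.1 - p.1.2) - b (p.2 - p.1.2)‖ₑ) (by fun_prop)
    _ ≤ ∫⁻ _t, ENNReal.ofReal (Λ * ((2 * r) ^ n * (2 * r) ^ n)) ∂bumpMeasure n k := by
        refine lintegral_mono fun t => ?_
        have e : cube c r = (fun x => x - t) ⁻¹' cube (c - t) r := by
          ext x; simp [cube]
        have hs : ∀ F : Rn n → ℝ≥0∞, ∫⁻ x in cube c r, F (x - t) = ∫⁻ x in cube (c - t) r, F x :=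
          fun F => by
            rw [e]
            exact (measurePreserving_sub_right volume t).setLIntegral_comp_preimage_emb
              (MeasurableEquiv.subRight t).measurableEmbedding F _
        refine le_trans (le_of_eq ?_) (h (c - t) r hr)
        rw [← hs (fun x => ∫⁻ y in cube (c - t) r, ‖b x - b y‖ₑ)]
        exact lintegral_congr fun x => hs (fun y => ‖b (x - t) - b y‖ₑ)
    _ = _ := by simp

/-- Bounds for the pairing with `N ∈ L¹` pass from smooth functions of bounded mean oscillation to
bounded measurable ones. -/
lemma OscLe.abs_integral_mul_le {b N : Rn n → ℝ} {Λ M B : ℝ} (hΛ : 0 ≤ Λ) (h : OscLe b Λ)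
    (hb : Measurable b) (hM : ∀ x, |b x| ≤ M) (hN : Integrable N)
    (H : ∀ b' : Rn n → ℝ, SmoothLp ∞ b' → MeanOscLe b' Λ → |∫ x, b' x * N x| ≤ B) :
    |∫ x, b x * N x| ≤ B := by
  have hbl : LocallyIntegrable b :=
    (memLp_top_of_bound hb.aestronglyMeasurable M (Eventually.of_forall hM)).locallyIntegrable le_top
  have hs : ∀ k, SmoothLp ∞ (GaffneyBMO.mollify (bumpKernel n k) b) := fun k =>
    SmoothLp.mollify (contDiff_bumpKernel k) (hasCompactSupport_bumpKernel k) hb hM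
  have hlim : Tendsto (fun k => ∫ x, GaffneyBMO.mollify (bumpKernel n k) b x * N x) atTop
      (𝓝 (∫ x, b x * N x)) := by
    refine tendsto_integral_of_dominated_convergence (fun x => M * |N x|)
      (fun k => (hs k).continuous.aestronglyMeasurable.mul hN.aestronglyMeasurable)
      (hN.abs.const_mul M) (fun k => Eventually.of_forall fun x => ?_) ?_
    · rw [norm_mul, Real.norm_eq_abs (N x)]
      have := norm_mollify_le (E := ℝ) k hM x
      gcongr
    · have := ContDiffBump.ae_convolution_tendsto_right_of_locallyIntegrable
        (φ := bump n) (K := 2) (tendsto_bump_rOut n) (Eventually.of_forall fun k => by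
          simp only [bump]; field_simp; norm_num) hbl
      filter_upwards [this] with x hx
      exact hx.mul_const _
  refine le_of_tendsto hlim.abs (Eventually.of_forall fun k => ?_)
  exact H _ (hs k) ((h.mollify hb hM k).meanOscLe hΛ (hs k).continuous)

end

section

/-! ### Multiplication operators and the Sobolev space -/

variable {n : ℕ} {m m' : Rn n → ℝ}

/-- Multiplication by a bounded real function, as an operator on `L²`. -/
def mulL (hm : MemLp m ∞ volume) : L2 n →L[ℂ] L2 n :=
  (ContinuousLinearMap.mul ℂ ℂ).holderL volume ∞ 2 2 (hm.ofReal (K := ℂ)).toLp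

lemma coeFn_mulL (hm : MemLp m ∞ volume) (u : L2 n) :
    mulL hm u =ᵐ[volume] fun x => (m x : ℂ) * u x := by
  have h1 := (ContinuousLinearMap.mul ℂ ℂ).coeFn_holder (r := 2) (hm.ofReal (K := ℂ)).toLp u
  filter_upwards [h1, (hm.ofReal (K := ℂ)).coeFn_toLp] with x hx hx'
  rw [hx'] at hx
  exact hx

lemma norm_mulL_le (hm : MemLp m ∞ volume) {C : ℝ} (hC : ∀ᵐ x, |m x| ≤ C) (u : L2 n) :
    ‖mulL hm u‖ ≤ C * ‖u‖ := by
  refine Lp.norm_le_mul_norm_of_ae_le_mul ?_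
  filter_upwards [coeFn_mulL hm u, hC] with x hx hCx
  rw [hx, norm_mul, Complex.norm_real, Real.norm_eq_abs]
  gcongr

lemma inner_eq_integral (u v : L2 n) : inner ℂ v u = ∫ x, u x * starRingEnd ℂ (v x) := by
  simp [L2.inner_def, RCLike.inner_apply]

lemma integrable_mul_conj (u v : L2 n) : Integrable fun x => u x * starRingEnd ℂ (v x) :=
  MemLp.integrable_mul (p := 2) (q := 2) (Lp.memLp u) (Lp.memLp v).star

lemma inner_mulL (hm : MemLp m ∞ volume) (u v : L2 n) :
    inner ℂ v (mulL hm u) = inner ℂ (mulL hm v) u := by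
  rw [inner_eq_integral, inner_eq_integral]
  refine integral_congr_ae ?_
  filter_upwards [coeFn_mulL hm u, coeFn_mulL hm v] with x hu hv
  rw [hu, hv, map_mul, Complex.conj_ofReal]
  ring

lemma mulL_congr (hm : MemLp m ∞ volume) (hm' : MemLp m' ∞ volume) (h : m =ᵐ[volume] m') :
    mulL hm = mulL hm' := by
  ext1 u
  refine Lp.ext ?_
  filter_upwards [coeFn_mulL hm u, coeFn_mulL hm' u, h] with x h1 h2 h3
  rw [h1, h2, h3]

lemma memLp_top_of_abs_le (hm : Continuous m) {C : ℝ} (hC : ∀ x, |m x| ≤ C) : MemLp m ∞ volume :=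
  memLp_top_of_bound hm.aestronglyMeasurable C (Eventually.of_forall hC)

/-- Dominated convergence for multiplication operators. -/
lemma tendsto_mulL {M : ℕ → Rn n → ℝ} (hM : ∀ k, MemLp (M k) ∞ volume) {C : ℝ}
    (hC : ∀ k x, |M k x| ≤ C) (hm : MemLp m ∞ volume)
    (hlim : ∀ x, Tendsto (fun k => M k x) atTop (𝓝 (m x))) (u : L2 n) :
    Tendsto (fun k => mulL (hM k) u) atTop (𝓝 (mulL hm u)) := by
  have hC0 : 0 ≤ C := (abs_nonneg _).trans (hC 0 0)
  have hmC : ∀ x, |m x| ≤ C := fun x =>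
    le_of_tendsto (hlim x).abs (Eventually.of_forall fun k => hC k x)
  rw [tendsto_iff_edist_tendsto_0]
  have key : Tendsto (fun k => ∫⁻ x, ‖((M k x - m x : ℝ) : ℂ) * u x‖ₑ ^ 2) atTop
      (𝓝 (∫⁻ _x : Rn n, 0)) := by
    refine tendsto_lintegral_of_dominated_convergence' (fun x => (ENNReal.ofReal (2 * C) * ‖u x‖ₑ) ^ 2)
      (fun k => ?_) (fun k => Eventually.of_forall fun x => ?_) ?_ (Eventually.of_forall fun x => ?_)
    · refine ((AEStronglyMeasurable.mul ?_ (Lp.aestronglyMeasurable u)).enorm).pow_const 2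
      exact Complex.continuous_ofReal.comp_aestronglyMeasurable
        ((hM k).aestronglyMeasurable.sub hm.aestronglyMeasurable)
    · dsimp only
      rw [enorm_mul]
      gcongr
      rw [← ofReal_norm, Complex.norm_real, Real.norm_eq_abs]
      refine ENNReal.ofReal_le_ofReal ((abs_sub _ _).trans ?_)
      linarith [hC k x, hmC x]
    · simp_rw [mul_pow]
      rw [lintegral_const_mul' _ _ (ENNReal.pow_ne_top ENNReal.ofReal_ne_top), ← eLpNorm_two_sq]
      exact ENNReal.mul_ne_top (ENNReal.pow_ne_top ENNReal.ofReal_ne_top) (ENNReal.pow_ne_top (Lp.memLp u).eLpNorm_ne_top)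
    · have h1 : Tendsto (fun k => ((M k x - m x : ℝ) : ℂ) * u x) atTop (𝓝 (((0 : ℝ) : ℂ) * u x)) := by
        refine Tendsto.mul_const _ ((Complex.continuous_ofReal.tendsto _).comp ?_)
        simpa using (hlim x).sub_const (m x)
      have h2 := ((continuous_enorm.tendsto _).comp h1)
      have h3 := ENNReal.Tendsto.pow (n := 2) h2
      simpa using h3
  have hsq : Tendsto (fun k => (edist (mulL (hM k) u) (mulL hm u)) ^ 2) atTop (𝓝 0) := by
    rw [lintegral_zero] at key
    refine key.congr fun k => ?_
    rw [Lp.edist_def, eLpNorm_two_sq]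
    refine lintegral_congr_ae ?_
    filter_upwards [coeFn_mulL (hM k) u, coeFn_mulL hm u] with x h1 h2
    rw [Pi.sub_apply, h1, h2]
    push_cast
    ring_nf
  have := (ENNReal.continuous_rpow_const (y := (1 / 2 : ℝ))).tendsto 0 |>.comp hsq
  rw [ENNReal.zero_rpow_of_pos (by norm_num)] at this
  refine this.congr fun k => ?_
  simp only [Function.comp_apply]
  rw [← ENNReal.rpow_natCast, ← ENNReal.rpow_mul]
  norm_num

lemma integral_smul_eq_inner {ψ : Rn n → ℝ} (hψ : MemLp ψ 2 volume) (u : L2 n) :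
    ∫ x, ψ x • u x = inner ℂ ((hψ.ofReal (K := ℂ)).toLp : L2 n) u := by
  rw [inner_eq_integral]
  refine integral_congr_ae ?_
  filter_upwards [(hψ.ofReal (K := ℂ)).coeFn_toLp] with x hx
  rw [hx, Complex.real_smul]
  simp [mul_comm]

/-- The product rule for weak gradients. -/
lemma HasWeakGrad.mulL {u : L2 n} {G : Fin n → L2 n} (hu : HasWeakGrad u G)
    (hms : ContDiff ℝ ∞ m) (hm : MemLp m ∞ volume) (hd : ∀ i, MemLp (partialDeriv i m) ∞ volume) :
    HasWeakGrad (mulL hm u) (fun i => GaffneyBMO.mulL hm (G i) + GaffneyBMO.mulL (hd i) u) := by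
  intro φ hφ hc i
  have hmd := hms.differentiable (by simp)
  have hφd := hφ.differentiable (by simp)
  have h1 := hu (fun x => φ x * m x) (hφ.mul hms) hc.mul_right i
  rw [partialDeriv_mul hφd hmd] at h1
  have e1 : ∫ x, partialDeriv i φ x • (GaffneyBMO.mulL hm u) x
      = ∫ x, ((partialDeriv i φ x * m x) • u x) := by
    refine integral_congr_ae ?_
    filter_upwards [coeFn_mulL hm u] with x hx
    rw [hx]
    simp only [Complex.real_smul, Complex.ofReal_mul]
    ring
  have e2 : ∫ x, φ x • (GaffneyBMO.mulL hm (G i) + GaffneyBMO.mulL (hd i) u : L2 n) x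
      = ∫ x, ((φ x * m x) • G i x + (φ x * partialDeriv i m x) • u x) := by
    refine integral_congr_ae ?_
    filter_upwards [Lp.coeFn_add (GaffneyBMO.mulL hm (G i)) (GaffneyBMO.mulL (hd i) u),
      coeFn_mulL hm (G i), coeFn_mulL (hd i) u] with x h1 h2 h3
    rw [h1, Pi.add_apply, h2, h3]
    simp only [Complex.real_smul, Complex.ofReal_mul]
    ring
  have i1 := integrable_test_smul ((continuous_partialDeriv hφ i).mul hms.continuous)
    (hasCompactSupport_partialDeriv hc i).mul_right u
  have i2 := integrable_test_smul (hφ.continuous.mul (continuous_partialDeriv hms i))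
    hc.mul_right u
  have i3 := integrable_test_smul (hφ.continuous.mul hms.continuous) hc.mul_right (G i)
  simp only [Pi.mul_apply] at i1 i2 i3
  have e3 : ∫ x, (partialDeriv i φ x * m x + φ x * partialDeriv i m x) • u x
      = (∫ x, (partialDeriv i φ x * m x) • u x) + ∫ x, (φ x * partialDeriv i m x) • u x := by
    rw [← integral_add i1 i2]
    simp only [add_smul]
  rw [e1, e2, integral_add i3 i2, neg_add]
  have h4 : (∫ x, (partialDeriv i φ x * m x) • u x) + ∫ x, (φ x * partialDeriv i m x) • u x
      = -∫ x, (φ x * m x) • G i x := by rw [← e3]; simpa [add_comm] using h1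
  rw [← h4]
  ring

/-- The Hilbert space of pairs `(u, G)` with `u ∈ L²` and `G ∈ (L²)ⁿ`; the coordinate `none`
carries `u`. -/
abbrev PairSpace (n : ℕ) : Type := PiLp 2 (fun _ : Option (Fin n) => L2 n)

/-- The pair `(u, G)`. -/
def pair (u : L2 n) (G : Fin n → L2 n) : PairSpace n := WithLp.toLp 2 fun o => o.elim u G

@[simp] lemma pair_none (u : L2 n) (G : Fin n → L2 n) : pair u G none = u := rfl
@[simp] lemma pair_some (u : L2 n) (G : Fin n → L2 n) (i : Fin n) : pair u G (some i) = G i := rfl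

lemma tendsto_pair {ι : Type*} {l : Filter ι} {u : ι → L2 n} {G : ι → Fin n → L2 n} {u₀ : L2 n}
    {G₀ : Fin n → L2 n} (hu : Tendsto u l (𝓝 u₀)) (hG : ∀ i, Tendsto (fun k => G k i) l (𝓝 (G₀ i))) :
    Tendsto (fun k => pair (u k) (G k)) l (𝓝 (pair u₀ G₀)) := by
  refine ((PiLp.continuous_toLp 2 _).tendsto _).comp (tendsto_pi_nhds.2 fun o => ?_)
  cases o with
  | none => exact hu
  | some i => exact hG i

/-- `W^{1,2}`, embedded in the Hilbert space of pairs as the graph of the weak gradient. -/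
def sobolevGraph (n : ℕ) : Submodule ℂ (PairSpace n) where
  carrier := {U | HasWeakGrad (U none) fun i => U (some i)}
  add_mem' := fun hU hV => hU.add hV
  zero_mem' := HasWeakGrad.zero
  smul_mem' := fun c _ hU => hU.smul c

lemma mem_sobolevGraph {U : PairSpace n} :
    U ∈ sobolevGraph n ↔ HasWeakGrad (U none) fun i => U (some i) := Iff.rfl

lemma isClosed_sobolevGraph : IsClosed (sobolevGraph n : Set (PairSpace n)) := by
  have h : (sobolevGraph n : Set (PairSpace n)) = ⋂ (φ : Rn n → ℝ) (_ : ContDiff ℝ ∞ φ)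
      (_ : HasCompactSupport φ) (i : Fin n),
        {U | ∫ x, partialDeriv i φ x • U none x = -∫ x, φ x • U (some i) x} := by
    ext U
    simp [mem_sobolevGraph, HasWeakGrad]
  rw [h]
  refine isClosed_iInter fun φ => isClosed_iInter fun hφ => isClosed_iInter fun hc =>
    isClosed_iInter fun i => ?_
  simp_rw [integral_smul_eq_inner
    ((continuous_partialDeriv hφ i).memLp_of_hasCompactSupport (hasCompactSupport_partialDeriv hc i)),
    integral_smul_eq_inner (hφ.continuous.memLp_of_hasCompactSupport hc)]
  exact isClosed_eq (by fun_prop) (by fun_prop)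

end

section

/-! ### Density of test functions in the Sobolev space -/

open Convolution

variable {n : ℕ}

/-- Pairs `(f, ∇f)` with `f` smooth and compactly supported. -/
def testSet (n : ℕ) : Set (PairSpace n) :=
  {U | ∃ f : Rn n → ℂ, ContDiff ℝ ∞ f ∧ HasCompactSupport f ∧ U none =ᵐ[volume] f ∧
    ∀ i, U (some i) =ᵐ[volume] fun x => fderiv ℝ f x (EuclideanSpace.single i 1)}

/-- Translation on `L²`. -/
def translateL (u : L2 n) (t : Rn n) : L2 n :=
  Lp.compMeasurePreserving (fun x => x - t) (measurePreserving_sub_right volume t) u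

lemma continuous_translateL (u : L2 n) : Continuous (translateL u) := by
  have hg : Continuous fun t : Rn n => (⟨fun x => x - t, by fun_prop⟩ : C(Rn n, Rn n)) :=
    ContinuousMap.continuous_of_continuous_uncurry _ (by
      show Continuous fun p : Rn n × Rn n => p.2 - p.1
      fun_prop)
  exact (continuous_const (y := u)).compMeasurePreservingLp hg
    (fun t => measurePreserving_sub_right volume t) (by norm_num)

lemma translateL_zero (u : L2 n) : translateL u 0 = u := by
  refine Lp.ext ?_
  filter_upwards [Lp.coeFn_compMeasurePreserving u
    (measurePreserving_sub_right (volume : Measure (Rn n)) 0)] with x hx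
  rw [translateL, hx]
  simp

lemma locallyIntegrable_L2 (u : L2 n) : LocallyIntegrable u :=
  (Lp.memLp u).locallyIntegrable (by norm_num)

lemma integrable_bumpMeasure (k : ℕ) (u : L2 n) (x : Rn n) :
    Integrable (fun t => u (x - t)) (bumpMeasure n k) := by
  have h := (hasCompactSupport_bumpKernel k).convolutionExists_left
    (ContinuousLinearMap.lsmul ℝ ℝ : ℝ →L[ℝ] ℂ →L[ℝ] ℂ) (contDiff_bumpKernel (n := n) k).continuous
    (locallyIntegrable_L2 u) x
  rw [bumpMeasure, integrable_withDensity_iff_integrable_smul'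
    (contDiff_bumpKernel k).continuous.measurable.ennreal_ofReal
    (Eventually.of_forall fun _ => ENNReal.ofReal_lt_top)]
  refine Integrable.congr h (Eventually.of_forall fun t => ?_)
  simp [ENNReal.toReal_ofReal (bumpKernel_nonneg k t)]

lemma ae_bumpMeasure_norm_lt (k : ℕ) : ∀ᵐ t ∂bumpMeasure n k, ‖t‖ < (bump n k).rOut := by
  rw [bumpMeasure, ae_withDensity_iff
    (contDiff_bumpKernel k).continuous.measurable.ennreal_ofReal]
  refine Eventually.of_forall fun t ht => ?_
  have h : t ∈ Function.support ((bump n k).normed volume) := by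
    intro h0
    exact ht (by rw [bumpKernel, h0, ENNReal.ofReal_zero])
  rw [(bump n k).support_normed_eq] at h
  simpa using h

/-- Mollifications converge in `L²`. -/
lemma tendsto_eLpNorm_mollify_sub (u : L2 n) :
    Tendsto (fun k => eLpNorm (fun x => mollify (bumpKernel n k) u x - u x) 2 volume) atTop
      (𝓝 0) := by
  rw [ENNReal.tendsto_atTop_zero]
  intro ε hε
  have h1 : Tendsto (fun t => edist (translateL u t) u) (𝓝 0) (𝓝 0) := by
    have := ((continuous_translateL u).tendsto 0).edist (tendsto_const_nhds (x := u))
    rwa [translateL_zero, edist_self] at this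
  obtain ⟨δ, hδ, hδε⟩ := Metric.eventually_nhds_iff.1 (h1.eventually (ge_mem_nhds hε))
  obtain ⟨K, hK⟩ := Filter.eventually_atTop.1 ((tendsto_bump_rOut n).eventually (gt_mem_nhds hδ))
  refine ⟨K, fun k hk => ?_⟩
  rw [← ENNReal.pow_le_pow_left_iff (two_ne_zero), eLpNorm_two_sq]
  have e : ∀ x, mollify (bumpKernel n k) u x - u x = ∫ t, (u (x - t) - u x) ∂bumpMeasure n k := by
    intro x
    rw [integral_sub (integrable_bumpMeasure k u x) (integrable_const _), mollify_bumpKernel]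
    simp
  simp_rw [e]
  refine (lintegral_enorm_integral_sq_le (bumpMeasure n k) (F := fun x t => u (x - t) - u x) ?_).trans ?_
  · exact ((Lp.stronglyMeasurable u).comp_measurable (measurable_fst.sub measurable_snd)).sub
      ((Lp.stronglyMeasurable u).comp_measurable measurable_fst)
  · calc ∫⁻ t, (∫⁻ x, ‖u (x - t) - u x‖ₑ ^ 2) ∂bumpMeasure n k
        ≤ ∫⁻ _t, ε ^ 2 ∂bumpMeasure n k := by
          refine lintegral_mono_ae ?_
          filter_upwards [ae_bumpMeasure_norm_lt k] with t ht
          have h2 := hδε (y := t) (by rw [dist_zero_right]; exact ht.trans (hK k hk))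
          refine le_trans (le_of_eq ?_) (pow_le_pow_left₀ zero_le h2 2)
          rw [Lp.edist_def, eLpNorm_two_sq]
          refine lintegral_congr_ae ?_
          filter_upwards [Lp.coeFn_compMeasurePreserving u
            (measurePreserving_sub_right (volume : Measure (Rn n)) t)] with x hx
          rw [Pi.sub_apply, translateL, hx]
          rfl
      _ = ε ^ 2 := by simp

lemma mollify_congr {ψ : Rn n → ℝ} {u v : Rn n → ℂ} (h : u =ᵐ[volume] v) :
    mollify ψ u = mollify ψ v := by
  funext x
  rw [mollify_apply, mollify_apply]
  refine integral_congr_ae ?_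
  filter_upwards [(Measure.measurePreserving_sub_left (volume : Measure (Rn n)) x).quasiMeasurePreserving.ae_eq_comp h]
    with t ht
  simp only [Function.comp_apply] at ht
  rw [ht]

lemma mollify_eq_swap (ψ : Rn n → ℝ) (u : Rn n → ℂ) (x : Rn n) :
    mollify ψ u x = ∫ y, ψ (x - y) • u y := convolution_lsmul_swap

/-- Weak derivatives commute with mollification. -/
lemma HasWeakGrad.mollify_partialDeriv {u : L2 n} {G : Fin n → L2 n} (hu : HasWeakGrad u G)
    {ψ : Rn n → ℝ} (hψ : ContDiff ℝ ∞ ψ) (hc : HasCompactSupport ψ) (i : Fin n) :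
    mollify (partialDeriv i ψ) u = mollify ψ (G i) := by
  funext x
  have h := hu (fun y => ψ (x - y)) (hψ.comp (contDiff_const.sub contDiff_id))
    (hc.comp_homeomorph (Homeomorph.subLeft x)) i
  have e : partialDeriv i (fun y => ψ (x - y)) = fun y => -partialDeriv i ψ (x - y) := by
    funext y
    have h1 := (hψ.differentiable (by simp)).differentiableAt (x := x - y) |>.hasFDerivAt
    have h2 := h1.comp y ((hasFDerivAt_id y).const_sub x)
    rw [partialDeriv]
    change fderiv ℝ (ψ ∘ fun y => x - y) y _ = _
    rw [h2.fderiv]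
    simp [partialDeriv]
  rw [e] at h
  simp only [neg_smul, integral_neg, neg_inj] at h
  rw [mollify_eq_swap, mollify_eq_swap, h]

lemma edist_toLp_left {f : Rn n → ℂ} (hf : MemLp f 2 volume) (u : L2 n) :
    edist (hf.toLp f) u = eLpNorm (fun x => f x - u x) 2 volume := by
  rw [Lp.edist_def]
  refine eLpNorm_congr_ae ?_
  filter_upwards [hf.coeFn_toLp] with x hx
  rw [Pi.sub_apply, hx]

/-- Compactly supported Sobolev functions are approximated by their mollifications. -/
lemma mem_closure_testSet_of_support {u : L2 n} {G : Fin n → L2 n} (hu : HasWeakGrad u G)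
    {K : Set (Rn n)} (hK : IsCompact K) (hs : ∀ᵐ x, x ∉ K → u x = 0) :
    pair u G ∈ closure (testSet n) := by
  set g : Rn n → ℂ := K.indicator u with hg
  have hug : u =ᵐ[volume] g := by
    filter_upwards [hs] with x hx
    by_cases h : x ∈ K
    · rw [hg, Set.indicator_of_mem h]
    · rw [hg, Set.indicator_of_notMem h, hx h]
  have hgc : HasCompactSupport g := HasCompactSupport.intro hK fun x hx => by
    rw [hg, Set.indicator_of_notMem hx]
  set F : ℕ → Rn n → ℂ := fun k => mollify (bumpKernel n k) u with hF
  have hFs : ∀ k, ContDiff ℝ ∞ (F k) := fun k =>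
    contDiff_mollify (contDiff_bumpKernel k) (hasCompactSupport_bumpKernel k) (locallyIntegrable_L2 u)
  have hFc : ∀ k, HasCompactSupport (F k) := fun k => by
    rw [hF]
    dsimp only
    rw [mollify_congr hug]
    exact HasCompactSupport.convolution _ (hasCompactSupport_bumpKernel k) hgc
  have hFd : ∀ k i x, fderiv ℝ (F k) x (EuclideanSpace.single i 1)
      = mollify (bumpKernel n k) (G i) x := fun k i x => by
    rw [hF]
    dsimp only
    rw [fderiv_mollify_apply (contDiff_bumpKernel k) (hasCompactSupport_bumpKernel k)
      (locallyIntegrable_L2 u)]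
    exact congrFun (hu.mollify_partialDeriv (contDiff_bumpKernel k)
      (hasCompactSupport_bumpKernel k) i) x
  have hF2 : ∀ k, MemLp (F k) 2 volume := fun k =>
    (hFs k).continuous.memLp_of_hasCompactSupport (hFc k)
  have hFd2 : ∀ k i, MemLp (fun x => fderiv ℝ (F k) x (EuclideanSpace.single i 1)) 2 volume :=
    fun k i => (((hFs k).continuous_fderiv (by simp)).clm_apply
      continuous_const).memLp_of_hasCompactSupport
        ((hFc k).fderiv_apply (𝕜 := ℝ) (EuclideanSpace.single i 1))
  refine mem_closure_of_tendsto (f := fun k => pair (hF2 k).toLp fun i => (hFd2 k i).toLp)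
    (b := atTop) ?_ (Eventually.of_forall fun k => ⟨F k, hFs k, hFc k, (hF2 k).coeFn_toLp,
      fun i => (hFd2 k i).coeFn_toLp⟩)
  refine tendsto_pair ?_ fun i => ?_
  · rw [tendsto_iff_edist_tendsto_0]
    simp_rw [edist_toLp_left]
    exact tendsto_eLpNorm_mollify_sub u
  · rw [tendsto_iff_edist_tendsto_0]
    simp_rw [edist_toLp_left, hFd]
    exact tendsto_eLpNorm_mollify_sub (G i)

/-- A smooth compactly supported cutoff function. -/
def cutoff (n : ℕ) : ContDiffBump (0 : Rn n) := ⟨1, 2, one_pos, one_lt_two⟩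

/-- Test functions are dense in `W^{1,2}`: cut off, then mollify. -/
lemma mem_closure_testSet {u : L2 n} {G : Fin n → L2 n} (hu : HasWeakGrad u G) :
    pair u G ∈ closure (testSet n) := by
  set a : ℕ → ℝ := fun k => 1 / (k + 1) with ha
  have ha0 : ∀ k, 0 < a k := fun k => by rw [ha]; positivity
  have ha1 : ∀ k, a k ≤ 1 := fun k => by
    rw [ha]
    exact (div_le_one (by positivity)).2 (by linarith [(Nat.cast_nonneg k : (0 : ℝ) ≤ k)])
  have hat : Tendsto a atTop (𝓝 0) := tendsto_one_div_add_atTop_nhds_zero_nat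
  set χ : ℕ → Rn n → ℝ := fun k x => cutoff n (a k • x) with hχ
  have hχs : ∀ k, ContDiff ℝ ∞ (χ k) := fun k =>
    (cutoff n).contDiff.comp (contDiff_const_smul (a k))
  have hχ1 : ∀ k x, |χ k x| ≤ 1 := fun k x => by
    rw [abs_of_nonneg ((cutoff n).nonneg)]; exact (cutoff n).le_one
  have hχd : ∀ k i x, partialDeriv i (χ k) x = a k * partialDeriv i (cutoff n) (a k • x) := by
    intro k i x
    have h0 : ContDiff ℝ ∞ (cutoff n) := (cutoff n).contDiff
    have h1 := (h0.differentiable (by simp)).differentiableAt (x := a k • x) |>.hasFDerivAt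
    have h2 := h1.comp x ((hasFDerivAt_id x).const_smul (a k))
    rw [partialDeriv]
    change fderiv ℝ (cutoff n ∘ fun x => a k • x) x _ = _
    rw [show (fun x : Rn n => a k • x) = HSMul.hSMul (a k) from rfl, h2.fderiv]
    simp [partialDeriv]
  have hd : ∀ i : Fin n, ∃ C, ∀ x, |partialDeriv i (cutoff n) x| ≤ C := fun i =>
    (SmoothLp.of_hasCompactSupport (p := ∞) (cutoff n).contDiff (cutoff n).hasCompactSupport).bdd [i]
  choose C hC using hd
  have hm : ∀ k, MemLp (χ k) ∞ volume := fun k => memLp_top_of_abs_le (hχs k).continuous (hχ1 k)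
  have hdb : ∀ i k x, |partialDeriv i (χ k) x| ≤ C i := fun i k x => by
    rw [hχd, abs_mul, abs_of_pos (ha0 k)]
    have := hC i (a k • x)
    have h0 := abs_nonneg (partialDeriv i (cutoff n) (a k • x))
    nlinarith [ha1 k, ha0 k]
  have hmd : ∀ k i, MemLp (partialDeriv i (χ k)) ∞ volume := fun k i =>
    memLp_top_of_abs_le (continuous_partialDeriv (hχs k) i) (hdb i k)
  have h1m : MemLp (fun _ : Rn n => (1 : ℝ)) ∞ volume := memLp_top_const 1
  have h0m : MemLp (fun _ : Rn n => (0 : ℝ)) ∞ volume := memLp_top_const 0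
  have hone : ∀ v : L2 n, mulL h1m v = v := fun v => Lp.ext (by
    filter_upwards [coeFn_mulL h1m v] with x hx
    rw [hx]; simp)
  have hzero : ∀ v : L2 n, mulL h0m v = 0 := fun v => Lp.ext (by
    filter_upwards [coeFn_mulL h0m v, Lp.coeFn_zero ℂ 2 (volume : Measure (Rn n))] with x hx h0
    rw [hx, h0]; simp)
  have hlim : ∀ v : L2 n, Tendsto (fun k => mulL (hm k) v) atTop (𝓝 v) := by
    intro v
    have := tendsto_mulL hm hχ1 h1m (fun x => by
      have h1 : Tendsto (fun k => a k • x) atTop (𝓝 0) := by simpa using hat.smul_const x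
      have h2 := ((cutoff n).continuous.tendsto 0).comp h1
      have h3 : cutoff n (0 : Rn n) = 1 :=
        (cutoff n).one_of_mem_closedBall (by simp [cutoff])
      rw [h3] at h2
      exact h2) v
    rwa [hone] at this
  have hlimd : ∀ (v : L2 n) i, Tendsto (fun k => mulL (hmd k i) v) atTop (𝓝 0) := by
    intro v i
    have := tendsto_mulL (fun k => hmd k i) (hdb i) h0m (fun x => by
      refine squeeze_zero_norm (a := fun k => a k * C i) (fun k => ?_) ?_
      · rw [hχd, Real.norm_eq_abs, abs_mul, abs_of_pos (ha0 k)]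
        exact mul_le_mul_of_nonneg_left (hC i _) (ha0 k).le
      · simpa using hat.mul_const (C i)) v
    rwa [hzero] at this
  rw [← closure_closure]
  refine mem_closure_of_tendsto (f := fun k => pair (mulL (hm k) u)
    fun i => mulL (hm k) (G i) + mulL (hmd k i) u) (b := atTop) ?_
    (Eventually.of_forall fun k => ?_)
  · refine tendsto_pair (hlim u) fun i => ?_
    simpa using (hlim (G i)).add (hlimd u i)
  · refine mem_closure_testSet_of_support (hu.mulL (hχs k) (hm k) (hmd k))
      (isCompact_closedBall (0 : Rn n) (2 / a k)) ?_
    filter_upwards [coeFn_mulL (hm k) u] with x hx hxK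
    rw [hx, hχ]
    dsimp only
    rw [(cutoff n).zero_of_le_dist, Complex.ofReal_zero, zero_mul]
    rw [Metric.mem_closedBall, dist_zero_right, not_le, div_lt_iff₀ (ha0 k)] at hxK
    rw [dist_zero_right, norm_smul, Real.norm_of_nonneg (ha0 k).le, mul_comm]
    exact hxK.le

end

section

/-! ### Sesquilinear forms with bounded coefficients -/

variable {n : ℕ} {c : Fin n → Fin n → Rn n → ℝ}

/-- The `L²` norm `‖G‖ = (∑ ‖Gᵢ‖²)^{1/2}` of a vector field. -/
def gradNorm (G : Fin n → L2 n) : ℝ := √(∑ i, ‖G i‖ ^ 2)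

lemma gradNorm_nonneg (G : Fin n → L2 n) : 0 ≤ gradNorm G := Real.sqrt_nonneg _

lemma gradNorm_sq (G : Fin n → L2 n) : gradNorm G ^ 2 = ∑ i, ‖G i‖ ^ 2 :=
  Real.sq_sqrt (Finset.sum_nonneg fun _ _ => sq_nonneg _)

lemma norm_le_gradNorm (G : Fin n → L2 n) (i : Fin n) : ‖G i‖ ≤ gradNorm G := by
  refine Real.le_sqrt_of_sq_le ?_
  exact Finset.single_le_sum (f := fun i => ‖G i‖ ^ 2) (fun _ _ => sq_nonneg _) (Finset.mem_univ i)

lemma continuous_gradNorm : Continuous (gradNorm (n := n)) := by unfold gradNorm; fun_prop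

lemma norm_sq_pairSpace (U : PairSpace n) :
    ‖U‖ ^ 2 = ‖U none‖ ^ 2 + gradNorm (fun i => U (some i)) ^ 2 := by
  rw [PiLp.norm_sq_eq_of_L2, Fintype.sum_option, gradNorm_sq]

lemma gradNorm_le_norm (U : PairSpace n) : gradNorm (fun i => U (some i)) ≤ ‖U‖ := by
  refine le_of_sq_le_sq ?_ (norm_nonneg _)
  rw [norm_sq_pairSpace]
  linarith [sq_nonneg ‖U none‖]

lemma norm_none_le_norm (U : PairSpace n) : ‖U none‖ ≤ ‖U‖ := by
  refine le_of_sq_le_sq ?_ (norm_nonneg _)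
  rw [norm_sq_pairSpace]
  linarith [sq_nonneg (gradNorm fun i => U (some i))]

/-- The form `(G, H) ↦ ∫ ∑ cᵢⱼ Gⱼ H̄ᵢ` on vector fields. -/
def coefForm (hc : ∀ i j, MemLp (c i j) ∞ volume) (G H : Fin n → L2 n) : ℂ :=
  ∑ i, ∑ j, inner ℂ (H i) (mulL (hc i j) (G j))

variable (hc : ∀ i j, MemLp (c i j) ∞ volume)

lemma coefForm_add_left (G G' H : Fin n → L2 n) :
    coefForm hc (G + G') H = coefForm hc G H + coefForm hc G' H := by
  simp [coefForm, inner_add_right, Finset.sum_add_distrib]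

lemma coefForm_add_right (G H H' : Fin n → L2 n) :
    coefForm hc G (H + H') = coefForm hc G H + coefForm hc G H' := by
  simp [coefForm, inner_add_left, Finset.sum_add_distrib]

lemma coefForm_smul_left (a : ℂ) (G H : Fin n → L2 n) :
    coefForm hc (a • G) H = a * coefForm hc G H := by
  simp [coefForm, inner_smul_right, Finset.mul_sum]

lemma coefForm_smul_right (a : ℂ) (G H : Fin n → L2 n) :
    coefForm hc G (a • H) = starRingEnd ℂ a * coefForm hc G H := by
  simp [coefForm, inner_smul_left, Finset.mul_sum]

lemma inner_mulL_eq_integral {m : Rn n → ℝ} (hm : MemLp m ∞ volume) (u v : L2 n) :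
    inner ℂ v (mulL hm u) = ∫ x, (m x : ℂ) * u x * starRingEnd ℂ (v x) := by
  rw [inner_eq_integral]
  refine integral_congr_ae ?_
  filter_upwards [coeFn_mulL hm u] with x hx
  rw [hx]

lemma integrable_mulL_conj {m : Rn n → ℝ} (hm : MemLp m ∞ volume) (u v : L2 n) :
    Integrable fun x => (m x : ℂ) * u x * starRingEnd ℂ (v x) := by
  refine (integrable_mul_conj (mulL hm u) v).congr ?_
  filter_upwards [coeFn_mulL hm u] with x hx
  rw [hx]

lemma coefForm_eq_integral (G H : Fin n → L2 n) :
    coefForm hc G H = ∫ x, ∑ i, ∑ j, (c i j x : ℂ) * G j x * starRingEnd ℂ (H i x) := by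
  rw [integral_finsetSum _ fun i _ => integrable_finsetSum _ fun j _ =>
    integrable_mulL_conj (hc i j) _ _]
  refine Finset.sum_congr rfl fun i _ => ?_
  rw [integral_finsetSum _ fun j _ => integrable_mulL_conj (hc i j) _ _]
  exact Finset.sum_congr rfl fun j _ => inner_mulL_eq_integral _ _ _

lemma coefForm_swap_of_symm (hs : ∀ i j, c i j = c j i) (G H : Fin n → L2 n) :
    coefForm hc H G = starRingEnd ℂ (coefForm hc G H) := by
  simp only [coefForm, map_sum]
  rw [Finset.sum_comm]
  refine Finset.sum_congr rfl fun i _ => Finset.sum_congr rfl fun j _ => ?_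
  rw [inner_conj_symm, ← inner_mulL, mulL_congr (hc j i) (hc i j) (by rw [hs])]

lemma mulL_neg {m m' : Rn n → ℝ} (hm : MemLp m ∞ volume) (hm' : MemLp m' ∞ volume)
    (h : ∀ x, m' x = -m x) (u : L2 n) : mulL hm' u = -mulL hm u := by
  refine Lp.ext ?_
  filter_upwards [coeFn_mulL hm u, coeFn_mulL hm' u, Lp.coeFn_neg (mulL hm u)] with x h1 h2 h3
  rw [h2, h3, Pi.neg_apply, h1, h]
  push_cast
  ring

lemma coefForm_swap_of_antisymm (hs : ∀ i j x, c i j x = -c j i x) (G H : Fin n → L2 n) :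
    coefForm hc H G = -starRingEnd ℂ (coefForm hc G H) := by
  simp only [coefForm, map_sum, ← Finset.sum_neg_distrib]
  rw [Finset.sum_comm]
  refine Finset.sum_congr rfl fun i _ => Finset.sum_congr rfl fun j _ => ?_
  rw [inner_conj_symm, ← inner_mulL, mulL_neg (hc i j) (hc j i) (hs j i), inner_neg_right]

lemma norm_coefForm_le {C : ℝ} (hC0 : 0 ≤ C) (hC : ∀ i j, ∀ᵐ x, |c i j x| ≤ C)
    (G H : Fin n → L2 n) : ‖coefForm hc G H‖ ≤ n ^ 2 * C * (gradNorm G * gradNorm H) := by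
  calc ‖coefForm hc G H‖ ≤ ∑ i : Fin n, ∑ j : Fin n, C * (gradNorm G * gradNorm H) := by
        refine norm_sum_le_of_le _ fun i _ => norm_sum_le_of_le _ fun j _ => ?_
        calc ‖inner ℂ (H i) (mulL (hc i j) (G j))‖ ≤ ‖H i‖ * ‖mulL (hc i j) (G j)‖ :=
              norm_inner_le_norm _ _
          _ ≤ gradNorm H * (C * gradNorm G) := by
              have h1 := norm_mulL_le (hc i j) (hC i j) (G j)
              have h2 := norm_le_gradNorm G j
              exact mul_le_mul (norm_le_gradNorm H i) (h1.trans (by gcongr)) (norm_nonneg _)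
                (gradNorm_nonneg H)
          _ = _ := by ring
    _ = _ := by simp; ring

lemma norm_sq_eq_integral (u : L2 n) : ‖u‖ ^ 2 = ∫ x, ‖u x‖ ^ 2 := by
  have h := inner_self_eq_norm_sq_to_K (𝕜 := ℂ) u
  rw [inner_eq_integral] at h
  have e : (fun x => u x * starRingEnd ℂ (u x)) = fun x => ((‖u x‖ ^ 2 : ℝ) : ℂ) := by
    funext x
    rw [Complex.mul_conj, Complex.normSq_eq_norm_sq]
  rw [e, integral_complex_ofReal] at h
  refine Complex.ofReal_injective ?_
  rw [h]
  push_cast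
  rfl

lemma integrable_norm_sq (u : L2 n) : Integrable fun x => ‖u x‖ ^ 2 :=
  (Lp.memLp u).integrable_norm_pow two_ne_zero

/-- Gårding's inequality for real elliptic coefficients and complex vector fields. -/
lemma le_re_coefForm {lam : ℝ}
    (hell : ∀ᵐ x, ∀ ξ : Rn n, lam * ‖ξ‖ ^ 2 ≤ ∑ i, ∑ j, c i j x * ξ i * ξ j)
    (G : Fin n → L2 n) : lam * gradNorm G ^ 2 ≤ (coefForm hc G G).re := by
  have hint : Integrable fun x => ∑ i, ∑ j, (c i j x : ℂ) * G j x * starRingEnd ℂ (G i x) :=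
    integrable_finsetSum _ fun i _ => integrable_finsetSum _ fun j _ =>
      integrable_mulL_conj (hc i j) _ _
  have h1 := integral_re (𝕜 := ℂ) hint
  simp only [RCLike.re_to_complex] at h1
  rw [coefForm_eq_integral, ← h1, gradNorm_sq]
  simp_rw [norm_sq_eq_integral]
  rw [← integral_finsetSum _ fun i _ => integrable_norm_sq (G i), ← integral_const_mul]
  refine integral_mono_ae ((integrable_finsetSum _ fun i _ => integrable_norm_sq (G i)).const_mul _)
    hint.re ?_
  filter_upwards [hell] with x hx
  have e1 := hx (WithLp.toLp 2 fun i => (G i x).re)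
  have e2 := hx (WithLp.toLp 2 fun i => (G i x).im)
  rw [EuclideanSpace.real_norm_sq_eq] at e1 e2
  simp only at e1 e2
  have e3 : ∑ i, ‖G i x‖ ^ 2 = ∑ i, (G i x).re ^ 2 + ∑ i, (G i x).im ^ 2 := by
    rw [← Finset.sum_add_distrib]
    refine Finset.sum_congr rfl fun i _ => ?_
    rw [← Complex.normSq_eq_norm_sq, Complex.normSq_apply]
    ring
  have e4 : (∑ i, ∑ j, (c i j x : ℂ) * G j x * starRingEnd ℂ (G i x)).re
      = ∑ i, ∑ j, c i j x * (G i x).re * (G j x).re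
        + ∑ i, ∑ j, c i j x * (G i x).im * (G j x).im := by
    simp only [Complex.re_sum, ← Finset.sum_add_distrib]
    refine Finset.sum_congr rfl fun i _ => Finset.sum_congr rfl fun j _ => ?_
    simp [Complex.mul_re]
    ring
  rw [e3, e4, mul_add]
  exact add_le_add e1 e2

end

section

/-! ### The antisymmetric part of the form -/

variable {n : ℕ} {lam0 Lam0 : ℝ}

namespace CoeffMatrix

variable (A : CoeffMatrix n lam0 Lam0)

/-- The truncation at height `k` of an entry of the antisymmetric part. -/
def antiTrunc (k : ℕ) (i j : Fin n) (x : Rn n) : ℝ := max (-(k : ℝ)) (min (k : ℝ) (A.anti x i j))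

lemma abs_antiTrunc_le (k : ℕ) (i j : Fin n) (x : Rn n) : |A.antiTrunc k i j x| ≤ k := by
  rw [abs_le]
  exact ⟨le_max_left _ _, max_le (by linarith [(Nat.cast_nonneg k : (0 : ℝ) ≤ k)]) (min_le_left _ _)⟩

lemma aestronglyMeasurable_anti (i j : Fin n) :
    AEStronglyMeasurable (fun x => A.anti x i j) volume := by
  unfold anti
  exact (((A.aestronglyMeasurable i j).sub (A.aestronglyMeasurable j i)).aemeasurable.div_const
    2).aestronglyMeasurable

lemma memLp_antiTrunc (k : ℕ) (i j : Fin n) : MemLp (A.antiTrunc k i j) ∞ volume :=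
  memLp_top_of_bound (aemeasurable_const.max (aemeasurable_const.min
    (A.aestronglyMeasurable_anti i j).aemeasurable)).aestronglyMeasurable k
    (Eventually.of_forall fun x => A.abs_antiTrunc_le k i j x)

lemma memLp_sym (i j : Fin n) : MemLp (fun x => A.sym x i j) ∞ volume := by
  refine memLp_top_of_bound ?_ lam0⁻¹ ?_
  · unfold sym
    exact (((A.aestronglyMeasurable i j).add (A.aestronglyMeasurable j i)).aemeasurable.div_const
      2).aestronglyMeasurable
  · filter_upwards [A.bounded] with x hx using hx i j

lemma antiTrunc_antisymm (k : ℕ) (i j : Fin n) (x : Rn n) :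
    A.antiTrunc k i j x = -A.antiTrunc k j i x := by
  have h : A.anti x i j = -A.anti x j i := by simp only [anti]; ring
  have hk : (0 : ℝ) ≤ k := Nat.cast_nonneg k
  simp only [antiTrunc, h]
  rcases le_total (A.anti x j i) k with h1 | h1 <;>
  rcases le_total (-(k : ℝ)) (A.anti x j i) with h2 | h2
  · rw [min_eq_right (by linarith), max_eq_right (by linarith), min_eq_right h1, max_eq_right h2]
  · rw [min_eq_left (by linarith), max_eq_right (by linarith), min_eq_right h1, max_eq_left h2,
      neg_neg]
  · rw [min_eq_right (by linarith), max_eq_left (by linarith), min_eq_left h1,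
      max_eq_right (by linarith)]
  · rw [show (k : ℝ) = 0 by linarith, show A.anti x j i = 0 by linarith]
    simp

/-- The symmetric part of the form. -/
def symForm (G H : Fin n → L2 n) : ℂ := coefForm A.memLp_sym G H

/-- The truncated antisymmetric part of the form. -/
def antiForm (k : ℕ) (G H : Fin n → L2 n) : ℂ := coefForm (A.memLp_antiTrunc k) G H

lemma truncForm_eq (k : ℕ) (u v : L2 n) :
    A.truncForm k u v = A.symForm (weakGrad u) (weakGrad v)
      + A.antiForm k (weakGrad u) (weakGrad v) := by
  have h : ∀ {c : Fin n → Fin n → Rn n → ℝ}, (∀ i j, MemLp (c i j) ∞ volume) →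
      Integrable fun x => ∑ i, ∑ j, (c i j x : ℂ) * weakGrad u j x *
        starRingEnd ℂ (weakGrad v i x) := fun hc =>
    integrable_finsetSum _ fun i _ => integrable_finsetSum _ fun j _ =>
      integrable_mulL_conj (hc i j) _ _
  rw [symForm, antiForm, coefForm_eq_integral, coefForm_eq_integral, ← integral_add
    (h A.memLp_sym) (h (A.memLp_antiTrunc k)), truncForm]
  refine integral_congr_ae (Eventually.of_forall fun x => ?_)
  simp only [← Finset.sum_add_distrib, trunc, antiTrunc]
  refine Finset.sum_congr rfl fun i _ => Finset.sum_congr rfl fun j _ => ?_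
  push_cast
  ring

/-- The bound for Gaussian variances of truncated entries of the antisymmetric part. -/
def varBound (n : ℕ) (Lam0 : ℝ) : ℝ := heatVarConst n * (2 * Lam0) ^ 2

/-- A bound for the pairing of `N` with smooth functions of controlled Gaussian variance holds for
truncated entries of `Aᵃ` too, whatever the height of the truncation. -/
lemma abs_integral_antiTrunc_mul_le (hn : n ≠ 0) (hL : 0 < Lam0) (k : ℕ) (i j : Fin n)
    {N : Rn n → ℝ} (hN : Integrable N) {B : ℝ}
    (H : ∀ b : Rn n → ℝ, SmoothLp ∞ b → (∀ s x, heatVar b s x ≤ varBound n Lam0) →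
      |∫ x, b x * N x| ≤ B) : |∫ x, A.antiTrunc k i j x * N x| ≤ B := by
  set b := (A.aestronglyMeasurable_anti i j).mk with hb
  have hab : (fun x => A.anti x i j) =ᵐ[volume] b := (A.aestronglyMeasurable_anti i j).ae_eq_mk
  have hbm : Measurable b := (A.aestronglyMeasurable_anti i j).stronglyMeasurable_mk.measurable
  have hosc : OscLe b (2 * Lam0) := (A.bmo i j).oscLe.congr hab
  have e : ∫ x, A.antiTrunc k i j x * N x = ∫ x, max (-(k : ℝ)) (min (k : ℝ) (b x)) * N x := by
    refine integral_congr_ae ?_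
    filter_upwards [hab] with x hx
    rw [antiTrunc, hx]
  rw [e]
  refine (hosc.trunc k).abs_integral_mul_le (M := k) (by positivity)
    (measurable_const.max (measurable_const.min hbm)) (fun x => ?_) hN fun b' hb' hm => ?_
  · rw [abs_le]
    exact ⟨le_max_left _ _,
      max_le (by linarith [(Nat.cast_nonneg k : (0 : ℝ) ≤ k)]) (min_le_left _ _)⟩
  · exact H b' hb' fun s x => hm.heatVar_le hn hb' (by positivity) s x

/-- `∫ Aᵃ ∇f · ∇g` for real functions, with `Aᵃ` truncated at height `k`. -/
def realAnti (k : ℕ) (f g : Rn n → ℝ) : ℝ :=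
  ∑ i, ∑ j, ∫ x, A.antiTrunc k i j x * (partialDeriv j f x * partialDeriv i g x)

lemma integrable_antiTrunc_mul (k : ℕ) (i j : Fin n) {F : Rn n → ℝ} (hF : Integrable F) :
    Integrable fun x => A.antiTrunc k i j x * F x :=
  memLp_one_iff_integrable.1 ((memLp_one_iff_integrable.2 hF).mul' (A.memLp_antiTrunc k i j))

/-- Only null forms are seen by antisymmetric coefficients. -/
lemma realAnti_eq (k : ℕ) {f g : Rn n → ℝ}
    (h : ∀ i j, Integrable fun x => partialDeriv i f x * partialDeriv j g x) :
    A.realAnti k f g = -(1 / 2) * ∑ i, ∑ j, ∫ x, A.antiTrunc k i j x * nullForm i j f g x := by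
  have h1 : A.realAnti k f g = -∑ i, ∑ j, ∫ x, A.antiTrunc k i j x *
      (partialDeriv i f x * partialDeriv j g x) := by
    rw [realAnti, Finset.sum_comm, ← Finset.sum_neg_distrib]
    refine Finset.sum_congr rfl fun i _ => ?_
    rw [← Finset.sum_neg_distrib]
    refine Finset.sum_congr rfl fun j _ => ?_
    rw [← integral_neg]
    refine integral_congr_ae (Eventually.of_forall fun x => ?_)
    dsimp only
    rw [A.antiTrunc_antisymm k j i x]
    ring
  have h2 : ∑ i, ∑ j, ∫ x, A.antiTrunc k i j x * nullForm i j f g x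
      = (∑ i, ∑ j, ∫ x, A.antiTrunc k i j x * (partialDeriv i f x * partialDeriv j g x))
        - A.realAnti k f g := by
    rw [realAnti, ← Finset.sum_sub_distrib]
    refine Finset.sum_congr rfl fun i _ => ?_
    rw [← Finset.sum_sub_distrib]
    refine Finset.sum_congr rfl fun j _ => ?_
    rw [← integral_sub (A.integrable_antiTrunc_mul k i j (h i j))
      (A.integrable_antiTrunc_mul k i j (h j i))]
    refine integral_congr_ae (Eventually.of_forall fun x => ?_)
    simp only [nullForm]
    ring
  rw [h2]
  linarith

lemma abs_realAnti_le_of_nullForm (k : ℕ) {f g : Rn n → ℝ}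
    (h : ∀ i j, Integrable fun x => partialDeriv i f x * partialDeriv j g x) {B : ℝ}
    (H : ∀ i j, |∫ x, A.antiTrunc k i j x * nullForm i j f g x| ≤ B) :
    |A.realAnti k f g| ≤ n ^ 2 * B := by
  have h1 : |∑ i, ∑ j, ∫ x, A.antiTrunc k i j x * nullForm i j f g x| ≤ n ^ 2 * B := by
    calc _ ≤ ∑ _i : Fin n, ∑ _j : Fin n, B := by
          refine (Finset.abs_sum_le_sum_abs _ _).trans (Finset.sum_le_sum fun i _ => ?_)
          exact (Finset.abs_sum_le_sum_abs _ _).trans (Finset.sum_le_sum fun j _ => H i j)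
      _ = _ := by simp; ring
  rw [A.realAnti_eq k h, abs_mul]
  norm_num
  have := abs_nonneg (∑ i, ∑ j, ∫ x, A.antiTrunc k i j x * nullForm i j f g x)
  linarith

/-- The bound for `realAnti` on gradients. -/
def antiConst (n : ℕ) (Lam0 : ℝ) : ℝ := n ^ 2 * (8 * n ^ 2 * √(6 * varBound n Lam0))

lemma varBound_pos (hL : 0 < Lam0) : 0 < varBound n Lam0 :=
  mul_pos (heatVarConst_pos n) (by positivity)

lemma abs_realAnti_le (hn : n ≠ 0) (hL : 0 < Lam0) (k : ℕ) {f g : Rn n → ℝ} (hf : SmoothLp 2 f)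
    (hg : SmoothLp 2 g) :
    |A.realAnti k f g| ≤ antiConst n Lam0 * (√(dirichlet f) * √(dirichlet g)) := by
  have hi : ∀ i j, Integrable fun x => partialDeriv i f x * partialDeriv j g x := fun i j =>
    integrable_mul_of_memLp_two (hf.partialDeriv i).memLp0 (hg.partialDeriv j).memLp0
  refine (A.abs_realAnti_le_of_nullForm k hi fun i j => ?_).trans (le_of_eq (mul_assoc _ _ _).symm)
  exact A.abs_integral_antiTrunc_mul_le hn hL k i j ((hi i j).sub (hi j i))
    fun b hb hv => abs_integral_nullForm_le hb (varBound_pos hL) hv hf hg i j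

/-- The bound for `realAnti` on pairs `(w², φ)`. -/
def antiConst' (n : ℕ) (Lam0 : ℝ) : ℝ :=
  n ^ 2 * ((4 * n ^ 2 + 8 * n ^ 2 + 48 * n ^ 3) * √(6 * varBound n Lam0))

lemma abs_realAnti_sq_le (hn : n ≠ 0) (hL : 0 < Lam0) (k : ℕ) {w φ : Rn n → ℝ}
    (hw : SmoothLp 2 w) (hφ : SmoothLp ∞ φ) (hφ1 : ∀ k x, |partialDeriv k φ x| ≤ 1) :
    |A.realAnti k (fun x => w x * w x) φ|
      ≤ antiConst' n Lam0 * (√(∫ x, w x ^ 2) * √(dirichlet w)) := by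
  have hww : SmoothLp 1 fun x => w x * w x := hw.mul hw
  have hi : ∀ i j, Integrable fun x => partialDeriv i (fun x => w x * w x) x * partialDeriv j φ x :=
    fun i j => ((hww.partialDeriv i).mul (r := 1) (hφ.partialDeriv j)).integrable
  refine (A.abs_realAnti_le_of_nullForm k hi fun i j => ?_).trans (le_of_eq (mul_assoc _ _ _).symm)
  exact A.abs_integral_antiTrunc_mul_le hn hL k i j ((hi i j).sub (hi j i))
    fun b hb hv => abs_integral_nullForm_sq_le hb (varBound_pos hL) hv hw hφ hφ1 i j

/-- For a test function `f` no cancellation is needed for convergence, `Aᵃ` being locally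
integrable. -/
lemma tendsto_realAnti {f g : Rn n → ℝ} (hf : ContDiff ℝ ∞ f) (hfc : HasCompactSupport f)
    (hg : ContDiff ℝ ∞ g) : ∃ l, Tendsto (fun k => A.realAnti k f g) atTop (𝓝 l) := by
  refine ⟨∑ i, ∑ j, ∫ x, A.anti x i j * (partialDeriv j f x * partialDeriv i g x), ?_⟩
  refine tendsto_finsetSum _ fun i _ => tendsto_finsetSum _ fun j _ => ?_
  have hc : Continuous fun x => partialDeriv j f x * partialDeriv i g x :=
    (continuous_partialDeriv hf j).mul (continuous_partialDeriv hg i)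
  have hcs : HasCompactSupport fun x => partialDeriv j f x * partialDeriv i g x :=
    (hasCompactSupport_partialDeriv hfc j).mul_right
  have hint : Integrable fun x => A.anti x i j * (partialDeriv j f x * partialDeriv i g x) :=
    (A.bmo i j).1.integrable_smul_right_of_hasCompactSupport hc hcs
  refine tendsto_integral_of_dominated_convergence
    (fun x => ‖A.anti x i j * (partialDeriv j f x * partialDeriv i g x)‖)
    (fun k => (A.memLp_antiTrunc k i j).aestronglyMeasurable.mul hc.aestronglyMeasurable) hint.norm
    (fun k => Eventually.of_forall fun x => ?_) (Eventually.of_forall fun x => ?_)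
  · rw [norm_mul, norm_mul (A.anti x i j)]
    refine mul_le_mul_of_nonneg_right ?_ (norm_nonneg _)
    have hk : (0 : ℝ) ≤ k := Nat.cast_nonneg k
    rw [Real.norm_eq_abs, Real.norm_eq_abs, abs_le, antiTrunc]
    have h1 := neg_abs_le (A.anti x i j)
    have h2 := le_abs_self (A.anti x i j)
    have h3 := abs_nonneg (A.anti x i j)
    constructor
    · rcases le_total (k : ℝ) (A.anti x i j) with h | h
      · rw [min_eq_left h]; exact le_max_of_le_right (by linarith)
      · rw [min_eq_right h]; exact le_max_of_le_right h1
    · rcases le_total (-(k : ℝ)) (A.anti x i j) with h | h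
      · exact max_le (by linarith) ((min_le_right _ _).trans h2)
      · exact max_le (by linarith) ((min_le_right _ _).trans h2)
  · refine Tendsto.mul_const _ (tendsto_const_nhds.congr' ?_)
    obtain ⟨K, hK⟩ := exists_nat_ge |A.anti x i j|
    filter_upwards [eventually_ge_atTop K] with k hk
    have hkK : |A.anti x i j| ≤ k := hK.trans (by exact_mod_cast hk)
    rw [abs_le] at hkK
    rw [antiTrunc, min_eq_right hkK.2, max_eq_right hkK.1]

end CoeffMatrix

end

section

/-! ### Bounds for the form on the Sobolev space -/

variable {n : ℕ} {lam0 Lam0 : ℝ}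

/-- The second component of a pair `(u, G)`. -/
def gradOf (U : PairSpace n) : Fin n → L2 n := fun i => U (some i)

lemma continuous_gradOf : Continuous (gradOf (n := n)) := by unfold gradOf; fun_prop

lemma mem_closure_testSet_of_mem {U : PairSpace n} (hU : U ∈ sobolevGraph n) :
    U ∈ closure (testSet n) := by
  have h := mem_closure_testSet (mem_sobolevGraph.1 hU)
  have e : pair (U none) (fun i => U (some i)) = U := by
    ext1 o
    cases o <;> rfl
  rwa [e] at h

/-- Closed conditions on pairs of Sobolev functions need only be checked on test functions. -/
lemma sobolev_induction₂ {P : PairSpace n → PairSpace n → Prop}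
    (hP : IsClosed {p : PairSpace n × PairSpace n | P p.1 p.2})
    (h : ∀ U ∈ testSet n, ∀ V ∈ testSet n, P U V) {U V : PairSpace n} (hU : U ∈ sobolevGraph n)
    (hV : V ∈ sobolevGraph n) : P U V := by
  have h1 : (U, V) ∈ closure (testSet n ×ˢ testSet n) := by
    rw [closure_prod_eq]
    exact ⟨mem_closure_testSet_of_mem hU, mem_closure_testSet_of_mem hV⟩
  exact closure_minimal (fun p hp => h p.1 hp.1 p.2 hp.2) hP h1

lemma exists_re_im_of_mem_testSet {U : PairSpace n} (hU : U ∈ testSet n) :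
    ∃ p q : Rn n → ℝ, ContDiff ℝ ∞ p ∧ HasCompactSupport p ∧ ContDiff ℝ ∞ q ∧
      HasCompactSupport q ∧ (U none =ᵐ[volume] fun x => (p x : ℂ) + q x * Complex.I) ∧
      ∀ i, gradOf U i =ᵐ[volume]
        fun x => (partialDeriv i p x : ℂ) + partialDeriv i q x * Complex.I := by
  obtain ⟨f, hf, hfc, h1, h2⟩ := hU
  refine ⟨fun x => (f x).re, fun x => (f x).im, Complex.reCLM.contDiff.comp hf,
    hfc.comp_left Complex.zero_re, Complex.imCLM.contDiff.comp hf, hfc.comp_left Complex.zero_im,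
    ?_, fun i => ?_⟩
  · filter_upwards [h1] with x hx
    rw [hx, Complex.re_add_im]
  · filter_upwards [h2 i] with x hx
    have hd := (hf.differentiable (by simp)).differentiableAt (x := x) |>.hasFDerivAt
    have er : partialDeriv i (fun x => (f x).re) x
        = (fderiv ℝ f x (EuclideanSpace.single i 1)).re := by
      have h : HasFDerivAt (fun x => (f x).re) (Complex.reCLM.comp (fderiv ℝ f x)) x :=
        Complex.reCLM.hasFDerivAt.comp x hd
      rw [partialDeriv, h.fderiv]
      rfl
    have ei : partialDeriv i (fun x => (f x).im) x
        = (fderiv ℝ f x (EuclideanSpace.single i 1)).im := by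
      have h : HasFDerivAt (fun x => (f x).im) (Complex.imCLM.comp (fderiv ℝ f x)) x :=
        Complex.imCLM.hasFDerivAt.comp x hd
      rw [partialDeriv, h.fderiv]
      rfl
    rw [er, ei, Complex.re_add_im]
    exact hx

lemma norm_sq_of_re_im {u : L2 n} {p q : Rn n → ℝ} (hp : MemLp p 2 volume) (hq : MemLp q 2 volume)
    (h : u =ᵐ[volume] fun x => (p x : ℂ) + q x * Complex.I) :
    ‖u‖ ^ 2 = (∫ x, p x ^ 2) + ∫ x, q x ^ 2 := by
  rw [norm_sq_eq_integral, ← integral_add hp.integrable_sq hq.integrable_sq]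
  refine integral_congr_ae ?_
  filter_upwards [h] with x hx
  rw [hx, ← Complex.normSq_eq_norm_sq, Complex.normSq_add_mul_I]

lemma gradNorm_sq_of_re_im {G : Fin n → L2 n} {p q : Rn n → ℝ} (hp : SmoothLp 2 p)
    (hq : SmoothLp 2 q)
    (h : ∀ i, G i =ᵐ[volume] fun x => (partialDeriv i p x : ℂ) + partialDeriv i q x * Complex.I) :
    gradNorm G ^ 2 = dirichlet p + dirichlet q := by
  rw [gradNorm_sq, dirichlet, dirichlet, ← Finset.sum_add_distrib]
  exact Finset.sum_congr rfl fun i _ =>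
    norm_sq_of_re_im (hp.partialDeriv i).memLp0 (hq.partialDeriv i).memLp0 (h i)

lemma sqrt_le_of_add_eq {a b c : ℝ} (hc : 0 ≤ c) (hb : 0 ≤ b) (h : c ^ 2 = a + b) : √a ≤ c :=
  (Real.sqrt_le_left hc).2 (by linarith)

lemma inner_mulL_re_im {m : Rn n → ℝ} (hm : MemLp m ∞ volume) {u v : L2 n} {p q p' q' : Rn n → ℝ}
    (hp : MemLp p 2 volume) (hq : MemLp q 2 volume) (hp' : MemLp p' 2 volume)
    (hq' : MemLp q' 2 volume) (hu : u =ᵐ[volume] fun x => (p x : ℂ) + q x * Complex.I)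
    (hv : v =ᵐ[volume] fun x => (p' x : ℂ) + q' x * Complex.I) :
    inner ℂ v (mulL hm u) = (((∫ x, m x * (p x * p' x)) + ∫ x, m x * (q x * q' x) : ℝ) : ℂ)
      + (((∫ x, m x * (q x * p' x)) - ∫ x, m x * (p x * q' x) : ℝ) : ℂ) * Complex.I := by
  have i1 := integrable_top_two_two hm hp hp'
  have i2 := integrable_top_two_two hm hq hq'
  have i3 := integrable_top_two_two hm hq hp'
  have i4 := integrable_top_two_two hm hp hq'
  rw [inner_mulL_eq_integral, ← integral_add i1 i2, ← integral_sub i3 i4, ← integral_complex_ofReal,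
    ← integral_complex_ofReal, ← integral_mul_const, ← integral_add (i1.add i2).ofReal
      ((i3.sub i4).ofReal.mul_const _)]
  refine integral_congr_ae ?_
  filter_upwards [hu, hv] with x hx hx'
  rw [hx, hx']
  simp only [map_add, map_mul, Complex.conj_ofReal, Complex.conj_I]
  push_cast
  linear_combination (m x * q x * q' x : ℂ) * (-Complex.I_sq)

namespace CoeffMatrix

variable (A : CoeffMatrix n lam0 Lam0)

lemma antiForm_re_im (k : ℕ) {G H : Fin n → L2 n} {p q p' q' : Rn n → ℝ} (hp : SmoothLp 2 p)
    (hq : SmoothLp 2 q) (hp' : SmoothLp 2 p') (hq' : SmoothLp 2 q')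
    (hG : ∀ i, G i =ᵐ[volume] fun x => (partialDeriv i p x : ℂ) + partialDeriv i q x * Complex.I)
    (hH : ∀ i, H i =ᵐ[volume]
      fun x => (partialDeriv i p' x : ℂ) + partialDeriv i q' x * Complex.I) :
    A.antiForm k G H = ((A.realAnti k p p' + A.realAnti k q q' : ℝ) : ℂ)
      + ((A.realAnti k q p' - A.realAnti k p q' : ℝ) : ℂ) * Complex.I := by
  have e : ∀ i j, inner ℂ (H i) (mulL (A.memLp_antiTrunc k i j) (G j)) = _ := fun i j =>
    inner_mulL_re_im (A.memLp_antiTrunc k i j) (hp.partialDeriv j).memLp0 (hq.partialDeriv j).memLp0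
      (hp'.partialDeriv i).memLp0 (hq'.partialDeriv i).memLp0 (hG j) (hH i)
  simp only [antiForm, coefForm, e, realAnti, Finset.sum_add_distrib, ← Finset.sum_mul,
    Complex.ofReal_add, Complex.ofReal_sub, Complex.ofReal_sum, Finset.sum_sub_distrib]

lemma continuous_antiForm (k : ℕ) :
    Continuous fun p : PairSpace n × PairSpace n => A.antiForm k (gradOf p.1) (gradOf p.2) := by
  unfold antiForm coefForm gradOf
  fun_prop

lemma antiConst_nonneg : 0 ≤ antiConst n Lam0 := by unfold antiConst; positivity

/-- The form is bounded on `W^{1,2}` independently of the height `k` of the truncation. -/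
lemma norm_antiForm_le (hn : n ≠ 0) (hL : 0 < Lam0) (k : ℕ) {U V : PairSpace n}
    (hU : U ∈ sobolevGraph n) (hV : V ∈ sobolevGraph n) :
    ‖A.antiForm k (gradOf U) (gradOf V)‖
      ≤ 4 * antiConst n Lam0 * (gradNorm (gradOf U) * gradNorm (gradOf V)) := by
  refine sobolev_induction₂ (P := fun U V => ‖A.antiForm k (gradOf U) (gradOf V)‖
      ≤ 4 * antiConst n Lam0 * (gradNorm (gradOf U) * gradNorm (gradOf V)))
    (isClosed_le (A.continuous_antiForm k).norm ?_) (fun U hU V hV => ?_) hU hV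
  · have h1 : Continuous fun p : PairSpace n × PairSpace n => gradNorm (gradOf p.1) :=
      continuous_gradNorm.comp (continuous_gradOf.comp continuous_fst)
    have h2 : Continuous fun p : PairSpace n × PairSpace n => gradNorm (gradOf p.2) :=
      continuous_gradNorm.comp (continuous_gradOf.comp continuous_snd)
    fun_prop
  · obtain ⟨p, q, hp, hpc, hq, hqc, -, hG⟩ := exists_re_im_of_mem_testSet hU
    obtain ⟨p', q', hp', hpc', hq', hqc', -, hH⟩ := exists_re_im_of_mem_testSet hV
    have sp := SmoothLp.of_hasCompactSupport (p := 2) hp hpc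
    have sq := SmoothLp.of_hasCompactSupport (p := 2) hq hqc
    have sp' := SmoothLp.of_hasCompactSupport (p := 2) hp' hpc'
    have sq' := SmoothLp.of_hasCompactSupport (p := 2) hq' hqc'
    have g1 := gradNorm_sq_of_re_im sp sq hG
    have g2 := gradNorm_sq_of_re_im sp' sq' hH
    have bp := sqrt_le_of_add_eq (gradNorm_nonneg _) (dirichlet_nonneg q) g1
    have bq := sqrt_le_of_add_eq (gradNorm_nonneg _) (dirichlet_nonneg p) (g1.trans (add_comm _ _))
    have bp' := sqrt_le_of_add_eq (gradNorm_nonneg _) (dirichlet_nonneg q') g2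
    have bq' := sqrt_le_of_add_eq (gradNorm_nonneg _) (dirichlet_nonneg p') (g2.trans (add_comm _ _))
    have key : ∀ {f g : Rn n → ℝ}, SmoothLp 2 f → SmoothLp 2 g → √(dirichlet f) ≤ gradNorm (gradOf U) →
        √(dirichlet g) ≤ gradNorm (gradOf V) → |A.realAnti k f g| ≤
          antiConst n Lam0 * (gradNorm (gradOf U) * gradNorm (gradOf V)) := by
      intro f g hf hg h1 h2
      refine (A.abs_realAnti_le hn hL k hf hg).trans ?_
      have := antiConst_nonneg (n := n) (Lam0 := Lam0)
      gcongr
      exact gradNorm_nonneg _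
    rw [A.antiForm_re_im k sp sq sp' sq' hG hH]
    refine (norm_add_le _ _).trans ?_
    rw [norm_mul, Complex.norm_I, mul_one, Complex.norm_real, Complex.norm_real, Real.norm_eq_abs,
      Real.norm_eq_abs]
    have k1 := key sp sp' bp bp'
    have k2 := key sq sq' bq bq'
    have k3 := key sq sp' bq bp'
    have k4 := key sp sq' bp bq'
    have t1 := abs_add_le (A.realAnti k p p') (A.realAnti k q q')
    have t2 := abs_sub (A.realAnti k q p') (A.realAnti k p q')
    linarith

/-- The antisymmetric part of the form converges as the height of the truncation increases: it does so
on test functions, and the bounds are uniform in the height. -/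
lemma exists_tendsto_antiForm (hn : n ≠ 0) (hL : 0 < Lam0) {U V : PairSpace n}
    (hU : U ∈ sobolevGraph n) (hV : V ∈ sobolevGraph n) :
    ∃ l, Tendsto (fun k => A.antiForm k (gradOf U) (gradOf V)) atTop (𝓝 l) := by
  have htest : ∀ U ∈ testSet n, ∀ V ∈ testSet n,
      ∃ l, Tendsto (fun k => A.antiForm k (gradOf U) (gradOf V)) atTop (𝓝 l) := by
    intro U hU V hV
    obtain ⟨p, q, hp, hpc, hq, hqc, -, hG⟩ := exists_re_im_of_mem_testSet hU
    obtain ⟨p', q', hp', hpc', hq', hqc', -, hH⟩ := exists_re_im_of_mem_testSet hV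
    have sp := SmoothLp.of_hasCompactSupport (p := 2) hp hpc
    have sq := SmoothLp.of_hasCompactSupport (p := 2) hq hqc
    have sp' := SmoothLp.of_hasCompactSupport (p := 2) hp' hpc'
    have sq' := SmoothLp.of_hasCompactSupport (p := 2) hq' hqc'
    obtain ⟨l1, h1⟩ := A.tendsto_realAnti hp hpc hp'
    obtain ⟨l2, h2⟩ := A.tendsto_realAnti hq hqc hq'
    obtain ⟨l3, h3⟩ := A.tendsto_realAnti hq hqc hp'
    obtain ⟨l4, h4⟩ := A.tendsto_realAnti hp hpc hq'
    refine ⟨((l1 + l2 : ℝ) : ℂ) + ((l3 - l4 : ℝ) : ℂ) * Complex.I, ?_⟩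
    simp_rw [A.antiForm_re_im _ sp sq sp' sq' hG hH]
    exact ((Complex.continuous_ofReal.tendsto _).comp (h1.add h2)).add
      (((Complex.continuous_ofReal.tendsto _).comp (h3.sub h4)).mul_const _)
  have htestS : testSet n ⊆ sobolevGraph n := by
    rintro W ⟨f, hf, hfc, h1, h2⟩ φ hφ hφc i
    have hfd : Continuous fun x => fderiv ℝ f x (EuclideanSpace.single i 1) :=
      (hf.continuous_fderiv (by simp)).clm_apply continuous_const
    have hfdc : HasCompactSupport fun x => fderiv ℝ f x (EuclideanSpace.single i 1) :=
      hfc.fderiv_apply (𝕜 := ℝ) (EuclideanSpace.single i 1)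
    have e1 : ∫ x, partialDeriv i φ x • W none x = ∫ x, partialDeriv i φ x • f x := by
      refine integral_congr_ae ?_
      filter_upwards [h1] with x hx
      rw [hx]
    have e2 : ∫ x, φ x • W (some i) x = ∫ x, φ x • fderiv ℝ f x (EuclideanSpace.single i 1) := by
      refine integral_congr_ae ?_
      filter_upwards [h2 i] with x hx
      rw [hx]
    rw [e1, e2, integral_smul_fderiv_eq_neg_fderiv_smul_of_integrable, neg_neg]
    · rfl
    · exact ((continuous_partialDeriv hφ i).smul hf.continuous).integrable_of_hasCompactSupport
        hfc.smul_left
    · exact (hφ.continuous.smul hfd).integrable_of_hasCompactSupport hfdc.smul_left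
    · exact (hφ.continuous.smul hf.continuous).integrable_of_hasCompactSupport hfc.smul_left
    · exact fun x _ => (hφ.differentiable (by simp)).differentiableAt
    · exact fun x _ => (hf.differentiable (by simp)).differentiableAt
  refine cauchySeq_tendsto_of_complete (Metric.cauchySeq_iff'.2 fun ε hε => ?_)
  set C := 4 * antiConst n Lam0 with hC
  have hC0 : 0 ≤ C := by have := antiConst_nonneg (n := n) (Lam0 := Lam0); positivity
  -- approximate `U` and then `V` by test functions, with errors below `ε / 8` in each form
  obtain ⟨U', hU', hUU⟩ := Metric.mem_closure_iff.1 (mem_closure_testSet_of_mem hU)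
    (ε / (8 * (C * (‖V‖ + 1) + 1))) (by positivity)
  obtain ⟨V', hV', hVV⟩ := Metric.mem_closure_iff.1 (mem_closure_testSet_of_mem hV)
    (ε / (8 * (C * (‖U'‖ + 1) + 1))) (by positivity)
  have hclose : ∀ k, ‖A.antiForm k (gradOf U) (gradOf V) - A.antiForm k (gradOf U') (gradOf V')‖
      ≤ ε / 4 := by
    intro k
    have e : A.antiForm k (gradOf U) (gradOf V) - A.antiForm k (gradOf U') (gradOf V')
        = A.antiForm k (gradOf (U - U')) (gradOf V) + A.antiForm k (gradOf U') (gradOf (V - V')) := by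
      have e1 : gradOf U = gradOf (U - U') + gradOf U' := by
        funext i; simp [gradOf]
      have e2 : gradOf V = gradOf (V - V') + gradOf V' := by
        funext i; simp [gradOf]
      rw [antiForm, antiForm, antiForm, antiForm]
      conv_lhs => rw [e1, coefForm_add_left, e2, coefForm_add_right (G := gradOf U'), ← e2]
      ring
    have b1 := A.norm_antiForm_le hn hL k (sub_mem hU (htestS hU')) hV
    have b2 := A.norm_antiForm_le hn hL k (htestS hU') (sub_mem hV (htestS hV'))
    have g : ∀ W : PairSpace n, gradNorm (gradOf W) ≤ ‖W‖ := gradNorm_le_norm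
    have aux : ∀ {x y : ℝ}, 0 ≤ x → 0 ≤ y → x < ε / (8 * (C * (y + 1) + 1)) → C * (x * y) ≤ ε / 8 := by
      intro x y hx hy h
      rw [lt_div_iff₀ (by positivity)] at h
      nlinarith [mul_nonneg hC0 hx, mul_nonneg hC0 (mul_nonneg hx hy)]
    rw [dist_eq_norm] at hUU hVV
    have c1 : C * (gradNorm (gradOf (U - U')) * gradNorm (gradOf V)) ≤ ε / 8 := by
      refine le_trans ?_ (aux (norm_nonneg _) (norm_nonneg V) hUU)
      gcongr
      · exact gradNorm_nonneg _
      · exact g _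
      · exact g _
    have c2 : C * (gradNorm (gradOf U') * gradNorm (gradOf (V - V'))) ≤ ε / 8 := by
      refine le_trans ?_ (aux (norm_nonneg _) (norm_nonneg U') hVV)
      rw [mul_comm (‖V - V'‖)]
      gcongr
      · exact gradNorm_nonneg _
      · exact g _
      · exact g _
    rw [e]
    refine (norm_add_le _ _).trans ?_
    linarith
  obtain ⟨l, hl⟩ := htest U' hU' V' hV'
  obtain ⟨N, hN⟩ := Metric.cauchySeq_iff'.1 hl.cauchySeq (ε / 4) (by positivity)
  refine ⟨N, fun k hk => ?_⟩
  have h1 := hclose k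
  have h2 := hclose N
  have h3 := hN k hk
  rw [← dist_eq_norm] at h1 h2
  rw [dist_comm] at h2
  have t1 := dist_triangle4 (A.antiForm k (gradOf U) (gradOf V))
    (A.antiForm k (gradOf U') (gradOf V')) (A.antiForm N (gradOf U') (gradOf V'))
    (A.antiForm N (gradOf U) (gradOf V))
  linarith

end CoeffMatrix

end

section

/-! ### The form on exponentially weighted functions -/

variable {n : ℕ} {lam0 Lam0 : ℝ} {φ : Rn n → ℝ}

lemma SmoothLp.memLp_partialDeriv (hφ : SmoothLp ∞ φ) (i : Fin n) :
    MemLp (GaffneyBMO.partialDeriv i φ) ∞ volume := (hφ.partialDeriv i).memLp0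

/-- The vector field `u ∇φ`. -/
def mulGrad (hφ : SmoothLp ∞ φ) (u : L2 n) : Fin n → L2 n :=
  fun i => mulL (hφ.memLp_partialDeriv i) u

lemma gradNorm_mulGrad_le (hφ : SmoothLp ∞ φ) (hφ1 : ∀ k x, |partialDeriv k φ x| ≤ 1) (u : L2 n) :
    gradNorm (mulGrad hφ u) ≤ n * ‖u‖ := by
  refine Real.sqrt_le_iff.2 ⟨by positivity, ?_⟩
  calc ∑ i, ‖mulGrad hφ u i‖ ^ 2 ≤ ∑ _i : Fin n, ‖u‖ ^ 2 := by
        refine Finset.sum_le_sum fun i _ => ?_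
        have := norm_mulL_le (hφ.memLp_partialDeriv i) (Eventually.of_forall (hφ1 i)) u
        rw [one_mul] at this
        exact pow_le_pow_left₀ (norm_nonneg _) this 2
    _ = n * ‖u‖ ^ 2 := by simp
    _ ≤ (n * ‖u‖) ^ 2 := by
        rw [mul_pow]
        gcongr
        exact_mod_cast Nat.le_self_pow two_ne_zero n

namespace CoeffMatrix

variable (A : CoeffMatrix n lam0 Lam0)

/-- The quadratic terms vanish by antisymmetry, as `∇φ` is real. -/
lemma antiForm_mulGrad_self (hφ : SmoothLp ∞ φ) (k : ℕ) (u : L2 n) :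
    A.antiForm k (mulGrad hφ u) (mulGrad hφ u) = 0 := by
  rw [antiForm, coefForm_eq_integral]
  rw [← integral_zero (Rn n) ℂ]
  have h : ∀ᵐ x, ∀ i, mulGrad hφ u i x = (partialDeriv i φ x : ℂ) * u x := by
    rw [ae_all_iff]
    exact fun i => coeFn_mulL _ u
  refine integral_congr_ae ?_
  filter_upwards [h] with x hx
  set s := ∑ i, ∑ j, (A.antiTrunc k i j x : ℂ) * mulGrad hφ u j x *
    starRingEnd ℂ (mulGrad hφ u i x) with hs
  have h1 : s = -s := by
    conv_lhs => rw [hs, Finset.sum_comm]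
    rw [hs, ← Finset.sum_neg_distrib]
    refine Finset.sum_congr rfl fun i _ => ?_
    rw [← Finset.sum_neg_distrib]
    refine Finset.sum_congr rfl fun j _ => ?_
    rw [hx, hx, A.antiTrunc_antisymm k j i x]
    simp only [map_mul, Complex.conj_ofReal]
    push_cast
    ring
  exact self_eq_neg.1 h1

lemma antiConst'_nonneg : 0 ≤ antiConst' n Lam0 := by unfold antiConst'; positivity

/-- The pairing of `Aᵃ` with `∇φ` and `∇|u|²`. The integrand is a sum of null forms of `|u|²` and
`φ`, so that the bound does not involve the height of the truncation. -/
lemma abs_re_antiForm_mulGrad_le (hn : n ≠ 0) (hL : 0 < Lam0) (hφ : SmoothLp ∞ φ)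
    (hφ1 : ∀ k x, |partialDeriv k φ x| ≤ 1) (k : ℕ) {U : PairSpace n} (hU : U ∈ sobolevGraph n) :
    |(A.antiForm k (gradOf U) (mulGrad hφ (U none))).re|
      ≤ antiConst' n Lam0 * (‖U none‖ * gradNorm (gradOf U)) := by
  refine sobolev_induction₂ (P := fun U _ => |(A.antiForm k (gradOf U) (mulGrad hφ (U none))).re|
      ≤ antiConst' n Lam0 * (‖U none‖ * gradNorm (gradOf U)))
    (isClosed_le ?_ ?_) (fun U hU _ _ => ?_) hU hU
  · refine continuous_abs.comp (Complex.continuous_re.comp ?_)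
    unfold antiForm coefForm gradOf mulGrad
    fun_prop
  · have h1 : Continuous fun p : PairSpace n × PairSpace n => gradNorm (gradOf p.1) :=
      continuous_gradNorm.comp (continuous_gradOf.comp continuous_fst)
    fun_prop
  · obtain ⟨p, q, hp, hpc, hq, hqc, h0, hG⟩ := exists_re_im_of_mem_testSet hU
    have sp := SmoothLp.of_hasCompactSupport (p := 2) hp hpc
    have sq := SmoothLp.of_hasCompactSupport (p := 2) hq hqc
    have g := gradNorm_sq_of_re_im sp sq hG
    have g0 := norm_sq_of_re_im sp.memLp0 sq.memLp0 h0
    have hmul : ∀ {f : Rn n → ℝ}, SmoothLp 2 f → ∀ i,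
        MemLp (fun x => partialDeriv i φ x * f x) 2 volume := fun hf i =>
      hf.memLp0.mul' (hφ.memLp_partialDeriv i)
    have hP : ∀ i, mulGrad hφ (U none) i =ᵐ[volume]
        fun x => ((partialDeriv i φ x * p x : ℝ) : ℂ) + (partialDeriv i φ x * q x : ℝ) * Complex.I := by
      intro i
      filter_upwards [coeFn_mulL (hφ.memLp_partialDeriv i) (U none), h0] with x hx hx0
      rw [mulGrad, hx, hx0]
      push_cast
      ring
    have e : ∀ i j, inner ℂ (mulGrad hφ (U none) i)
        (mulL (A.memLp_antiTrunc k i j) (gradOf U j)) = _ := fun i j =>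
      inner_mulL_re_im (A.memLp_antiTrunc k i j) (sp.partialDeriv j).memLp0
        (sq.partialDeriv j).memLp0 (hmul sp i) (hmul sq i) (hG j) (hP i)
    have hre : (A.antiForm k (gradOf U) (mulGrad hφ (U none))).re
        = 1 / 2 * (A.realAnti k (fun x => p x * p x) φ + A.realAnti k (fun x => q x * q x) φ) := by
      have aux : ∀ {f : Rn n → ℝ}, SmoothLp 2 f →
          A.realAnti k (fun x => f x * f x) φ = 2 * ∑ i, ∑ j, ∫ x, A.antiTrunc k i j x *
            (partialDeriv j f x * (partialDeriv i φ x * f x)) := by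
        intro f hf
        simp only [realAnti, Finset.mul_sum, ← integral_const_mul]
        refine Finset.sum_congr rfl fun i _ => Finset.sum_congr rfl fun j _ => ?_
        refine integral_congr_ae (Eventually.of_forall fun x => ?_)
        dsimp only
        rw [partialDeriv_mul hf.differentiable hf.differentiable]
        ring
      simp only [antiForm, coefForm, e, aux sp, aux sq, Complex.re_sum, Complex.add_re,
        Complex.mul_re, Complex.I_re, Complex.I_im, Complex.ofReal_re, Complex.ofReal_im, mul_zero,
        sub_zero, zero_mul, add_zero, Finset.sum_add_distrib, Finset.sum_const_zero]
      ring
    have bp := sqrt_le_of_add_eq (gradNorm_nonneg _) (dirichlet_nonneg q) g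
    have bq := sqrt_le_of_add_eq (gradNorm_nonneg _) (dirichlet_nonneg p) (g.trans (add_comm _ _))
    have bp0 := sqrt_le_of_add_eq (norm_nonneg _) (integral_nonneg fun x => sq_nonneg (q x)) g0
    have bq0 := sqrt_le_of_add_eq (norm_nonneg _) (integral_nonneg fun x => sq_nonneg (p x))
      (g0.trans (add_comm _ _))
    have hc := antiConst'_nonneg (n := n) (Lam0 := Lam0)
    have k1 : |A.realAnti k (fun x => p x * p x) φ|
        ≤ antiConst' n Lam0 * (‖U none‖ * gradNorm (gradOf U)) := by
      refine (A.abs_realAnti_sq_le hn hL k sp hφ hφ1).trans ?_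
      gcongr
    have k2 : |A.realAnti k (fun x => q x * q x) φ|
        ≤ antiConst' n Lam0 * (‖U none‖ * gradNorm (gradOf U)) := by
      refine (A.abs_realAnti_sq_le hn hL k sq hφ hφ1).trans ?_
      gcongr
    rw [hre, abs_mul, abs_of_pos (by norm_num : (0 : ℝ) < 1 / 2)]
    have := abs_add_le (A.realAnti k (fun x => p x * p x) φ) (A.realAnti k (fun x => q x * q x) φ)
    linarith

lemma norm_symForm_le (hlam : 0 < lam0) (G H : Fin n → L2 n) :
    ‖A.symForm G H‖ ≤ n ^ 2 * lam0⁻¹ * (gradNorm G * gradNorm H) :=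
  norm_coefForm_le A.memLp_sym (by positivity)
    (fun i j => by filter_upwards [A.bounded] with x hx using hx i j) G H

lemma sym_comm (i j : Fin n) : (fun x => A.sym x i j) = fun x => A.sym x j i := by
  funext x; simp only [sym]; ring

lemma im_symForm_self (G : Fin n → L2 n) : (A.symForm G G).im = 0 :=
  Complex.conj_eq_iff_im.1 (coefForm_swap_of_symm A.memLp_sym A.sym_comm G G).symm

lemma le_re_symForm (G : Fin n → L2 n) : lam0 * gradNorm G ^ 2 ≤ (A.symForm G G).re :=
  le_re_coefForm A.memLp_sym A.elliptic G

lemma antiForm_swap (k : ℕ) (G H : Fin n → L2 n) :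
    A.antiForm k H G = -starRingEnd ℂ (A.antiForm k G H) :=
  coefForm_swap_of_antisymm _ (A.antiTrunc_antisymm k) G H

lemma re_antiForm_self (k : ℕ) (G : Fin n → L2 n) : (A.antiForm k G G).re = 0 := by
  have h := congrArg Complex.re (A.antiForm_swap k G G)
  rw [Complex.neg_re, Complex.conj_re] at h
  linarith

/-- A bound for the imaginary part of the form relative to `‖∇u‖²`. -/
def imConst (n : ℕ) (Lam0 : ℝ) : ℝ := 4 * antiConst n Lam0

/-- The constant of the lower order terms in `le_re_weighted`. -/
def lowerConst (n : ℕ) (lam0 Lam0 : ℝ) : ℝ :=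
  2 * (n ^ 3 * lam0⁻¹) + n ^ 4 * lam0⁻¹ + 2 * antiConst' n Lam0

/-- Lower bound for the real part of `z t[e^{-ρφ}w, e^{ρφ}w]`. The weights enter through the first
derivatives `ρ w ∇φ` only; the antisymmetric part contributes `2ρ Re (Aᵃ ∇w, w ∇φ)`, whose bound is
`abs_re_antiForm_mulGrad_le`. -/
lemma le_re_weighted (hn : n ≠ 0) (hlam : 0 < lam0) (hL : 0 < Lam0) (hφ : SmoothLp ∞ φ)
    (hφ1 : ∀ k x, |partialDeriv k φ x| ≤ 1) (k : ℕ) {W : PairSpace n} (hW : W ∈ sobolevGraph n)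
    {ρ : ℝ} (hρ : 0 ≤ ρ) {z : ℂ} (hz : 0 ≤ z.re) :
    (lam0 * z.re - imConst n Lam0 * |z.im|) * gradNorm (gradOf W) ^ 2
        - ‖z‖ * lowerConst n lam0 Lam0 * (ρ * (‖W none‖ * gradNorm (gradOf W)) + ρ ^ 2 * ‖W none‖ ^ 2)
      ≤ (z * (A.symForm (gradOf W + (-ρ : ℂ) • mulGrad hφ (W none))
            (gradOf W + (ρ : ℂ) • mulGrad hφ (W none))
          + A.antiForm k (gradOf W + (-ρ : ℂ) • mulGrad hφ (W none))
            (gradOf W + (ρ : ℂ) • mulGrad hφ (W none)))).re := by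
  set G := gradOf W with hG
  set P := mulGrad hφ (W none) with hP
  set w := ‖W none‖ with hw
  set g := gradNorm G with hg
  have hw0 : 0 ≤ w := norm_nonneg _
  have hg0 : 0 ≤ g := gradNorm_nonneg _
  have hz0 : 0 ≤ ‖z‖ := norm_nonneg _
  have hPn : gradNorm P ≤ n * w := gradNorm_mulGrad_le hφ hφ1 _
  have hP0 : 0 ≤ gradNorm P := gradNorm_nonneg _
  have exps : A.symForm (G + (-ρ : ℂ) • P) (G + (ρ : ℂ) • P) = A.symForm G G
      + (ρ * (A.symForm G P - A.symForm P G) - ρ ^ 2 * A.symForm P P) := by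
    simp only [symForm, coefForm_add_left, coefForm_add_right, coefForm_smul_left,
      coefForm_smul_right, Complex.conj_ofReal]
    ring
  have expa : A.antiForm k (G + (-ρ : ℂ) • P) (G + (ρ : ℂ) • P) = A.antiForm k G G
      + (ρ * (2 * (A.antiForm k G P).re) : ℝ) := by
    have h1 := A.antiForm_swap k G P
    have h2 := A.antiForm_mulGrad_self hφ k (W none)
    have h3 := Complex.add_conj (A.antiForm k G P)
    rw [← hP] at h2
    simp only [antiForm, coefForm_add_left, coefForm_add_right, coefForm_smul_left,
      coefForm_smul_right, Complex.conj_ofReal] at h1 h2 h3 ⊢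
    rw [h1, h2]
    push_cast at h3 ⊢
    linear_combination (ρ : ℂ) * h3
  have hb1 := A.norm_symForm_le hlam G P
  have hb2 := A.norm_symForm_le hlam P G
  have hb3 := A.norm_symForm_le hlam P P
  have hli : 0 ≤ lam0⁻¹ := by positivity
  set E : ℂ := ρ * (A.symForm G P - A.symForm P G) - ρ ^ 2 * A.symForm P P with hE
  have hEb : ‖E‖ ≤ 2 * (n ^ 3 * lam0⁻¹) * (ρ * (w * g)) + n ^ 4 * lam0⁻¹ * (ρ ^ 2 * w ^ 2) := by
    have n1 : ‖E‖ ≤ ρ * (‖A.symForm G P‖ + ‖A.symForm P G‖) + ρ ^ 2 * ‖A.symForm P P‖ := by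
      refine (norm_sub_le _ _).trans ?_
      rw [norm_mul, norm_mul, norm_pow, Complex.norm_real, Real.norm_of_nonneg hρ]
      gcongr
      exact norm_sub_le _ _
    have n2 : g * gradNorm P ≤ g * (n * w) := by gcongr
    have n3 : gradNorm P * gradNorm P ≤ (n * w) * (n * w) := by gcongr
    have m1 : ‖A.symForm G P‖ ≤ n ^ 2 * lam0⁻¹ * (g * (n * w)) := hb1.trans (by gcongr)
    have m2 : ‖A.symForm P G‖ ≤ n ^ 2 * lam0⁻¹ * (g * (n * w)) :=
      hb2.trans (by rw [mul_comm (gradNorm P)]; gcongr)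
    have m3 : ‖A.symForm P P‖ ≤ n ^ 2 * lam0⁻¹ * ((n * w) * (n * w)) := hb3.trans (by gcongr)
    calc ‖E‖ ≤ ρ * (n ^ 2 * lam0⁻¹ * (g * (n * w)) + n ^ 2 * lam0⁻¹ * (g * (n * w)))
          + ρ ^ 2 * (n ^ 2 * lam0⁻¹ * ((n * w) * (n * w))) := n1.trans (by gcongr)
      _ = _ := by ring
  set R := ρ * (2 * (A.antiForm k G P).re) with hR
  have hRb : |R| ≤ 2 * antiConst' n Lam0 * (ρ * (w * g)) := by
    have := A.abs_re_antiForm_mulGrad_le hn hL hφ hφ1 k hW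
    rw [← hP, ← hG, ← hw, ← hg] at this
    rw [hR, abs_mul, abs_mul, abs_of_nonneg hρ, abs_two]
    calc _ ≤ ρ * (2 * (antiConst' n Lam0 * (w * g))) := by gcongr
      _ = _ := by ring
  rw [exps, expa]
  have hs1 := A.le_re_symForm G
  have hs2 := A.im_symForm_self G
  have ha1 := A.re_antiForm_self k G
  have ha2 : |(A.antiForm k G G).im| ≤ imConst n Lam0 * g ^ 2 := by
    refine (Complex.abs_im_le_norm _).trans ((A.norm_antiForm_le hn hL k hW hW).trans (le_of_eq ?_))
    rw [imConst, sq, ← hG]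
  have e : (z * (A.symForm G G + E + (A.antiForm k G G + (R : ℝ)))).re
      = z.re * (A.symForm G G).re - z.im * (A.antiForm k G G).im + (z * E).re + z.re * R := by
    simp only [mul_add, Complex.add_re, Complex.mul_re, Complex.ofReal_re, Complex.ofReal_im, hs2, ha1]
    ring
  rw [e]
  have t1 : z.re * (lam0 * g ^ 2) ≤ z.re * (A.symForm G G).re := by gcongr
  have t2 : z.im * (A.antiForm k G G).im ≤ |z.im| * (imConst n Lam0 * g ^ 2) := by
    refine (le_abs_self _).trans ?_
    rw [abs_mul]
    gcongr
  have t3 : -(‖z‖ * (2 * (n ^ 3 * lam0⁻¹) * (ρ * (w * g)) + n ^ 4 * lam0⁻¹ * (ρ ^ 2 * w ^ 2)))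
      ≤ (z * E).re := by
    have h1 := Complex.abs_re_le_norm (z * E)
    rw [norm_mul] at h1
    have h2 : ‖z‖ * ‖E‖ ≤ ‖z‖ * (2 * (n ^ 3 * lam0⁻¹) * (ρ * (w * g))
      + n ^ 4 * lam0⁻¹ * (ρ ^ 2 * w ^ 2)) := by gcongr
    linarith [neg_abs_le (z * E).re]
  have t4 : -(‖z‖ * (2 * antiConst' n Lam0 * (ρ * (w * g)))) ≤ z.re * R := by
    have h1 : |z.re * R| ≤ ‖z‖ * (2 * antiConst' n Lam0 * (ρ * (w * g))) := by
      rw [abs_mul]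
      gcongr
      exact Complex.abs_re_le_norm z
    linarith [neg_abs_le (z.re * R)]
  have hac := antiConst'_nonneg (n := n) (Lam0 := Lam0)
  have t5 : 0 ≤ ‖z‖ * ((n ^ 4 * lam0⁻¹) * (ρ * (w * g))) := by positivity
  have t6 : 0 ≤ ‖z‖ * ((2 * (n ^ 3 * lam0⁻¹) + 2 * antiConst' n Lam0) * (ρ ^ 2 * w ^ 2)) := by
    positivity
  rw [lowerConst]
  nlinarith [t1, t2, t3, t4, t5, t6]

end CoeffMatrix

end

section

/-! ### Weighted accretivity of the operator -/

variable {n : ℕ} {lam0 Lam0 : ℝ} {φ : Rn n → ℝ}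

/-- The exponential weight `e^{ρφ}`. -/
def expWeight (ρ : ℝ) (φ : Rn n → ℝ) (x : Rn n) : ℝ := Real.exp (ρ * φ x)

lemma contDiff_expWeight (hφ : SmoothLp ∞ φ) (ρ : ℝ) : ContDiff ℝ ∞ (expWeight ρ φ) :=
  Real.contDiff_exp.comp (contDiff_const.mul hφ.contDiff)

lemma partialDeriv_expWeight (hφ : SmoothLp ∞ φ) (ρ : ℝ) (i : Fin n) (x : Rn n) :
    partialDeriv i (expWeight ρ φ) x = ρ * (partialDeriv i φ x * expWeight ρ φ x) := by
  have h := ((hφ.differentiable x).hasFDerivAt.const_mul ρ).exp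
  rw [partialDeriv]
  change fderiv ℝ (fun x => Real.exp (ρ * φ x)) x _ = _
  rw [h.fderiv]
  simp [partialDeriv, expWeight]
  ring

lemma memLp_expWeight (hφ : SmoothLp ∞ φ) (ρ : ℝ) : MemLp (expWeight ρ φ) ∞ volume := by
  obtain ⟨C, hC⟩ := hφ.bdd0
  refine memLp_top_of_abs_le (contDiff_expWeight hφ ρ).continuous (C := Real.exp (|ρ| * C))
    fun x => ?_
  rw [expWeight, abs_of_pos (Real.exp_pos _)]
  refine Real.exp_le_exp.2 ((le_abs_self _).trans ?_)
  rw [abs_mul]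
  have := hC x
  gcongr

/-- Multiplication by `e^{ρφ}` on `L²`. -/
def weightL (hφ : SmoothLp ∞ φ) (ρ : ℝ) : L2 n →L[ℂ] L2 n := mulL (memLp_expWeight hφ ρ)

lemma mulL_comm {m m' : Rn n → ℝ} (hm : MemLp m ∞ volume) (hm' : MemLp m' ∞ volume) (u : L2 n) :
    mulL hm (mulL hm' u) = mulL hm' (mulL hm u) := by
  refine Lp.ext ?_
  filter_upwards [coeFn_mulL hm (mulL hm' u), coeFn_mulL hm' u, coeFn_mulL hm' (mulL hm u),
    coeFn_mulL hm u] with x h1 h2 h3 h4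
  rw [h1, h2, h3, h4]
  ring

lemma weightL_zero (hφ : SmoothLp ∞ φ) (u : L2 n) : weightL hφ 0 u = u := by
  refine Lp.ext ?_
  filter_upwards [coeFn_mulL (memLp_expWeight hφ 0) u] with x hx
  rw [weightL, hx]
  simp [expWeight]

lemma HasWeakGrad.weightL {u : L2 n} {G : Fin n → L2 n} (hu : HasWeakGrad u G)
    (hφ : SmoothLp ∞ φ) (ρ : ℝ) :
    HasWeakGrad (weightL hφ ρ u)
      ((fun i => GaffneyBMO.weightL hφ ρ (G i)) + (ρ : ℂ) • mulGrad hφ (GaffneyBMO.weightL hφ ρ u)) := by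
  have hd : ∀ i, MemLp (partialDeriv i (expWeight ρ φ)) ∞ volume := fun i => by
    rw [show partialDeriv i (expWeight ρ φ) = fun x => ρ * (partialDeriv i φ x * expWeight ρ φ x) from
      funext (partialDeriv_expWeight hφ ρ i)]
    exact ((memLp_expWeight hφ ρ).mul' (hφ.memLp_partialDeriv i)).const_mul ρ
  have h := hu.mulL (contDiff_expWeight hφ ρ) (memLp_expWeight hφ ρ) hd
  convert h using 1
  · rfl
  funext i
  rw [Pi.add_apply, Pi.smul_apply]
  congr 1
  refine Lp.ext ?_
  filter_upwards [coeFn_mulL (hd i) u, coeFn_mulL (memLp_expWeight hφ ρ) u,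
    coeFn_mulL (hφ.memLp_partialDeriv i) (GaffneyBMO.weightL hφ ρ u),
    Lp.coeFn_smul (ρ : ℂ) (mulGrad hφ (GaffneyBMO.weightL hφ ρ u) i)] with x h1 h2 h3 h4
  rw [h4, Pi.smul_apply, mulGrad, h3,
    show GaffneyBMO.weightL hφ ρ u = GaffneyBMO.mulL (memLp_expWeight hφ ρ) u from rfl, h2, h1,
    partialDeriv_expWeight hφ]
  push_cast
  simp only [smul_eq_mul]
  ring

/-- The pair `(e^{ρφ}u, ∇(e^{ρφ}u))` for `u ∈ W^{1,2}`. -/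
def weightPair (hφ : SmoothLp ∞ φ) (ρ : ℝ) (u : L2 n) : PairSpace n :=
  pair (weightL hφ ρ u)
    ((fun i => weightL hφ ρ (weakGrad u i)) + (ρ : ℂ) • mulGrad hφ (weightL hφ ρ u))

lemma weightPair_mem (hφ : SmoothLp ∞ φ) (ρ : ℝ) {u : L2 n} (hu : u ∈ W12 n) :
    weightPair hφ ρ u ∈ sobolevGraph n := (hasWeakGrad_weakGrad hu).weightL hφ ρ

namespace CoeffMatrix

variable (A : CoeffMatrix n lam0 Lam0)

lemma coefForm_weightL {c : Fin n → Fin n → Rn n → ℝ} (hc : ∀ i j, MemLp (c i j) ∞ volume)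
    (hφ : SmoothLp ∞ φ) (ρ : ℝ) (G H : Fin n → L2 n) :
    coefForm hc G (fun i => weightL hφ ρ (H i)) = coefForm hc (fun i => weightL hφ ρ (G i)) H := by
  refine Finset.sum_congr rfl fun i _ => Finset.sum_congr rfl fun j _ => ?_
  rw [weightL, ← inner_mulL, mulL_comm]

/-- The weighted Gårding inequality on the graph of `L`, obtained by testing `t[u, ·]` with
`e^{2ρφ} u`. -/
lemma le_re_inner_weightL (hn : n ≠ 0) (hlam : 0 < lam0) (hL : 0 < Lam0) (hφ : SmoothLp ∞ φ)
    (hφ1 : ∀ k x, |partialDeriv k φ x| ≤ 1) {ρ : ℝ} (hρ : 0 ≤ ρ) {z : ℂ} (hz : 0 ≤ z.re)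
    {u g : L2 n} (hug : (u, g) ∈ A.op.graph) :
    (lam0 * z.re - imConst n Lam0 * |z.im|) * gradNorm (gradOf (weightPair hφ ρ u)) ^ 2
        - ‖z‖ * lowerConst n lam0 Lam0 *
          (ρ * (‖weightL hφ ρ u‖ * gradNorm (gradOf (weightPair hφ ρ u)))
            + ρ ^ 2 * ‖weightL hφ ρ u‖ ^ 2)
      ≤ (z * inner ℂ (weightL hφ ρ u) (weightL hφ ρ g)).re := by
  obtain ⟨hu, hform⟩ := A.mem_op_graph_iff.1 hug
  have hgu := hasWeakGrad_weakGrad hu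
  have hw := hgu.weightL hφ ρ
  have hv := hw.weightL hφ ρ
  have ht := hform _ ⟨_, hv⟩
  rw [HasForm] at ht
  simp_rw [truncForm_eq, hv.weakGrad_eq] at ht
  set P := mulGrad hφ (weightL hφ ρ u) with hP
  set G := gradOf (weightPair hφ ρ u) with hG
  have hG' : G = (fun i => weightL hφ ρ (weakGrad u i)) + (ρ : ℂ) • P := rfl
  have e1 : (fun i => weightL hφ ρ (weakGrad u i)) = G + (-ρ : ℂ) • P := by
    rw [hG']; simp
  have e2 : (fun i => weightL hφ ρ (G i)) + (ρ : ℂ) • mulGrad hφ (weightL hφ ρ (weightL hφ ρ u))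
      = fun i => weightL hφ ρ ((G + (ρ : ℂ) • P) i) := by
    funext i
    simp only [Pi.add_apply, Pi.smul_apply, map_add, map_smul]
    congr 2
    exact mulL_comm _ _ _
  have e3 : ∀ k, A.symForm (weakGrad u) ((fun i => weightL hφ ρ (G i))
      + (ρ : ℂ) • mulGrad hφ (weightL hφ ρ (weightL hφ ρ u)))
      + A.antiForm k (weakGrad u) ((fun i => weightL hφ ρ (G i))
      + (ρ : ℂ) • mulGrad hφ (weightL hφ ρ (weightL hφ ρ u)))
      = A.symForm (G + (-ρ : ℂ) • P) (G + (ρ : ℂ) • P)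
      + A.antiForm k (G + (-ρ : ℂ) • P) (G + (ρ : ℂ) • P) := by
    intro k
    rw [e2, symForm, symForm, antiForm, antiForm, coefForm_weightL, coefForm_weightL, e1]
  change Tendsto (fun k => A.symForm (weakGrad u) ((fun i => weightL hφ ρ (G i))
      + (ρ : ℂ) • mulGrad hφ (weightL hφ ρ (weightL hφ ρ u)))
      + A.antiForm k (weakGrad u) ((fun i => weightL hφ ρ (G i))
      + (ρ : ℂ) • mulGrad hφ (weightL hφ ρ (weightL hφ ρ u)))) _ _ at ht
  simp_rw [e3] at ht
  rw [weightL, ← inner_mulL] at ht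
  have hlim := (Complex.continuous_re.tendsto _).comp (ht.const_mul z)
  refine ge_of_tendsto hlim (Eventually.of_forall fun k => ?_)
  exact A.le_re_weighted hn hlam hL hφ hφ1 k (weightPair_mem hφ ρ hu) hρ hz

lemma smoothLp_zero : SmoothLp ∞ (fun _ : Rn n => (0 : ℝ)) :=
  SmoothLp.of_hasCompactSupport contDiff_const (HasCompactSupport.zero)

/-- `zL` is accretive for `z` in a sector. -/
lemma re_inner_nonneg (hn : n ≠ 0) (hlam : 0 < lam0) (hL : 0 < Lam0) {z : ℂ}
    (hz : imConst n Lam0 * |z.im| ≤ lam0 * z.re) {u g : L2 n} (hug : (u, g) ∈ A.op.graph) :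
    0 ≤ (z * inner ℂ u g).re := by
  have hM : 0 ≤ imConst n Lam0 := by
    have := antiConst_nonneg (n := n) (Lam0 := Lam0); unfold imConst; positivity
  have hz0 : 0 ≤ z.re := by
    have : 0 ≤ lam0 * z.re := le_trans (by positivity) hz
    exact nonneg_of_mul_nonneg_right this hlam
  have h := A.le_re_inner_weightL hn hlam hL smoothLp_zero (fun k x => by
    simp [partialDeriv]) (le_refl 0) hz0 hug
  rw [weightL_zero, weightL_zero] at h
  refine le_trans ?_ h
  simp only [zero_mul, ne_eq, OfNat.ofNat_ne_zero, not_false_eq_true, zero_pow, add_zero, mul_zero,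
    sub_zero]
  exact mul_nonneg (sub_nonneg.2 hz) (sq_nonneg _)

/-- The limit of the antisymmetric forms. The limit exists on `W^{1,2}` by `tendsto_antiLim`. -/
def antiLim (U V : PairSpace n) : ℂ :=
  limUnder atTop fun k => A.antiForm k (gradOf U) (gradOf V)

lemma tendsto_antiLim (hn : n ≠ 0) (hL : 0 < Lam0) {U V : PairSpace n} (hU : U ∈ sobolevGraph n)
    (hV : V ∈ sobolevGraph n) :
    Tendsto (fun k => A.antiForm k (gradOf U) (gradOf V)) atTop (𝓝 (A.antiLim U V)) :=
  tendsto_nhds_limUnder (A.exists_tendsto_antiForm hn hL hU hV)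

/-- The conjugate of `t[u, v] + l (u, v)`, as a sesquilinear map on `W^{1,2}`; the conjugation makes it
antilinear in `u` and linear in `v`, as `InnerProductSpace.continuousLinearMapOfBilin` expects. -/
def shiftedForm (hn : n ≠ 0) (hL : 0 < Lam0) (l : ℝ) :
    sobolevGraph n →ₗ⋆[ℂ] sobolevGraph n →ₗ[ℂ] ℂ :=
  LinearMap.mk₂'ₛₗ (starRingEnd ℂ) (RingHom.id ℂ)
    (fun U V => starRingEnd ℂ (A.symForm (gradOf U.1) (gradOf V.1) + A.antiLim U.1 V.1
      + l * inner ℂ (V.1 none) (U.1 none)))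
    (fun U U' V => by
      have h : A.antiLim (U + U' : PairSpace n) V = A.antiLim U V + A.antiLim U' V :=
        tendsto_nhds_unique (A.tendsto_antiLim hn hL (add_mem U.2 U'.2) V.2)
          (((A.tendsto_antiLim hn hL U.2 V.2).add (A.tendsto_antiLim hn hL U'.2 V.2)).congr
            fun k => (coefForm_add_left _ _ _ _).symm)
      have h' : A.symForm (gradOf (U + U' : PairSpace n)) (gradOf V.1)
          = A.symForm (gradOf U.1) (gradOf V.1) + A.symForm (gradOf U'.1) (gradOf V.1) :=
        coefForm_add_left _ _ _ _
      rw [← map_add, Submodule.coe_add, h, h', PiLp.add_apply, inner_add_right]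
      congr 1
      ring)
    (fun a U V => by
      have h : A.antiLim (a • U : PairSpace n) V = a * A.antiLim U V :=
        tendsto_nhds_unique (A.tendsto_antiLim hn hL (Submodule.smul_mem _ a U.2) V.2)
          (((A.tendsto_antiLim hn hL U.2 V.2).const_mul a).congr
            fun k => (coefForm_smul_left _ _ _ _).symm)
      have h' : A.symForm (gradOf (a • U : PairSpace n)) (gradOf V.1)
          = a * A.symForm (gradOf U.1) (gradOf V.1) := coefForm_smul_left _ _ _ _
      rw [smul_eq_mul, ← map_mul, Submodule.coe_smul, h, h', PiLp.smul_apply, inner_smul_right]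
      congr 1
      ring)
    (fun U V V' => by
      have h : A.antiLim U (V + V' : PairSpace n) = A.antiLim U V + A.antiLim U V' :=
        tendsto_nhds_unique (A.tendsto_antiLim hn hL U.2 (add_mem V.2 V'.2))
          (((A.tendsto_antiLim hn hL U.2 V.2).add (A.tendsto_antiLim hn hL U.2 V'.2)).congr
            fun k => (coefForm_add_right _ _ _ _).symm)
      have h' : A.symForm (gradOf U.1) (gradOf (V + V' : PairSpace n))
          = A.symForm (gradOf U.1) (gradOf V.1) + A.symForm (gradOf U.1) (gradOf V'.1) :=
        coefForm_add_right _ _ _ _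
      rw [← map_add, Submodule.coe_add, h, h', PiLp.add_apply, inner_add_left]
      congr 1
      ring)
    (fun a U V => by
      have h : A.antiLim U (a • V : PairSpace n) = starRingEnd ℂ a * A.antiLim U V :=
        tendsto_nhds_unique (A.tendsto_antiLim hn hL U.2 (Submodule.smul_mem _ a V.2))
          (((A.tendsto_antiLim hn hL U.2 V.2).const_mul _).congr
            fun k => (coefForm_smul_right _ _ _ _).symm)
      have h' : A.symForm (gradOf U.1) (gradOf (a • V : PairSpace n))
          = starRingEnd ℂ a * A.symForm (gradOf U.1) (gradOf V.1) := coefForm_smul_right _ _ _ _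
      rw [Submodule.coe_smul, h, h', PiLp.smul_apply, inner_smul_left, RingHom.id_apply, smul_eq_mul]
      simp only [map_add, map_mul, Complex.conj_conj]
      ring)

/-- `L + l` is onto for `l > 0`, by the Lax–Milgram theorem. -/
lemma exists_resolvent (hn : n ≠ 0) (hlam : 0 < lam0) (hL : 0 < Lam0) {l : ℝ} (hl : 0 < l)
    (f : L2 n) : ∃ u g, (u, g) ∈ A.op.graph ∧ g + (l : ℂ) • u = f := by
  have : CompleteSpace (sobolevGraph n) := isClosed_sobolevGraph.completeSpace_coe
  have hgn : ∀ U : PairSpace n, gradNorm (gradOf U) ≤ ‖U‖ := gradNorm_le_norm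
  have hbound : ∀ U V, ‖A.shiftedForm hn hL l U V‖
      ≤ (n ^ 2 * lam0⁻¹ + 4 * antiConst n Lam0 + l) * ‖U‖ * ‖V‖ := by
    intro U V
    have h1 := A.norm_symForm_le hlam (gradOf U.1) (gradOf V.1)
    have h2 : ‖A.antiLim U V‖ ≤ 4 * antiConst n Lam0 *
        (gradNorm (gradOf U.1) * gradNorm (gradOf V.1)) :=
      le_of_tendsto (A.tendsto_antiLim hn hL U.2 V.2).norm
        (Eventually.of_forall fun k => A.norm_antiForm_le hn hL k U.2 V.2)
    have h3 : ‖inner ℂ (V.1 none) (U.1 none)‖ ≤ ‖V‖ * ‖U‖ :=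
      (norm_inner_le_norm _ _).trans (mul_le_mul (norm_none_le_norm _) (norm_none_le_norm _)
        (norm_nonneg _) (norm_nonneg _))
    have h4 : gradNorm (gradOf U.1) * gradNorm (gradOf V.1) ≤ ‖U‖ * ‖V‖ :=
      mul_le_mul (hgn _) (hgn _) (gradNorm_nonneg _) (norm_nonneg _)
    have h5 := antiConst_nonneg (n := n) (Lam0 := Lam0)
    have h6 : 0 ≤ lam0⁻¹ := by positivity
    change ‖starRingEnd ℂ _‖ ≤ _
    rw [RCLike.norm_conj]
    refine (norm_add₃_le).trans ?_
    rw [norm_mul, Complex.norm_real, Real.norm_of_nonneg hl.le]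
    calc _ ≤ n ^ 2 * lam0⁻¹ * (‖U‖ * ‖V‖) + 4 * antiConst n Lam0 * (‖U‖ * ‖V‖)
          + l * (‖V‖ * ‖U‖) := by
          gcongr
          · exact h1.trans (by gcongr)
          · exact h2.trans (by gcongr)
      _ = _ := by ring
  set B := (A.shiftedForm hn hL l).mkContinuous₂ _ hbound with hB
  set T := InnerProductSpace.continuousLinearMapOfBilin B with hT
  have hTB : ∀ U V : sobolevGraph n, inner ℂ (T U) V
      = starRingEnd ℂ (A.symForm (gradOf U.1) (gradOf V.1) + A.antiLim U.1 V.1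
      + l * inner ℂ (V.1 none) (U.1 none)) := fun U V =>
    InnerProductSpace.continuousLinearMapOfBilin_apply B U V
  have hunit : IsUnit T := by
    refine ContinuousLinearMap.isUnit_of_forall_le_norm_inner_map T
      (c := ⟨min lam0 l, (lt_min hlam hl).le⟩) (lt_min hlam hl) fun U => ?_
    refine le_trans ?_ (Complex.re_le_norm _)
    rw [hTB, Complex.conj_re, Complex.add_re, Complex.add_re]
    have h1 := A.le_re_symForm (gradOf U.1)
    have h2 : (A.antiLim U.1 U.1).re = 0 := by
      refine tendsto_nhds_unique ((Complex.continuous_re.tendsto _).comp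
        (A.tendsto_antiLim hn hL U.2 U.2)) ?_
      simp only [Function.comp_def, re_antiForm_self]
      exact tendsto_const_nhds
    have h3 : ((l : ℂ) * inner ℂ (U.1 none) (U.1 none)).re = l * ‖U.1 none‖ ^ 2 := by
      rw [inner_self_eq_norm_sq_to_K, Complex.re_ofReal_mul]
      norm_cast
    have h4 : ‖U‖ ^ 2 = ‖U.1 none‖ ^ 2 + gradNorm (gradOf U.1) ^ 2 := norm_sq_pairSpace U.1
    rw [h2, h3, h4]
    change _ * min lam0 l ≤ _
    have h5 := mul_le_mul_of_nonneg_right (min_le_left lam0 l) (sq_nonneg (gradNorm (gradOf U.1)))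
    have h6 := mul_le_mul_of_nonneg_right (min_le_right lam0 l) (sq_nonneg ‖U.1 none‖)
    linarith
  set Q : sobolevGraph n →L[ℂ] L2 n :=
    (PiLp.proj 2 (fun _ : Option (Fin n) => L2 n) none).comp (sobolevGraph n).subtypeL with hQ
  obtain ⟨U, hU⟩ := (ContinuousLinearMap.isUnit_iff_bijective.1 hunit).2
    (ContinuousLinearMap.adjoint Q f)
  have hgU : weakGrad (U.1 none) = gradOf U.1 := (mem_sobolevGraph.1 U.2).weakGrad_eq
  refine ⟨U.1 none, f - (l : ℂ) • U.1 none, A.mem_op_graph_iff.2 ⟨⟨_, U.2⟩, fun v hv => ?_⟩,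
    sub_add_cancel _ _⟩
  set V : sobolevGraph n := ⟨pair v (weakGrad v), hasWeakGrad_weakGrad hv⟩ with hV
  have h1 := hTB U V
  rw [hU, ContinuousLinearMap.adjoint_inner_left] at h1
  have h2 := congrArg (starRingEnd ℂ) h1
  rw [Complex.conj_conj, inner_conj_symm] at h2
  have h3 : inner ℂ v (f - (l : ℂ) • U.1 none)
      = A.symForm (gradOf U.1) (gradOf V.1) + A.antiLim U.1 V.1 := by
    rw [inner_sub_right, inner_smul_right]
    exact sub_eq_of_eq_add h2
  rw [h3, HasForm]
  simp_rw [truncForm_eq, hgU]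
  exact (A.tendsto_antiLim hn hL U.2 V.2).const_add _

end CoeffMatrix

end

section

/-! ### Sectors -/

/-- The function `z ↦ l Re z - M |Im z|`, which is positive precisely on an open sector. -/
def coneFun (M l : ℝ) (z : ℂ) : ℝ := l * z.re - M * |z.im|

lemma coneFun_eq {M l : ℝ} (hl : 0 < l) (z : ℂ) :
    coneFun M l z = ‖z‖ * (l / Real.cos (Real.arctan (M / l))
      * Real.cos (|z.arg| + Real.arctan (M / l))) := by
  set om := Real.arctan (M / l) with hom
  have hc : 0 < Real.cos om := Real.cos_arctan_pos _
  have h1 : z.re = ‖z‖ * Real.cos |z.arg| := by rw [Real.cos_abs, Complex.norm_mul_cos_arg]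
  have h2 : |z.im| = ‖z‖ * Real.sin |z.arg| := by
    rw [← Complex.norm_mul_sin_arg, abs_mul, abs_norm]
    congr 1
    rcases le_total 0 z.arg with h | h
    · rw [abs_of_nonneg h, abs_of_nonneg (Real.sin_nonneg_of_nonneg_of_le_pi h z.arg_le_pi)]
    · rw [abs_of_nonpos h, abs_of_nonpos (Real.sin_nonpos_of_nonpos_of_neg_pi_le h
        (Complex.neg_pi_lt_arg z).le), Real.sin_neg]
  have h3 : M = l * (Real.sin om / Real.cos om) := by
    rw [← Real.tan_eq_sin_div_cos, hom, Real.tan_arctan]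
    field_simp
  rw [coneFun, h1, h2, Real.cos_add]
  conv_lhs => rw [h3]
  field_simp

/-- The cone `M |Im z| < l Re z` is the sector of half angle `π/2 - arctan (M / l)`. -/
lemma mem_sector_iff {M l : ℝ} (hM : 0 < M) (hl : 0 < l) (z : ℂ) :
    z ∈ sector (Real.pi / 2 - Real.arctan (M / l)) ↔ 0 < coneFun M l z := by
  have hc : 0 < Real.cos (Real.arctan (M / l)) := Real.cos_arctan_pos _
  have hom : 0 < Real.arctan (M / l) := Real.arctan_pos.2 (by positivity)
  have hom2 := Real.arctan_lt_pi_div_two (M / l)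
  have h0 := abs_nonneg z.arg
  have hpi := Complex.abs_arg_le_pi z
  rw [coneFun_eq hl]
  constructor
  · rintro ⟨hz, h⟩
    have := Real.cos_pos_of_mem_Ioo (x := |z.arg| + Real.arctan (M / l))
      ⟨by linarith [Real.pi_pos], by linarith⟩
    have hz' : 0 < ‖z‖ := norm_pos_iff.2 hz
    positivity
  · intro h
    refine ⟨fun hz => by simp [hz] at h, ?_⟩
    by_contra hcon
    have h1 : Real.cos (|z.arg| + Real.arctan (M / l)) ≤ 0 :=
      Real.cos_nonpos_of_pi_div_two_le_of_le (by linarith) (by linarith)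
    have h2 : ‖z‖ * (l / Real.cos (Real.arctan (M / l))
      * Real.cos (|z.arg| + Real.arctan (M / l))) ≤ 0 :=
      mul_nonpos_of_nonneg_of_nonpos (norm_nonneg _)
        (mul_nonpos_of_nonneg_of_nonpos (by positivity) h1)
    linarith

/-- On smaller sectors `coneFun` is comparable with `|z|`. -/
lemma exists_le_coneFun {M l : ℝ} (hM : 0 < M) (hl : 0 < l) {μ : ℝ}
    (hμ : μ ∈ Set.Ioo 0 (Real.pi / 2 - Real.arctan (M / l))) :
    ∃ c > 0, ∀ z ∈ sector μ, c * ‖z‖ ≤ coneFun M l z := by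
  have hc : 0 < Real.cos (Real.arctan (M / l)) := Real.cos_arctan_pos _
  have hom : 0 < Real.arctan (M / l) := Real.arctan_pos.2 (by positivity)
  have h1 : 0 < Real.cos (μ + Real.arctan (M / l)) :=
    Real.cos_pos_of_mem_Ioo ⟨by linarith [hμ.1, Real.pi_pos], by linarith [hμ.2]⟩
  refine ⟨l / Real.cos (Real.arctan (M / l)) * Real.cos (μ + Real.arctan (M / l)), by positivity,
    fun z hz => ?_⟩
  rw [coneFun_eq hl, mul_comm]
  refine mul_le_mul_of_nonneg_left (mul_le_mul_of_nonneg_left ?_ (by positivity)) (norm_nonneg _)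
  have := hz.2
  have := abs_nonneg z.arg
  exact Real.cos_le_cos_of_nonneg_of_le_pi (by linarith) (by linarith [hμ.2]) (by linarith)

lemma continuous_coneFun (M l : ℝ) : Continuous (coneFun M l) := by unfold coneFun; fun_prop

lemma coneFun_real_mul {M l t : ℝ} (ht : 0 ≤ t) (z : ℂ) :
    coneFun M l (t * z) = t * coneFun M l z := by
  simp only [coneFun, Complex.re_ofReal_mul, Complex.im_ofReal_mul, abs_mul, abs_of_nonneg ht]
  ring

lemma coneFun_ofReal {M l : ℝ} (t : ℝ) : coneFun M l t = l * t := by simp [coneFun]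

lemma le_coneFun_add {M l : ℝ} (hM : 0 ≤ M) (z w : ℂ) :
    coneFun M l z + coneFun M l w ≤ coneFun M l (z + w) := by
  simp only [coneFun, Complex.add_re, Complex.add_im]
  have := mul_le_mul_of_nonneg_left (abs_add_le z.im w.im) hM
  linarith

lemma coneFun_ge_sub {M l : ℝ} (hM : 0 ≤ M) (hl : 0 ≤ l) (z w : ℂ) :
    coneFun M l z - (l + M) * ‖w - z‖ ≤ coneFun M l w := by
  have h := le_coneFun_add (l := l) hM z (w - z)
  rw [add_sub_cancel] at h
  have h1 := mul_le_mul_of_nonneg_left ((Complex.abs_im_le_norm (w - z))) hM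
  have h2 := mul_le_mul_of_nonneg_left ((neg_le_neg (Complex.abs_re_le_norm (w - z))).trans
    (neg_abs_le (w - z).re)) hl
  have h3 : l * (w - z).re - M * |(w - z).im| = coneFun M l (w - z) := rfl
  linarith

lemma isOpen_sector {M l : ℝ} (hM : 0 < M) (hl : 0 < l) :
    IsOpen (sector (Real.pi / 2 - Real.arctan (M / l))) := by
  rw [show sector (Real.pi / 2 - Real.arctan (M / l)) = {z | 0 < coneFun M l z} from
    Set.ext fun z => mem_sector_iff hM hl z]
  exact isOpen_lt continuous_const (continuous_coneFun M l)

/-! ### Exponentials of bounded accretive operators -/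

variable {H : Type*} [NormedAddCommGroup H] [InnerProductSpace ℂ H]

/-- Gronwall's inequality for the norm of a curve. -/
lemma norm_le_exp_mul_of_re_inner_le {y y' : ℝ → H} {a b c : ℝ} (hab : a ≤ b)
    (hc : ContinuousOn y (Set.Icc a b)) (hd : ∀ t ∈ Set.Ioo a b, HasDerivAt y (y' t) t)
    (h : ∀ t ∈ Set.Ioo a b, (inner ℂ (y t) (y' t)).re ≤ c * ‖y t‖ ^ 2) :
    ‖y b‖ ≤ Real.exp (c * (b - a)) * ‖y a‖ := by
  set F : ℝ → ℝ := fun t => Real.exp (-(2 * c) * t) * ‖y t‖ ^ 2 with hF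
  have hns : ∀ v : H, ‖v‖ ^ 2 = (inner ℂ v v).re := fun v => by
    rw [inner_self_eq_norm_sq_to_K]; norm_cast
  have hFd : ∀ t ∈ Set.Ioo a b, HasDerivAt F
      (Real.exp (-(2 * c) * t) * (2 * ((inner ℂ (y t) (y' t)).re - c * ‖y t‖ ^ 2))) t := by
    intro t ht
    have h1 : HasDerivAt (fun t => ‖y t‖ ^ 2) (2 * (inner ℂ (y t) (y' t)).re) t := by
      have h2 := (hd t ht).inner ℂ (hd t ht)
      have h3 := Complex.reCLM.hasFDerivAt.comp_hasDerivAt t h2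
      simp only [hns]
      refine h3.congr_deriv ?_
      rw [Complex.reCLM_apply, Complex.add_re, ← inner_conj_symm (y' t) (y t), Complex.conj_re]
      ring
    have h4 : HasDerivAt (fun t => Real.exp (-(2 * c) * t))
        (Real.exp (-(2 * c) * t) * (-(2 * c))) t := by
      simpa using ((hasDerivAt_id t).const_mul (-(2 * c))).exp
    exact (h4.fun_mul h1).congr_deriv (by ring)
  have hanti : AntitoneOn F (Set.Icc a b) := by
    refine antitoneOn_of_deriv_nonpos (convex_Icc a b) ?_ ?_ ?_
    · exact (Continuous.continuousOn (by fun_prop)).mul ((hc.norm).pow 2)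
    · rw [interior_Icc]
      exact fun t ht => (hFd t ht).differentiableAt.differentiableWithinAt
    · rw [interior_Icc]
      intro t ht
      rw [(hFd t ht).deriv]
      exact mul_nonpos_of_nonneg_of_nonpos (Real.exp_pos _).le (by linarith [h t ht])
  have h1 := hanti (Set.left_mem_Icc.2 hab) (Set.right_mem_Icc.2 hab) hab
  refine le_of_sq_le_sq ?_ (by positivity)
  have h2 : ‖y b‖ ^ 2 = Real.exp (2 * c * b) * F b := by
    rw [hF]
    dsimp only
    rw [← mul_assoc, ← Real.exp_add]
    ring_nf
    simp
  have h3 : (Real.exp (c * (b - a)) * ‖y a‖) ^ 2 = Real.exp (2 * c * b) * F a := by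
    rw [hF]
    dsimp only
    rw [mul_pow, ← Real.exp_nat_mul, ← mul_assoc (Real.exp (2 * c * b)), ← Real.exp_add]
    congr 2
    push_cast
    ring
  rw [h2, h3]
  gcongr

variable [CompleteSpace H]

/-- The exponential `e^{-zB}`. -/
def expNeg (B : H →L[ℂ] H) (z : ℂ) : H →L[ℂ] H := NormedSpace.exp ((-z) • B)

lemma expNeg_zero (B : H →L[ℂ] H) : expNeg B 0 = 1 := by simp [expNeg]

lemma hasDerivAt_expNeg (B : H →L[ℂ] H) (z : ℂ) :
    HasDerivAt (expNeg B) (-(B * expNeg B z)) z := by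
  have h := (hasDerivAt_exp_smul_const' (𝕂 := ℂ) B (-z)).scomp z (hasDerivAt_neg z)
  refine h.congr_deriv ?_
  simp [expNeg]

lemma expNeg_add (B : H →L[ℂ] H) (z w : ℂ) : expNeg B (z + w) = expNeg B z * expNeg B w := by
  let _ : NormedAlgebra ℚ (H →L[ℂ] H) := NormedAlgebra.restrictScalars ℚ ℂ _
  rw [expNeg, neg_add, add_smul]
  exact NormedSpace.exp_add_of_commute (((Commute.refl B).smul_left _).smul_right _)

/-- `zB` is accretive. -/
def AccretiveAt (z : ℂ) (B : H →L[ℂ] H) : Prop := ∀ f, 0 ≤ (z * inner ℂ f (B f)).re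

lemma AccretiveAt.norm_expNeg_le {z : ℂ} {B : H →L[ℂ] H} (h : AccretiveAt z B) (f : H) :
    ‖expNeg B z f‖ ≤ ‖f‖ := by
  have hd : ∀ t : ℝ, HasDerivAt (fun t : ℝ => expNeg B (t * z) f)
      (-(z • B (expNeg B (t * z) f))) t := by
    intro t
    have h1 : HasDerivAt (fun t : ℝ => (t : ℂ) * z) z t := by
      simpa using (hasDerivAt_id t).ofReal_comp.mul_const z
    have h2 := (hasDerivAt_expNeg B (t * z)).scomp t h1
    have h3 := (ContinuousLinearMap.apply ℂ H f).hasFDerivAt.restrictScalars ℝ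
      |>.comp_hasDerivAt t h2
    refine h3.congr_deriv ?_
    simp
  have := norm_le_exp_mul_of_re_inner_le (y := fun t : ℝ => expNeg B (t * z) f) (c := 0)
    zero_le_one (fun t _ => (hd t).continuousAt.continuousWithinAt) (fun t _ => hd t) (fun t _ => by
      rw [inner_neg_right, inner_smul_right, Complex.neg_re, zero_mul]
      linarith [h (expNeg B (t * z) f)])
  simpa [expNeg_zero] using this

/-- The exponentials of commuting accretive operators differ by at most the difference of the
generators. -/
lemma norm_expNeg_sub_le {z : ℂ} {B B' : H →L[ℂ] H} (h : AccretiveAt z B) (h' : AccretiveAt z B')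
    (hc : Commute B B') (f : H) : ‖expNeg B z f - expNeg B' z f‖ ≤ ‖z‖ * ‖B f - B' f‖ := by
  -- interpolate between the two generators; convex combinations remain accretive
  set D : ℝ → H →L[ℂ] H := fun s => B' + (s : ℂ) • (B - B') with hD
  have hacc : ∀ s ∈ Set.Icc (0 : ℝ) 1, AccretiveAt z (D s) := by
    intro s hs f
    have e : D s f = ((1 - s : ℝ) : ℂ) • B' f + (s : ℂ) • B f := by
      simp only [hD, add_apply, smul_apply, sub_apply, smul_sub, sub_smul, Complex.ofReal_sub,
        Complex.ofReal_one, one_smul]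
      abel
    rw [e, inner_add_right, inner_smul_right, inner_smul_right, mul_add, Complex.add_re,
      mul_left_comm, mul_left_comm z, Complex.re_ofReal_mul, Complex.re_ofReal_mul]
    exact add_nonneg (mul_nonneg (by linarith [hs.2]) (h' f)) (mul_nonneg hs.1 (h f))
  have hcomm : Commute B' (B - B') := hc.symm.sub_right (Commute.refl B')
  have hsplit : ∀ s : ℝ, expNeg (D s) z
      = expNeg B' z * NormedSpace.exp ((s : ℂ) • ((-z) • (B - B'))) := by
    intro s
    let _ : NormedAlgebra ℚ (H →L[ℂ] H) := NormedAlgebra.restrictScalars ℚ ℂ _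
    rw [expNeg, hD, smul_add, smul_comm]
    exact NormedSpace.exp_add_of_commute
      ((((hcomm.smul_left _).smul_right _)).smul_right _)
  have hd : ∀ s : ℝ, HasDerivAt (fun s : ℝ => expNeg (D s) z f)
      (expNeg (D s) z ((-z) • (B f - B' f))) s := by
    intro s
    have h1 := (hasDerivAt_exp_smul_const (𝕂 := ℂ) ((-z) • (B - B')) (s : ℂ)).scomp s
      (hasDerivAt_id s).ofReal_comp
    have h2 := h1.const_mul (expNeg B' z)
    have h3 := (ContinuousLinearMap.apply ℂ H f).hasFDerivAt.restrictScalars ℝ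
      |>.comp_hasDerivAt s h2
    have e : (fun s : ℝ => expNeg (D s) z f) = fun s : ℝ => (expNeg B' z *
        NormedSpace.exp ((s : ℂ) • ((-z) • (B - B')))) f := funext fun s => by rw [hsplit]
    rw [e]
    refine h3.congr_deriv ?_
    rw [hsplit]
    simp
  have := norm_image_sub_le_of_norm_deriv_le_segment_01' (C := ‖z‖ * ‖B f - B' f‖)
    (fun s _ => (hd s).hasDerivWithinAt) (fun s hs => by
      refine ((hacc s ⟨hs.1, hs.2.le⟩).norm_expNeg_le _).trans (le_of_eq ?_)
      rw [norm_smul, norm_neg])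
  simpa [hD] using this

lemma norm_expNeg_sub_self_le {z : ℂ} {B : H →L[ℂ] H} (h : AccretiveAt z B) (f : H) :
    ‖expNeg B z f - f‖ ≤ ‖z‖ * ‖B f‖ := by
  have h0 : AccretiveAt z (0 : H →L[ℂ] H) := fun f => by simp
  simpa [expNeg] using norm_expNeg_sub_le h h0 (Commute.zero_right B) f

end

section

/-! ### Resolvents and Yosida approximations -/

variable {H : Type*} [NormedAddCommGroup H] [InnerProductSpace ℂ H]

/-- `L` is maximal accretive, and so is `zL` for all `z` in the cone `M |Im z| ≤ l Re z`. -/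
structure IsMaxAccretive (M l : ℝ) (L : H →ₗ.[ℂ] H) : Prop where
  M_pos : 0 < M
  l_pos : 0 < l
  accretive : ∀ u g, (u, g) ∈ L.graph → ∀ z, 0 ≤ coneFun M l z → 0 ≤ (z * inner ℂ u g).re
  surjective : ∀ k : ℝ, 0 < k → ∀ f, ∃ u g, (u, g) ∈ L.graph ∧ g + (k : ℂ) • u = f

/-- `R` is the resolvent `(L + k)⁻¹`. -/
def IsResolvent (L : H →ₗ.[ℂ] H) (k : ℝ) (R : H →L[ℂ] H) : Prop :=
  ∀ f, (R f, f - (k : ℂ) • R f) ∈ L.graph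

/-- The Yosida approximation `k (1 - k R) = k L (L + k)⁻¹`, where `R = (L + k)⁻¹`. -/
def yosida (k : ℝ) (R : H →L[ℂ] H) : H →L[ℂ] H := (k : ℂ) • (1 - (k : ℂ) • R)

lemma yosida_apply (k : ℝ) (R : H →L[ℂ] H) (f : H) :
    yosida k R f = (k : ℂ) • (f - (k : ℂ) • R f) := by
  simp [yosida]

lemma re_inner_self (f : H) : (inner ℂ f f).re = ‖f‖ ^ 2 := by
  rw [inner_self_eq_norm_sq_to_K]; norm_cast

lemma re_le_norm_mul (f g : H) : (inner ℂ f g).re ≤ ‖f‖ * ‖g‖ :=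
  (Complex.re_le_norm _).trans (norm_inner_le_norm f g)

namespace IsMaxAccretive

variable {M l : ℝ} {L : H →ₗ.[ℂ] H}

lemma re_inner_nonneg (h : IsMaxAccretive M l L) {u g : H} (hug : (u, g) ∈ L.graph) :
    0 ≤ (inner ℂ u g).re := by
  have := h.accretive u g hug 1 (by simpa [coneFun] using h.l_pos.le)
  simpa using this

lemma norm_fst_le (h : IsMaxAccretive M l L) {u g : H} (hug : (u, g) ∈ L.graph) (k : ℝ) :
    k * ‖u‖ ≤ ‖g + (k : ℂ) • u‖ := by
  have h1 := re_le_norm_mul u (g + (k : ℂ) • u)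
  rw [inner_add_right, inner_smul_right, Complex.add_re, Complex.re_ofReal_mul,
    re_inner_self] at h1
  have h2 := h.re_inner_nonneg hug
  rcases (norm_nonneg u).eq_or_lt with h0 | h0
  · rw [← h0, mul_zero]; exact norm_nonneg _
  · refine le_of_mul_le_mul_left ?_ h0
    linarith

lemma norm_snd_le (h : IsMaxAccretive M l L) {u g : H} (hug : (u, g) ∈ L.graph) {k : ℝ}
    (hk : 0 ≤ k) : ‖g‖ ≤ ‖g + (k : ℂ) • u‖ := by
  have h1 := re_le_norm_mul g (g + (k : ℂ) • u)
  rw [inner_add_right, inner_smul_right, Complex.add_re, Complex.re_ofReal_mul,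
    re_inner_self, ← inner_conj_symm, Complex.conj_re] at h1
  have h2 := mul_nonneg hk (h.re_inner_nonneg hug)
  rcases (norm_nonneg g).eq_or_lt with h0 | h0
  · rw [← h0]; exact norm_nonneg _
  · refine le_of_mul_le_mul_left ?_ h0
    linarith

lemma eq_of_add_smul_eq (h : IsMaxAccretive M l L) {u g u' g' : H} (hug : (u, g) ∈ L.graph)
    (hug' : (u', g') ∈ L.graph) {k : ℝ} (hk : 0 < k)
    (he : g + (k : ℂ) • u = g' + (k : ℂ) • u') : u = u' := by
  have h1 := h.norm_fst_le (L.graph.sub_mem hug hug') k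
  have h2 : g - g' + (k : ℂ) • (u - u') = 0 := by
    rw [smul_sub, sub_add_sub_comm, he, sub_self]
  rw [h2, norm_zero] at h1
  have h3 : ‖u - u'‖ ≤ 0 := by
    by_contra hcon
    push Not at hcon
    linarith [mul_pos hk hcon]
  exact sub_eq_zero.1 (norm_le_zero_iff.1 h3)

lemma exists_isResolvent (h : IsMaxAccretive M l L) {k : ℝ} (hk : 0 < k) :
    ∃ R, IsResolvent L k R := by
  choose u g hug he using h.surjective k hk
  have hu : ∀ f f', u (f + f') = u f + u f' := fun f f' =>
    h.eq_of_add_smul_eq (hug _) (L.graph.add_mem (hug f) (hug f')) hk (by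
      rw [he, smul_add, add_add_add_comm, he, he])
  have hs : ∀ (c : ℂ) f, u (c • f) = c • u f := fun c f =>
    h.eq_of_add_smul_eq (hug _) (L.graph.smul_mem c (hug f)) hk (by
      rw [he, smul_comm, ← smul_add, he])
  let R : H →ₗ[ℂ] H := { toFun := u, map_add' := hu, map_smul' := hs }
  refine ⟨R.mkContinuous k⁻¹ fun f => ?_, fun f => ?_⟩
  · have h1 := h.norm_fst_le (hug f) k
    rw [he] at h1
    rw [inv_mul_eq_div, le_div_iff₀ hk, mul_comm]
    exact h1
  · have h1 : f - (k : ℂ) • u f = g f := sub_eq_of_eq_add (he f).symm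
    have h2 := hug f
    rw [← h1] at h2
    exact h2

lemma dense_domain (h : IsMaxAccretive M l L) [CompleteSpace H] :
    Dense (L.domain : Set H) := by
  rw [Submodule.dense_iff_topologicalClosure_eq_top, Submodule.topologicalClosure_eq_top_iff,
    Submodule.eq_bot_iff]
  intro v hv
  obtain ⟨u, g, hug, he⟩ := h.surjective 1 one_pos v
  have hu : u ∈ L.domain := LinearPMap.mem_domain_of_mem_graph hug
  have h1 : inner ℂ u v = 0 := (Submodule.mem_orthogonal _ _).1 hv u hu
  have h2 := congrArg Complex.re h1
  rw [← he, Complex.ofReal_one, one_smul, inner_add_right, Complex.add_re, re_inner_self,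
    Complex.zero_re] at h2
  have h3 : ‖u‖ ^ 2 = 0 := le_antisymm (by linarith [h.re_inner_nonneg hug]) (sq_nonneg _)
  have h4 : u = 0 := norm_eq_zero.1 (pow_eq_zero_iff two_ne_zero |>.1 h3)
  rw [← he, L.graph_fst_eq_zero_snd hug h4, h4]
  simp

end IsMaxAccretive

namespace IsResolvent

variable {M l k : ℝ} {L : H →ₗ.[ℂ] H} {R : H →L[ℂ] H}

lemma apply_eq (hR : IsResolvent L k R) (h : IsMaxAccretive M l L) (hk : 0 < k) {u g : H}
    (hug : (u, g) ∈ L.graph) : R (g + (k : ℂ) • u) = u :=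
  h.eq_of_add_smul_eq (hR _) hug hk (by rw [sub_add_cancel])

lemma norm_le (hR : IsResolvent L k R) (h : IsMaxAccretive M l L) (f : H) :
    k * ‖R f‖ ≤ ‖f‖ := by
  have := h.norm_fst_le (hR f) k
  rwa [sub_add_cancel] at this

lemma norm_sub_le (hR : IsResolvent L k R) (h : IsMaxAccretive M l L) (hk : 0 < k) (f : H) :
    ‖f - (k : ℂ) • R f‖ ≤ ‖f‖ := by
  have := h.norm_snd_le (hR f) hk.le
  rwa [sub_add_cancel] at this

lemma yosida_eq (hR : IsResolvent L k R) (h : IsMaxAccretive M l L) (hk : 0 < k) {u g : H}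
    (hug : (u, g) ∈ L.graph) : yosida k R u = (k : ℂ) • R g := by
  have h1 := hR.apply_eq h hk hug
  rw [map_add, map_smul] at h1
  rw [yosida_apply]
  congr 1
  exact sub_eq_of_eq_add h1.symm

lemma norm_yosida_le (hR : IsResolvent L k R) (h : IsMaxAccretive M l L) (hk : 0 < k) {u g : H}
    (hug : (u, g) ∈ L.graph) : ‖yosida k R u‖ ≤ ‖g‖ := by
  rw [hR.yosida_eq h hk hug, norm_smul, Complex.norm_of_nonneg hk.le]
  exact hR.norm_le h g

lemma accretiveAt_yosida (hR : IsResolvent L k R) (h : IsMaxAccretive M l L) (hk : 0 < k) {z : ℂ}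
    (hz : 0 ≤ coneFun M l z) : AccretiveAt z (yosida k R) := by
  intro f
  set g := f - (k : ℂ) • R f with hg
  have hf : f = g + (k : ℂ) • R f := by rw [hg, sub_add_cancel]
  have h1 := h.accretive _ _ (hR f) z hz
  have hre : 0 ≤ z.re := by
    rw [coneFun] at hz
    exact nonneg_of_mul_nonneg_right
      (by linarith [mul_nonneg h.M_pos.le (abs_nonneg z.im)] : 0 ≤ l * z.re) h.l_pos
  have e : z * inner ℂ f (yosida k R f)
      = ((k * ‖g‖ ^ 2 : ℝ) : ℂ) * z + ((k ^ 2 : ℝ) : ℂ) * (z * inner ℂ (R f) g) := by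
    have e1 : inner ℂ f g = (‖g‖ : ℂ) ^ 2 + (k : ℂ) * inner ℂ (R f) g := by
      conv_lhs => rw [hf]
      rw [inner_add_left, inner_smul_left, Complex.conj_ofReal, inner_self_eq_norm_sq_to_K]
      rfl
    rw [yosida_apply, ← hg, inner_smul_right, e1]
    push_cast
    ring
  rw [e, Complex.add_re, Complex.re_ofReal_mul, Complex.re_ofReal_mul]
  positivity

lemma commute {j : ℝ} {R' : H →L[ℂ] H} (hR : IsResolvent L k R) (hR' : IsResolvent L j R')
    (h : IsMaxAccretive M l L) (hk : 0 < k) (hj : 0 < j) : Commute R R' := by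
  have key : ∀ {a b : ℝ} {A B : H →L[ℂ] H}, IsResolvent L a A → IsResolvent L b B → 0 < a →
      ∀ f, A f + ((a : ℂ) - b) • A (B f) = B f := by
    intro a b A B hA hB ha f
    have := hA.apply_eq h ha (hB f)
    rw [map_add, map_sub, map_smul, map_smul] at this
    rw [sub_smul, ← add_sub_assoc, add_sub_right_comm]
    exact this
  ext f
  simp only [mul_apply_eq_comp]
  have h1 := key hR hR' hk f
  have h2 := key hR' hR hj f
  by_cases hkj : k = j
  · have h3 : ∀ f, R f = R' f := fun f => by
      have := key hR hR' hk f
      rwa [hkj, sub_self, zero_smul, add_zero] at this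
    rw [h3, h3]
  · have h3 : ((k : ℂ) - j) • (R (R' f) - R' (R f)) = 0 := by
      rw [smul_sub, eq_sub_of_add_eq' h1]
      have h4 := eq_sub_of_add_eq' h2
      rw [← neg_sub (j : ℂ) k, neg_smul, h4]
      abel
    exact sub_eq_zero.1 ((smul_eq_zero.1 h3).resolve_left
      (sub_ne_zero.2 (by exact_mod_cast hkj)))

lemma commute_yosida {j : ℝ} {R' : H →L[ℂ] H} (hR : IsResolvent L k R) (hR' : IsResolvent L j R')
    (h : IsMaxAccretive M l L) (hk : 0 < k) (hj : 0 < j) :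
    Commute (yosida k R) (yosida j R') := by
  have h1 : Commute (1 - (k : ℂ) • R) (1 - (j : ℂ) • R') :=
    (Commute.one_left _).sub_left ((Commute.one_right _).sub_right
      (((hR.commute hR' h hk hj).smul_left _).smul_right _))
  exact (h1.smul_left _).smul_right _

end IsResolvent

/-- The Yosida approximations converge strongly on the domain. -/
lemma IsMaxAccretive.tendsto_yosida [CompleteSpace H] {M l : ℝ} {L : H →ₗ.[ℂ] H}
    (h : IsMaxAccretive M l L) {R : ℕ → H →L[ℂ] H}
    (hR : ∀ m : ℕ, IsResolvent L (m + 1) (R m)) {u g : H} (hug : (u, g) ∈ L.graph) :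
    Tendsto (fun m : ℕ => yosida (m + 1) (R m) u) atTop (𝓝 g) := by
  have hpos : ∀ m : ℕ, (0 : ℝ) < m + 1 := fun m => by positivity
  rw [Metric.tendsto_atTop]
  intro ε hε
  obtain ⟨v, hv, hgv⟩ := Metric.dense_iff.1 h.dense_domain g (ε / 2) (half_pos hε)
  obtain ⟨w, hvw⟩ := LinearPMap.mem_domain_iff.1 hgv
  obtain ⟨N, hN⟩ := exists_nat_gt (‖w‖ / (ε / 2))
  refine ⟨N, fun m hm => ?_⟩
  have h1 : yosida (m + 1) (R m) u - g = -((g - v) - ((m + 1 : ℝ) : ℂ) • R m (g - v)) - R m w := by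
    have h2 := (hR m).apply_eq h (hpos m) hvw
    rw [map_add, map_smul] at h2
    rw [(hR m).yosida_eq h (hpos m) hug, map_sub, smul_sub, eq_sub_of_add_eq' h2]
    abel
  have h3 := (hR m).norm_sub_le h (hpos m) (g - v)
  have h4 := (hR m).norm_le h w
  have h5 : ‖R m w‖ < ε / 2 := by
    have h6 : (N : ℝ) ≤ m := by exact_mod_cast hm
    have h7 : ‖w‖ < (m + 1) * (ε / 2) := by
      rw [div_lt_iff₀ (half_pos hε)] at hN
      nlinarith
    exact lt_of_mul_lt_mul_left (h4.trans_lt h7) (hpos m).le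
  have h8 : ‖g - v‖ < ε / 2 := by rw [← dist_eq_norm, dist_comm]; exact hv
  rw [dist_eq_norm, h1]
  refine (_root_.norm_sub_le _ _).trans_lt ?_
  rw [norm_neg]
  linarith

end

section

/-! ### Generation of the analytic semigroup -/

variable {H : Type*} [NormedAddCommGroup H] [InnerProductSpace ℂ H]

/-- A bounded, strongly analytic family of operators is analytic in operator norm: the second
order Taylor remainder of `z ↦ S z f` is bounded by the Schwarz lemma, uniformly in `f`. -/
lemma differentiableOn_of_strongly {S : ℂ → H →L[ℂ] H} {U : Set ℂ} (hU : IsOpen U) {K : ℝ}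
    (hd : ∀ f, DifferentiableOn ℂ (fun z => S z f) U) (hK : ∀ z ∈ U, ∀ f, ‖S z f‖ ≤ K * ‖f‖) :
    DifferentiableOn ℂ S U := by
  intro c hc
  obtain ⟨r, hr, hrU⟩ := Metric.isOpen_iff.1 hU c hc
  set R := r / 2 with hR
  have hR0 : 0 < R := half_pos hr
  have hcl : Metric.closedBall c R ⊆ U :=
    (Metric.closedBall_subset_ball (half_lt_self hr)).trans hrU
  have hda : ∀ f, HasDerivAt (fun z => S z f) (deriv (fun z => S z f) c) c := fun f =>
    ((hd f).differentiableAt (hU.mem_nhds hc)).hasDerivAt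
  have hDb : ∀ f, ‖deriv (fun z => S z f) c‖ ≤ K * ‖f‖ / R := fun f =>
    Complex.norm_deriv_le_of_forall_mem_sphere_norm_le hR0
      (((hd f).mono (Metric.closure_ball_subset_closedBall.trans hcl)).diffContOnCl)
      fun z hz => hK z (hcl (Metric.sphere_subset_closedBall hz)) f
  let D₀ : H →ₗ[ℂ] H :=
    { toFun := fun f => deriv (fun z => S z f) c
      map_add' := fun f g => by
        have := ((hda f).add (hda g)).deriv
        rw [← this]
        congr 1
        ext z
        simp
      map_smul' := fun a f => by
        have := ((hda f).const_smul a).deriv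
        rw [RingHom.id_apply, ← this]
        congr 1
        ext z
        simp }
  let D : H →L[ℂ] H := D₀.mkContinuous (K / R) fun f => (hDb f).trans (le_of_eq (by ring))
  have hDapp : ∀ f, D f = deriv (fun z => S z f) c := fun f => rfl
  have hK0 : ∀ f : H, 0 ≤ K * ‖f‖ := fun f => (norm_nonneg _).trans (hK c hc f)
  have key : ∀ z ∈ Metric.ball c R, ∀ f,
      ‖S z f - S c f - (z - c) • D f‖ ≤ 3 * (K * ‖f‖) * (dist z c / R) ^ 2 := by
    intro z hz f
    have hq0 : (fun z => S z f - S c f - (z - c) • D f) c = 0 := by simp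
    have hqd : DifferentiableOn ℂ (fun z => S z f - S c f - (z - c) • D f) (Metric.ball c R) :=
      (((hd f).mono (Metric.ball_subset_closedBall.trans hcl)).sub_const _).sub
        (by fun_prop)
    have hmaps : Set.MapsTo (fun z => S z f - S c f - (z - c) • D f) (Metric.ball c R)
        (Metric.closedBall ((fun z => S z f - S c f - (z - c) • D f) c) (3 * (K * ‖f‖))) := by
      intro w hw
      rw [hq0, mem_closedBall_zero_iff]
      have h1 := hK w (hcl (Metric.ball_subset_closedBall hw)) f
      have h2 := hK c hc f
      have h3 : ‖(w - c) • D f‖ ≤ K * ‖f‖ := by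
        rw [norm_smul, ← dist_eq_norm]
        calc dist w c * ‖D f‖ ≤ R * (K * ‖f‖ / R) :=
              mul_le_mul (Metric.mem_ball.1 hw).le (hDb f) (norm_nonneg _) hR0.le
          _ = K * ‖f‖ := by field_simp
      refine (norm_sub_le _ _).trans ?_
      linarith [norm_sub_le (S w f) (S c f)]
    have hlo : ((fun w => (fun z => S z f - S c f - (z - c) • D f) w
        - (fun z => S z f - S c f - (z - c) • D f) c)) =o[𝓝 c] (fun w ↦ ‖w - c‖ ^ 1) := by
      rw [hq0]
      simp only [sub_zero, pow_one]
      exact ((hasDerivAt_iff_isLittleO.1 (hda f))).norm_right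
    have := Complex.dist_le_mul_div_pow_of_mapsTo_ball_of_isLittleO hqd hmaps hlo hz
    rwa [sub_self, sub_self, zero_smul, sub_zero, dist_zero_right] at this
  have hmain : HasDerivAt S D c := by
    rw [hasDerivAt_iff_isLittleO]
    have hbig : (fun z => S z - S c - (z - c) • D) =O[𝓝 c] fun z => ‖z - c‖ ^ 2 := by
      refine Asymptotics.IsBigO.of_bound (3 * |K| / R ^ 2) ?_
      filter_upwards [Metric.ball_mem_nhds c hR0] with z hz
      refine ContinuousLinearMap.opNorm_le_bound _ (by positivity) fun f => ?_
      refine (key z hz f).trans ?_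
      rw [norm_pow, norm_norm, ← dist_eq_norm, div_pow]
      have : 3 * (K * ‖f‖) ≤ 3 * (|K| * ‖f‖) := by
        gcongr
        exact le_abs_self K
      calc 3 * (K * ‖f‖) * (dist z c ^ 2 / R ^ 2)
          ≤ 3 * (|K| * ‖f‖) * (dist z c ^ 2 / R ^ 2) := by gcongr
        _ = _ := by ring
    refine hbig.trans_isLittleO ?_
    have h1 : (fun z : ℂ => ‖z - c‖ * ‖z - c‖) =o[𝓝 c] fun z => 1 * ‖z - c‖ := by
      refine Asymptotics.IsLittleO.mul_isBigO ?_ (Asymptotics.isBigO_refl _ _)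
      rw [Asymptotics.isLittleO_one_iff]
      have : Continuous fun z : ℂ => ‖z - c‖ := by fun_prop
      simpa using this.tendsto c
    simp only [one_mul, ← pow_two] at h1
    exact h1.of_norm_right
  exact hmain.differentiableAt.differentiableWithinAt

variable [CompleteSpace H]

/-- Integration of `d/ds e^{-sB} f = -e^{-sB} B f` over `[0, t]`. -/
lemma norm_expNeg_sub_add_le {B : H →L[ℂ] H} {t C : ℝ} (ht : 0 ≤ t) {f g : H}
    (hC : ∀ s ∈ Set.Icc 0 t, ‖expNeg B s (B f) - g‖ ≤ C) :
    ‖expNeg B t f - f + (t : ℂ) • g‖ ≤ C * t := by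
  have hd : ∀ s : ℝ, HasDerivAt (fun s : ℝ => expNeg B s f + (s : ℂ) • g)
      (-(expNeg B s (B f) - g)) s := by
    intro s
    have h0 : HasDerivAt (expNeg B) (-(expNeg B s * B)) (s : ℂ) := by
      have h := (hasDerivAt_exp_smul_const (𝕂 := ℂ) B (-(s : ℂ))).scomp (s : ℂ)
        (hasDerivAt_neg (s : ℂ))
      refine h.congr_deriv ?_
      simp [expNeg]
    have h2 := h0.scomp s (hasDerivAt_id s).ofReal_comp
    have h3 := (ContinuousLinearMap.apply ℂ H f).hasFDerivAt.restrictScalars ℝ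
      |>.comp_hasDerivAt s h2
    have h4 := (hasDerivAt_id s).ofReal_comp.smul_const g
    refine (h3.add h4).congr_deriv ?_
    simp
    abel
  have := norm_image_sub_le_of_norm_deriv_le_segment' (C := C)
    (fun s _ => (hd s).hasDerivWithinAt) (fun s hs => by
      rw [norm_neg]
      exact hC s ⟨hs.1, hs.2.le⟩) t (Set.right_mem_Icc.2 ht)
  simp only [Complex.ofReal_zero, zero_smul, add_zero, sub_zero, expNeg_zero,
    one_apply_eq_self] at this
  convert this using 2
  abel

namespace IsMaxAccretive

variable {M l : ℝ} {L : H →ₗ.[ℂ] H}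

lemma exists_mem_graph_norm_sub_lt (h : IsMaxAccretive M l L) (f : H) {ε : ℝ} (hε : 0 < ε) :
    ∃ u g, (u, g) ∈ L.graph ∧ ‖f - u‖ < ε := by
  obtain ⟨u, hu, huD⟩ := Metric.dense_iff.1 h.dense_domain f ε hε
  obtain ⟨g, hg⟩ := LinearPMap.mem_domain_iff.1 huD
  exact ⟨u, g, hg, by rw [← dist_eq_norm, dist_comm]; exact hu⟩

section Limit

variable {R : ℕ → H →L[ℂ] H}

/-- On the domain of `L` the Yosida exponentials are uniformly Cauchy by `norm_expNeg_sub_le`; the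
domain is dense and the exponentials are contractions. -/
lemma uniformCauchySeqOn_expNeg (h : IsMaxAccretive M l L)
    (hR : ∀ m : ℕ, IsResolvent L (m + 1) (R m)) (f : H) (r : ℝ) :
    UniformCauchySeqOn (fun (m : ℕ) z => expNeg (yosida (m + 1) (R m)) z f) atTop
      {z | 0 ≤ coneFun M l z ∧ ‖z‖ ≤ r} := by
  have hpos : ∀ m : ℕ, (0 : ℝ) < m + 1 := fun m => by positivity
  rw [Metric.uniformCauchySeqOn_iff]
  intro ε hε
  obtain ⟨u, g, hug, hfu⟩ := h.exists_mem_graph_norm_sub_lt f (show 0 < ε / 4 by positivity)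
  have hc := (h.tendsto_yosida hR hug).cauchySeq
  obtain ⟨N, hN⟩ := Metric.cauchySeq_iff.1 hc (ε / (2 * (|r| + 1))) (by positivity)
  refine ⟨N, fun m hm k hk z hz => ?_⟩
  have hacc : ∀ m : ℕ, AccretiveAt z (yosida (m + 1) (R m)) := fun m =>
    (hR m).accretiveAt_yosida h (hpos m) hz.1
  have h1 := norm_expNeg_sub_le (hacc m) (hacc k)
    ((hR m).commute_yosida (hR k) h (hpos m) (hpos k)) u
  have h2 := (hacc m).norm_expNeg_le (f - u)
  have h3 := (hacc k).norm_expNeg_le (f - u)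
  have h4 := hN m hm k hk
  rw [dist_eq_norm] at h4 ⊢
  have h5 : ‖z‖ * ‖yosida (m + 1) (R m) u - yosida (k + 1) (R k) u‖ ≤ ε / 2 := by
    calc _ ≤ (|r| + 1) * (ε / (2 * (|r| + 1))) := by
          refine mul_le_mul ?_ h4.le (norm_nonneg _) (by positivity)
          linarith [hz.2, le_abs_self r]
      _ = ε / 2 := by field_simp
  have e : expNeg (yosida (m + 1) (R m)) z f - expNeg (yosida (k + 1) (R k)) z f
      = expNeg (yosida (m + 1) (R m)) z (f - u) - expNeg (yosida (k + 1) (R k)) z (f - u)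
        + (expNeg (yosida (m + 1) (R m)) z u - expNeg (yosida (k + 1) (R k)) z u) := by
    simp only [map_sub]
    abel
  rw [e]
  refine (norm_add_le _ _).trans_lt ?_
  linarith [norm_sub_le (expNeg (yosida (m + 1) (R m)) z (f - u))
    (expNeg (yosida (k + 1) (R k)) z (f - u))]

/-- The Yosida exponentials converge strongly on the cone. -/
lemma exists_tendsto_expNeg (h : IsMaxAccretive M l L)
    (hR : ∀ m : ℕ, IsResolvent L (m + 1) (R m)) :
    ∃ S : ℂ → H →L[ℂ] H, ∀ z, 0 ≤ coneFun M l z → ∀ f,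
      Tendsto (fun m : ℕ => expNeg (yosida (m + 1) (R m)) z f) atTop (𝓝 (S z f)) := by
  have : ∀ z, ∃ T : H →L[ℂ] H, 0 ≤ coneFun M l z → ∀ f,
      Tendsto (fun m : ℕ => expNeg (yosida (m + 1) (R m)) z f) atTop (𝓝 (T f)) := by
    intro z
    by_cases hz : 0 ≤ coneFun M l z
    · have h1 : ∀ f, ∃ y,
          Tendsto (fun m : ℕ => expNeg (yosida (m + 1) (R m)) z f) atTop (𝓝 y) := fun f =>
        cauchySeq_tendsto_of_complete
          ((h.uniformCauchySeqOn_expNeg hR f ‖z‖).cauchySeq ⟨hz, le_rfl⟩)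
      choose T hT using h1
      exact ⟨continuousLinearMapOfTendsto (fun m : ℕ => expNeg (yosida (m + 1) (R m)) z)
        (tendsto_pi_nhds.2 hT), fun _ f => hT f⟩
    · exact ⟨0, fun hz' => absurd hz' hz⟩
  choose S hS using this
  exact ⟨S, hS⟩

end Limit

/-- If `L` is maximal accretive on the cone `M |Im z| ≤ l Re z`, then `-L` generates an analytic
semigroup on its interior. -/
theorem exists_isAnalyticSemigroup (h : IsMaxAccretive M l L) :
    ∃ S : ℂ → H →L[ℂ] H, IsAnalyticSemigroup (Real.pi / 2 - Real.arctan (M / l)) L S := by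
  have hpos : ∀ m : ℕ, (0 : ℝ) < m + 1 := fun m => by positivity
  have hsec := mem_sector_iff h.M_pos h.l_pos
  choose R hR using fun m : ℕ => h.exists_isResolvent (hpos m)
  obtain ⟨S, hS⟩ := h.exists_tendsto_expNeg hR
  have hacc : ∀ z, 0 ≤ coneFun M l z → ∀ m : ℕ, AccretiveAt z (yosida (m + 1) (R m)) :=
    fun z hz m => (hR m).accretiveAt_yosida h (hpos m) hz
  have hreal : ∀ t : ℝ, 0 ≤ t → 0 ≤ coneFun M l t := fun t ht => by
    rw [coneFun_ofReal]; exact mul_nonneg h.l_pos.le ht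
  have hcontr : ∀ z, 0 ≤ coneFun M l z → ∀ f, ‖S z f‖ ≤ ‖f‖ := fun z hz f =>
    le_of_tendsto' (hS z hz f).norm fun m => (hacc z hz m).norm_expNeg_le f
  have hself : ∀ u g, (u, g) ∈ L.graph → ∀ z, 0 ≤ coneFun M l z → ∀ m : ℕ,
      ‖expNeg (yosida (m + 1) (R m)) z u - u‖ ≤ ‖z‖ * ‖g‖ := fun u g hug z hz m =>
    (norm_expNeg_sub_self_le (hacc z hz m) u).trans
      (mul_le_mul_of_nonneg_left ((hR m).norm_yosida_le h (hpos m) hug) (norm_nonneg _))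
  -- vectors `f` near the domain are moved little, uniformly in the approximation
  have hself' : ∀ f u g, (u, g) ∈ L.graph → ∀ z, 0 ≤ coneFun M l z → ∀ m : ℕ,
      ‖expNeg (yosida (m + 1) (R m)) z f - f‖ ≤ 2 * ‖f - u‖ + ‖z‖ * ‖g‖ := by
    intro f u g hug z hz m
    have h1 := hself u g hug z hz m
    have h2 := (hacc z hz m).norm_expNeg_le (f - u)
    have e : expNeg (yosida (m + 1) (R m)) z f - f
        = expNeg (yosida (m + 1) (R m)) z (f - u) - (f - u)
          + (expNeg (yosida (m + 1) (R m)) z u - u) := by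
      simp only [map_sub]
      abel
    rw [e]
    refine (norm_add_le _ _).trans ?_
    linarith [norm_sub_le (expNeg (yosida (m + 1) (R m)) z (f - u)) (f - u)]
  -- `-L` is contained in the generator
  have hgen : ∀ f g, (f, g) ∈ L.graph →
      Tendsto (fun t : ℝ => (t : ℂ)⁻¹ • (S (t : ℂ) f - f)) (𝓝[>] 0) (𝓝 (-g)) := by
    intro f g hfg
    rw [Metric.tendsto_nhdsWithin_nhds]
    intro ε hε
    obtain ⟨u, w, huw, hgu⟩ := h.exists_mem_graph_norm_sub_lt g (show 0 < ε / 4 by positivity)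
    refine ⟨ε / (2 * (‖w‖ + 1)), by positivity, fun {t} ht htδ => ?_⟩
    have ht0 : 0 < t := ht
    rw [Real.dist_eq, sub_zero, abs_of_pos ht0, lt_div_iff₀ (by positivity)] at htδ
    have h1 : ∀ m : ℕ, ‖expNeg (yosida (m + 1) (R m)) t f - f + (t : ℂ) • g‖
        ≤ (‖yosida (m + 1) (R m) f - g‖ + (2 * ‖g - u‖ + t * ‖w‖)) * t := by
      intro m
      refine norm_expNeg_sub_add_le ht0.le fun s hs => ?_
      have h2 := hself' g u w huw s (hreal s hs.1) m
      have h3 := (hacc s (hreal s hs.1) m).norm_expNeg_le (yosida (m + 1) (R m) f - g)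
      rw [Complex.norm_of_nonneg hs.1] at h2
      have h4 := mul_le_mul_of_nonneg_right hs.2 (norm_nonneg w)
      have e : expNeg (yosida (m + 1) (R m)) s (yosida (m + 1) (R m) f) - g
          = expNeg (yosida (m + 1) (R m)) s (yosida (m + 1) (R m) f - g)
            + (expNeg (yosida (m + 1) (R m)) s g - g) := by
        simp only [map_sub]
        abel
      rw [e]
      exact (norm_add_le _ _).trans (by linarith)
    have h5 : ‖S t f - f + (t : ℂ) • g‖ ≤ (0 + (2 * ‖g - u‖ + t * ‖w‖)) * t := by
      refine le_of_tendsto_of_tendsto' (((hS t (hreal t ht0.le) f).sub_const f).add_const _).norm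
        (((?_ : Tendsto _ _ _).add_const _).mul_const t) h1
      simpa using ((h.tendsto_yosida hR hfg).sub_const g).norm
    have ht' : (t : ℂ) ≠ 0 := by exact_mod_cast ht0.ne'
    have e : (t : ℂ)⁻¹ • (S t f - f) - -g = (t : ℂ)⁻¹ • (S t f - f + (t : ℂ) • g) := by
      rw [smul_add, smul_smul, inv_mul_cancel₀ ht', one_smul, sub_neg_eq_add]
    rw [dist_eq_norm, e, norm_smul, norm_inv, Complex.norm_of_nonneg ht0.le, inv_mul_eq_div]
    refine ((div_le_iff₀ ht0).2 h5).trans_lt ?_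
    linarith
  refine ⟨S, ⟨?_, ?_, ?_, ?_⟩⟩
  · refine differentiableOn_of_strongly (isOpen_sector h.M_pos h.l_pos) (K := 1) (fun f => ?_)
      fun z hz f => by
        rw [one_mul]
        exact hcontr z ((hsec z).1 hz).le f
    have hlim : TendstoLocallyUniformlyOn
        (fun (m : ℕ) z => expNeg (yosida (m + 1) (R m)) z f) (fun z => S z f) atTop
        (sector (Real.pi / 2 - Real.arctan (M / l))) := by
      refine tendstoLocallyUniformlyOn_of_forall_exists_nhds fun z _ => ?_
      refine ⟨sector (Real.pi / 2 - Real.arctan (M / l)) ∩ Metric.closedBall 0 (‖z‖ + 1),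
        inter_mem_nhdsWithin _ (Metric.closedBall_mem_nhds_of_mem ?_), ?_⟩
      · simp
      · refine ((h.uniformCauchySeqOn_expNeg hR f (‖z‖ + 1)).tendstoUniformlyOn_of_tendsto
          fun w hw => hS w hw.1 f).mono ?_
        rintro w ⟨hw, hw'⟩
        exact ⟨((hsec w).1 hw).le, mem_closedBall_zero_iff.1 hw'⟩
    refine hlim.differentiableOn (Eventually.of_forall fun m z _ => ?_)
      (isOpen_sector h.M_pos h.l_pos)
    exact (((ContinuousLinearMap.apply ℂ H f).hasFDerivAt.comp_hasDerivAt z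
      (hasDerivAt_expNeg _ z)).differentiableAt).differentiableWithinAt
  · intro z hz w hw
    have hz' := ((hsec z).1 hz).le
    have hw' := ((hsec w).1 hw).le
    ext1 f
    refine tendsto_nhds_unique (hS (z + w)
      ((add_nonneg hz' hw').trans (le_coneFun_add h.M_pos.le z w)) f) ?_
    rw [ContinuousLinearMap.comp_apply]
    have h1 : Tendsto (fun m : ℕ => expNeg (yosida (m + 1) (R m)) z
        (expNeg (yosida (m + 1) (R m)) w f - S w f)) atTop (𝓝 0) := by
      refine squeeze_zero_norm (fun m => (hacc z hz' m).norm_expNeg_le _) ?_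
      simpa using ((hS w hw' f).sub_const (S w f)).norm
    have h2 := h1.add (hS z hz' (S w f))
    rw [zero_add] at h2
    refine h2.congr fun m => ?_
    rw [map_sub, sub_add_cancel, expNeg_add, mul_apply_eq_comp]
  · intro f
    rw [Metric.tendsto_nhdsWithin_nhds]
    intro ε hε
    obtain ⟨u, g, hug, hfu⟩ := h.exists_mem_graph_norm_sub_lt f (show 0 < ε / 4 by positivity)
    refine ⟨ε / (2 * (‖g‖ + 1)), by positivity, fun {z} hz hzδ => ?_⟩
    have hz' := ((hsec z).1 hz).le
    rw [dist_zero_right, lt_div_iff₀ (by positivity)] at hzδ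
    have h1 : ‖S z f - f‖ ≤ 2 * ‖f - u‖ + ‖z‖ * ‖g‖ :=
      le_of_tendsto' ((hS z hz' f).sub_const f).norm fun m => hself' f u g hug z hz' m
    rw [dist_eq_norm]
    linarith [norm_nonneg z]
  · refine fun f g => ⟨hgen f g, fun hfg => ?_⟩
    -- conversely, solve `(L + 1) u = g + f`
    obtain ⟨u, w, huw, he⟩ := h.surjective 1 one_pos (g + f)
    rw [Complex.ofReal_one, one_smul] at he
    -- `d = f - u` satisfies `L d = -d` in the sense of the semigroup, so `d = 0` by contractivity
    have h1 : Tendsto (fun t : ℝ => (t : ℂ)⁻¹ • (S (t : ℂ) (f - u) - (f - u))) (𝓝[>] 0)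
        (𝓝 (f - u)) := by
      have e : f - u = -g - -w := by
        rw [sub_eq_sub_iff_add_eq_add, ← sub_eq_add_neg, neg_add_eq_sub, sub_eq_sub_iff_add_eq_add,
          add_comm f, ← he, add_comm]
      rw [e]
      refine (hfg.sub (hgen u w huw)).congr fun t => ?_
      rw [← e, ← smul_sub, map_sub]
      congr 1
      abel
    have h2 : (inner ℂ (f - u) (f - u)).re ≤ 0 := by
      refine le_of_tendsto (Complex.continuous_re.tendsto _ |>.comp
        (tendsto_const_nhds.inner (𝕜 := ℂ) h1)) ?_
      filter_upwards [self_mem_nhdsWithin] with t ht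
      have ht0 : (0 : ℝ) < t := ht
      have h3 := re_le_norm_mul (f - u) (S t (f - u))
      have h4 := mul_le_mul_of_nonneg_left (hcontr t (hreal t ht0.le) (f - u))
        (norm_nonneg (f - u))
      rw [Function.comp_apply, inner_smul_right, inner_sub_right, ← Complex.ofReal_inv,
        Complex.re_ofReal_mul, Complex.sub_re, re_inner_self]
      exact mul_nonpos_of_nonneg_of_nonpos (inv_nonneg.2 ht0.le) (by nlinarith)
    rw [re_inner_self] at h2
    have h5 : f - u = 0 :=
      norm_eq_zero.1 (pow_eq_zero_iff two_ne_zero |>.1 (le_antisymm h2 (sq_nonneg _)))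
    have h6 : f = u := sub_eq_zero.1 h5
    rw [h6] at he ⊢
    rwa [← add_right_cancel he]

end IsMaxAccretive

end

section

/-! ### Weighted estimates for the semigroup -/

lemma IsAnalyticSemigroup.hasDerivAt {H : Type*} [NormedAddCommGroup H] [NormedSpace ℂ H]
    {M l : ℝ} (hM : 0 < M) (hl : 0 < l) {L : H →ₗ.[ℂ] H} {S : ℂ → H →L[ℂ] H}
    (hS : IsAnalyticSemigroup (Real.pi / 2 - Real.arctan (M / l)) L S) {z : ℂ}
    (hz : 0 < coneFun M l z) : HasDerivAt S (deriv S z) z :=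
  (hS.analytic.differentiableAt
    ((isOpen_sector hM hl).mem_nhds ((mem_sector_iff hM hl z).2 hz))).hasDerivAt

/-- `S z` maps into the domain of `L`, and `L (S z f) = -S'(z) f`. -/
lemma IsAnalyticSemigroup.mem_graph {H : Type*} [NormedAddCommGroup H] [NormedSpace ℂ H]
    {M l : ℝ} (hM : 0 < M) (hl : 0 < l) {L : H →ₗ.[ℂ] H} {S : ℂ → H →L[ℂ] H}
    (hS : IsAnalyticSemigroup (Real.pi / 2 - Real.arctan (M / l)) L S) {z : ℂ}
    (hz : 0 < coneFun M l z) (f : H) : (S z f, -(deriv S z f)) ∈ L.graph := by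
  rw [hS.generator, neg_neg]
  have hd : HasDerivAt (fun t : ℝ => S (z + t) f) (deriv S z f) 0 := by
    have h1 : HasDerivAt (fun t : ℝ => z + (t : ℂ)) 1 0 :=
      ((hasDerivAt_id (0 : ℝ)).ofReal_comp).const_add z
    have h0 : HasDerivAt S (deriv S z) (z + ((0 : ℝ) : ℂ)) := by
      rw [Complex.ofReal_zero, add_zero]
      exact hS.hasDerivAt hM hl hz
    have h2 := h0.scomp (0 : ℝ) h1
    have h3 := (ContinuousLinearMap.apply ℂ H f).hasFDerivAt.restrictScalars ℝ
      |>.comp_hasDerivAt (0 : ℝ) h2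
    exact h3.congr_deriv (by simp)
  have h4 := (hasDerivAt_iff_tendsto_slope_zero.1 hd).mono_left
    (nhdsWithin_mono (0 : ℝ) (fun t (ht : 0 < t) => ht.ne'))
  refine h4.congr' ?_
  filter_upwards [self_mem_nhdsWithin] with t ht
  have ht0 : (0 : ℝ) < t := ht
  have hts : (t : ℂ) ∈ sector (Real.pi / 2 - Real.arctan (M / l)) := by
    rw [mem_sector_iff hM hl, coneFun_ofReal]
    positivity
  rw [zero_add, Complex.ofReal_zero, add_zero, add_comm z,
    hS.map_add t hts z ((mem_sector_iff hM hl z).2 hz), ContinuousLinearMap.comp_apply,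
    ← Complex.ofReal_inv, Complex.coe_smul]

lemma hasDerivAt_apply_ray {H : Type*} [NormedAddCommGroup H] [NormedSpace ℂ H]
    {S : ℂ → H →L[ℂ] H} {S' : H →L[ℂ] H} {t : ℝ} {z : ℂ} (h : HasDerivAt S S' (t * z))
    (W : H →L[ℂ] H) (f : H) :
    HasDerivAt (fun t : ℝ => W (S (t * z) f)) (W (z • S' f)) t := by
  have h1 : HasDerivAt (fun t : ℝ => (t : ℂ) * z) z t := by
    simpa using (hasDerivAt_id t).ofReal_comp.mul_const z
  have h2 := h.scomp t h1
  have h3 := (ContinuousLinearMap.apply ℂ H f).hasFDerivAt.restrictScalars ℝ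
    |>.comp_hasDerivAt t h2
  exact W.hasFDerivAt.restrictScalars ℝ |>.comp_hasDerivAt t h3

variable {n : ℕ} {lam0 Lam0 : ℝ} {φ : Rn n → ℝ}

namespace CoeffMatrix

lemma imConst_pos (hn : n ≠ 0) (hL : 0 < Lam0) : 0 < imConst n Lam0 := by
  have := varBound_pos (n := n) hL
  have : (0 : ℝ) < n := by exact_mod_cast Nat.pos_of_ne_zero hn
  unfold imConst antiConst
  positivity

lemma lowerConst_nonneg (hlam : 0 < lam0) : 0 ≤ lowerConst n lam0 Lam0 := by
  have := antiConst'_nonneg (n := n) (Lam0 := Lam0)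
  unfold lowerConst
  positivity

/-- The growth rate of the weighted semigroup at those `z` with `c |z| ≤ coneFun M lam0 z`. -/
def growthConst (n : ℕ) (lam0 Lam0 c : ℝ) : ℝ :=
  lowerConst n lam0 Lam0 + lowerConst n lam0 Lam0 ^ 2 / (4 * c)

lemma growthConst_nonneg (hlam : 0 < lam0) {c : ℝ} (hc : 0 < c) :
    0 ≤ growthConst n lam0 Lam0 c := by
  have := lowerConst_nonneg (n := n) (Lam0 := Lam0) hlam
  unfold growthConst
  positivity

/-- The angle of the sector on which the semigroup is analytic. -/
def sectorAngle (n : ℕ) (lam0 Lam0 : ℝ) : ℝ :=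
  Real.pi / 2 - Real.arctan (imConst n Lam0 / lam0)

variable (A : CoeffMatrix n lam0 Lam0)

/-- `zL` is maximal accretive on a cone. -/
lemma isMaxAccretive_op (hn : n ≠ 0) (hlam : 0 < lam0) (hL : 0 < Lam0) :
    IsMaxAccretive (imConst n Lam0) lam0 A.op where
  M_pos := imConst_pos hn hL
  l_pos := hlam
  accretive _ _ hug _ hz := A.re_inner_nonneg hn hlam hL (sub_nonneg.1 hz) hug
  surjective _ hk f := A.exists_resolvent hn hlam hL hk f

section Weighted

variable {A} {S : ℂ → L2 n →L[ℂ] L2 n}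

lemma re_nonneg_of_coneFun {M l : ℝ} (hM : 0 ≤ M) (hl : 0 < l) {z : ℂ} (hz : 0 ≤ coneFun M l z) :
    0 ≤ z.re := by
  rw [coneFun] at hz
  exact nonneg_of_mul_nonneg_right (by linarith [mul_nonneg hM (abs_nonneg z.im)] : 0 ≤ l * z.re) hl

/-- Davies' method: the weighted semigroup `e^{ρφ} S(z) e^{-ρφ}` has norm at most
`exp(κ ρ² |z|)`, by Gronwall's inequality along the ray through `z`. -/
lemma norm_weightL_semigroup_le (hn : n ≠ 0) (hlam : 0 < lam0) (hL : 0 < Lam0)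
    (hS : IsAnalyticSemigroup (sectorAngle n lam0 Lam0) A.op S) (hφ : SmoothLp ∞ φ)
    (hφ1 : ∀ k x, |partialDeriv k φ x| ≤ 1) {ρ : ℝ} (hρ : 0 ≤ ρ) {c : ℝ} (hc : 0 < c) {z : ℂ}
    (hz0 : z ≠ 0) (hz : c * ‖z‖ ≤ coneFun (imConst n Lam0) lam0 z) (h : L2 n) :
    ‖weightL hφ ρ (S z h)‖
      ≤ Real.exp (growthConst n lam0 Lam0 c * (ρ ^ 2 * ‖z‖)) * ‖weightL hφ ρ h‖ := by
  have hM := imConst_pos (Lam0 := Lam0) hn hL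
  have hzp : 0 < ‖z‖ := norm_pos_iff.2 hz0
  have hcone : 0 < coneFun (imConst n Lam0) lam0 z := (mul_pos hc hzp).trans_le hz
  have hcone' : ∀ t : ℝ, 0 < t → 0 < coneFun (imConst n Lam0) lam0 (t * z) := fun t ht => by
    rw [coneFun_real_mul ht.le]; positivity
  set y : ℝ → L2 n := fun t => weightL hφ ρ (S (t * z) h) with hy
  have hd : ∀ t : ℝ, 0 < t → HasDerivAt y (weightL hφ ρ (z • deriv S (t * z) h)) t := by
    exact fun t ht => hasDerivAt_apply_ray (hS.hasDerivAt hM hlam (hcone' t ht)) _ h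
  set κ := growthConst n lam0 Lam0 c * (ρ ^ 2 * ‖z‖) with hκ
  have hκ0 : 0 ≤ κ := mul_nonneg (growthConst_nonneg hlam hc) (by positivity)
  have hest : ∀ t : ℝ, 0 < t →
      (inner ℂ (y t) (weightL hφ ρ (z • deriv S (t * z) h))).re ≤ κ * ‖y t‖ ^ 2 := by
    intro t ht
    have h1 := A.le_re_inner_weightL hn hlam hL hφ hφ1 hρ
      (re_nonneg_of_coneFun hM.le hlam hcone.le) (hS.mem_graph hM hlam (hcone' t ht) h)
    rw [map_neg, inner_neg_right, mul_neg, Complex.neg_re] at h1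
    rw [map_smul, inner_smul_right]
    set w := ‖weightL hφ ρ (S (t * z) h)‖ with hw
    set G := gradNorm (gradOf (weightPair hφ ρ (S (t * z) h))) with hG
    set K := lowerConst n lam0 Lam0 with hK
    have h2 : (c * ‖z‖) * G ^ 2 ≤ (lam0 * z.re - imConst n Lam0 * |z.im|) * G ^ 2 :=
      mul_le_mul_of_nonneg_right hz (sq_nonneg _)
    -- the gradient in the error term is absorbed
    have h3 : K * ρ * (w * G) ≤ c * G ^ 2 + K ^ 2 / (4 * c) * (ρ ^ 2 * w ^ 2) := by
      have e : c * G ^ 2 + K ^ 2 / (4 * c) * (ρ ^ 2 * w ^ 2) - K * ρ * (w * G)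
          = c * (G - K * ρ * w / (2 * c)) ^ 2 := by field_simp; ring
      have : 0 ≤ c * (G - K * ρ * w / (2 * c)) ^ 2 := by positivity
      linarith
    have h4 := mul_le_mul_of_nonneg_left h3 hzp.le
    have e2 : κ * ‖y t‖ ^ 2 = ‖z‖ * (K * (ρ ^ 2 * w ^ 2))
        + ‖z‖ * (K ^ 2 / (4 * c) * (ρ ^ 2 * w ^ 2)) := by
      rw [hκ, growthConst]; ring
    rw [e2]
    linarith
  -- `S 0` is unspecified, so Gronwall's inequality starts at `s > 0`, and then `s` tends to `0`
  have hgr : ∀ s ∈ Set.Ioo (0 : ℝ) 1, ‖y 1‖ ≤ Real.exp κ * ‖y s‖ := by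
    intro s hs
    refine (norm_le_exp_mul_of_re_inner_le hs.2.le
      (fun t ht => (hd t (hs.1.trans_le ht.1)).continuousAt.continuousWithinAt)
      (fun t ht => hd t (hs.1.trans ht.1)) (fun t ht => hest t (hs.1.trans ht.1))).trans ?_
    gcongr
    nlinarith [hs.1]
  have hlim : Tendsto y (𝓝[>] 0) (𝓝 (weightL hφ ρ h)) := by
    refine ((weightL hφ ρ).continuous.tendsto h).comp ((hS.continuous_zero h).comp ?_)
    refine tendsto_nhdsWithin_iff.2 ⟨?_, ?_⟩
    · have : Continuous fun t : ℝ => (t : ℂ) * z := by fun_prop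
      simpa using (this.tendsto 0).mono_left nhdsWithin_le_nhds
    · filter_upwards [self_mem_nhdsWithin] with t ht
      exact (mem_sector_iff hM hlam _).2 (hcone' t ht)
  have hfin := ge_of_tendsto (hlim.norm.const_mul (Real.exp κ)) (by
    filter_upwards [Ioo_mem_nhdsGT (zero_lt_one' ℝ)] with s hs using hgr s hs)
  simpa [hy] using hfin

end Weighted

end CoeffMatrix

end

section

variable {n : ℕ} {lam0 Lam0 : ℝ} {φ : Rn n → ℝ}

/-- Cauchy's estimate for `w ↦ W (S w f)`. -/
lemma norm_apply_deriv_le {H : Type*} [NormedAddCommGroup H] [NormedSpace ℂ H]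
    {S : ℂ → H →L[ℂ] H} {z : ℂ} {r B : ℝ} (hr : 0 < r)
    (hS : ∀ w ∈ Metric.closedBall z r, DifferentiableAt ℂ S w) (W : H →L[ℂ] H) (f : H)
    (hB : ∀ w ∈ Metric.closedBall z r, ‖W (S w f)‖ ≤ B) : ‖W (deriv S z f)‖ ≤ B / r := by
  have hd : ∀ w ∈ Metric.closedBall z r, HasDerivAt (fun w => W (S w f)) (W (deriv S w f)) w := by
    intro w hw
    have h1 := (ContinuousLinearMap.apply ℂ H f).hasFDerivAt.comp_hasDerivAt w (hS w hw).hasDerivAt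
    exact W.hasFDerivAt.comp_hasDerivAt w h1
  have h2 : DifferentiableOn ℂ (fun w => W (S w f)) (Metric.closedBall z r) := fun w hw =>
    (hd w hw).differentiableAt.differentiableWithinAt
  rw [← (hd z (Metric.mem_closedBall_self hr.le)).deriv]
  exact Complex.norm_deriv_le_of_forall_mem_sphere_norm_le hr
    (h2.mono Metric.closure_ball_subset_closedBall).diffContOnCl
    fun w hw => hB w (Metric.sphere_subset_closedBall hw)

namespace CoeffMatrix

variable {A : CoeffMatrix n lam0 Lam0} {S : ℂ → L2 n →L[ℂ] L2 n}

/-- Discs of radius `radiusConst * |z|` about `z` with `c |z| ≤ coneFun M lam0 z` stay well inside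
the sector of analyticity. -/
def radiusConst (n : ℕ) (lam0 Lam0 c : ℝ) : ℝ := min 1 (c / (2 * (lam0 + imConst n Lam0)))

lemma radiusConst_pos (hn : n ≠ 0) (hlam : 0 < lam0) (hL : 0 < Lam0) {c : ℝ} (hc : 0 < c) :
    0 < radiusConst n lam0 Lam0 c := by
  have := imConst_pos (Lam0 := Lam0) hn hL
  exact lt_min one_pos (by positivity)

/-- The weighted bound for `z S'(z)`, by Cauchy's estimate on a disc of radius comparable with `|z|`. -/
lemma norm_weightL_deriv_le (hn : n ≠ 0) (hlam : 0 < lam0) (hL : 0 < Lam0)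
    (hS : IsAnalyticSemigroup (sectorAngle n lam0 Lam0) A.op S) (hφ : SmoothLp ∞ φ)
    (hφ1 : ∀ k x, |partialDeriv k φ x| ≤ 1) {ρ : ℝ} (hρ : 0 ≤ ρ) {c : ℝ} (hc : 0 < c) {z : ℂ}
    (hz0 : z ≠ 0) (hz : c * ‖z‖ ≤ coneFun (imConst n Lam0) lam0 z) (h : L2 n) :
    ‖z‖ * ‖weightL hφ ρ (deriv S z h)‖
      ≤ (radiusConst n lam0 Lam0 c)⁻¹ *
        (Real.exp (2 * growthConst n lam0 Lam0 (c / 4) * (ρ ^ 2 * ‖z‖)) * ‖weightL hφ ρ h‖) := by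
  have hM := imConst_pos (Lam0 := Lam0) hn hL
  have hzp : 0 < ‖z‖ := norm_pos_iff.2 hz0
  have hr := radiusConst_pos hn hlam hL hc
  have hγ := growthConst_nonneg (n := n) (Lam0 := Lam0) hlam (show 0 < c / 4 by positivity)
  set r := radiusConst n lam0 Lam0 c with hr_def
  have hr1 : r ≤ 1 := min_le_left _ _
  have hr2 : (lam0 + imConst n Lam0) * r ≤ c / 2 := by
    have h1 : r ≤ c / (2 * (lam0 + imConst n Lam0)) := min_le_right _ _
    rw [le_div_iff₀ (by positivity)] at h1
    linarith
  have hball : ∀ w ∈ Metric.closedBall z (r * ‖z‖), ‖w‖ ≤ 2 * ‖z‖ ∧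
      c / 2 * ‖z‖ ≤ coneFun (imConst n Lam0) lam0 w := by
    intro w hw
    rw [Metric.mem_closedBall, dist_eq_norm] at hw
    constructor
    · have h1 : ‖w‖ ≤ ‖w - z‖ + ‖z‖ := by simpa using norm_add_le (w - z) z
      nlinarith
    · have h1 := coneFun_ge_sub hM.le hlam.le z w
      have h2 := mul_le_mul_of_nonneg_left hw (show 0 ≤ lam0 + imConst n Lam0 by positivity)
      nlinarith
  have h1 := norm_apply_deriv_le (B := Real.exp (2 * growthConst n lam0 Lam0 (c / 4) *
      (ρ ^ 2 * ‖z‖)) * ‖weightL hφ ρ h‖) (mul_pos hr hzp)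
    (fun w hw => (hS.hasDerivAt hM hlam ((by positivity : 0 < c / 2 * ‖z‖).trans_le
      (hball w hw).2)).differentiableAt) (weightL hφ ρ) h (fun w hw => by
      obtain ⟨hw1, hw2⟩ := hball w hw
      have hw0 : w ≠ 0 := by
        rintro rfl
        have : 0 < c / 2 * ‖z‖ := by positivity
        simp [coneFun] at hw2
        linarith
      refine (norm_weightL_semigroup_le hn hlam hL hS hφ hφ1 hρ (show 0 < c / 4 by positivity) hw0
        (by nlinarith) h).trans ?_
      gcongr ?_ * _
      refine Real.exp_le_exp.2 ?_
      have : ρ ^ 2 * ‖w‖ ≤ ρ ^ 2 * (2 * ‖z‖) := by gcongr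
      nlinarith)
  rw [le_div_iff₀ (by positivity)] at h1
  rw [inv_mul_eq_div, le_div_iff₀ hr]
  linarith

/-- The absorption argument behind `norm_weightL_weakGrad_le`. -/
lemma mul_sq_le_of_garding {c r K Z ρ w d v G E : ℝ} (hc : 0 < c) (hr : 0 < r) (hK : 0 ≤ K)
    (hZ : 0 < Z) (hw0 : 0 ≤ w) (hd0 : 0 ≤ d) (hv0 : 0 ≤ v) (hE0 : 0 ≤ E)
    (hwE : w ≤ E) (hwD : Z * d ≤ r⁻¹ * E) (h3 : v ≤ G + ρ * w)
    (h4 : c * Z * G ^ 2 - Z * K * (ρ * (w * G) + ρ ^ 2 * w ^ 2) ≤ Z * (w * d)) :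
    Z * v ^ 2 ≤ (4 / c * (K + K ^ 2 / (2 * c)) + 4 / (c * r) + 2)
      * (E * Real.exp (ρ ^ 2 * Z)) ^ 2 := by
  have hX0 : 0 ≤ ρ ^ 2 * Z := by positivity
  have h5 : K * ρ * (w * G) ≤ c / 2 * G ^ 2 + K ^ 2 / (2 * c) * (ρ ^ 2 * w ^ 2) := by
    have e : c / 2 * G ^ 2 + K ^ 2 / (2 * c) * (ρ ^ 2 * w ^ 2) - K * ρ * (w * G)
        = c / 2 * (G - K * ρ * w / c) ^ 2 := by field_simp; ring
    have : 0 ≤ c / 2 * (G - K * ρ * w / c) ^ 2 := by positivity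
    linarith
  have h6 := mul_le_mul_of_nonneg_left h5 hZ.le
  have hwsq : w ^ 2 ≤ E ^ 2 := by gcongr
  have h7 : c / 2 * (Z * G ^ 2) ≤ (K + K ^ 2 / (2 * c)) * ((ρ ^ 2 * Z) * E ^ 2) + r⁻¹ * E ^ 2 := by
    have e1 : Z * (w * d) ≤ r⁻¹ * E ^ 2 := by
      calc Z * (w * d) = w * (Z * d) := by ring
        _ ≤ E * (r⁻¹ * E) := by gcongr
        _ = _ := by ring
    have e2 : (K + K ^ 2 / (2 * c)) * ((ρ ^ 2 * Z) * w ^ 2) ≤ (K + K ^ 2 / (2 * c)) * ((ρ ^ 2 * Z) * E ^ 2) := by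
      gcongr
    have e3 : (K + K ^ 2 / (2 * c)) * ((ρ ^ 2 * Z) * w ^ 2)
        = Z * (K * (ρ ^ 2 * w ^ 2)) + Z * (K ^ 2 / (2 * c) * (ρ ^ 2 * w ^ 2)) := by
      ring
    linarith
  have h8 : Z * G ^ 2 ≤ 2 / c * ((K + K ^ 2 / (2 * c)) * ((ρ ^ 2 * Z) * E ^ 2) + r⁻¹ * E ^ 2) := by
    have e : Z * G ^ 2 = 2 / c * (c / 2 * (Z * G ^ 2)) := by field_simp
    rw [e]
    gcongr
  have h9 : v ^ 2 ≤ 2 * G ^ 2 + 2 * (ρ ^ 2 * w ^ 2) := by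
    have : v ^ 2 ≤ (G + ρ * w) ^ 2 := by gcongr
    nlinarith [sq_nonneg (G - ρ * w)]
  have e1 := mul_le_mul_of_nonneg_left h9 hZ.le
  have e2 : (ρ ^ 2 * Z) * w ^ 2 ≤ (ρ ^ 2 * Z) * E ^ 2 := by gcongr
  have e3 : Z * (2 * (ρ ^ 2 * w ^ 2)) = 2 * ((ρ ^ 2 * Z) * w ^ 2) := by ring
  have e4 : Z * v ^ 2 ≤ (4 / c * (K + K ^ 2 / (2 * c)) + 2) * ((ρ ^ 2 * Z) * E ^ 2)
      + 4 / (c * r) * E ^ 2 := by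
    have e5 : 2 * (2 / c * ((K + K ^ 2 / (2 * c)) * ((ρ ^ 2 * Z) * E ^ 2) + r⁻¹ * E ^ 2))
        = 4 / c * (K + K ^ 2 / (2 * c)) * ((ρ ^ 2 * Z) * E ^ 2) + 4 / (c * r) * E ^ 2 := by
      field_simp; ring
    linarith
  have hexp : (ρ ^ 2 * Z) + 1 ≤ Real.exp (ρ ^ 2 * Z) ^ 2 := by
    have := Real.add_one_le_exp (ρ ^ 2 * Z)
    nlinarith
  have e6 : (ρ ^ 2 * Z) * E ^ 2 ≤ (E * Real.exp (ρ ^ 2 * Z)) ^ 2 := by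
    rw [mul_pow, mul_comm]; gcongr; linarith
  have e7 : E ^ 2 ≤ (E * Real.exp (ρ ^ 2 * Z)) ^ 2 := by
    rw [mul_pow]; exact le_mul_of_one_le_right (sq_nonneg _) (by linarith)
  calc Z * v ^ 2 ≤ _ := e4
    _ ≤ (4 / c * (K + K ^ 2 / (2 * c)) + 2) * (E * Real.exp (ρ ^ 2 * Z)) ^ 2
        + 4 / (c * r) * (E * Real.exp (ρ ^ 2 * Z)) ^ 2 := by gcongr
    _ = _ := by ring

/-- The constant in the weighted gradient bound. -/
def gradConst (n : ℕ) (lam0 Lam0 c : ℝ) : ℝ :=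
  4 / c * (lowerConst n lam0 Lam0 + lowerConst n lam0 Lam0 ^ 2 / (2 * c))
    + 4 / (c * radiusConst n lam0 Lam0 c) + 2

/-- The weighted Gårding inequality bounds the weighted gradient of `S z h` by the weighted norms
of `S z h` and `L (S z h)`. -/
lemma norm_weightL_weakGrad_le (hn : n ≠ 0) (hlam : 0 < lam0) (hL : 0 < Lam0)
    (hS : IsAnalyticSemigroup (sectorAngle n lam0 Lam0) A.op S) (hφ : SmoothLp ∞ φ)
    (hφ1 : ∀ k x, |partialDeriv k φ x| ≤ 1) {ρ : ℝ} (hρ : 0 ≤ ρ) {c : ℝ} (hc : 0 < c) {z : ℂ}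
    (hz0 : z ≠ 0) (hz : c * ‖z‖ ≤ coneFun (imConst n Lam0) lam0 z) (h : L2 n) (i : Fin n) :
    √‖z‖ * ‖weightL hφ ρ (weakGrad (S z h) i)‖
      ≤ √(gradConst n lam0 Lam0 c) *
        (Real.exp ((2 * growthConst n lam0 Lam0 (c / 4) + 1) * (ρ ^ 2 * ‖z‖))
          * ‖weightL hφ ρ h‖) := by
  have hM := imConst_pos (Lam0 := Lam0) hn hL
  have hzp : 0 < ‖z‖ := norm_pos_iff.2 hz0
  have hr := radiusConst_pos hn hlam hL hc
  have hK := lowerConst_nonneg (n := n) (Lam0 := Lam0) hlam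
  have hγ := growthConst_nonneg (n := n) (Lam0 := Lam0) hlam (show 0 < c / 4 by positivity)
  have hcone : 0 < coneFun (imConst n Lam0) lam0 z := (mul_pos hc hzp).trans_le hz
  have h1 := A.le_re_inner_weightL hn hlam hL hφ hφ1 hρ
    (re_nonneg_of_coneFun hM.le hlam hcone.le) (hS.mem_graph hM hlam hcone h)
  have hwS := norm_weightL_semigroup_le hn hlam hL hS hφ hφ1 hρ (show 0 < c / 4 by positivity) hz0
    (by nlinarith) h
  have hwD := norm_weightL_deriv_le hn hlam hL hS hφ hφ1 hρ hc hz0 hz h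
  have h2 : (z * inner ℂ (weightL hφ ρ (S z h)) (weightL hφ ρ (-(deriv S z h)))).re
      ≤ ‖z‖ * (‖weightL hφ ρ (S z h)‖ * ‖weightL hφ ρ (deriv S z h)‖) := by
    refine (Complex.re_le_norm _).trans ?_
    rw [norm_mul, map_neg, inner_neg_right, norm_neg]
    gcongr
    exact norm_inner_le_norm _ _
  have h3 : ‖weightL hφ ρ (weakGrad (S z h) i)‖
      ≤ gradNorm (gradOf (weightPair hφ ρ (S z h))) + ρ * ‖weightL hφ ρ (S z h)‖ := by
    have e1 : weightL hφ ρ (weakGrad (S z h) i) = gradOf (weightPair hφ ρ (S z h)) i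
        - (ρ : ℂ) • mulL (hφ.memLp_partialDeriv i) (weightL hφ ρ (S z h)) :=
      (add_sub_cancel_right _ _).symm
    have e2 := norm_mulL_le (hφ.memLp_partialDeriv i) (Eventually.of_forall (hφ1 i))
      (weightL hφ ρ (S z h))
    rw [one_mul] at e2
    rw [e1]
    refine (norm_sub_le _ _).trans (add_le_add (norm_le_gradNorm _ i) ?_)
    rw [norm_smul, Complex.norm_of_nonneg hρ]
    gcongr
  set w := ‖weightL hφ ρ (S z h)‖ with hw
  set d := ‖weightL hφ ρ (deriv S z h)‖ with hd
  set v := ‖weightL hφ ρ (weakGrad (S z h) i)‖ with hv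
  set G := gradNorm (gradOf (weightPair hφ ρ (S z h))) with hG
  set K := lowerConst n lam0 Lam0 with hKdef
  set r := radiusConst n lam0 Lam0 c with hrdef
  set γ := growthConst n lam0 Lam0 (c / 4) with hγdef
  set X := ρ ^ 2 * ‖z‖ with hX
  have hX0 : 0 ≤ X := by positivity
  set E := Real.exp (2 * γ * X) * ‖weightL hφ ρ h‖ with hE
  have hE0 : 0 ≤ E := by positivity
  have hw0 : 0 ≤ w := norm_nonneg _
  have hd0 : 0 ≤ d := norm_nonneg _
  have hv0 : 0 ≤ v := norm_nonneg _
  have hG0 : 0 ≤ G := gradNorm_nonneg _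
  have hwE : w ≤ E := by
    refine hwS.trans ?_
    rw [hE]
    gcongr ?_ * _
    exact Real.exp_le_exp.2 (mul_le_mul_of_nonneg_right (by linarith) hX0)
  have h4 : (c * ‖z‖) * G ^ 2 ≤ (lam0 * z.re - imConst n Lam0 * |z.im|) * G ^ 2 :=
    mul_le_mul_of_nonneg_right hz (sq_nonneg _)
  have hD : ‖z‖ * v ^ 2 ≤ gradConst n lam0 Lam0 c * (E * Real.exp X) ^ 2 :=
    mul_sq_le_of_garding hc hr hK hzp hw0 hd0 hv0 hE0 hwE hwD h3 (by linarith)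
  have e8 : E * Real.exp X = Real.exp ((2 * γ + 1) * X) * ‖weightL hφ ρ h‖ := by
    rw [hE, mul_right_comm, ← Real.exp_add]
    congr 2
    ring
  rw [← e8]
  have h10 := Real.sqrt_le_sqrt hD
  rwa [Real.sqrt_mul hzp.le, Real.sqrt_sq hv0, Real.sqrt_mul' _ (sq_nonneg _),
    Real.sqrt_sq (by positivity)] at h10

/-- The weighted bounds for `S z`, `z S'(z)` and `√z ∇S z`, uniform over smaller sectors. -/
lemma exists_weighted_bounds (hn : n ≠ 0) (hlam : 0 < lam0) (hL : 0 < Lam0) {μ : ℝ}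
    (hμ : μ ∈ Set.Ioo 0 (sectorAngle n lam0 Lam0)) :
    ∃ C κ : ℝ, 0 ≤ C ∧ 0 < κ ∧ ∀ (A : CoeffMatrix n lam0 Lam0) (S : ℂ → L2 n →L[ℂ] L2 n),
      IsAnalyticSemigroup (sectorAngle n lam0 Lam0) A.op S →
      ∀ (φ : Rn n → ℝ) (hφ : SmoothLp ∞ φ), (∀ k x, |partialDeriv k φ x| ≤ 1) →
      ∀ ρ : ℝ, 0 ≤ ρ → ∀ z ∈ sector μ, ∀ h : L2 n,
        ‖weightL hφ ρ (S z h)‖ ≤ C * (Real.exp (κ * (ρ ^ 2 * ‖z‖)) * ‖weightL hφ ρ h‖) ∧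
        ‖z‖ * ‖weightL hφ ρ (deriv S z h)‖
          ≤ C * (Real.exp (κ * (ρ ^ 2 * ‖z‖)) * ‖weightL hφ ρ h‖) ∧
        ∀ i, √‖z‖ * ‖weightL hφ ρ (weakGrad (S z h) i)‖
          ≤ C * (Real.exp (κ * (ρ ^ 2 * ‖z‖)) * ‖weightL hφ ρ h‖) := by
  have hM := imConst_pos (Lam0 := Lam0) hn hL
  obtain ⟨c, hc, hcz⟩ := exists_le_coneFun hM hlam hμ
  have hγ := growthConst_nonneg (n := n) (Lam0 := Lam0) hlam (show 0 < c / 4 by positivity)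
  have hr := radiusConst_pos hn hlam hL hc
  set γ := growthConst n lam0 Lam0 (c / 4) with hγdef
  set r := radiusConst n lam0 Lam0 c with hrdef
  set D := √(gradConst n lam0 Lam0 c) with hDdef
  have hD0 : 0 ≤ D := Real.sqrt_nonneg _
  refine ⟨1 + r⁻¹ + D, 2 * γ + 1, by positivity, by positivity,
    fun A S hS φ hφ hφ1 ρ hρ z hz h => ?_⟩
  have hX : 0 ≤ ρ ^ 2 * ‖z‖ := by positivity
  have hmono : ∀ {a b : ℝ}, 0 ≤ a → a ≤ 1 + r⁻¹ + D → b ≤ 2 * γ + 1 →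
      a * (Real.exp (b * (ρ ^ 2 * ‖z‖)) * ‖weightL hφ ρ h‖)
        ≤ (1 + r⁻¹ + D) * (Real.exp ((2 * γ + 1) * (ρ ^ 2 * ‖z‖)) * ‖weightL hφ ρ h‖) := by
    intro a b ha hab hb
    gcongr
  have hri : 0 < r⁻¹ := inv_pos.2 hr
  have hcz' := hcz z hz
  refine ⟨?_, ?_, fun i => ?_⟩
  · refine le_trans ?_ (hmono (a := 1) (b := γ) zero_le_one (by linarith) (by linarith))
    rw [one_mul]
    exact norm_weightL_semigroup_le hn hlam hL hS hφ hφ1 hρ (show 0 < c / 4 by positivity) hz.1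
      (by nlinarith [norm_nonneg z]) h
  · exact (norm_weightL_deriv_le hn hlam hL hS hφ hφ1 hρ hc hz.1 hcz' h).trans
      (hmono hri.le (by linarith) (by linarith))
  · exact (norm_weightL_weakGrad_le hn hlam hL hS hφ hφ1 hρ hc hz.1 hcz' h i).trans
      (hmono hD0 (by linarith) le_rfl)

end CoeffMatrix

end

section

/-! ### Off-diagonal estimates -/

variable {n : ℕ} {lam0 Lam0 : ℝ} {φ : Rn n → ℝ}

lemma abs_partialDeriv_le_of_lipschitz (hφ : LipschitzWith 1 φ) (i : Fin n) (x : Rn n) :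
    |partialDeriv i φ x| ≤ 1 := by
  have h1 := norm_fderiv_le_of_lipschitz ℝ hφ (x₀ := x)
  have h2 := (fderiv ℝ φ x).le_opNorm (EuclideanSpace.single i 1)
  rw [PiLp.norm_single, norm_one, mul_one] at h2
  exact h2.trans h1

lemma setDist_nonneg (E F : Set (Rn n)) : 0 ≤ setDist E F := Real.iInf_nonneg fun _ => dist_nonneg

lemma setDist_le_dist {E F : Set (Rn n)} {x y : Rn n} (hx : x ∈ E) (hy : y ∈ F) :
    setDist E F ≤ dist x y :=
  ciInf_le (f := fun p : E × F => dist (p.1 : Rn n) (p.2 : Rn n))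
    ⟨0, by rintro _ ⟨p, rfl⟩; exact dist_nonneg⟩ (⟨x, hx⟩, ⟨y, hy⟩)

/-- Smooth bounded `1`-Lipschitz functions separating `E` from `F`, obtained by mollifying the
truncated distance to `E`. -/
lemma exists_smooth_separating (E F : Set (Rn n)) :
    ∃ φ : Rn n → ℝ, SmoothLp ∞ φ ∧ (∀ k x, |partialDeriv k φ x| ≤ 1) ∧
      (∀ x ∈ E, φ x ≤ setDist E F / 4) ∧ ∀ x ∈ F, 3 / 4 * setDist E F ≤ φ x := by
  set d := setDist E F with hd
  have hd0 : 0 ≤ d := setDist_nonneg E F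
  -- if `d = 0`, which is also the value for empty `E` or `F`, then `φ = 0` will do
  rcases hd0.eq_or_lt with h0 | hdpos
  · refine ⟨fun _ => 0, CoeffMatrix.smoothLp_zero, fun k x => by simp [partialDeriv], fun x _ => ?_,
      fun x _ => ?_⟩ <;> simp [← h0]
  have hE : E.Nonempty := by
    by_contra hcon
    rw [Set.not_nonempty_iff_eq_empty] at hcon
    have : IsEmpty (E × F) := by rw [hcon]; infer_instance
    rw [hd, setDist, Real.iInf_of_isEmpty] at hdpos
    exact lt_irrefl _ hdpos
  set b : Rn n → ℝ := fun x => min (Metric.infDist x E) d with hb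
  have hblip : LipschitzWith 1 b := by
    have := (Metric.lipschitz_infDist_pt E).min (LipschitzWith.const d)
    simpa using this
  have hbM : ∀ x, |b x| ≤ d := fun x => by
    rw [abs_of_nonneg (le_min Metric.infDist_nonneg hd0)]
    exact min_le_right _ _
  obtain ⟨k, hk⟩ := ((tendsto_bump_rOut n).eventually_lt_const
    (show 0 < d / 4 by positivity)).exists
  -- mollification at scale below `d / 4` changes the `1`-Lipschitz function `b` by at most `d / 4`
  set f := mollify (bumpKernel n k) b with hf
  have hbi : ∀ x, Integrable (fun t => b (x - t)) (bumpMeasure n k) := fun x =>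
    Integrable.of_bound (hblip.continuous.comp (by fun_prop)).aestronglyMeasurable d
      (Eventually.of_forall fun t => hbM _)
  have hfapp : ∀ x, f x = ∫ t, b (x - t) ∂bumpMeasure n k := mollify_bumpKernel k b
  have hflip : LipschitzWith 1 f := by
    refine LipschitzWith.of_dist_le_mul fun x y => ?_
    rw [NNReal.coe_one, one_mul, hfapp, hfapp, dist_eq_norm, ← integral_sub (hbi x) (hbi y)]
    have := norm_integral_le_of_norm_le_const (μ := bumpMeasure n k)
      (f := fun t => b (x - t) - b (y - t)) (C := dist x y) (Eventually.of_forall fun t => by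
        have h1 := hblip.dist_le_mul (x - t) (y - t)
        rw [NNReal.coe_one, one_mul, dist_sub_right] at h1
        exact h1)
    simpa using this
  have hfb : ∀ x, |f x - b x| ≤ d / 4 := by
    intro x
    have e : f x - b x = ∫ t, (b (x - t) - b x) ∂bumpMeasure n k := by
      rw [integral_sub (hbi x) (integrable_const _), hfapp]
      simp
    rw [e, ← Real.norm_eq_abs]
    have := norm_integral_le_of_norm_le_const (μ := bumpMeasure n k)
      (f := fun t => b (x - t) - b x) (C := d / 4) (by
        filter_upwards [ae_bumpMeasure_norm_lt k] with t ht
        have h1 := hblip.dist_le_mul (x - t) x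
        rw [NNReal.coe_one, one_mul, dist_eq_norm, dist_eq_norm, sub_sub_cancel_left,
          norm_neg] at h1
        linarith)
    simpa using this
  refine ⟨f, SmoothLp.mollify (contDiff_bumpKernel k) (hasCompactSupport_bumpKernel k)
    hblip.continuous.measurable hbM, fun i x => abs_partialDeriv_le_of_lipschitz hflip i x,
    fun x hx => ?_, fun x hx => ?_⟩
  · have h1 : b x = 0 := by
      rw [hb]
      dsimp only
      rw [Metric.infDist_zero_of_mem hx, min_eq_left hd0]
    have := (abs_le.1 (hfb x)).2
    linarith
  · have h1 : b x = d := min_eq_right ((Metric.le_infDist hE).2 fun {y} hy => by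
      rw [dist_comm]; exact setDist_le_dist hy hx)
    have := (abs_le.1 (hfb x)).1
    linarith

lemma eLpNorm_restrict_le_weightL (hφ : SmoothLp ∞ φ) {ρ b : ℝ} (hρ : 0 ≤ ρ) {F : Set (Rn n)}
    (hF : MeasurableSet F) (hb : ∀ x ∈ F, b ≤ φ x) (v : L2 n) :
    eLpNorm v 2 (volume.restrict F) ≤ ENNReal.ofReal (Real.exp (-(ρ * b)) * ‖weightL hφ ρ v‖) := by
  have h1 : eLpNorm v 2 (volume.restrict F)
      ≤ ENNReal.ofReal (Real.exp (-(ρ * b))) * eLpNorm (weightL hφ ρ v) 2 (volume.restrict F) := by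
    refine eLpNorm_le_mul_eLpNorm_of_ae_le_mul ?_ 2
    rw [ae_restrict_iff' hF]
    filter_upwards [coeFn_mulL (memLp_expWeight hφ ρ) v] with x hx hxF
    rw [weightL, hx, norm_mul, Complex.norm_real, Real.norm_eq_abs, expWeight,
      abs_of_pos (Real.exp_pos _), ← mul_assoc, ← Real.exp_add]
    refine le_mul_of_one_le_left (norm_nonneg _) (Real.one_le_exp ?_)
    nlinarith [mul_le_mul_of_nonneg_left (hb x hxF) hρ]
  refine h1.trans ?_
  rw [ENNReal.ofReal_mul (Real.exp_pos _).le, Lp.norm_def,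
    ENNReal.ofReal_toReal (Lp.eLpNorm_ne_top _)]
  gcongr
  exact Measure.restrict_le_self

lemma norm_weightL_le_of_support (hφ : SmoothLp ∞ φ) {ρ b : ℝ} (hρ : 0 ≤ ρ) {E : Set (Rn n)}
    (hb : ∀ x ∈ E, φ x ≤ b) {h : L2 n} (hh : ∀ᵐ x, x ∉ E → h x = 0) :
    ‖weightL hφ ρ h‖ ≤ Real.exp (ρ * b) * ‖h‖ := by
  refine Lp.norm_le_mul_norm_of_ae_le_mul ?_
  filter_upwards [coeFn_mulL (memLp_expWeight hφ ρ) h, hh] with x hx hhx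
  rw [weightL, hx, norm_mul, Complex.norm_real, Real.norm_eq_abs, expWeight,
    abs_of_pos (Real.exp_pos _)]
  by_cases hxE : x ∈ E
  · gcongr
    exact hb x hxE
  · simp [hhx hxE]

/-- Weighted bounds `‖e^{ρφ} v‖ ≤ C e^{κρ²r} ‖e^{ρφ} h‖` for all admissible `φ` and `ρ` give a
Gaussian off-diagonal bound, on choosing `ρ = d(E, F) / (4κr)`. -/
lemma eLpNorm_restrict_le_gaussian {C κ r : ℝ} (hC : 0 ≤ C) (hκ : 0 < κ) (hr : 0 < r)
    {h v : L2 n} {E F : Set (Rn n)} (hF : IsClosed F) (hh : ∀ᵐ x, x ∉ E → h x = 0)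
    (hv : ∀ (φ : Rn n → ℝ) (hφ : SmoothLp ∞ φ), (∀ k x, |partialDeriv k φ x| ≤ 1) →
      ∀ ρ : ℝ, 0 ≤ ρ → ‖weightL hφ ρ v‖ ≤ C * (Real.exp (κ * (ρ ^ 2 * r)) * ‖weightL hφ ρ h‖)) :
    eLpNorm v 2 (volume.restrict F)
      ≤ ENNReal.ofReal (C * Real.exp (-(1 / (16 * κ) * setDist E F ^ 2 / r)))
        * eLpNorm h 2 volume := by
  obtain ⟨φ, hφ, hφ1, hφE, hφF⟩ := exists_smooth_separating E F
  set d := setDist E F with hd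
  have hd0 : 0 ≤ d := setDist_nonneg E F
  set ρ := d / (4 * κ * r) with hρdef
  have hρ : 0 ≤ ρ := by positivity
  refine (eLpNorm_restrict_le_weightL hφ hρ hF.measurableSet hφF v).trans ?_
  have e : eLpNorm h 2 volume = ENNReal.ofReal ‖h‖ := by
    rw [Lp.norm_def, ENNReal.ofReal_toReal (Lp.eLpNorm_ne_top _)]
  rw [e, ← ENNReal.ofReal_mul (by positivity)]
  refine ENNReal.ofReal_le_ofReal ?_
  calc Real.exp (-(ρ * (3 / 4 * d))) * ‖weightL hφ ρ v‖
      ≤ Real.exp (-(ρ * (3 / 4 * d))) *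
        (C * (Real.exp (κ * (ρ ^ 2 * r)) * (Real.exp (ρ * (d / 4)) * ‖h‖))) := by
        gcongr
        refine (hv φ hφ hφ1 ρ hρ).trans ?_
        gcongr
        exact norm_weightL_le_of_support hφ hρ hφE hh
    _ = C * (Real.exp (-(ρ * (3 / 4 * d))) * Real.exp (κ * (ρ ^ 2 * r)) *
          Real.exp (ρ * (d / 4))) * ‖h‖ := by ring
    _ = _ := by
        rw [← Real.exp_add, ← Real.exp_add]
        congr 3
        rw [hρdef]
        field_simp
        ring

lemma norm_toLp_le_sum (v : Fin n → ℂ) : ‖(WithLp.toLp 2 v : EuclideanSpace ℂ (Fin n))‖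
    ≤ ∑ i, ‖v i‖ := by
  rw [EuclideanSpace.norm_eq]
  exact Real.sqrt_le_iff.2 ⟨Finset.sum_nonneg fun _ _ => norm_nonneg _,
    Finset.sum_sq_le_sq_sum_of_nonneg fun i _ => norm_nonneg (v i)⟩

lemma eLpNorm_gradField_le (a : ℂ) (u : L2 n) (ν : Measure (Rn n)) (hν : ν ≪ volume) :
    eLpNorm (fun x => a • gradField u x) 2 ν ≤ ∑ i, eLpNorm (a • weakGrad u i : L2 n) 2 ν := by
  have hm : ∀ i, AEStronglyMeasurable (fun x => ‖(a • weakGrad u i : L2 n) x‖) ν := fun i =>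
    (Lp.aestronglyMeasurable (a • weakGrad u i)).norm.mono_ac hν
  have h1 : eLpNorm (fun x => a • gradField u x) 2 ν
      ≤ eLpNorm (∑ i, fun x => ‖(a • weakGrad u i : L2 n) x‖) 2 ν := by
    refine eLpNorm_mono_ae_real ?_
    have h2 : ∀ᵐ x, ∀ i, (a • weakGrad u i : L2 n) x = a * weakGrad u i x := by
      rw [ae_all_iff]
      exact fun i => Lp.coeFn_smul _ _
    filter_upwards [hν.ae_le h2] with x hx
    rw [norm_smul, Finset.sum_apply]
    refine (mul_le_mul_of_nonneg_left (norm_toLp_le_sum _) (norm_nonneg _)).trans (le_of_eq ?_)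
    rw [Finset.mul_sum]
    exact Finset.sum_congr rfl fun i _ => by rw [hx, norm_mul]
  refine h1.trans ((eLpNorm_sum_le (fun i _ => hm i) (by norm_num)).trans (le_of_eq ?_))
  exact Finset.sum_congr rfl fun i _ => eLpNorm_norm _

lemma norm_cpow_half (z : ℂ) : ‖z ^ (1 / 2 : ℂ)‖ = √‖z‖ := by
  have h : (1 / 2 : ℂ) = ((1 / 2 : ℝ) : ℂ) := by push_cast; rfl
  rw [h, Complex.norm_cpow_real, Real.sqrt_eq_rpow]

namespace CoeffMatrix

/-- Gaussian off-diagonal bounds for any analytic semigroup generated by `-L`, with constants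
depending only on the ellipticity and BMO bounds and the sector. -/
lemma exists_offDiagonal (hn : n ≠ 0) (hlam : 0 < lam0) (hL : 0 < Lam0) {μ : ℝ}
    (hμ : μ ∈ Set.Ioo 0 (sectorAngle n lam0 Lam0)) :
    ∃ C : ℝ, 0 ≤ C ∧ ∃ α : ℝ, 0 < α ∧
      ∀ (A : CoeffMatrix n lam0 Lam0) (S : ℂ → L2 n →L[ℂ] L2 n),
        IsAnalyticSemigroup (sectorAngle n lam0 Lam0) A.op S →
          OffDiagonal μ C α (fun z h x => S z h x) ∧
          (∃ hD : ∀ (z : sector μ) (h : L2 n), S z h ∈ A.op.domain,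
            OffDiagonal μ C α (fun z h x => (z : ℂ) * A.op ⟨S z h, hD z h⟩ x)) ∧
          (∀ (z : sector μ) (h : L2 n), S z h ∈ W12 n) ∧
          OffDiagonal μ C α
            (fun z h x => (z : ℂ) ^ (1 / 2 : ℂ) • gradField (S z h) x) := by
  have hM := imConst_pos (Lam0 := Lam0) hn hL
  have hn1 : (1 : ℝ) ≤ n := by exact_mod_cast Nat.one_le_iff_ne_zero.2 hn
  obtain ⟨C, κ, hC, hκ, hbd⟩ := exists_weighted_bounds (Lam0 := Lam0) hn hlam hL hμ
  -- the factor `n` comes from bounding the gradient by the sum of its components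
  refine ⟨n * C, by positivity, 1 / (16 * κ), by positivity, fun A S hS => ?_⟩
  have hCn : C ≤ n * C := le_mul_of_one_le_left hC hn1
  have hgraph : ∀ z ∈ sector μ, ∀ h, (S z h, -(deriv S z h)) ∈ A.op.graph := fun z hz h =>
    hS.mem_graph hM hlam ((mem_sector_iff hM hlam z).1 ⟨hz.1, hz.2.trans hμ.2⟩) h
  have hdom : ∀ (z : sector μ) (h : L2 n), S z h ∈ A.op.domain := fun z h =>
    LinearPMap.mem_domain_of_mem_graph (hgraph z z.2 h)
  have hpos : ∀ z : sector μ, 0 < ‖(z : ℂ)‖ := fun z => norm_pos_iff.2 z.2.1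
  have hmono : ∀ (d r : ℝ) (x : ℝ≥0∞), ENNReal.ofReal (C * Real.exp (-(1 / (16 * κ) * d ^ 2 / r))) * x
      ≤ ENNReal.ofReal (n * C * Real.exp (-(1 / (16 * κ) * d ^ 2 / r))) * x := by
    intro d r x
    gcongr
  refine ⟨fun E F hE hF h hh z => ?_, ⟨hdom, fun E F hE hF h hh z => ?_⟩,
    fun z h => (A.mem_op_graph_iff.1 (hgraph z z.2 h)).1, fun E F hE hF h hh z => ?_⟩
  · refine (eLpNorm_restrict_le_gaussian hC hκ (hpos z) hF hh fun φ hφ hφ1 ρ hρ => ?_).trans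
      (hmono _ _ _)
    exact (hbd A S hS φ hφ hφ1 ρ hρ z z.2 h).1
  · have hop : A.op ⟨S z h, hdom z h⟩ = -(deriv S z h) := by
      obtain ⟨y, hy1, hy2⟩ := (LinearPMap.mem_graph_iff A.op).1 (hgraph z z.2 h)
      have e : (⟨S z h, hdom z h⟩ : A.op.domain) = y := Subtype.ext hy1.symm
      rw [e]
      exact hy2
    have e : eLpNorm (fun x => (z : ℂ) * A.op ⟨S z h, hdom z h⟩ x) 2 (volume.restrict F)
        = eLpNorm ((z : ℂ) • A.op ⟨S z h, hdom z h⟩ : L2 n) 2 (volume.restrict F) := by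
      refine eLpNorm_congr_ae (ae_restrict_of_ae ?_)
      exact (Lp.coeFn_smul (z : ℂ) (A.op ⟨S z h, hdom z h⟩)).symm
    dsimp only
    rw [e]
    refine (eLpNorm_restrict_le_gaussian hC hκ (hpos z) hF hh fun φ hφ hφ1 ρ hρ => ?_).trans
      (hmono _ _ _)
    rw [hop, map_smul, map_neg, norm_smul, norm_neg]
    exact (hbd A S hS φ hφ hφ1 ρ hρ z z.2 h).2.1
  · refine (eLpNorm_gradField_le _ _ _ Measure.restrict_le_self.absolutelyContinuous).trans ?_
    have key : ∀ i, eLpNorm ((z : ℂ) ^ (1 / 2 : ℂ) • weakGrad (S z h) i : L2 n) 2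
        (volume.restrict F)
        ≤ ENNReal.ofReal (C * Real.exp (-(1 / (16 * κ) * setDist E F ^ 2 / ‖(z : ℂ)‖)))
          * eLpNorm h 2 volume := fun i =>
      eLpNorm_restrict_le_gaussian hC hκ (hpos z) hF hh fun φ hφ hφ1 ρ hρ => by
        rw [map_smul, norm_smul, norm_cpow_half]
        exact (hbd A S hS φ hφ hφ1 ρ hρ z z.2 h).2.2 i
    refine (Finset.sum_le_sum fun i _ => key i).trans (le_of_eq ?_)
    rw [Finset.sum_const, Finset.card_univ, Fintype.card_fin, nsmul_eq_mul, ← mul_assoc,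
      mul_assoc (n : ℝ), ENNReal.ofReal_mul (p := (n : ℝ)) (by positivity), ENNReal.ofReal_natCast]

end CoeffMatrix

end

end GaffneyBMO

end

open GaffneyBMO in
theorem mainTheorem9 (n : ℕ) (hn : 2 ≤ n) (lam0 Lam0 : ℝ) (hlam : 0 < lam0) (hlam1 : lam0 ≤ 1)
    (hLam : 0 < Lam0) :
    ∃ ω₀ ∈ Set.Ioo (0 : ℝ) (Real.pi / 2),
      (∀ A : CoeffMatrix n lam0 Lam0,
        ∃ S : ℂ → L2 n →L[ℂ] L2 n, IsAnalyticSemigroup (Real.pi / 2 - ω₀) A.op S) ∧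
      ∀ μ ∈ Set.Ioo (0 : ℝ) (Real.pi / 2 - ω₀),
        ∃ C : ℝ, 0 ≤ C ∧ ∃ α : ℝ, 0 < α ∧
          ∀ (A : CoeffMatrix n lam0 Lam0) (S : ℂ → L2 n →L[ℂ] L2 n),
            IsAnalyticSemigroup (Real.pi / 2 - ω₀) A.op S →
              OffDiagonal μ C α (fun z h x => S z h x) ∧
              (∃ hD : ∀ (z : sector μ) (h : L2 n), S z h ∈ A.op.domain,
                OffDiagonal μ C α (fun z h x => (z : ℂ) * A.op ⟨S z h, hD z h⟩ x)) ∧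
              (∀ (z : sector μ) (h : L2 n), S z h ∈ W12 n) ∧
              OffDiagonal μ C α
                (fun z h x => (z : ℂ) ^ (1 / 2 : ℂ) • gradField (S z h) x) := by
  have hn0 : n ≠ 0 := by omega
  have hM := CoeffMatrix.imConst_pos (Lam0 := Lam0) hn0 hLam
  refine ⟨Real.arctan (CoeffMatrix.imConst n Lam0 / lam0),
    ⟨Real.arctan_pos.2 (by positivity), Real.arctan_lt_pi_div_two _⟩, fun A => ?_, fun μ hμ => ?_⟩
  · exact (A.isMaxAccretive_op hn0 hlam hLam).exists_isAnalyticSemigroup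
  · exact CoeffMatrix.exists_offDiagonal hn0 hlam hLam hμ
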